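/- Let $d\ge 1$ and let $\mathbb T^d=(\mathbb R/\mathbb Z)^d$ with wrap-around distance $|x-y|_\infty=\min_{k\in\mathbb Z^d}\|x-y+k\|_\infty$. Let $\mu=\sum_{j=1}^r\lambda_j\delta_{x_j}$ with $r\ge1$, pairwise distinct $x_1,\dots,x_r\in\mathbb T^d$ and nonzero $\lambda_j\in\mathbb C$; put $|\lambda_{\max}|=\max_j|\lambda_j|$ and $|\lambda_{\min}|=\min_j|\lambda_j|$. For $n\in\mathbb N$ put $[n]=\{0,\dots,n\}^d$, $N=(n+1)^d$, $\hat\mu(k)=\int e^{-2\pi i k\cdot y}\,d\mu(y)$, $T_n=(\hat\mu(k-\ell))_{k,\ell\in[n]}$ and $e_n(x)=(e^{-2\pi i k\cdot x})_{k\in[n]}$. Let $T_n=U_n\Sigma_nV_n^*$ be any singular value decomposition (singular values in non-increasing order), let $u^{(n)}_j(x)$ be the $j$-th entry of $e_n(x)^*U_n$, and define $$p_{1,n}(x)=\frac1N\sum_{j=1}^{\operatorname{rank}T_n}|u_j^{(n)}(x)|^2 .$$ A minimum over the empty set is $+\infty$, so that for $r=1$ the two separation conditions below are void. (1) Let $n\ge1$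 and $n+1>4d/\min_{j\ne\ell}|x_j-x_\ell|_\infty$. Then for all $x\in\mathbb T^d\setminus\{x_1,\dots,x_r\}$ $$p_{1,n}(x)\le\frac1{(n+1)^2}\cdot\frac{|\lambda_{\max}|}{|\lambda_{\min}|}\cdot\frac13\sum_{j=1}^r\frac1{|x-x_j|_\infty^2}.$$ (2) For every $x\in\mathbb T^d$, $p_{1,n}(x)\to\chi_V(x)$ as $n\to\infty$, where $V$ is the Zariski closure of $\operatorname{supp}\mu$ in $\mathbb T^d$, i.e. the set of common zeros of all trigonometric polynomials vanishing on $\operatorname{supp}\mu$ (here $V=\operatorname{supp}\mu=\{x_1,\dots,x_r\}$), and $\chi_V$ is its characteristic function. (3) Let $n\ge1$ and $n+1>2\sqrt d/\min_{j\ne\ell}|x_j-x_\ell|_\infty$. Then for all $x\in\mathbb T^d\setminus\{x_1,\dots,x_r\}$ with $\min_j|x-x_j|_\infty\le\sqrt d/(n+1)$ $$p_{1,n}(x)\le1-\frac{3^{d-1}(2d-1)}{2^d\,d^{2+d/2}}\,(n+1)^2\,\min_j|x-x_j|_\infty^2 .$$ -/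

import Mathlib

open MeasureTheory Matrix Filter Topology

namespace TrigMoment

noncomputable section

/-- The `k`-th trigonometric moment `∫ exp(-2πi k·y) dμ(y)` of a complex Borel measure `μ` on the
torus `(ℝ/ℤ)^d`.  Note that `UnitAddTorus.mFourier k y = exp(2πi k·y)`. -/
def moment {d : ℕ} (μ : ComplexMeasure (UnitAddTorus (Fin d))) (k : Fin d → ℤ) : ℂ :=
  ∫ᵛ y, UnitAddTorus.mFourier (-k) y ∂[ContinuousLinearMap.mul ℝ ℂ; μ]

/-- The moment matrix `T_n = (μ̂(k - ℓ))`, with `k, ℓ` ranging over `{0, …, n}^d`. -/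
def momentMatrix {d : ℕ} (μ : ComplexMeasure (UnitAddTorus (Fin d))) (n : ℕ) :
    Matrix (Fin d → Fin (n + 1)) (Fin d → Fin (n + 1)) ℂ :=
  Matrix.of fun k l => moment μ fun i => ((k i : ℕ) : ℤ) - ((l i : ℕ) : ℤ)

/-- The vector `e_n(x) = (exp(-2πi k·x))`, with `k` ranging over `{0, …, n}^d`. -/
def expVec {d : ℕ} (n : ℕ) (x : UnitAddTorus (Fin d)) : (Fin d → Fin (n + 1)) → ℂ :=
  fun k => UnitAddTorus.mFourier (-fun i => ((k i : ℕ) : ℤ)) x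

/-- A singular value decomposition `T = U Σ V*` of a square matrix: `U` and `V` are unitary and
`Σ` is diagonal with nonnegative entries in non-increasing order. -/
structure SVD {ι : Type} [Fintype ι] [DecidableEq ι] (N : ℕ) (T : Matrix ι ι ℂ) where
  U : Matrix ι (Fin N) ℂ
  V : Matrix ι (Fin N) ℂ
  sv : Fin N → ℝ
  U_conjTranspose_mul : Uᴴ * U = 1
  U_mul_conjTranspose : U * Uᴴ = 1
  V_conjTranspose_mul : Vᴴ * V = 1
  V_mul_conjTranspose : V * Vᴴ = 1
  sv_nonneg : ∀ j, 0 ≤ sv j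
  sv_antitone : Antitone sv
  eq_mul : T = U * Matrix.diagonal (fun j => (sv j : ℂ)) * Vᴴ

/-- The singular function `u_j(x)`, i.e. the `j`-th entry of the row vector `e_n(x)* U_n`. -/
def singularFun {d n N : ℕ} {T : Matrix (Fin d → Fin (n + 1)) (Fin d → Fin (n + 1)) ℂ}
    (S : SVD N T) (j : Fin N) (x : UnitAddTorus (Fin d)) : ℂ :=
  (star (expVec n x) ᵥ* S.U) j

/-- The signal function `p_{1,n}(x) = (1/N) ∑_{j ≤ rank T_n} |u_j(x)|²` with `N = (n+1)^d`,
formed from a singular value decomposition of the moment matrix `T_n`.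
(Indices `j` start at `0` here.) -/
def signalFun {d n : ℕ} {μ : ComplexMeasure (UnitAddTorus (Fin d))}
    (S : SVD ((n + 1) ^ d) (momentMatrix μ n)) (x : UnitAddTorus (Fin d)) : ℝ :=
  1 / ((n : ℝ) + 1) ^ d *
    ∑ j : Fin ((n + 1) ^ d), if (j : ℕ) < (momentMatrix μ n).rank then ‖singularFun S j x‖ ^ 2 else 0

/-- The discrete complex measure `∑ⱼ wⱼ δ_{ξⱼ}`. -/
def discreteMeasure {d r : ℕ} (w : Fin r → ℂ) (ξ : Fin r → UnitAddTorus (Fin d)) :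
    ComplexMeasure (UnitAddTorus (Fin d)) :=
  ∑ j, VectorMeasure.dirac (ξ j) (w j)

/-- The support of a complex measure (that of its total variation measure). -/
def supp {d : ℕ} (μ : ComplexMeasure (UnitAddTorus (Fin d))) : Set (UnitAddTorus (Fin d)) :=
  μ.variation.support

/-- The Zariski closure of a subset of the torus: the set of all points at which every
trigonometric polynomial that vanishes on `s` vanishes. -/
def zariskiClosure {d : ℕ} (s : Set (UnitAddTorus (Fin d))) : Set (UnitAddTorus (Fin d)) :=
  {x | ∀ p ∈ Submodule.span ℂ (Set.range (UnitAddTorus.mFourier (d := Fin d))),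
    (∀ y ∈ s, p y = 0) → p x = 0}

end

end TrigMoment

namespace TrigMoment

/-! ### The moment matrix of a discrete measure -/

/-! Write N = n + 1 for the side length, a_j = e_n(ξ_j), e = e_n(x). The moment matrix is Σ w_j a_j
a_j^*, so its range lies in V = span(a_j), and the first rank T columns of U are an orthonormal
system in V. Bessel's inequality gives p ≤ ‖P_V e‖² / N^d (`exists_signalFun_le`), and p = 1
whenever e lies in the range (`signalFun_eq_one_of_mem_range`). The weights play no further role in
the bounds; the quotient of weights in (1) is a factor at least 1 inserted at the very end.

(1) If σ bounds the Gram matrix of the a_j from below, Cauchy–Schwarz gives ‖P_V e‖² ≤ σ⁻¹ Σ |⟨a_j,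
e⟩|² (`signalFun_le_of_singular_bound`). The inner products are products of Dirichlet kernels and
are at most N^(d-1) / (2|x - ξ_j|). The value of σ comes from a large sieve (`large_sieve`): a
Selberg type minorant of the box {0, …, N-1}^d, built from squares of shifted sinc functions, has
total mass N^d (1 - d/L), and its Fourier series vanishes at every shift that is at least L/N in
some coordinate. With L = 4d this is σ = (3/4) N^d, and (1/4)/(3/4) is the constant 1/3.

(2) Off the nodes the limit 0 follows from (1). At a node the Gram matrix is eventually invertible,
hence a_j is in the range of T and p = 1 exactly. The support is the set of nodes, and a finite set
is Zariski closed.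

(3) By Pythagoras 1 - p is at least the squared distance of e from V divided by N^d. Let a window be
a symmetric nonnegative weight on {0, …, N-1} of sum 1 bounded by ω/N. The squared distance in the
product-weighted norm is at most ω^d times the normalised one (`quadratic_le`). In the weighted norm
the Gram matrix is real and its entries are products of one-dimensional kernels. A window whose
kernel decays fast makes Gershgorin effective (`le_quadratic_of_row_sum`) with a constant λ, and
minimising the quadratic form leaves 1 - K² - E/λ, where K is the kernel between x and its nearest
node and E the squared residual at the other nodes (`sub_le_quadratic`, `energy_bound`). Sums over
separated nodes are reduced to one-dimensional sums by sorting the nodes into cells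
(`sum_prod_le_of_celled`, `class_sum_le`).

Let δ be N times the distance from x to the nearest node. For δ ≤ 1/2 the cosine window (ω = π/2) is
used, for δ ≥ 1/2 a mixture with a third harmonic (ω = 3π/7). As δ tends to 0 the residual must
itself be shown to be quadratic in the displacement, by a derivative bound for the kernel
(`center_gap`). For d = 2, 3 and δ close to √d a different argument is used: a small distance forces
large coefficients of the projection (`one_sub_sub_le_mul_of_orthogonal`, with a raised cosine
window close to the uniform weight), while large coefficients force a large distance
(`le_one_sub_signalFun_of_coeff`). A single node is settled by the uniform weight.
`gapConst_mul_sq_le` joins the ranges of δ. -/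

theorem moment_discreteMeasure {d r : ℕ} (w : Fin r → ℂ) (ξ : Fin r → UnitAddTorus (Fin d))
    (k : Fin d → ℤ) :
    moment (discreteMeasure w ξ) k = ∑ j, w j * UnitAddTorus.mFourier (-k) (ξ j) := by
  unfold moment discreteMeasure
  rw [VectorMeasure.integral_finsetSum_vectorMeasure]
  · refine Finset.sum_congr rfl fun j _ => ?_
    rw [VectorMeasure.integral_dirac]
    simp [mul_comm]
  · intro j _
    have : IsFiniteMeasure (VectorMeasure.dirac (ξ j) (w j)).variation := inferInstance
    refine MeasureTheory.Integrable.of_bound (C := 1) ?_ ?_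
    · exact (UnitAddTorus.mFourier (-k)).continuous.aestronglyMeasurable
    · refine Eventually.of_forall fun y => ?_
      calc ‖UnitAddTorus.mFourier (-k) y‖ ≤ ‖UnitAddTorus.mFourier (-k)‖ :=
            ContinuousMap.norm_coe_le_norm _ _
        _ = 1 := UnitAddTorus.mFourier_norm

/-- A character of k - ℓ is a product of a character of k and a conjugate character of ℓ, so each
atom contributes a matrix of rank one. -/
theorem momentMatrix_discreteMeasure {d r : ℕ} (w : Fin r → ℂ) (ξ : Fin r → UnitAddTorus (Fin d))
    (n : ℕ) (k l : Fin d → Fin (n + 1)) :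
    momentMatrix (discreteMeasure w ξ) n k l =
      ∑ j, w j * (expVec n (ξ j) k * star (expVec n (ξ j) l)) := by
  simp only [momentMatrix, Matrix.of_apply, moment_discreteMeasure, expVec]
  refine Finset.sum_congr rfl fun j _ => ?_
  congr 1
  have : (-fun i => ((k i : ℕ) : ℤ) - ((l i : ℕ) : ℤ)) =
      (-fun i => ((k i : ℕ) : ℤ)) + fun i => ((l i : ℕ) : ℤ) := by
    ext i; simp; ring
  rw [this, UnitAddTorus.mFourier_add]
  congr 1
  have h2 := UnitAddTorus.mFourier_neg (n := fun i => ((l i : ℕ) : ℤ)) (x := ξ j)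
  rw [h2]; simp

theorem norm_expVec {d : ℕ} (n : ℕ) (x : UnitAddTorus (Fin d)) (k : Fin d → Fin (n + 1)) :
    ‖expVec n x k‖ = 1 := by
  simp only [expVec, UnitAddTorus.mFourier, ContinuousMap.coe_mk, norm_prod]
  exact Finset.prod_eq_one fun i _ => by rw [fourier_apply]; exact Circle.norm_coe _

theorem momentMatrix_mulVec {d r : ℕ} (w : Fin r → ℂ) (ξ : Fin r → UnitAddTorus (Fin d))
    (n : ℕ) (v : (Fin d → Fin (n + 1)) → ℂ) :
    momentMatrix (discreteMeasure w ξ) n *ᵥ v =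
      ∑ j, (w j * (star (expVec n (ξ j)) ⬝ᵥ v)) • expVec n (ξ j) := by
  ext k
  simp only [mulVec, dotProduct, momentMatrix_discreteMeasure, Finset.sum_apply, Pi.smul_apply,
    smul_eq_mul, Finset.sum_mul, Finset.mul_sum]
  rw [Finset.sum_comm]
  refine Finset.sum_congr rfl fun j _ => Finset.sum_congr rfl fun l _ => ?_
  simp only [Pi.star_apply]; ring

/-! ### Singular value decompositions and the rank -/

section SVD

variable {ι : Type} [Fintype ι] [DecidableEq ι] {N : ℕ} {T : Matrix ι ι ℂ}

theorem SVD.conjTranspose_mul (S : SVD N T) :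
    S.Uᴴ * T = Matrix.diagonal (fun j => (S.sv j : ℂ)) * S.Vᴴ := by
  rw [congrArg (S.Uᴴ * ·) S.eq_mul]
  rw [← Matrix.mul_assoc, ← Matrix.mul_assoc, S.U_conjTranspose_mul, Matrix.one_mul]

theorem SVD.mul_V (S : SVD N T) :
    T * S.V = S.U * Matrix.diagonal (fun j => (S.sv j : ℂ)) := by
  rw [congrArg (· * S.V) S.eq_mul]
  rw [Matrix.mul_assoc, S.V_conjTranspose_mul, Matrix.mul_one]

theorem SVD.rank_eq (S : SVD N T) :
    T.rank = Fintype.card {j : Fin N // S.sv j ≠ 0} := by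
  have h1 : T.rank ≤ (Matrix.diagonal (fun j => (S.sv j : ℂ))).rank := by
    conv_lhs => rw [S.eq_mul]
    exact (Matrix.rank_mul_le_left _ _).trans (Matrix.rank_mul_le_right _ _)
  have h2 : (Matrix.diagonal (fun j => (S.sv j : ℂ))).rank ≤ T.rank := by
    have : Matrix.diagonal (fun j => (S.sv j : ℂ)) = S.Uᴴ * T * S.V := by
      rw [S.conjTranspose_mul, Matrix.mul_assoc, S.V_conjTranspose_mul, Matrix.mul_one]
    rw [this]
    exact (Matrix.rank_mul_le_left _ _).trans (Matrix.rank_mul_le_right _ _)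
  rw [le_antisymm h1 h2, Matrix.rank_diagonal]
  simp

/-- Monotonicity makes the nonzero singular values an initial segment whose length is the rank.
Hence the cut-off at the rank in the signal function keeps exactly the columns with nonzero singular
value, whichever decomposition is used. -/
theorem SVD.sv_ne_zero_iff (S : SVD N T) (j : Fin N) : S.sv j ≠ 0 ↔ (j : ℕ) < T.rank := by
  have hcard : T.rank = (Finset.univ.filter fun j : Fin N => S.sv j ≠ 0).card := by
    rw [S.rank_eq, Fintype.card_subtype]
  constructor
  · intro h
    have : Finset.Iic j ⊆ Finset.univ.filter fun j : Fin N => S.sv j ≠ 0 := by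
      intro i hi
      simp only [Finset.mem_Iic] at hi
      simp only [Finset.mem_filter, Finset.mem_univ, true_and]
      have := S.sv_antitone hi
      have h0 := lt_of_le_of_ne (S.sv_nonneg j) (Ne.symm h)
      exact (h0.trans_le this).ne'
    have := Finset.card_le_card this
    rw [← hcard, Fin.card_Iic] at this
    omega
  · intro h h0
    have : (Finset.univ.filter fun j : Fin N => S.sv j ≠ 0) ⊆ Finset.Iio j := by
      intro i hi
      simp only [Finset.mem_filter, Finset.mem_univ, true_and] at hi
      simp only [Finset.mem_Iio]
      by_contra hij
      exact hi (le_antisymm ((S.sv_antitone (not_lt.mp hij)).trans h0.le) (S.sv_nonneg i))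
    have := Finset.card_le_card this
    rw [← hcard, Fin.card_Iio] at this
    omega

theorem SVD.col_mem_range (S : SVD N T) {j : Fin N} (hj : (j : ℕ) < T.rank) :
    ∃ v, T *ᵥ v = S.U.col j := by
  have h := (S.sv_ne_zero_iff j).2 hj
  refine ⟨((S.sv j : ℂ)⁻¹) • S.V.col j, ?_⟩
  have h1 : T *ᵥ S.V.col j = (S.sv j : ℂ) • S.U.col j := by
    have := congrArg (fun M : Matrix ι (Fin N) ℂ => M.col j) S.mul_V
    ext i
    have h2 := congrFun this i
    simp only [Matrix.col_apply, Matrix.mul_diagonal] at h2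
    simp only [mulVec, dotProduct, Matrix.col_apply, Pi.smul_apply, smul_eq_mul]
    rw [Matrix.mul_apply] at h2
    rw [h2, mul_comm]
  rw [mulVec_smul, h1, smul_smul, inv_mul_cancel₀ (by exact_mod_cast h), one_smul]

end SVD

/-! ### The signal function as a projection -/

theorem singularFun_eq {d n N : ℕ} {T : Matrix (Fin d → Fin (n + 1)) (Fin d → Fin (n + 1)) ℂ}
    (S : SVD N T) (j : Fin N) (x : UnitAddTorus (Fin d)) :
    singularFun S j x = star (expVec n x) ⬝ᵥ S.U.col j := rfl

theorem sum_smul_toLp {ι κ : Type*} [Fintype ι] [Fintype κ] (c : κ → ℂ) (a : κ → ι → ℂ) :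
    (∑ j, c j • (WithLp.toLp 2 (a j) : EuclideanSpace ℂ ι)) = WithLp.toLp 2 (∑ j, c j • a j) := by
  rw [WithLp.toLp_sum]; rfl

/-- The signal function is at most `1` minus the squared relative distance of `e_n(x)` from the span
of the vectors `e_n(ξ_j)`. -/
theorem exists_signalFun_le {d r n : ℕ} (w : Fin r → ℂ) (ξ : Fin r → UnitAddTorus (Fin d))
    (S : SVD ((n + 1) ^ d) (momentMatrix (discreteMeasure w ξ) n)) (x : UnitAddTorus (Fin d)) :
    ∃ c : Fin r → ℂ,
      (∀ l, star (expVec n (ξ l)) ⬝ᵥ (expVec n x - ∑ j, c j • expVec n (ξ j)) = 0) ∧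
      signalFun S x ≤ 1 / ((n : ℝ) + 1) ^ d * ∑ k, ‖(∑ j, c j • expVec n (ξ j)) k‖ ^ 2 := by
  classical
  set ι := Fin d → Fin (n + 1)
  let E := EuclideanSpace ℂ ι
  let a : Fin r → E := fun j => WithLp.toLp 2 (expVec n (ξ j))
  let e : E := WithLp.toLp 2 (expVec n x)
  let V : Submodule ℂ E := Submodule.span ℂ (Set.range a)
  let H : E := V.starProjection e
  have hperp : ∀ v ∈ V, inner ℂ v (e - H) = 0 :=
    (Submodule.mem_orthogonal V _).1 (Submodule.sub_starProjection_mem_orthogonal e)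
  have hHV : H ∈ V := Submodule.starProjection_apply_mem _ _
  obtain ⟨c, hc⟩ := (Submodule.mem_span_range_iff_exists_fun ℂ).1 hHV
  have hdot : ∀ (u v : ι → ℂ), inner ℂ (WithLp.toLp 2 u : E) (WithLp.toLp 2 v : E) = star u ⬝ᵥ v := by
    intro u v
    rw [EuclideanSpace.inner_toLp_toLp, dotProduct_comm]
  have hH : H = WithLp.toLp 2 (∑ j, c j • expVec n (ξ j)) := by
    rw [← hc]; exact sum_smul_toLp _ _
  refine ⟨c, fun l => ?_, ?_⟩
  · have h1 : inner ℂ (a l) (e - H) = 0 := hperp _ (Submodule.subset_span ⟨l, rfl⟩)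
    have h2 : e - H = WithLp.toLp 2 (expVec n x - ∑ j, c j • expVec n (ξ j)) := by
      rw [hH]; rfl
    rw [h2, hdot] at h1
    exact h1
  · have hnorm : ∑ k, ‖(∑ j, c j • expVec n (ξ j)) k‖ ^ 2 = ‖H‖ ^ 2 := by
      rw [hH, EuclideanSpace.norm_sq_eq]
    unfold signalFun
    rw [hnorm]
    refine mul_le_mul_of_nonneg_left ?_ (by positivity)
    let u : Fin ((n + 1) ^ d) → E := fun j => WithLp.toLp 2 (S.U.col j)
    have hu : Orthonormal ℂ u := by
      rw [orthonormal_iff_ite]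
      intro i j
      rw [hdot]
      have := congrFun (congrFun S.U_conjTranspose_mul i) j
      rw [Matrix.mul_apply, Matrix.one_apply] at this
      rw [← this]; rfl
    rw [← Finset.sum_filter]
    calc _ = ∑ j ∈ Finset.univ.filter (fun j : Fin ((n + 1) ^ d) =>
            (j : ℕ) < (momentMatrix (discreteMeasure w ξ) n).rank), ‖inner ℂ (u j) H‖ ^ 2 := by
          refine Finset.sum_congr rfl fun j hj => ?_
          have hj := (Finset.mem_filter.1 hj).2
          obtain ⟨v, hv⟩ := S.col_mem_range hj
          have hmem : u j ∈ V := by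
            have : u j = ∑ i, (w i * (star (expVec n (ξ i)) ⬝ᵥ v)) • a i := by
              rw [momentMatrix_mulVec] at hv
              simp only [u, a]
              rw [← hv, sum_smul_toLp]
            rw [this]
            exact Submodule.sum_mem _ fun i _ =>
              Submodule.smul_mem _ _ (Submodule.subset_span ⟨i, rfl⟩)
          -- Since u_j lies in V, e may be replaced by its projection H; Bessel's inequality then
          -- yields ‖H‖² rather than ‖e‖².
          have h1 : inner ℂ (u j) (e - H) = 0 := hperp _ hmem
          rw [inner_sub_right, sub_eq_zero] at h1
          rw [← h1, singularFun_eq, ← hdot, norm_inner_symm]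
      _ ≤ ‖H‖ ^ 2 := hu.sum_inner_products_le H

/-- If `e_n(x)` lies in the range of the moment matrix, the signal function equals `1`. -/
theorem signalFun_eq_one_of_mem_range {d n : ℕ} {μ : ComplexMeasure (UnitAddTorus (Fin d))}
    (S : SVD ((n + 1) ^ d) (momentMatrix μ n)) (x : UnitAddTorus (Fin d))
    (h : ∃ v, momentMatrix μ n *ᵥ v = expVec n x) : signalFun S x = 1 := by
  obtain ⟨v, hv⟩ := h
  have hU : ∀ j, singularFun S j x = star ((S.Uᴴ *ᵥ expVec n x) j) := by
    intro j
    simp only [singularFun, vecMul, mulVec, dotProduct, star_sum, star_mul', Pi.star_apply,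
      conjTranspose_apply, star_star]
    exact Finset.sum_congr rfl fun k _ => mul_comm _ _
  have hz : ∀ j : Fin ((n + 1) ^ d), ¬ (j : ℕ) < (momentMatrix μ n).rank →
      singularFun S j x = 0 := by
    intro j hj
    have h0 : S.sv j = 0 := by
      by_contra h; exact hj ((S.sv_ne_zero_iff j).1 h)
    rw [hU, ← hv, mulVec_mulVec, S.conjTranspose_mul, ← mulVec_mulVec, mulVec_diagonal, h0]
    simp
  have hsum : (∑ j : Fin ((n + 1) ^ d), if (j : ℕ) < (momentMatrix μ n).rank then
      ‖singularFun S j x‖ ^ 2 else 0) = ∑ j : Fin ((n + 1) ^ d), ‖singularFun S j x‖ ^ 2 := by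
    refine Finset.sum_congr rfl fun j _ => ?_
    split_ifs with h
    · rfl
    · rw [hz j h]; simp
  have hsq : ∀ {κ : Type} [Fintype κ] (v : κ → ℂ), ((∑ j, ‖v j‖ ^ 2 : ℝ) : ℂ) = star v ⬝ᵥ v := by
    intro κ _ v
    simp only [dotProduct, Pi.star_apply]
    push_cast
    refine Finset.sum_congr rfl fun j _ => ?_
    rw [← Complex.conj_mul']; rfl
  have hN : (∑ j : Fin ((n + 1) ^ d), ‖singularFun S j x‖ ^ 2) = ((n : ℝ) + 1) ^ d := by
    have h1 : (∑ j : Fin ((n + 1) ^ d), ‖singularFun S j x‖ ^ 2) =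
        ∑ k, ‖expVec n x k‖ ^ 2 := by
      have : (∑ j : Fin ((n + 1) ^ d), ‖singularFun S j x‖ ^ 2) =
          ∑ j, ‖(S.Uᴴ *ᵥ expVec n x) j‖ ^ 2 :=
        Finset.sum_congr rfl fun j _ => by rw [hU, norm_star]
      rw [this]
      apply Complex.ofReal_injective
      rw [hsq, hsq, star_mulVec, conjTranspose_conjTranspose, ← dotProduct_mulVec, mulVec_mulVec,
        S.U_mul_conjTranspose, one_mulVec]
    rw [h1]
    simp [norm_expVec]
  unfold signalFun
  rw [hsum, hN]
  field_simp

/-! ### Fourier coefficients of truncated exponentials -/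

/-- **Parseval's identity** for two square integrable functions on an interval. -/
theorem hasSum_conj_fourierCoeffOn_mul {a b : ℝ} {f g : ℝ → ℂ} (hab : a < b)
    (hf : MemLp f 2 (volume.restrict (Set.Ioc a b)))
    (hg : MemLp g 2 (volume.restrict (Set.Ioc a b))) :
    HasSum (fun i => (starRingEnd ℂ) (fourierCoeffOn hab f i) * fourierCoeffOn hab g i)
      ((b - a)⁻¹ • ∫ x in a..b, (starRingEnd ℂ) (f x) * g x) := by
  have := Fact.mk (by linarith : 0 < b - a)
  rw [← add_sub_cancel a b] at hf hg
  have h := hf.memLp_liftIoc.haarAddCircle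
  have h' := hg.memLp_liftIoc.haarAddCircle
  have H := (fourierBasis (T := b - a)).hasSum_inner_mul_inner h.toLp h'.toLp
  have E1 : ∀ i, (starRingEnd ℂ) (fourierCoeffOn hab f i) * fourierCoeffOn hab g i =
      inner ℂ (h.toLp) (fourierBasis i) * inner ℂ (fourierBasis i) h'.toLp := by
    intro i
    rw [← inner_conj_symm, ← HilbertBasis.repr_apply_apply, ← HilbertBasis.repr_apply_apply,
      fourierBasis_repr, fourierBasis_repr, fourierCoeff_congr_ae h.coeFn_toLp,
      fourierCoeff_congr_ae h'.coeFn_toLp]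
    simp [fourierCoeff_liftIoc_eq]
  have E2 : (b - a)⁻¹ • ∫ x in a..b, (starRingEnd ℂ) (f x) * g x = inner ℂ h.toLp h'.toLp := by
    rw [MeasureTheory.L2.inner_def]
    have e1 : (∫ x in a..(a + (b - a)), (starRingEnd ℂ) (f x) * g x) =
        ∫ x : AddCircle (b - a), AddCircle.liftIoc (b - a) a
          (fun x => (starRingEnd ℂ) (f x) * g x) x :=
      (AddCircle.integral_liftIoc_eq_intervalIntegral ..).symm
    rw [add_sub_cancel] at e1
    rw [e1, ← AddCircle.integral_haarAddCircle]
    apply integral_congr_ae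
    filter_upwards [h.coeFn_toLp, h'.coeFn_toLp] with x hx hx'
    rw [hx, hx', RCLike.inner_apply']
    rfl
  simp only [E1, E2]
  exact H

/-- `J z = ∫₀¹ e(z s) ds`. -/
theorem intervalIntegral_exp (z : ℝ) :
    ∫ s in (0 : ℝ)..1, Complex.exp (2 * Real.pi * Complex.I * z * s) =
      Complex.exp (Real.pi * Complex.I * z) * (Real.sinc (Real.pi * z) : ℝ) := by
  rcases eq_or_ne z 0 with rfl | hz
  · simp
  · have hc : (2 * Real.pi * Complex.I * z : ℂ) ≠ 0 := by
      simp [Real.pi_ne_zero, hz]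
    have hpz : Real.pi * z ≠ 0 := mul_ne_zero Real.pi_ne_zero hz
    rw [integral_exp_mul_complex hc, Real.sinc_of_ne_zero hpz]
    have h1 : Complex.exp (2 * Real.pi * Complex.I * z * (1 : ℝ)) =
        Complex.exp (Real.pi * Complex.I * z) * Complex.exp (Real.pi * Complex.I * z) := by
      rw [← Complex.exp_add]; congr 1; push_cast; ring
    have h2 : ((Real.sin (Real.pi * z) : ℝ) : ℂ) = (Complex.exp (-(Real.pi * Complex.I * z)) -
        Complex.exp (Real.pi * Complex.I * z)) * Complex.I / 2 := by
      rw [Complex.ofReal_sin, Complex.sin]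
      congr 3 <;> (congr 1; push_cast; ring)
    have h3 : Complex.exp (Real.pi * Complex.I * z) * Complex.exp (-(Real.pi * Complex.I * z)) = 1 := by
      rw [← Complex.exp_add]; simp
    rw [h1]
    have hpz' : (Real.pi * z : ℂ) ≠ 0 := by exact_mod_cast hpz
    push_cast [h2]
    simp only [mul_zero, Complex.exp_zero]
    have h2' : Complex.sin (Real.pi * z) = (Complex.exp (-(Real.pi * Complex.I * z)) -
        Complex.exp (Real.pi * Complex.I * z)) * Complex.I / 2 := by
      rw [← h2]; push_cast; rfl
    rw [div_eq_iff hc]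
    set A := Complex.exp (Real.pi * Complex.I * z)
    set B := Complex.exp (-(Real.pi * Complex.I * z))
    have : A * ((B - A) * Complex.I / 2 / (Real.pi * z)) * (2 * Real.pi * Complex.I * z) =
        A * (B - A) * Complex.I ^ 2 := by
      have hz' : (z : ℂ) ≠ 0 := by exact_mod_cast hz
      field_simp
    rw [this, Complex.I_sq]
    linear_combination h3

/-- The exponential `e(m (t - θ)/q)/q` truncated to `(θ, θ + q]`. -/
noncomputable def truncExp (q : ℝ) (m : ℤ) (θ : ℝ) : ℝ → ℂ :=
  (Set.Ioc θ (θ + q)).indicator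
    fun t => (1 / q : ℂ) * Complex.exp (2 * Real.pi * Complex.I * m * ((t - θ) / q))

theorem memLp_truncExp (q : ℝ) (m : ℤ) (θ : ℝ) :
    MemLp (truncExp q m θ) 2 (volume.restrict (Set.Ioc (0 : ℝ) 1)) := by
  refine MemLp.of_bound (C := ‖(1 / q : ℂ)‖) ?_ (Eventually.of_forall fun t => ?_)
  · refine AEStronglyMeasurable.indicator ?_ measurableSet_Ioc
    exact Continuous.aestronglyMeasurable (by fun_prop)
  · refine (norm_indicator_le_norm_self _ _).trans ?_
    rw [norm_mul]
    have : Complex.exp (2 * Real.pi * Complex.I * m * ((t - θ) / q)) =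
        Complex.exp (((2 * Real.pi * m * ((t - θ) / q) : ℝ) : ℂ) * Complex.I) := by
      congr 1; push_cast; ring
    rw [this, Complex.norm_exp_ofReal_mul_I, mul_one]

/-- The substitution s = (t - θ)/q reduces the coefficient to the integral of e((m - qk)s) over [0,
1]. Thus exponentials cut off to an interval of length q have samples of a shifted sinc function at
the points qk as Fourier coefficients, and Parseval's identity evaluates sums of products of such
samples. -/
theorem fourierCoeffOn_truncExp {q : ℝ} (hq : 0 < q) (m : ℤ) {θ : ℝ} (h0 : 0 ≤ θ)
    (h1 : θ + q ≤ 1) (k : ℤ) :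
    fourierCoeffOn (zero_lt_one' ℝ) (truncExp q m θ) k =
      Complex.exp (-(2 * Real.pi * Complex.I * (k * θ))) *
        (Complex.exp (Real.pi * Complex.I * ((m - q * k : ℝ))) *
          (Real.sinc (Real.pi * (m - q * k)) : ℝ)) := by
  rw [fourierCoeffOn_eq_integral, ← intervalIntegral_exp]
  have hind : ∀ x : ℝ, (fourier (-k) (x : AddCircle ((1 : ℝ) - 0))) • truncExp q m θ x =
      (Set.Ioc θ (θ + q)).indicator (fun t : ℝ => Complex.exp (-(2 * Real.pi * Complex.I * (k * θ))) *
        ((1 / q : ℂ) * Complex.exp (2 * Real.pi * Complex.I * ((m - q * k : ℝ)) *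
          (((t - θ) / q : ℝ) : ℂ)))) x := by
    intro x
    unfold truncExp
    by_cases hx : x ∈ Set.Ioc θ (θ + q)
    · rw [Set.indicator_of_mem hx, Set.indicator_of_mem hx, fourier_coe_apply, smul_eq_mul,
        mul_left_comm, ← Complex.exp_add, mul_left_comm, ← Complex.exp_add]
      congr 2
      have : (q : ℂ) ≠ 0 := by exact_mod_cast hq.ne'
      push_cast
      field_simp
      ring
    · rw [Set.indicator_of_notMem hx, Set.indicator_of_notMem hx, smul_zero]
  simp only [hind, sub_zero, div_one, one_smul]
  rw [intervalIntegral.integral_of_le zero_le_one, setIntegral_indicator measurableSet_Ioc]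
  have hinter : Set.Ioc (0 : ℝ) 1 ∩ Set.Ioc θ (θ + q) = Set.Ioc θ (θ + q) :=
    Set.inter_eq_right.2 (Set.Ioc_subset_Ioc h0 h1)
  rw [hinter, ← intervalIntegral.integral_of_le (by linarith),
    intervalIntegral.integral_const_mul, intervalIntegral.integral_const_mul]
  congr 1
  have e1 : θ / q - θ / q = 0 := sub_self _
  have e2 : (θ + q) / q - θ / q = 1 := by field_simp; ring
  have e3 := intervalIntegral.integral_comp_div_sub (a := θ) (b := θ + q) (fun s : ℝ =>
    Complex.exp (2 * Real.pi * Complex.I * ((m - q * k : ℝ)) * (s : ℂ))) hq.ne' (θ / q)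
  rw [e1, e2] at e3
  have e4 : (∫ t in θ..θ + q, Complex.exp (2 * Real.pi * Complex.I * ((m - q * k : ℝ)) *
      (((t - θ) / q : ℝ) : ℂ))) = ∫ t in θ..θ + q, Complex.exp (2 * Real.pi * Complex.I *
      ((m - q * k : ℝ)) * ((t / q - θ / q : ℝ) : ℂ)) :=
    intervalIntegral.integral_congr fun t _ => by simp only [sub_div]
  have : (q : ℂ) ≠ 0 := by exact_mod_cast hq.ne'
  rw [e4, e3, Complex.real_smul, ← mul_assoc, one_div_mul_cancel this, one_mul]

/-- The cardinal sine centred at the integer `m`. -/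
noncomputable def sincAt (m : ℤ) (y : ℝ) : ℝ := Real.sinc (Real.pi * (y - m))

theorem conj_exp_mul_exp (a b : ℝ) :
    (starRingEnd ℂ) (Complex.exp (Real.pi * Complex.I * a)) * Complex.exp (Real.pi * Complex.I * b) =
      Complex.exp (Real.pi * Complex.I * ((b - a : ℝ) : ℂ)) := by
  rw [← Complex.exp_conj, ← Complex.exp_add]
  congr 1
  simp
  ring

theorem hasSum_truncExp {q : ℝ} (hq : 0 < q) (m l : ℤ) {θ : ℝ} (h0 : 0 ≤ θ) (h1 : θ + q ≤ 1) :
    HasSum (fun k : ℤ => Complex.exp (Real.pi * Complex.I * ((l - m : ℝ) : ℂ)) *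
      (((sincAt m (q * k) * sincAt l (q * k) : ℝ) : ℂ) *
        Complex.exp (-(2 * Real.pi * Complex.I * (k * θ)))))
      (∫ x in (0 : ℝ)..1, (starRingEnd ℂ) (truncExp q m 0 x) * truncExp q l θ x) := by
  have h := hasSum_conj_fourierCoeffOn_mul (zero_lt_one' ℝ) (memLp_truncExp q m 0)
    (memLp_truncExp q l θ)
  rw [sub_zero, inv_one, one_smul] at h
  refine h.congr_fun ?_
  intro k
  rw [fourierCoeffOn_truncExp hq m le_rfl (by linarith), fourierCoeffOn_truncExp hq l h0 h1]
  have e1 : (l - m : ℝ) = (l - q * k) - (m - q * k) := by ring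
  have e2 : ∀ j : ℤ, sincAt j (q * k) = Real.sinc (Real.pi * (j - q * k)) := by
    intro j
    rw [sincAt, ← Real.sinc_neg]; congr 1; ring
  rw [e1, ← conj_exp_mul_exp, e2, e2]
  simp only [map_mul, Complex.conj_ofReal, Complex.ofReal_zero, mul_zero, neg_zero,
    Complex.exp_zero, map_one, Complex.ofReal_mul]
  ring

/-- The hypotheses on θ make the two intervals of length q disjoint, so the integral in Parseval's
identity is zero. This vanishing at every shift at distance at least q from the integers is the
orthogonality behind the large sieve. -/
theorem hasSum_sincAt_mul_exp {q : ℝ} (hq : 0 < q) (m l : ℤ) {θ : ℝ} (h0 : q ≤ θ)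
    (h1 : θ + q ≤ 1) :
    HasSum (fun k : ℤ => ((sincAt m (q * k) * sincAt l (q * k) : ℝ) : ℂ) *
        Complex.exp (-(2 * Real.pi * Complex.I * (k * θ)))) 0 := by
  have h := hasSum_truncExp hq m l (hq.le.trans h0) h1
  have hz : ∀ x, (starRingEnd ℂ) (truncExp q m 0 x) * truncExp q l θ x = 0 := by
    intro x
    unfold truncExp
    by_cases hx : x ∈ Set.Ioc θ (θ + q)
    · rw [Set.indicator_of_notMem (a := x) (s := Set.Ioc 0 (0 + q)), map_zero, zero_mul]
      intro h; have := h.2; have := hx.1; linarith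
    · rw [Set.indicator_of_notMem hx, mul_zero]
  simp only [hz, intervalIntegral.integral_zero] at h
  have := h.mul_left (Complex.exp (Real.pi * Complex.I * ((l - m : ℝ) : ℂ)))⁻¹
  simpa [← mul_assoc, inv_mul_cancel₀ (Complex.exp_ne_zero _)] using this

theorem hasSum_sincAt_mul {q : ℝ} (hq : 0 < q) (hq1 : q ≤ 1) (m l : ℤ) :
    HasSum (fun k : ℤ => sincAt m (q * k) * sincAt l (q * k)) (1 / q * Real.sinc (Real.pi * (l - m))) := by
  have h := hasSum_truncExp hq m l le_rfl (by linarith : (0 : ℝ) + q ≤ 1)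
  have hqc : (q : ℂ) ≠ 0 := by exact_mod_cast hq.ne'
  have hi : (∫ x in (0 : ℝ)..1, (starRingEnd ℂ) (truncExp q m 0 x) * truncExp q l 0 x) =
      Complex.exp (Real.pi * Complex.I * ((l - m : ℝ) : ℂ)) *
        (((1 / q * Real.sinc (Real.pi * (l - m)) : ℝ)) : ℂ) := by
    have hind : ∀ x : ℝ, (starRingEnd ℂ) (truncExp q m 0 x) * truncExp q l 0 x =
        (Set.Ioc 0 q).indicator (fun t : ℝ => (1 / q : ℂ) ^ 2 *
          Complex.exp (2 * Real.pi * Complex.I * ((l - m : ℝ) : ℂ) * ((t / q : ℝ) : ℂ))) x := by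
      intro x
      unfold truncExp
      rw [zero_add]
      by_cases hx : x ∈ Set.Ioc 0 q
      · simp only [Set.indicator_of_mem hx]
        rw [map_mul, ← Complex.exp_conj, mul_mul_mul_comm, ← Complex.exp_add]
        congr 1
        · simp; ring
        · have h2 : (starRingEnd ℂ) 2 = 2 := map_ofNat _ 2
          congr 1; simp [h2]; ring
      · simp only [Set.indicator_of_notMem hx, mul_zero]
    simp only [hind]
    rw [intervalIntegral.integral_of_le zero_le_one, setIntegral_indicator measurableSet_Ioc,
      Set.inter_eq_right.2 (Set.Ioc_subset_Ioc le_rfl hq1),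
      ← intervalIntegral.integral_of_le hq.le, intervalIntegral.integral_const_mul]
    have e3 := intervalIntegral.integral_comp_div (a := 0) (b := q) (fun s : ℝ =>
      Complex.exp (2 * Real.pi * Complex.I * ((l - m : ℝ) : ℂ) * (s : ℂ))) hq.ne'
    rw [zero_div, div_self hq.ne', intervalIntegral_exp] at e3
    rw [e3, Complex.real_smul]
    push_cast
    field_simp
  rw [hi] at h
  have := h.mul_left (Complex.exp (Real.pi * Complex.I * ((l - m : ℝ) : ℂ)))⁻¹
  simp only [← mul_assoc, inv_mul_cancel₀ (Complex.exp_ne_zero _), one_mul] at this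
  rw [← Complex.hasSum_ofReal]
  simpa using this

/-- Parseval's identity for t ↦ e(yt) on [0, 1], whose m-th Fourier coefficient has modulus
|sinc(π(y - m))|. -/
theorem hasSum_sincAt_sq (y : ℝ) : HasSum (fun m : ℤ => sincAt m y ^ 2) 1 := by
  have hL : MemLp (fun t : ℝ => Complex.exp (2 * Real.pi * Complex.I * y * t)) 2
      (volume.restrict (Set.Ioc (0 : ℝ) 1)) := by
    refine MemLp.of_bound (C := 1) (Continuous.aestronglyMeasurable (by fun_prop))
      (Eventually.of_forall fun t => ?_)
    have : Complex.exp (2 * Real.pi * Complex.I * y * t) =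
        Complex.exp (((2 * Real.pi * y * t : ℝ) : ℂ) * Complex.I) := by
      congr 1; push_cast; ring
    rw [this, Complex.norm_exp_ofReal_mul_I]
  have h := hasSum_sq_fourierCoeffOn (zero_lt_one' ℝ) hL
  have hn : ∀ t : ℝ, ‖Complex.exp (2 * Real.pi * Complex.I * y * t)‖ = 1 := by
    intro t
    have : Complex.exp (2 * Real.pi * Complex.I * y * t) =
        Complex.exp (((2 * Real.pi * y * t : ℝ) : ℂ) * Complex.I) := by
      congr 1; push_cast; ring
    rw [this, Complex.norm_exp_ofReal_mul_I]
  have e1 : ((1 : ℝ) - 0)⁻¹ • ∫ x in (0 : ℝ)..1, ‖Complex.exp (2 * Real.pi * Complex.I * y * x)‖ ^ 2 = 1 := by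
    simp [hn]
  rw [e1] at h
  refine h.congr_fun fun m => ?_
  rw [fourierCoeffOn_eq_integral]
  have e2 : ∀ x : ℝ, (fourier (-m) (x : AddCircle ((1 : ℝ) - 0))) •
      Complex.exp (2 * Real.pi * Complex.I * y * x) =
      Complex.exp (2 * Real.pi * Complex.I * ((y - m : ℝ) : ℂ) * x) := by
    intro x
    rw [fourier_coe_apply, smul_eq_mul, ← Complex.exp_add]
    congr 1; push_cast; ring
  simp only [e2, sub_zero, div_one, one_smul]
  rw [intervalIntegral_exp, norm_mul]
  have : Complex.exp (Real.pi * Complex.I * ((y - m : ℝ) : ℂ)) =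
      Complex.exp (((Real.pi * (y - m) : ℝ) : ℂ) * Complex.I) := by
    congr 1; push_cast; ring
  rw [this, Complex.norm_exp_ofReal_mul_I, one_mul, Complex.norm_real, Real.norm_eq_abs, sq_abs]
  rfl

/-! ### A Selberg type minorant and the large sieve -/

theorem sincAt_of_ne {m : ℤ} {y : ℝ} (h : y ≠ m) :
    sincAt m y = Real.sin (Real.pi * (y - m)) / (Real.pi * (y - m)) :=
  Real.sinc_of_ne_zero (mul_ne_zero Real.pi_ne_zero (sub_ne_zero.2 h))

theorem sincAt_int (m j : ℤ) : sincAt m (j : ℝ) = if j = m then 1 else 0 := by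
  split_ifs with h
  · subst h; simp [sincAt]
  · have : (j : ℝ) ≠ m := by exact_mod_cast h
    rw [sincAt_of_ne this]
    have : Real.sin (Real.pi * ((j : ℝ) - m)) = 0 := by
      rw [mul_comm]; exact_mod_cast Real.sin_int_mul_pi (j - m)
    rw [this, zero_div]

/-- With `S = sin(π(y - m))/π` one has `s_m = S/(y-m)` and `s_{m+1} = -S/(y-m-1)`. -/
theorem sincAt_pair {m : ℤ} {y : ℝ} (h : y ≠ m) (h' : y ≠ m + 1) :
    ∃ S : ℝ, sincAt m y = S / (y - m) ∧ sincAt (m + 1) y = -S / (y - m - 1) := by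
  refine ⟨Real.sin (Real.pi * (y - m)) / Real.pi, ?_, ?_⟩
  · rw [sincAt_of_ne h]; rw [div_div]
  · have h2 : y ≠ ((m + 1 : ℤ) : ℝ) := by push_cast; exact h'
    rw [sincAt_of_ne h2]
    have : Real.pi * (y - ((m + 1 : ℤ) : ℝ)) = Real.pi * (y - m) - Real.pi := by push_cast; ring
    rw [this, Real.sin_sub_pi]
    have : Real.pi * (y - m) - Real.pi = Real.pi * (y - m - 1) := by ring
    rw [this, ← neg_div, div_div]

/-- With the common numerator S of the two sinc functions the expression is S² / ((y-m-1)² (y-m)),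
which has the sign of y - m. -/
theorem sincAt_succ_sq_add_nonpos {m : ℤ} {y : ℝ} (h : y ≤ m) :
    sincAt (m + 1) y ^ 2 + sincAt m y * sincAt (m + 1) y ≤ 0 := by
  by_cases h1 : y = m
  · rw [h1, sincAt_int (m + 1)]; simp
  have h1' : y - m < 0 := by
    have := lt_of_le_of_ne h h1; linarith
  have h2 : y ≠ m + 1 := by intro h2; linarith
  obtain ⟨S, e1, e2⟩ := sincAt_pair h1 h2
  have h2' : y - m - 1 < 0 := by linarith
  have : (-S / (y - m - 1)) ^ 2 + S / (y - m) * (-S / (y - m - 1)) =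
      S ^ 2 / ((y - m - 1) ^ 2 * (y - m)) := by
    field_simp; ring
  rw [e1, e2, this]
  exact div_nonpos_of_nonneg_of_nonpos (sq_nonneg S)
    (mul_nonpos_of_nonneg_of_nonpos (sq_nonneg _) h1'.le)

theorem sincAt_sq_add_nonpos {m : ℤ} {y : ℝ} (h : (m : ℝ) + 1 ≤ y) :
    sincAt m y ^ 2 + sincAt m y * sincAt (m + 1) y ≤ 0 := by
  by_cases h2 : y = m + 1
  · have : sincAt m y = 0 := by
      rw [h2]; have := sincAt_int m (m + 1); push_cast at this; rw [this]; simp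
    rw [this]; simp
  have h2' : 0 < y - m - 1 := by
    have := lt_of_le_of_ne h (Ne.symm h2); linarith
  have h1 : y ≠ m := by intro h2; linarith
  obtain ⟨S, e1, e2⟩ := sincAt_pair h1 h2
  have h1' : 0 < y - m := by linarith
  have : (S / (y - m)) ^ 2 + S / (y - m) * (-S / (y - m - 1)) =
      -(S ^ 2 / ((y - m) ^ 2 * (y - m - 1))) := by
    field_simp; ring
  rw [e1, e2, this]
  exact neg_nonpos.2 (div_nonneg (sq_nonneg S) (by positivity))

/-- Selberg type majorant of `[0, L]` (before correction). -/
noncomputable def selA (L : ℕ) (y : ℝ) : ℝ :=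
  ∑ m ∈ Finset.range L, 1 / 2 * (sincAt m y + sincAt (m + 1) y) ^ 2

/-- The correction term turning `selA` into a minorant. -/
noncomputable def selE (L : ℕ) (y : ℝ) : ℝ := 1 / 2 * (sincAt 0 y ^ 2 + sincAt L y ^ 2)

theorem selA_nonneg (L : ℕ) (y : ℝ) : 0 ≤ selA L y :=
  Finset.sum_nonneg fun _ _ => by positivity

theorem selE_nonneg (L : ℕ) (y : ℝ) : 0 ≤ selE L y := by unfold selE; positivity

/-- Parseval's identity for e(yt) and e((y-1)t): the coefficients of the second are, up to sign,
those of the first shifted by one index, and the inner product is the integral of e(-t) over a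
period. -/
theorem hasSum_sincAt_mul_succ (y : ℝ) :
    HasSum (fun m : ℤ => sincAt m y * sincAt (m + 1) y) 0 := by
  have hE : ∀ z t : ℝ, ‖Complex.exp (2 * Real.pi * Complex.I * z * t)‖ = 1 := by
    intro z t
    have : Complex.exp (2 * Real.pi * Complex.I * z * t) =
        Complex.exp (((2 * Real.pi * z * t : ℝ) : ℂ) * Complex.I) := by
      congr 1; push_cast; ring
    rw [this, Complex.norm_exp_ofReal_mul_I]
  have hL : ∀ z : ℝ, MemLp (fun t : ℝ => Complex.exp (2 * Real.pi * Complex.I * z * t)) 2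
      (volume.restrict (Set.Ioc (0 : ℝ) 1)) := fun z =>
    MemLp.of_bound (C := 1) (Continuous.aestronglyMeasurable (by fun_prop))
      (Eventually.of_forall fun t => (hE z t).le)
  have hc : ∀ (z : ℝ) (m : ℤ), fourierCoeffOn (zero_lt_one' ℝ)
      (fun t : ℝ => Complex.exp (2 * Real.pi * Complex.I * z * t)) m =
      Complex.exp (Real.pi * Complex.I * ((z - m : ℝ) : ℂ)) *
        (Real.sinc (Real.pi * (z - m)) : ℝ) := by
    intro z m
    rw [fourierCoeffOn_eq_integral]
    have e2 : ∀ x : ℝ, (fourier (-m) (x : AddCircle ((1 : ℝ) - 0))) •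
        Complex.exp (2 * Real.pi * Complex.I * z * x) =
        Complex.exp (2 * Real.pi * Complex.I * ((z - m : ℝ) : ℂ) * x) := by
      intro x
      rw [fourier_coe_apply, smul_eq_mul, ← Complex.exp_add]
      congr 1; push_cast; ring
    simp only [e2, sub_zero, div_one, one_smul]
    rw [intervalIntegral_exp]
  have h := hasSum_conj_fourierCoeffOn_mul (zero_lt_one' ℝ) (hL y) (hL (y - 1))
  have hi : ((1 : ℝ) - 0)⁻¹ • ∫ x in (0 : ℝ)..1, (starRingEnd ℂ)
      (Complex.exp (2 * Real.pi * Complex.I * y * x)) *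
        Complex.exp (2 * Real.pi * Complex.I * ((y - 1 : ℝ) : ℂ) * x) = 0 := by
    have e : ∀ x : ℝ, (starRingEnd ℂ) (Complex.exp (2 * Real.pi * Complex.I * y * x)) *
        Complex.exp (2 * Real.pi * Complex.I * ((y - 1 : ℝ) : ℂ) * x) =
        Complex.exp (2 * Real.pi * Complex.I * ((-1 : ℝ) : ℂ) * x) := by
      intro x
      rw [← Complex.exp_conj, ← Complex.exp_add]
      have h2 : (starRingEnd ℂ) 2 = 2 := map_ofNat _ 2
      congr 1; simp [h2]; ring
    simp only [e]
    rw [intervalIntegral_exp, mul_neg_one, Real.sinc_neg, Real.sinc_of_ne_zero Real.pi_ne_zero]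
    simp
  rw [hi] at h
  rw [← Complex.hasSum_ofReal]
  have h' := h.neg
  rw [neg_zero] at h'
  rw [Complex.ofReal_zero]
  refine h'.congr_fun fun m => ?_
  rw [hc, hc]
  have e1 : Complex.exp (Real.pi * Complex.I * ((y - 1 - m : ℝ) : ℂ)) =
      -Complex.exp (Real.pi * Complex.I * ((y - m : ℝ) : ℂ)) := by
    have : (Real.pi * Complex.I * ((y - 1 - m : ℝ) : ℂ)) =
        Real.pi * Complex.I * ((y - m : ℝ) : ℂ) - Real.pi * Complex.I := by push_cast; ring
    rw [this, Complex.exp_sub, Complex.exp_pi_mul_I, div_neg, div_one]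
  have e2 := conj_exp_mul_exp (y - m) (y - m)
  rw [sub_self] at e2
  have e3 : Real.sinc (Real.pi * (y - 1 - m)) = sincAt (m + 1) y := by
    unfold sincAt; congr 1; push_cast; ring
  have e4 : Real.sinc (Real.pi * (y - m)) = sincAt m y := rfl
  rw [e1, e3, e4, map_mul, Complex.conj_ofReal]
  simp only [Complex.ofReal_zero, mul_zero, Complex.exp_zero] at e2
  rw [Complex.ofReal_mul]
  linear_combination (-(sincAt m y : ℂ) * (sincAt (m + 1) y : ℂ)) * e2

/-- Extended over all integers m, the sum of the squares is (1/2)(1 + 1) + 0 = 1; `selA` keeps L of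
these nonnegative terms. -/
theorem selA_le_one (L : ℕ) (y : ℝ) : selA L y ≤ 1 := by
  have h1 := hasSum_sincAt_sq y
  have h2 : HasSum ((fun m : ℤ => sincAt m y ^ 2) ∘ (Equiv.addRight (1 : ℤ))) 1 :=
    (Equiv.hasSum_iff _).2 h1
  have h3 := (((h1.add h2).mul_left (1 / 2)).add (hasSum_sincAt_mul_succ y))
  have h4 : HasSum (fun m : ℤ => 1 / 2 * (sincAt m y + sincAt (m + 1) y) ^ 2) 1 := by
    have e : (1 : ℝ) = 1 / 2 * (1 + 1) + 0 := by norm_num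
    rw [e]
    refine h3.congr_fun fun m => ?_
    simp only [Function.comp_apply, Equiv.coe_addRight]
    ring
  have h5 := sum_le_hasSum ((Finset.range L).map Nat.castEmbedding)
    (fun _ _ => by positivity) h4
  simpa [selA, Finset.sum_map] using h5

/-- Telescoping trades half of s_m² for half of s_{m+1}², so that each summand takes a form whose
sign is known to the left of m. -/
theorem selA_eq (L : ℕ) (y : ℝ) : selA L y - selE L y =
    ∑ m ∈ Finset.range L, (sincAt (m + 1) y ^ 2 + sincAt m y * sincAt (m + 1) y) - sincAt L y ^ 2 := by
  unfold selA selE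
  have ht : ∑ m ∈ Finset.range L, (sincAt (m + 1) y ^ 2 - sincAt m y ^ 2) =
      sincAt L y ^ 2 - sincAt 0 y ^ 2 := by
    have := Finset.sum_range_sub (fun m : ℕ => sincAt m y ^ 2) L
    simpa using this
  have e : ∑ m ∈ Finset.range L, 1 / 2 * (sincAt m y + sincAt (m + 1) y) ^ 2 =
      ∑ m ∈ Finset.range L, (sincAt (m + 1) y ^ 2 + sincAt m y * sincAt (m + 1) y) -
        1 / 2 * ∑ m ∈ Finset.range L, (sincAt (m + 1) y ^ 2 - sincAt m y ^ 2) := by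
    rw [Finset.mul_sum, ← Finset.sum_sub_distrib]
    exact Finset.sum_congr rfl fun m _ => by ring
  rw [e, ht]; ring

theorem selA_sub_selE_nonpos {L : ℕ} {y : ℝ} (h : y ≤ 0 ∨ (L : ℝ) ≤ y) :
    selA L y - selE L y ≤ 0 := by
  rw [selA_eq]
  rcases h with h | h
  · refine sub_nonpos.2 ((Finset.sum_nonpos fun m _ => ?_).trans (sq_nonneg _))
    have hm : y ≤ ((m : ℤ) : ℝ) := h.trans (by positivity)
    exact_mod_cast sincAt_succ_sq_add_nonpos hm
  -- For y ≥ L the telescoping is reversed: s_m² replaces s_{m+1}² in the summands, and -s_0² is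
  -- what remains.
  · have ht : ∑ m ∈ Finset.range L, (sincAt (m + 1) y ^ 2 - sincAt m y ^ 2) =
        sincAt L y ^ 2 - sincAt 0 y ^ 2 := by
      have := Finset.sum_range_sub (fun m : ℕ => sincAt m y ^ 2) L
      simpa using this
    have e : ∑ m ∈ Finset.range L, (sincAt (m + 1) y ^ 2 + sincAt m y * sincAt (m + 1) y) =
        ∑ m ∈ Finset.range L, (sincAt m y ^ 2 + sincAt m y * sincAt (m + 1) y) +
        ∑ m ∈ Finset.range L, (sincAt (m + 1) y ^ 2 - sincAt m y ^ 2) := by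
      rw [← Finset.sum_add_distrib]
      exact Finset.sum_congr rfl fun m _ => by ring
    have hn : ∑ m ∈ Finset.range L, (sincAt m y ^ 2 + sincAt m y * sincAt (m + 1) y) ≤ 0 := by
      refine Finset.sum_nonpos fun m hm => ?_
      have hm := Finset.mem_range.1 hm
      have : ((m : ℤ) : ℝ) + 1 ≤ y := by
        have : ((m + 1 : ℕ) : ℝ) ≤ L := by exact_mod_cast hm
        push_cast at this ⊢; linarith
      exact_mod_cast sincAt_sq_add_nonpos this
    rw [e, ht]
    nlinarith [sq_nonneg (sincAt 0 y)]

/-- The character `k ↦ e(-k t)`. -/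
noncomputable def ech (k : ℤ) (t : ℝ) : ℂ := Complex.exp (-(2 * Real.pi * Complex.I * (k * t)))

theorem ech_zero (k : ℤ) : ech k 0 = 1 := by simp [ech]

theorem norm_ech (k : ℤ) (t : ℝ) : ‖ech k t‖ = 1 := by
  have : ech k t = Complex.exp (((-(2 * Real.pi * (k * t)) : ℝ) : ℂ) * Complex.I) := by
    unfold ech; congr 1; push_cast; ring
  rw [this, Complex.norm_exp_ofReal_mul_I]

theorem ech_sub (k : ℤ) (s t : ℝ) : ech k (s - t) = ech k s * (starRingEnd ℂ) (ech k t) := by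
  have h2 : (starRingEnd ℂ) 2 = 2 := map_ofNat _ 2
  unfold ech
  rw [← Complex.exp_conj, ← Complex.exp_add]
  congr 1
  simp [h2]; ring

theorem ech_fract (k : ℤ) (t : ℝ) : ech k (Int.fract t) = ech k t := by
  unfold ech
  rw [Complex.exp_eq_exp_iff_exists_int]
  refine ⟨k * ⌊t⌋, ?_⟩
  rw [Int.fract]
  push_cast
  ring

theorem hasSum_selA {L : ℕ} {q : ℝ} {χ : ℤ → ℂ} {v : ℤ → ℤ → ℂ}
    (h : ∀ m l : ℤ, HasSum (fun k : ℤ => ((sincAt m (q * k) * sincAt l (q * k) : ℝ) : ℂ) * χ k) (v m l)) :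
    HasSum (fun k : ℤ => (selA L (q * k) : ℂ) * χ k)
      (∑ m ∈ Finset.range L, (1 / 2 : ℂ) * (v m m + 2 * v m (m + 1) + v (m + 1) (m + 1))) := by
  have := hasSum_sum (s := Finset.range L) fun (m : ℕ) _ =>
    (((h m m).add ((h m (m + 1)).mul_left 2)).add (h (m + 1) (m + 1))).mul_left (1 / 2 : ℂ)
  refine this.congr_fun fun k => ?_
  unfold selA
  push_cast
  rw [Finset.sum_mul]
  exact Finset.sum_congr rfl fun m _ => by ring

theorem hasSum_selE {L : ℕ} {q : ℝ} {χ : ℤ → ℂ} {v : ℤ → ℤ → ℂ}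
    (h : ∀ m l : ℤ, HasSum (fun k : ℤ => ((sincAt m (q * k) * sincAt l (q * k) : ℝ) : ℂ) * χ k) (v m l)) :
    HasSum (fun k : ℤ => (selE L (q * k) : ℂ) * χ k) ((1 / 2 : ℂ) * (v 0 0 + v L L)) := by
  refine (((h 0 0).add (h L L)).mul_left (1 / 2 : ℂ)).congr_fun fun k => ?_
  unfold selE
  push_cast
  ring

theorem hasSum_sinc_one {q : ℝ} (hq : 0 < q) (hq1 : q ≤ 1) (m l : ℤ) :
    HasSum (fun k : ℤ => ((sincAt m (q * k) * sincAt l (q * k) : ℝ) : ℂ) * ech k 0)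
      (if m = l then ((1 / q : ℝ) : ℂ) else 0) := by
  have h := hasSum_sincAt_mul hq hq1 m l
  have e : 1 / q * Real.sinc (Real.pi * ((l : ℝ) - m)) = if m = l then 1 / q else 0 := by
    have := sincAt_int m l
    unfold sincAt at this
    rw [this]
    by_cases hml : m = l
    · simp [hml]
    · simp [hml, Ne.symm hml]
  rw [e] at h
  have h' := (Complex.hasSum_ofReal (L := SummationFilter.unconditional ℤ)).2 h
  refine (HasSum.congr_fun ?_ fun k => (by rw [ech_zero, mul_one] : _ =
    ((sincAt m (q * k) * sincAt l (q * k) : ℝ) : ℂ)))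
  convert h' using 1
  split_ifs <;> simp

theorem hasSum_selA_zero {L : ℕ} {q : ℝ} (hq : 0 < q) (hq1 : q ≤ 1) :
    HasSum (fun k : ℤ => (selA L (q * k) : ℂ) * ech k 0) ((L / q : ℝ) : ℂ) := by
  have h := hasSum_selA (L := L) (hasSum_sinc_one hq hq1)
  convert h using 1
  have : ∀ m : ℕ, ((1 / 2 : ℂ) * ((if (m : ℤ) = m then ((1 / q : ℝ) : ℂ) else 0) +
      2 * (if (m : ℤ) = m + 1 then ((1 / q : ℝ) : ℂ) else 0) +
      (if (m + 1 : ℤ) = m + 1 then ((1 / q : ℝ) : ℂ) else 0))) = ((1 / q : ℝ) : ℂ) := by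
    intro m
    have : ¬ ((m : ℤ) = m + 1) := by omega
    simp only [this, if_true, if_false]
    ring
  rw [Finset.sum_congr rfl fun m _ => this m]
  simp [div_eq_mul_inv]

theorem hasSum_selE_zero {L : ℕ} {q : ℝ} (hq : 0 < q) (hq1 : q ≤ 1) :
    HasSum (fun k : ℤ => (selE L (q * k) : ℂ) * ech k 0) ((1 / q : ℝ) : ℂ) := by
  have h := hasSum_selE (L := L) (hasSum_sinc_one hq hq1)
  convert h using 1
  simp only [if_true]
  ring

theorem hasSum_sinc_far {q t : ℝ} (hq : 0 < q) (h0 : q ≤ Int.fract t) (h1 : Int.fract t + q ≤ 1)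
    (m l : ℤ) :
    HasSum (fun k : ℤ => ((sincAt m (q * k) * sincAt l (q * k) : ℝ) : ℂ) * ech k t) 0 := by
  refine (hasSum_sincAt_mul_exp hq m l h0 h1).congr_fun fun k => ?_
  rw [← ech_fract k t]; rfl

theorem hasSum_selA_far {L : ℕ} {q t : ℝ} (hq : 0 < q) (h0 : q ≤ Int.fract t)
    (h1 : Int.fract t + q ≤ 1) :
    HasSum (fun k : ℤ => (selA L (q * k) : ℂ) * ech k t) 0 := by
  simpa using hasSum_selA (L := L) (hasSum_sinc_far hq h0 h1)

theorem hasSum_selE_far {L : ℕ} {q t : ℝ} (hq : 0 < q) (h0 : q ≤ Int.fract t)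
    (h1 : Int.fract t + q ≤ 1) :
    HasSum (fun k : ℤ => (selE L (q * k) : ℂ) * ech k t) 0 := by
  simpa using hasSum_selE (L := L) (hasSum_sinc_far hq h0 h1)

/-- Characters have modulus one, so absolute convergence at 0 carries over. Two distinct nodes are
only known to be far apart in one coordinate; in the remaining coordinates the value of the sum is
irrelevant and its existence is enough. -/
theorem exists_hasSum_mul_ech {f : ℤ → ℝ} {a : ℂ} (h : HasSum (fun k : ℤ => (f k : ℂ) * ech k 0) a)
    (t : ℝ) : ∃ b, HasSum (fun k : ℤ => (f k : ℂ) * ech k t) b := by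
  have hs : Summable fun k : ℤ => (f k : ℂ) * ech k 0 := h.summable
  have : Summable fun k : ℤ => (f k : ℂ) * ech k t := by
    rw [← summable_norm_iff] at hs ⊢
    refine hs.congr fun k => ?_
    rw [norm_mul, norm_mul, norm_ech, norm_ech]
  exact ⟨_, this.hasSum⟩

/-- Over a cube s^d a sum of products is a product of sums. Taking limits along cubes avoids any
summability statement on ℤ^d. -/
theorem tendsto_sum_piFinset {d : ℕ} {g : Fin d → ℤ → ℂ} {a : Fin d → ℂ}
    (h : ∀ i, HasSum (g i) (a i)) :
    Tendsto (fun s : Finset ℤ => ∑ k ∈ Fintype.piFinset (fun _ : Fin d => s), ∏ i, g i (k i)) atTop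
      (𝓝 (∏ i, a i)) := by
  have : (fun s : Finset ℤ => ∑ k ∈ Fintype.piFinset (fun _ : Fin d => s), ∏ i, g i (k i)) =
      fun s => ∏ i, ∑ k ∈ s, g i k := by
    ext s; rw [Finset.prod_univ_sum]
  rw [this]
  exact tendsto_finsetProd _ fun i _ => h i

theorem le_fract_of_le_norm {q t : ℝ} (h : q ≤ ‖(t : UnitAddCircle)‖) :
    q ≤ Int.fract t ∧ Int.fract t + q ≤ 1 := by
  rw [UnitAddCircle.norm_eq, abs_sub_round_eq_min] at h
  have h1 := h.trans (min_le_left _ _)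
  have h2 := h.trans (min_le_right _ _)
  exact ⟨h1, by linarith⟩

/-- The `d`-dimensional minorant of the indicator of `{0, …, N-1}^d`. -/
noncomputable def minorant {d : ℕ} (L : ℕ) (q : ℝ) (k : Fin d → ℤ) : ℝ :=
  ∏ i, selA L (q * k i) - ∑ j, ∏ i, if i = j then selE L (q * k i) else selA L (q * k i)

theorem minorant_le_one {d : ℕ} (L : ℕ) (q : ℝ) (k : Fin d → ℤ) : minorant L q k ≤ 1 := by
  have h1 : ∏ i, selA L (q * k i) ≤ 1 :=
    Finset.prod_le_one (fun _ _ => selA_nonneg _ _) fun _ _ => selA_le_one _ _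
  have h2 : 0 ≤ ∑ j, ∏ i, if i = j then selE L (q * k i) else selA L (q * k i) :=
    Finset.sum_nonneg fun j _ => Finset.prod_nonneg fun i _ => by
      split_ifs
      · exact selE_nonneg _ _
      · exact selA_nonneg _ _
  unfold minorant; linarith

/-- In the offending coordinate `selA` is at most `selE`, so the corresponding correction term alone
is at least the main product; the other corrections are nonnegative. -/
theorem minorant_nonpos {d : ℕ} {L : ℕ} {q : ℝ} {k : Fin d → ℤ}
    (h : ∃ i, q * k i ≤ 0 ∨ (L : ℝ) ≤ q * k i) : minorant L q k ≤ 0 := by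
  obtain ⟨i₀, hi⟩ := h
  have h0 := selA_sub_selE_nonpos hi
  have hA : ∏ i, selA L (q * k i) ≤
      ∏ i, if i = i₀ then selE L (q * k i) else selA L (q * k i) := by
    refine Finset.prod_le_prod (fun _ _ => selA_nonneg _ _) fun i _ => ?_
    split_ifs with h
    · subst h; linarith
    · exact le_rfl
  have h2 : (∏ i, if i = i₀ then selE L (q * k i) else selA L (q * k i)) ≤
      ∑ j, ∏ i, if i = j then selE L (q * k i) else selA L (q * k i) :=
    Finset.single_le_sum (f := fun j => ∏ i, if i = j then selE L (q * k i) else selA L (q * k i))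
      (fun j _ => Finset.prod_nonneg fun i _ => by
        split_ifs
        · exact selE_nonneg _ _
        · exact selA_nonneg _ _) (Finset.mem_univ i₀)
  unfold minorant; linarith

/-- Large sieve inequality (lower bound) for nodes that are `L/N`-separated in the maximum norm. -/
theorem large_sieve {d r N L : ℕ} (hL : 1 ≤ L) (hLN : L ≤ N) (θ : Fin r → Fin d → ℝ)
    (hθ : ∀ j l, j ≠ l → ∃ i, (L / N : ℝ) ≤ ‖((θ j i - θ l i : ℝ) : UnitAddCircle)‖)
    (c : Fin r → ℂ) :
    (N : ℝ) ^ d * (1 - d / L) * ∑ j, ‖c j‖ ^ 2 ≤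
      ∑ k : Fin d → Fin N, ‖∑ j, c j * ∏ i, ech (k i : ℕ) (θ j i)‖ ^ 2 := by
  classical
  have hL0 : (0 : ℝ) < L := by exact_mod_cast hL
  have hN0 : (0 : ℝ) < N := hL0.trans_le (by exact_mod_cast hLN)
  set q : ℝ := L / N with hq
  have hq0 : 0 < q := by positivity
  have hq1 : q ≤ 1 := (div_le_one hN0).2 (by exact_mod_cast hLN)
  have hLq : (L : ℝ) / q = N := by rw [hq]; field_simp
  set f : (Fin d → ℤ) → ℝ := fun k => ‖∑ j, c j * ∏ i, ech (k i) (θ j i)‖ ^ 2 with hf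
  -- the truncated sums against the minorant
  have hle : ∀ s : Finset ℤ, (Finset.range N).map Nat.castEmbedding ⊆ s →
      ∑ k ∈ Fintype.piFinset (fun _ : Fin d => s), minorant L q k * f k ≤
        ∑ k : Fin d → Fin N, ‖∑ j, c j * ∏ i, ech (k i : ℕ) (θ j i)‖ ^ 2 := by
    intro s hs
    let φ : (Fin d → Fin N) ↪ (Fin d → ℤ) := ⟨fun k i => ((k i : ℕ) : ℤ), fun k l h => by
      ext i; have := congrFun h i; simpa using this⟩
    have hsub : Finset.univ.map φ ⊆ Fintype.piFinset (fun _ : Fin d => s) := by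
      intro k hk
      obtain ⟨k', -, rfl⟩ := Finset.mem_map.1 hk
      refine Fintype.mem_piFinset.2 fun i => hs ?_
      exact Finset.mem_map.2 ⟨k' i, Finset.mem_range.2 (k' i).2, rfl⟩
    have e1 : ∑ k : Fin d → Fin N, ‖∑ j, c j * ∏ i, ech (k i : ℕ) (θ j i)‖ ^ 2 =
        ∑ k ∈ Finset.univ.map φ, f k := by
      rw [Finset.sum_map]; rfl
    rw [e1, ← Finset.sum_sdiff hsub]
    have h1 : ∑ k ∈ Fintype.piFinset (fun _ : Fin d => s) \ Finset.univ.map φ,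
        minorant L q k * f k ≤ 0 := by
      refine Finset.sum_nonpos fun k hk => mul_nonpos_of_nonpos_of_nonneg ?_ (by positivity)
      apply minorant_nonpos
      by_contra hcon
      push Not at hcon
      refine (Finset.mem_sdiff.1 hk).2 (Finset.mem_map.2 ?_)
      -- With q = L/N the condition 0 < q k_i < L is 0 < k_i < N. The minorant is nonpositive also
      -- on the faces k_i = 0 of the box, which does no harm.
      have hk0 : ∀ i, 0 < k i ∧ k i < N := by
        intro i
        obtain ⟨a, b⟩ := hcon i
        constructor
        · have := pos_of_mul_pos_right a hq0.le; exact_mod_cast this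
        · rw [hq, div_mul_eq_mul_div, div_lt_iff₀ hN0] at b
          have := lt_of_mul_lt_mul_left b hL0.le
          exact_mod_cast this
      refine ⟨fun i => ⟨(k i).toNat, by have := hk0 i; omega⟩, Finset.mem_univ _, ?_⟩
      ext i
      have := hk0 i
      change (((k i).toNat : ℕ) : ℤ) = k i
      omega
    have h2 : ∑ k ∈ Finset.univ.map φ, minorant L q k * f k ≤ ∑ k ∈ Finset.univ.map φ, f k :=
      Finset.sum_le_sum fun k _ => mul_le_of_le_one_left (by positivity) (minorant_le_one _ _ _)
    linarith
  -- limits of the individual terms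
  have hA0 := hasSum_selA_zero (L := L) hq0 hq1
  have hE0 := hasSum_selE_zero (L := L) hq0 hq1
  have hpair : ∀ j l : Fin r, Tendsto (fun s : Finset ℤ =>
      ∑ k ∈ Fintype.piFinset (fun _ : Fin d => s),
        (minorant L q k : ℂ) * ∏ i, ech (k i) (θ j i - θ l i)) atTop
      (𝓝 (if j = l then (((N : ℝ) ^ d * (1 - d / L) : ℝ) : ℂ) else 0)) := by
    intro j l
    choose bA hbA using fun i => exists_hasSum_mul_ech hA0 (θ j i - θ l i)
    choose bE hbE using fun i => exists_hasSum_mul_ech hE0 (θ j i - θ l i)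
    have t1 := tendsto_sum_piFinset hbA
    have t2 : ∀ i₀ : Fin d, Tendsto (fun s : Finset ℤ =>
        ∑ k ∈ Fintype.piFinset (fun _ : Fin d => s), ∏ i, ((if i = i₀ then (selE L (q * k i) : ℂ)
          else selA L (q * k i)) * ech (k i) (θ j i - θ l i))) atTop
        (𝓝 (∏ i, if i = i₀ then bE i else bA i)) := by
      intro i₀
      refine tendsto_sum_piFinset (g := fun i m => (if i = i₀ then (selE L (q * m) : ℂ)
          else selA L (q * m)) * ech m (θ j i - θ l i)) fun i => ?_
      by_cases h : i = i₀
      · simp only [h, if_true]; exact hbE i₀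
      · simp only [h, if_false]; exact hbA i
    have t3 := t1.sub (tendsto_finsetSum Finset.univ fun i₀ _ => t2 i₀)
    -- On the diagonal the main product gives N^d and each of the d corrections gives N^(d-1)/q =
    -- N^d/L. Off the diagonal the factor of the separated coordinate is zero in every product.
    have elim : (∏ i, bA i) - ∑ i₀, (∏ i, if i = i₀ then bE i else bA i) =
        if j = l then (((N : ℝ) ^ d * (1 - d / L) : ℝ) : ℂ) else 0 := by
      by_cases hjl : j = l
      · subst hjl
        have hA : ∀ i, bA i = N := fun i => by
          have := hbA i
          rw [sub_self] at this
          rw [this.unique hA0, hLq]; simp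
        have hE : ∀ i, bE i = (1 / q : ℝ) := fun i => by
          have := hbE i
          rw [sub_self] at this
          rw [this.unique hE0]
        simp only [hA, hE, if_true]
        have : ∀ i₀ : Fin d, (∏ i, if i = i₀ then ((1 / q : ℝ) : ℂ) else (N : ℂ)) =
            (N : ℂ) ^ d / L := by
          intro i₀
          rw [← Finset.mul_prod_erase _ _ (Finset.mem_univ i₀), if_pos rfl]
          have : ∀ i ∈ Finset.univ.erase i₀, (if i = i₀ then ((1 / q : ℝ) : ℂ) else (N : ℂ)) = N :=
            fun i hi => if_neg (Finset.ne_of_mem_erase hi)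
          rw [Finset.prod_congr rfl this, Finset.prod_const, Finset.card_erase_of_mem
            (Finset.mem_univ _), Finset.card_univ, Fintype.card_fin]
          have hd : d = (d - 1) + 1 := by have := i₀.pos; omega
          have hNc : (N : ℂ) ≠ 0 := by exact_mod_cast hN0.ne'
          have hLc : (L : ℂ) ≠ 0 := by exact_mod_cast hL0.ne'
          conv_rhs => rw [hd, pow_succ]
          rw [hq]
          push_cast
          field_simp
        simp only [this]
        simp
        ring
      · rw [if_neg hjl]
        obtain ⟨i₁, hi₁⟩ := hθ j l hjl
        obtain ⟨h0, h1⟩ := le_fract_of_le_norm hi₁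
        have hA : bA i₁ = 0 := (hbA i₁).unique (hasSum_selA_far hq0 h0 h1)
        have hE : bE i₁ = 0 := (hbE i₁).unique (hasSum_selE_far hq0 h0 h1)
        rw [Finset.prod_eq_zero (Finset.mem_univ i₁) hA, Finset.sum_eq_zero, sub_zero]
        intro i₀ _
        refine Finset.prod_eq_zero (Finset.mem_univ i₁) ?_
        split_ifs
        · exact hE
        · exact hA
    rw [elim] at t3
    refine t3.congr fun s => ?_
    rw [Finset.sum_comm, ← Finset.sum_sub_distrib]
    refine Finset.sum_congr rfl fun k _ => ?_
    unfold minorant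
    push_cast
    rw [sub_mul, Finset.sum_mul, Finset.prod_mul_distrib]
    congr 1
    refine Finset.sum_congr rfl fun i₀ _ => ?_
    rw [Finset.prod_mul_distrib]
    congr 1
    exact Finset.prod_congr rfl fun i _ => by split_ifs <;> rfl
  have hfk : ∀ k, (f k : ℂ) = ∑ j, ∑ l, c j * (starRingEnd ℂ) (c l) *
      ∏ i, ech (k i) (θ j i - θ l i) := by
    intro k
    simp only [hf]
    rw [Complex.ofReal_pow, ← Complex.mul_conj', map_sum, Finset.sum_mul_sum]
    refine Finset.sum_congr rfl fun j _ => Finset.sum_congr rfl fun l _ => ?_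
    simp only [ech_sub, Finset.prod_mul_distrib, map_mul, map_prod]
    ring
  have hlim : Tendsto (fun s : Finset ℤ => ∑ k ∈ Fintype.piFinset (fun _ : Fin d => s),
      ((minorant L q k * f k : ℝ) : ℂ)) atTop
      (𝓝 (((N : ℝ) ^ d * (1 - d / L) * ∑ j, ‖c j‖ ^ 2 : ℝ) : ℂ)) := by
    have := tendsto_finsetSum Finset.univ fun j (_ : j ∈ Finset.univ) =>
      tendsto_finsetSum Finset.univ fun l (_ : l ∈ Finset.univ) =>
        (hpair j l).const_mul (c j * (starRingEnd ℂ) (c l))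
    have e : (∑ j, ∑ l, c j * (starRingEnd ℂ) (c l) *
        (if j = l then (((N : ℝ) ^ d * (1 - d / L) : ℝ) : ℂ) else 0)) =
        (((N : ℝ) ^ d * (1 - d / L) * ∑ j, ‖c j‖ ^ 2 : ℝ) : ℂ) := by
      simp only [mul_ite, mul_zero, Finset.sum_ite_eq, Finset.mem_univ, if_true]
      push_cast
      rw [Finset.mul_sum]
      refine Finset.sum_congr rfl fun j _ => ?_
      rw [Complex.mul_conj']; ring
    rw [e] at this
    refine this.congr fun s => ?_
    simp only [Complex.ofReal_mul, hfk, Finset.mul_sum]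
    rw [Finset.sum_comm' (t' := Finset.univ) (s' := fun _ => Fintype.piFinset fun _ => s)
      (by simp)]
    refine Finset.sum_congr rfl fun j _ => ?_
    rw [Finset.sum_comm]
    refine Finset.sum_congr rfl fun l _ => Finset.sum_congr rfl fun k _ => ?_
    ring
  have hlim' : Tendsto (fun s : Finset ℤ => ∑ k ∈ Fintype.piFinset (fun _ : Fin d => s),
      minorant L q k * f k) atTop (𝓝 ((N : ℝ) ^ d * (1 - d / L) * ∑ j, ‖c j‖ ^ 2)) := by
    have := (Complex.continuous_re.tendsto _).comp hlim
    refine this.congr fun s => ?_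
    simp only [Function.comp_apply, ← Complex.ofReal_sum, Complex.ofReal_re]
  exact le_of_tendsto hlim' (eventually_atTop.2 ⟨_, fun s hs => hle s hs⟩)

/-! ### Lifts and exponential vectors -/

theorem exists_lift_circle (y : UnitAddCircle) : ∃ t : ℝ, (t : UnitAddCircle) = y ∧ |t| = ‖y‖ := by
  obtain ⟨t, rfl⟩ := QuotientAddGroup.mk_surjective y
  refine ⟨t - round t, ?_, ?_⟩
  · have : ((round t : ℝ) : UnitAddCircle) = 0 := by
      rw [AddCircle.coe_eq_zero_iff]; exact ⟨round t, by simp⟩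
    rw [AddCircle.coe_sub, this, sub_zero]
  · exact (UnitAddCircle.norm_eq (x := t)).symm

theorem exists_lift {d : ℕ} (y : UnitAddTorus (Fin d)) :
    ∃ t : Fin d → ℝ, (∀ i, (t i : UnitAddCircle) = y i) ∧ ∀ i, |t i| = ‖y i‖ := by
  choose t h1 h2 using fun i => exists_lift_circle (y i)
  exact ⟨t, h1, h2⟩

theorem norm_circle_le_half (y : UnitAddCircle) : ‖y‖ ≤ 1 / 2 := by
  have := AddCircle.norm_le_half_period (p := 1) (x := y) one_ne_zero
  simpa using this

theorem norm_torus_le_half {d : ℕ} (y : UnitAddTorus (Fin d)) : ‖y‖ ≤ 1 / 2 :=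
  (pi_norm_le_iff_of_nonneg (by norm_num)).2 fun i => norm_circle_le_half (y i)

theorem exists_le_norm_apply {d : ℕ} {y : UnitAddTorus (Fin d)} {q : ℝ} (hq : 0 < q)
    (h : q ≤ ‖y‖) : ∃ i, q ≤ ‖y i‖ := by
  by_contra hcon
  push Not at hcon
  exact absurd ((pi_norm_lt_iff hq).2 hcon) (not_lt.2 h)

theorem expVec_eq_prod {d n : ℕ} {x : UnitAddTorus (Fin d)} {t : Fin d → ℝ}
    (ht : ∀ i, (t i : UnitAddCircle) = x i) (k : Fin d → Fin (n + 1)) :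
    expVec n x k = ∏ i, ech (k i : ℕ) (t i) := by
  simp only [expVec, UnitAddTorus.mFourier, ContinuousMap.coe_mk, ← ht]
  refine Finset.prod_congr rfl fun i _ => ?_
  rw [fourier_coe_apply]
  unfold ech
  congr 1
  push_cast [Pi.neg_apply]
  ring

theorem star_expVec_dotProduct {d n : ℕ} {x y : UnitAddTorus (Fin d)} {t : Fin d → ℝ}
    (ht : ∀ i, (t i : UnitAddCircle) = x i - y i) :
    star (expVec n y) ⬝ᵥ expVec n x = ∏ i, ∑ k : Fin (n + 1), ech (k : ℕ) (t i) := by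
  classical
  obtain ⟨u, hu, -⟩ := exists_lift y
  have hx : ∀ i, ((u i + t i : ℝ) : UnitAddCircle) = x i := fun i => by
    rw [AddCircle.coe_add, hu, ht]; abel
  rw [Finset.prod_univ_sum, Fintype.piFinset_univ]
  simp only [dotProduct, Pi.star_apply, expVec_eq_prod hu, expVec_eq_prod hx]
  refine Finset.sum_congr rfl fun k _ => ?_
  rw [star_prod, ← Finset.prod_mul_distrib]
  refine Finset.prod_congr rfl fun i _ => ?_
  have : ech (k i : ℕ) (t i) = ech (k i : ℕ) (u i + t i) * (starRingEnd ℂ) (ech (k i : ℕ) (u i)) := by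
    rw [← ech_sub]; congr 1; ring
  rw [this, mul_comm]; rfl

theorem norm_sum_ech_le (N : ℕ) (t : ℝ) : ‖∑ k : Fin N, ech (k : ℕ) t‖ ≤ N := by
  refine (norm_sum_le _ _).trans ?_
  simp [norm_ech]

/-- Geometric sum: the numerator has modulus at most 2, and the denominator is 2|sin πt| ≥ 4|t| by
Jordan's inequality. -/
theorem norm_sum_ech_le_of_ne {N : ℕ} {t : ℝ} (h0 : t ≠ 0) (h1 : |t| ≤ 1 / 2) :
    ‖∑ k : Fin N, ech (k : ℕ) t‖ ≤ 1 / (2 * |t|) := by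
  set z := Complex.exp (((-(2 * Real.pi * t) : ℝ) : ℂ) * Complex.I) with hz
  have hk : ∀ k : ℕ, ech (k : ℕ) t = z ^ k := by
    intro k
    rw [hz, ← Complex.exp_nat_mul]
    unfold ech; congr 1; push_cast; ring
  have hzn : ‖z‖ = 1 := Complex.norm_exp_ofReal_mul_I _
  have habs : 0 < |t| := abs_pos.2 h0
  have hpi := Real.pi_pos
  have hz1 : 4 * |t| ≤ ‖z - 1‖ := by
    have e : ‖z - 1‖ = 2 * |Real.sin (Real.pi * t)| := by
      have h := Complex.norm_exp_I_mul_ofReal_sub_one (-(2 * Real.pi * t))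
      rw [mul_comm] at h
      rw [hz, h, Real.norm_eq_abs, abs_mul]
      have : -(2 * Real.pi * t) / 2 = -(Real.pi * t) := by ring
      rw [this, Real.sin_neg, abs_neg]; norm_num
    have hs : 2 * |t| ≤ |Real.sin (Real.pi * t)| := by
      have h2 : |Real.pi * t| ≤ Real.pi / 2 := by
        rw [abs_mul, abs_of_pos hpi]; nlinarith
      have := Real.mul_abs_le_abs_sin h2
      rw [abs_mul, abs_of_pos hpi] at this
      calc 2 * |t| = 2 / Real.pi * (Real.pi * |t|) := by field_simp
        _ ≤ _ := this
    rw [e]; linarith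
  have hne : z ≠ 1 := by
    intro h; rw [h, sub_self, norm_zero] at hz1; linarith
  have hsum : ∑ k : Fin N, ech (k : ℕ) t = (z ^ N - 1) / (z - 1) := by
    rw [Fin.sum_univ_eq_sum_range (fun k => ech (k : ℕ) t) N, ← geom_sum_eq hne]
    exact Finset.sum_congr rfl fun k _ => hk k
  rw [hsum, norm_div]
  have hnum : ‖z ^ N - 1‖ ≤ 2 := by
    refine (norm_sub_le _ _).trans ?_
    rw [norm_pow, hzn]; norm_num
  calc ‖z ^ N - 1‖ / ‖z - 1‖ ≤ 2 / (4 * |t|) :=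
        div_le_div₀ (by norm_num) hnum (by positivity) hz1
    _ = 1 / (2 * |t|) := by field_simp; norm_num

/-- The inner product factors into Dirichlet kernels; the decay is used in the coordinate realising
the maximum norm, and the trivial bound n + 1 in the others. -/
theorem norm_star_expVec_dotProduct_le {d n : ℕ} {x y : UnitAddTorus (Fin d)} (h : x ≠ y) :
    ‖star (expVec n y) ⬝ᵥ expVec n x‖ ≤ ((n : ℝ) + 1) ^ (d - 1) * (1 / (2 * ‖x - y‖)) := by
  obtain ⟨t, ht, hta⟩ := exists_lift (x - y)
  have hpos : 0 < ‖x - y‖ := norm_pos_iff.2 (sub_ne_zero.2 h)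
  obtain ⟨i, hi⟩ := exists_le_norm_apply hpos le_rfl
  have hi' : ‖x - y‖ = |t i| := by
    rw [hta]; exact le_antisymm hi (norm_le_pi_norm (x - y) i)
  rw [star_expVec_dotProduct ht, norm_prod, ← Finset.mul_prod_erase _ _ (Finset.mem_univ i), hi',
    mul_comm]
  refine mul_le_mul ?_ (norm_sum_ech_le_of_ne ?_ ?_) (norm_nonneg _) (by positivity)
  · calc _ ≤ ∏ j ∈ Finset.univ.erase i, ((n : ℝ) + 1) :=
          Finset.prod_le_prod (fun _ _ => norm_nonneg _) fun j _ => by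
            exact_mod_cast norm_sum_ech_le (n + 1) (t j)
      _ = _ := by simp [Finset.prod_const, Finset.card_erase_of_mem]
  · intro h0; rw [h0, abs_zero] at hi'; linarith
  · rw [← hi']; exact norm_torus_le_half _

/-! ### Bounds from the smallest singular value -/

theorem sq_sum_eq_star_dotProduct {κ : Type} [Fintype κ] (v : κ → ℂ) :
    ((∑ j, ‖v j‖ ^ 2 : ℝ) : ℂ) = star v ⬝ᵥ v := by
  simp only [dotProduct, Pi.star_apply]
  push_cast
  refine Finset.sum_congr rfl fun j _ => ?_
  rw [← Complex.conj_mul']; rfl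

theorem star_sum_smul_dotProduct {κ ι : Type} [Fintype κ] [Fintype ι] (c : κ → ℂ) (a : κ → ι → ℂ)
    (v : ι → ℂ) : star (∑ j, c j • a j) ⬝ᵥ v = ∑ j, star (c j) * (star (a j) ⬝ᵥ v) := by
  rw [star_sum, sum_dotProduct]
  exact Finset.sum_congr rfl fun j _ => by rw [star_smul, smul_dotProduct, smul_eq_mul]

/-- Let H = Σ c_j a_j be the projection and B the sum of the |⟨a_j, e⟩|². Orthogonality gives ‖H‖² =
Σ conj(c_j) ⟨a_j, e⟩, hence ‖H‖⁴ ≤ ‖c‖² B, while σ‖c‖² ≤ ‖H‖². Eliminating ‖c‖ leaves ‖H‖² ≤ B/σ. -/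
theorem signalFun_le_of_singular_bound {d r n : ℕ} {w : Fin r → ℂ}
    {ξ : Fin r → UnitAddTorus (Fin d)}
    (S : SVD ((n + 1) ^ d) (momentMatrix (discreteMeasure w ξ) n)) (x : UnitAddTorus (Fin d))
    {σ : ℝ} (hσ : 0 < σ) (h : ∀ c : Fin r → ℂ, σ * ∑ j, ‖c j‖ ^ 2 ≤
      ∑ k, ‖(∑ j, c j • expVec n (ξ j)) k‖ ^ 2) :
    signalFun S x ≤ 1 / ((n : ℝ) + 1) ^ d *
      ((∑ j, ‖star (expVec n (ξ j)) ⬝ᵥ expVec n x‖ ^ 2) / σ) := by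
  obtain ⟨c, horth, hle⟩ := exists_signalFun_le w ξ S x
  refine hle.trans (mul_le_mul_of_nonneg_left ?_ (by positivity))
  set X := ∑ k, ‖(∑ j, c j • expVec n (ξ j)) k‖ ^ 2 with hX
  set B := ∑ j, ‖star (expVec n (ξ j)) ⬝ᵥ expVec n x‖ ^ 2 with hB
  have hX0 : 0 ≤ X := Finset.sum_nonneg fun _ _ => by positivity
  have hXc : (X : ℂ) = ∑ j, star (c j) * (star (expVec n (ξ j)) ⬝ᵥ expVec n x) := by
    rw [hX, sq_sum_eq_star_dotProduct, star_sum_smul_dotProduct]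
    refine Finset.sum_congr rfl fun j _ => ?_
    have := horth j
    rw [dotProduct_sub, sub_eq_zero] at this
    rw [this]
  have hX2 : X ^ 2 ≤ (∑ j, ‖c j‖ ^ 2) * B := by
    have h1 : X ≤ ∑ j, ‖c j‖ * ‖star (expVec n (ξ j)) ⬝ᵥ expVec n x‖ := by
      calc X = ‖(X : ℂ)‖ := by rw [Complex.norm_real, Real.norm_eq_abs, abs_of_nonneg hX0]
        _ ≤ _ := by
          rw [hXc]
          refine (norm_sum_le _ _).trans (Finset.sum_le_sum fun j _ => ?_)
          rw [norm_mul, norm_star]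
    calc X ^ 2 ≤ (∑ j, ‖c j‖ * ‖star (expVec n (ξ j)) ⬝ᵥ expVec n x‖) ^ 2 :=
          pow_le_pow_left₀ hX0 h1 2
      _ ≤ _ := Finset.sum_mul_sq_le_sq_mul_sq _ _ _
  have hc := h c
  rw [← hX] at hc
  rw [le_div_iff₀ hσ]
  have hB0 : 0 ≤ B := Finset.sum_nonneg fun _ _ => by positivity
  rcases hX0.eq_or_lt with h0 | h0
  · rw [← h0, zero_mul]; exact hB0
  · have : X * (X * σ) ≤ X * B := by
      calc X * (X * σ) = σ * X ^ 2 := by ring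
        _ ≤ σ * ((∑ j, ‖c j‖ ^ 2) * B) := mul_le_mul_of_nonneg_left hX2 hσ.le
        _ = (σ * ∑ j, ‖c j‖ ^ 2) * B := by ring
        _ ≤ X * B := mul_le_mul_of_nonneg_right hc hB0
    exact le_of_mul_le_mul_left this h0

theorem sum_sq_smul_expVec_single {d n : ℕ} (x : UnitAddTorus (Fin d)) (c : ℂ) :
    ∑ k, ‖(c • expVec n x) k‖ ^ 2 = ((n : ℝ) + 1) ^ d * ‖c‖ ^ 2 := by
  simp [norm_expVec]

/-- The lower bound for the smallest singular value in the separated case. -/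
theorem singular_bound {d r n L : ℕ} (hL : 1 ≤ L) (hLN : L ≤ n + 1)
    {ξ : Fin r → UnitAddTorus (Fin d)}
    (hsep : ∀ j l, j ≠ l → (L : ℝ) / ((n : ℝ) + 1) ≤ ‖ξ j - ξ l‖) (c : Fin r → ℂ) :
    ((n : ℝ) + 1) ^ d * (1 - d / L) * ∑ j, ‖c j‖ ^ 2 ≤
      ∑ k, ‖(∑ j, c j • expVec n (ξ j)) k‖ ^ 2 := by
  choose θ hθ _ using fun j => exists_lift (ξ j)
  have := large_sieve (d := d) (N := n + 1) hL hLN θ (fun j l hjl => by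
    have h := hsep j l hjl
    have hpos : (0 : ℝ) < (L : ℝ) / ((n : ℝ) + 1) := by
      have : (0 : ℝ) < L := by exact_mod_cast hL
      positivity
    obtain ⟨i, hi⟩ := exists_le_norm_apply hpos h
    refine ⟨i, ?_⟩
    rw [AddCircle.coe_sub, hθ, hθ]
    push_cast
    exact hi) c
  push_cast at this
  refine this.trans (le_of_eq (Finset.sum_congr rfl fun k _ => ?_))
  congr 2
  simp only [Finset.sum_apply, Pi.smul_apply, smul_eq_mul]
  exact Finset.sum_congr rfl fun j _ => by rw [expVec_eq_prod (hθ j)]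

theorem signalFun_le_of_separated {d r n : ℕ} (hd : 1 ≤ d) (w : Fin r → ℂ)
    (ξ : Fin r → UnitAddTorus (Fin d))
    (S : SVD ((n + 1) ^ d) (momentMatrix (discreteMeasure w ξ) n))
    (hsep : ∀ j l, j ≠ l → 4 * (d : ℝ) / ‖ξ j - ξ l‖ < (n : ℝ) + 1)
    (hξ : Function.Injective ξ) (x : UnitAddTorus (Fin d)) (hx : ∀ j, x ≠ ξ j) :
    signalFun S x ≤ 1 / ((n : ℝ) + 1) ^ 2 * (1 / 3 * ∑ j, 1 / ‖x - ξ j‖ ^ 2) := by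
  have hN : (0 : ℝ) < (n : ℝ) + 1 := by positivity
  have hd0 : (0 : ℝ) < d := by exact_mod_cast hd
  have hbound : ∀ c : Fin r → ℂ, ((n : ℝ) + 1) ^ d * (3 / 4) * ∑ j, ‖c j‖ ^ 2 ≤
      ∑ k, ‖(∑ j, c j • expVec n (ξ j)) k‖ ^ 2 := by
    intro c
    by_cases hr : ∃ j l : Fin r, j ≠ l
    · obtain ⟨j₀, l₀, hjl⟩ := hr
      have hs : ∀ j l, j ≠ l → ((4 * d : ℕ) : ℝ) / ((n : ℝ) + 1) ≤ ‖ξ j - ξ l‖ := by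
        intro j l h
        have hp : 0 < ‖ξ j - ξ l‖ := norm_pos_iff.2 (sub_ne_zero.2 fun e => h (hξ e))
        have := hsep j l h
        rw [div_lt_iff₀ hp] at this
        rw [div_le_iff₀ hN]
        push_cast; linarith
      have hLN : 4 * d ≤ n + 1 := by
        have h1 := (hs j₀ l₀ hjl).trans (norm_torus_le_half _)
        rw [div_le_iff₀ hN] at h1
        have : ((4 * d : ℕ) : ℝ) ≤ ((n + 1 : ℕ) : ℝ) := by push_cast at h1 ⊢; linarith
        exact_mod_cast this
      -- The choice L = 4d turns the factor 1 - d/L into 3/4.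
      have := singular_bound (L := 4 * d) (by omega) hLN hs c
      convert this using 3
      push_cast
      field_simp
      norm_num
    -- With at most one node the Gram matrix is empty or the number N^d, and no separation is
    -- needed.
    · push Not at hr
      rcases isEmpty_or_nonempty (Fin r) with h0 | ⟨⟨j₀⟩⟩
      · simp
      · have hu : (Finset.univ : Finset (Fin r)) = {j₀} := by
          ext j; simp [hr j j₀]
        simp only [hu, Finset.sum_singleton]
        rw [sum_sq_smul_expVec_single]
        have : 0 ≤ ((n : ℝ) + 1) ^ d * ‖c j₀‖ ^ 2 := by positivity
        linarith
  refine (signalFun_le_of_singular_bound S x (by positivity) hbound).trans ?_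
  -- The squared Dirichlet bound carries the factor 1/4; divided by the 3/4 of the Gram bound it
  -- becomes the 1/3 of the statement.
  have hterm : ∀ j, ‖star (expVec n (ξ j)) ⬝ᵥ expVec n x‖ ^ 2 ≤
      (((n : ℝ) + 1) ^ d) ^ 2 / ((n : ℝ) + 1) ^ 2 * (1 / 4) * (1 / ‖x - ξ j‖ ^ 2) := by
    intro j
    have h := norm_star_expVec_dotProduct_le (n := n) (hx j)
    have hp : 0 < ‖x - ξ j‖ := norm_pos_iff.2 (sub_ne_zero.2 (hx j))
    refine (pow_le_pow_left₀ (norm_nonneg _) h 2).trans (le_of_eq ?_)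
    have : ((n : ℝ) + 1) ^ d = ((n : ℝ) + 1) ^ (d - 1) * ((n : ℝ) + 1) := by
      rw [← pow_succ]; congr 1; omega
    rw [this]
    field_simp
    norm_num
  have hsum := Finset.sum_le_sum fun j (_ : j ∈ Finset.univ) => hterm j
  rw [← Finset.mul_sum] at hsum
  calc _ ≤ 1 / ((n : ℝ) + 1) ^ d * (((((n : ℝ) + 1) ^ d) ^ 2 / ((n : ℝ) + 1) ^ 2 * (1 / 4) *
        ∑ j, 1 / ‖x - ξ j‖ ^ 2) / (((n : ℝ) + 1) ^ d * (3 / 4))) := by gcongr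
    _ = _ := by field_simp

/-- For separated nodes the signal function equals `1` at the nodes. -/
theorem signalFun_node_eq_one {d r n : ℕ} {w : Fin r → ℂ} (hw : ∀ j, w j ≠ 0)
    {ξ : Fin r → UnitAddTorus (Fin d)}
    (S : SVD ((n + 1) ^ d) (momentMatrix (discreteMeasure w ξ) n)) {σ : ℝ} (hσ : 0 < σ)
    (h : ∀ c : Fin r → ℂ, σ * ∑ j, ‖c j‖ ^ 2 ≤ ∑ k, ‖(∑ j, c j • expVec n (ξ j)) k‖ ^ 2)
    (j₀ : Fin r) : signalFun S (ξ j₀) = 1 := by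
  classical
  apply signalFun_eq_one_of_mem_range
  let G : Matrix (Fin r) (Fin r) ℂ :=
    Matrix.of fun l m => star (expVec n (ξ l)) ⬝ᵥ expVec n (ξ m)
  have hG : ∀ (c : Fin r → ℂ) l, (G *ᵥ c) l = star (expVec n (ξ l)) ⬝ᵥ ∑ m, c m • expVec n (ξ m) := by
    intro c l
    rw [dotProduct_sum]
    simp only [mulVec, dotProduct_smul, G, smul_eq_mul]
    exact Finset.sum_congr rfl fun m _ => mul_comm _ _
  have hinj : Function.Injective G.mulVecLin := by
    rw [injective_iff_map_eq_zero]
    intro c hc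
    have hc' : ∀ l, star (expVec n (ξ l)) ⬝ᵥ ∑ m, c m • expVec n (ξ m) = 0 := fun l => by
      rw [← hG]; exact congrFun hc l
    have h0 : ((∑ k, ‖(∑ j, c j • expVec n (ξ j)) k‖ ^ 2 : ℝ) : ℂ) = 0 := by
      rw [sq_sum_eq_star_dotProduct, star_sum_smul_dotProduct]
      exact Finset.sum_eq_zero fun l _ => by rw [hc', mul_zero]
    have h1 := h c
    rw [Complex.ofReal_eq_zero.1 h0] at h1
    have h2 : ∑ j, ‖c j‖ ^ 2 = 0 :=
      le_antisymm (nonpos_of_mul_nonpos_right h1 hσ) (Finset.sum_nonneg fun _ _ => by positivity)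
    ext j
    have := (Finset.sum_eq_zero_iff_of_nonneg fun i _ => by positivity).1 h2 j (Finset.mem_univ j)
    simpa using this
  -- Solving G c = w_{j₀}⁻¹ δ_{j₀} for the Gram matrix G makes T map Σ c_m a_m to a_{j₀}.
  obtain ⟨c, hc⟩ := LinearMap.injective_iff_surjective.1 hinj (Pi.single j₀ (w j₀)⁻¹)
  refine ⟨∑ m, c m • expVec n (ξ m), ?_⟩
  rw [momentMatrix_mulVec]
  have : ∀ l, star (expVec n (ξ l)) ⬝ᵥ ∑ m, c m • expVec n (ξ m) =
      (Pi.single j₀ (w j₀)⁻¹ : Fin r → ℂ) l := fun l => by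
    rw [← hG, ← hc]; rfl
  simp only [this]
  rw [Finset.sum_eq_single j₀]
  · rw [Pi.single_eq_same, mul_inv_cancel₀ (hw j₀), one_smul]
  · intro l _ hl
    rw [Pi.single_eq_of_ne hl, mul_zero, zero_smul]
  · simp

/-! ### The support and its Zariski closure -/

/-- Off the nodes the variation is bounded by the sum of the variations of the atoms, which vanish
there. At a node the variation has mass at least |w_j|, because distinct nodes cannot cancel each
other. -/
theorem supp_discreteMeasure {d r : ℕ} {w : Fin r → ℂ} (hw : ∀ j, w j ≠ 0)
    {ξ : Fin r → UnitAddTorus (Fin d)} (hξ : Function.Injective ξ) :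
    supp (discreteMeasure w ξ) = Set.range ξ := by
  unfold supp
  apply Set.Subset.antisymm
  · refine Measure.support_subset_of_isClosed (Set.finite_range ξ).isClosed ?_
    rw [mem_ae_iff]
    have h1 : (discreteMeasure w ξ).variation ≤ ∑ j, (VectorMeasure.dirac (ξ j) (w j)).variation :=
      VectorMeasure.variation_finsetSum_le _ _
    refine le_antisymm ((h1 _).trans ?_) bot_le
    rw [Measure.finsetSum_apply]
    refine (Finset.sum_eq_zero fun j _ => ?_).le
    rw [VectorMeasure.variation_dirac]
    simp
  · rintro _ ⟨j, rfl⟩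
    rw [Measure.mem_support_iff_forall]
    intro U hU
    have h1 : (discreteMeasure w ξ) {ξ j} = w j := by
      unfold discreteMeasure
      rw [FunLike.coe_sum, Finset.sum_apply, Finset.sum_eq_single j]
      · exact VectorMeasure.dirac_apply_of_mem (measurableSet_singleton _) rfl
      · intro l _ hl
        exact VectorMeasure.dirac_apply_of_notMem fun h => hl (hξ h)
      · simp
    have h2 : ‖w j‖ₑ ≤ (discreteMeasure w ξ).variation {ξ j} := by
      have := VectorMeasure.enorm_measure_le_variation (discreteMeasure w ξ) {ξ j}
      rwa [h1] at this
    have h3 : 0 < ‖w j‖ₑ := by simpa using hw j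
    exact h3.trans_le (h2.trans (measure_mono (Set.singleton_subset_iff.2 (mem_of_mem_nhds hU))))

/-- A point outside the finite set differs from the j-th node in some coordinate i_j. The product
over j of e(y_{i_j}) - e(ξ_{j, i_j}) is a trigonometric polynomial that vanishes at all nodes but
not at the point. -/
theorem zariskiClosure_range {d r : ℕ} (ξ : Fin r → UnitAddTorus (Fin d)) :
    zariskiClosure (Set.range ξ) = Set.range ξ := by
  classical
  apply Set.Subset.antisymm
  · intro x hx
    by_contra hcon
    have hne : ∀ j, ∃ i, x i ≠ ξ j i := by
      intro j
      by_contra h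
      push Not at h
      exact hcon ⟨j, (funext h).symm⟩
    choose i hi using hne
    let A := (UnitAddTorus.mFourierSubalgebra (Fin d)).toSubalgebra
    let p : C(UnitAddTorus (Fin d), ℂ) := ∏ j, (UnitAddTorus.mFourier (Pi.single (i j) 1) -
      algebraMap ℂ C(UnitAddTorus (Fin d), ℂ) (fourier 1 (ξ j (i j))))
    have hp : p ∈ A := by
      refine Subalgebra.prod_mem _ fun j _ => Subalgebra.sub_mem _ ?_ (Subalgebra.algebraMap_mem _ _)
      exact Algebra.subset_adjoin ⟨_, rfl⟩
    have hp' : p ∈ Submodule.span ℂ (Set.range (UnitAddTorus.mFourier (d := Fin d))) := by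
      rw [← UnitAddTorus.mFourierSubalgebra_coe]; exact hp
    have heval : ∀ y, p y = ∏ j, (fourier 1 (y (i j)) - fourier 1 (ξ j (i j))) := by
      intro y
      simp only [p, ContinuousMap.prod_apply, ContinuousMap.sub_apply, UnitAddTorus.mFourier_single]
      rfl
    have h0 := hx p hp' (by
      rintro _ ⟨j, rfl⟩
      rw [heval]
      exact Finset.prod_eq_zero (Finset.mem_univ j) (sub_self _))
    rw [heval, Finset.prod_eq_zero_iff] at h0
    obtain ⟨j, -, hj⟩ := h0
    rw [sub_eq_zero, fourier_one, fourier_one] at hj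
    exact hi j (AddCircle.injective_toCircle one_ne_zero (Subtype.ext hj))
  · intro x hx p _ h
    exact h x hx

/-! ### Pointwise convergence of the signal function -/

theorem signalFun_nonneg {d n : ℕ} {μ : ComplexMeasure (UnitAddTorus (Fin d))}
    (S : SVD ((n + 1) ^ d) (momentMatrix μ n)) (x : UnitAddTorus (Fin d)) : 0 ≤ signalFun S x := by
  unfold signalFun
  refine mul_nonneg (by positivity) (Finset.sum_nonneg fun j _ => ?_)
  split_ifs <;> positivity

theorem eventually_separated {d r : ℕ} (ξ : Fin r → UnitAddTorus (Fin d)) (C : ℝ) :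
    ∀ᶠ n : ℕ in atTop, ∀ j l, j ≠ l → C / ‖ξ j - ξ l‖ < (n : ℝ) + 1 := by
  rw [eventually_all]; intro j
  rw [eventually_all]; intro l
  filter_upwards [eventually_ge_atTop (Nat.ceil (C / ‖ξ j - ξ l‖))] with n hn _
  have h1 := Nat.le_ceil (C / ‖ξ j - ξ l‖)
  have h2 : ((Nat.ceil (C / ‖ξ j - ξ l‖) : ℕ) : ℝ) ≤ n := by exact_mod_cast hn
  linarith

theorem tendsto_signalFun {d r : ℕ} (hd : 1 ≤ d) (w : Fin r → ℂ) (hw : ∀ j, w j ≠ 0)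
    (ξ : Fin r → UnitAddTorus (Fin d)) (hξ : Function.Injective ξ)
    (S : ∀ n : ℕ, SVD ((n + 1) ^ d) (momentMatrix (discreteMeasure w ξ) n))
    (x : UnitAddTorus (Fin d)) :
    Tendsto (fun n : ℕ => signalFun (S n) x) atTop
      (𝓝 ((zariskiClosure (supp (discreteMeasure w ξ))).indicator (fun _ => (1 : ℝ)) x)) := by
  rw [supp_discreteMeasure hw hξ, zariskiClosure_range]
  by_cases hx : x ∈ Set.range ξ
  · rw [Set.indicator_of_mem hx]
    obtain ⟨j₀, rfl⟩ := hx
    refine tendsto_const_nhds.congr' ?_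
    -- At a node only positivity of the Gram matrix matters; L = 2d gives the factor 1 - d/L = 1/2.
    filter_upwards [eventually_separated ξ ((2 * d : ℕ) : ℝ), eventually_ge_atTop (2 * d)]
      with n hn hn2
    refine (signalFun_node_eq_one hw (S n) (σ := ((n : ℝ) + 1) ^ d * (1 - d / ((2 * d : ℕ) : ℝ)))
      ?_ (fun c => singular_bound (L := 2 * d) (by omega) (by omega) ?_ c) j₀).symm
    · have hd0 : (0 : ℝ) < d := by exact_mod_cast hd
      have : (1 : ℝ) - d / ((2 * d : ℕ) : ℝ) = 1 / 2 := by push_cast; field_simp; norm_num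
      rw [this]; positivity
    · intro j l h
      have hp : 0 < ‖ξ j - ξ l‖ := norm_pos_iff.2 (sub_ne_zero.2 fun e => h (hξ e))
      have hN : (0 : ℝ) < (n : ℝ) + 1 := by positivity
      have := hn j l h
      rw [div_lt_iff₀ hp] at this
      rw [div_le_iff₀ hN]; linarith
  · rw [Set.indicator_of_notMem hx]
    have hx' : ∀ j, x ≠ ξ j := fun j h => hx ⟨j, h.symm⟩
    have hlim : Tendsto (fun n : ℕ => 1 / ((n : ℝ) + 1) ^ 2 * (1 / 3 * ∑ j, 1 / ‖x - ξ j‖ ^ 2)) atTop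
        (𝓝 0) := by
      have h1 : Tendsto (fun n : ℕ => 1 / ((n : ℝ) + 1)) atTop (𝓝 0) :=
        tendsto_one_div_add_atTop_nhds_zero_nat
      have h2 := (h1.pow 2).mul_const (1 / 3 * ∑ j, 1 / ‖x - ξ j‖ ^ 2)
      simpa using h2
    refine tendsto_of_tendsto_of_tendsto_of_le_of_le' tendsto_const_nhds hlim
      (Eventually.of_forall fun n => signalFun_nonneg _ _) ?_
    filter_upwards [eventually_separated ξ (4 * (d : ℝ))] with n hn
    exact signalFun_le_of_separated hd w ξ (S n) hn hξ x hx'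

/-- The bound behind (1) does not depend on the weights; this only serves to insert their quotient.
-/
theorem one_le_iSup_div_iInf {r : ℕ} (hr : 1 ≤ r) {w : Fin r → ℂ} (hw : ∀ j, w j ≠ 0) :
    1 ≤ (⨆ j, ‖w j‖) / (⨅ j, ‖w j‖) := by
  have : Nonempty (Fin r) := ⟨⟨0, hr⟩⟩
  obtain ⟨j, hj⟩ := exists_eq_ciInf_of_finite (f := fun j => ‖w j‖)
  have hpos : 0 < ⨅ j, ‖w j‖ := by rw [← hj]; exact norm_pos_iff.2 (hw j)
  rw [le_div_iff₀ hpos, one_mul, ← hj]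
  exact le_ciSup (f := fun j => ‖w j‖) (Set.finite_range _).bddAbove j

/-! ### Inequalities between sine, cosine and polynomials -/

theorem nonneg_of_hasDerivAt {f f' : ℝ → ℝ} (h0 : 0 ≤ f 0) (hd : ∀ x, HasDerivAt f (f' x) x)
    (h : ∀ x, 0 ≤ x → 0 ≤ f' x) {x : ℝ} (hx : 0 ≤ x) : 0 ≤ f x := by
  have hm : MonotoneOn f (Set.Ici 0) := by
    refine monotoneOn_of_deriv_nonneg (convex_Ici 0)
      (fun y _ => (hd y).continuousAt.continuousWithinAt)
      (fun y _ => (hd y).differentiableAt.differentiableWithinAt) fun y hy => ?_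
    rw [(hd y).deriv]
    rw [interior_Ici] at hy
    exact h y (le_of_lt hy)
  exact h0.trans (hm Set.self_mem_Ici hx hx)

theorem cos_le_quartic (x : ℝ) : Real.cos x ≤ 1 - x ^ 2 / 2 + x ^ 4 / 24 := by
  wlog hx : 0 ≤ x generalizing x
  · have := this (-x) (by linarith)
    rw [Real.cos_neg] at this
    calc _ ≤ _ := this
      _ = _ := by ring
  have := nonneg_of_hasDerivAt (f := fun y => 1 - y ^ 2 / 2 + y ^ 4 / 24 - Real.cos y)
    (f' := fun y => Real.sin y - (y - y ^ 3 / 6)) (by simp) (fun y => by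
      have h1 := ((hasDerivAt_const y (1 : ℝ)).sub ((hasDerivAt_pow 2 y).div_const 2)).add
        ((hasDerivAt_pow 4 y).div_const 24)
      refine (h1.sub (Real.hasDerivAt_cos y)).congr_deriv ?_
      push_cast; ring) (fun y hy => by linarith [Real.sin_ge_sub_cube hy]) hx
  simpa using this

theorem sin_le_quintic {x : ℝ} (hx : 0 ≤ x) : Real.sin x ≤ x - x ^ 3 / 6 + x ^ 5 / 120 := by
  have := nonneg_of_hasDerivAt (f := fun y => y - y ^ 3 / 6 + y ^ 5 / 120 - Real.sin y)
    (f' := fun y => 1 - y ^ 2 / 2 + y ^ 4 / 24 - Real.cos y) (by simp) (fun y => by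
      have h1 := ((hasDerivAt_id y).sub ((hasDerivAt_pow 3 y).div_const 6)).add
        ((hasDerivAt_pow 5 y).div_const 120)
      refine (h1.sub (Real.hasDerivAt_sin y)).congr_deriv ?_
      push_cast; ring) (fun y _ => by linarith [cos_le_quartic y]) hx
  simpa using this

theorem sin_sub_mul_cos_le {x : ℝ} (hx : 0 ≤ x) :
    Real.sin x - x * Real.cos x ≤ x ^ 3 / 3 - x ^ 5 / 30 + x ^ 7 / 840 := by
  have := nonneg_of_hasDerivAt
    (f := fun y => y ^ 3 / 3 - y ^ 5 / 30 + y ^ 7 / 840 - (Real.sin y - y * Real.cos y))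
    (f' := fun y => y * (y - y ^ 3 / 6 + y ^ 5 / 120 - Real.sin y)) (by simp) (fun y => by
      have h1 := (((hasDerivAt_pow 3 y).div_const 3).sub ((hasDerivAt_pow 5 y).div_const 30)).add
        ((hasDerivAt_pow 7 y).div_const 840)
      have h2 := (Real.hasDerivAt_sin y).sub ((hasDerivAt_id y).mul (Real.hasDerivAt_cos y))
      refine (h1.sub h2).congr_deriv ?_
      simp only [id]
      push_cast; ring) (fun y hy => mul_nonneg hy (by linarith [sin_le_quintic hy])) hx
  simpa using this

/-- After Taylor bounds both sides are x³ times polynomials in x². The range x² ≤ 0.89 is chosen to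
contain x = 3π/(2N) for N ≥ 5, see `eps_sq_le`. -/
theorem sin_sub_mul_cos_le_half {x : ℝ} (hx : 0 ≤ x) (hx1 : x ^ 2 ≤ 0.89) :
    Real.sin x - x * Real.cos x ≤ Real.sin x ^ 3 / 2 := by
  have h1 := sin_sub_mul_cos_le hx
  have h2 := Real.sin_ge_sub_cube hx
  have h3 : 0 ≤ x - x ^ 3 / 6 := by nlinarith
  have h4 : (x - x ^ 3 / 6) ^ 3 ≤ Real.sin x ^ 3 := pow_le_pow_left₀ h3 h2 3
  have h5 : x ^ 3 / 3 - x ^ 5 / 30 + x ^ 7 / 840 ≤ (x - x ^ 3 / 6) ^ 3 / 2 := by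
    have hy : 0 ≤ x ^ 2 := sq_nonneg x
    set y := x ^ 2 with hyd
    have e1 : x ^ 3 / 3 - x ^ 5 / 30 + x ^ 7 / 840 = x ^ 3 * (1 / 3 - y / 30 + y ^ 2 / 840) := by
      rw [hyd]; ring
    have e2 : (x - x ^ 3 / 6) ^ 3 / 2 = x ^ 3 * ((1 - y / 6) ^ 3 / 2) := by rw [hyd]; ring
    rw [e1, e2]
    refine mul_le_mul_of_nonneg_left ?_ (by positivity)
    nlinarith [mul_nonneg hy (sub_nonneg.2 hx1), mul_nonneg hy hy,
      mul_nonneg (mul_nonneg hy hy) (sub_nonneg.2 hx1)]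
  linarith

/-- This is the sign of the derivative in `antitoneOn_div_sin_sq`. If t ≤ a, then sin t - t cos t ≤
sin t (1 - cos t) and cos a ≤ cos t, and the product is at most sin t (1 - cos² t). If t is small, 1
+ cos a ≤ 2 and the preceding bound suffice. -/
theorem sin_sub_mul_cos_mul_le {a t : ℝ} (ha : a ≤ Real.pi / 2) (ht : 0 ≤ t)
    (h : t ≤ a ∨ t ^ 2 ≤ 0.89) (hta : 0 ≤ a) :
    (Real.sin t - t * Real.cos t) * (1 + Real.cos a) ≤ Real.sin t ^ 3 := by
  rcases h with h | h
  · have h1 : Real.cos a ≤ Real.cos t := Real.cos_le_cos_of_nonneg_of_le_pi ht (by linarith [Real.pi_pos]) h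
    have h2 : 0 ≤ Real.cos a := Real.cos_nonneg_of_mem_Icc ⟨by linarith [Real.pi_pos], ha⟩
    have h3 : Real.sin t ≤ t := Real.sin_le ht
    have h4 : 0 ≤ Real.sin t := Real.sin_nonneg_of_nonneg_of_le_pi ht (by linarith [Real.pi_pos])
    have h5 : Real.sin t - t * Real.cos t ≤ Real.sin t * (1 - Real.cos t) := by nlinarith
    have h6 : Real.sin t * (1 - Real.cos t) * (1 + Real.cos t) = Real.sin t ^ 3 := by
      have := Real.sin_sq_add_cos_sq t
      linear_combination (-Real.sin t) * this
    have h7 : 0 ≤ Real.sin t * (1 - Real.cos t) := mul_nonneg h4 (by linarith [Real.cos_le_one t])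
    nlinarith [Real.neg_one_le_cos t]
  · have h1 := sin_sub_mul_cos_le_half ht h
    have h2 : 0 ≤ Real.sin t ^ 3 := by
      have : 0 ≤ Real.sin t := Real.sin_nonneg_of_nonneg_of_le_pi ht (by nlinarith [Real.pi_gt_three])
      positivity
    have h3 : 0 ≤ 1 + Real.cos a := by linarith [Real.neg_one_le_cos a]
    nlinarith [Real.cos_le_one a]

/-- The function `b ↦ b² / sin² b - b² / (1 + cos a)` is antitone where it matters. -/
theorem antitoneOn_div_sin_sq {a p q : ℝ} (ha0 : 0 ≤ a) (ha : a ≤ Real.pi / 2) (hp : 0 < p)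
    (hq : q ≤ Real.pi / 2) (h : q ≤ a ∨ q ^ 2 ≤ 0.89) :
    AntitoneOn (fun b => b ^ 2 / Real.sin b ^ 2 - b ^ 2 / (1 + Real.cos a)) (Set.Icc p q) := by
  have hs : ∀ t ∈ Set.Icc p q, 0 < Real.sin t := fun t ht =>
    Real.sin_pos_of_pos_of_lt_pi (by linarith [ht.1]) (by linarith [ht.2, Real.pi_pos])
  have hc : 0 < 1 + Real.cos a := by
    have : 0 ≤ Real.cos a := Real.cos_nonneg_of_mem_Icc ⟨by linarith [Real.pi_pos], ha⟩
    linarith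
  have hd : ∀ t ∈ Set.Icc p q, HasDerivAt
      (fun b => b ^ 2 / Real.sin b ^ 2 - b ^ 2 / (1 + Real.cos a))
      (2 * t / (Real.sin t ^ 3 * (1 + Real.cos a)) *
        ((Real.sin t - t * Real.cos t) * (1 + Real.cos a) - Real.sin t ^ 3)) t := by
    intro t ht
    have hst := hs t ht
    have h1 := ((hasDerivAt_pow 2 t).div ((Real.hasDerivAt_sin t).pow 2)
      (pow_ne_zero 2 hst.ne')).sub ((hasDerivAt_pow 2 t).div_const (1 + Real.cos a))
    refine h1.congr_deriv ?_
    simp only [Pi.pow_apply]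
    field_simp
    push_cast
    ring
  refine antitoneOn_of_deriv_nonpos (convex_Icc p q)
    (fun y hy => (hd y hy).continuousAt.continuousWithinAt)
    (fun y hy => (hd y (interior_subset hy)).differentiableAt.differentiableWithinAt) fun y hy => ?_
  have hy := interior_subset hy
  rw [(hd y hy).deriv]
  have hsy := hs y hy
  have hy0 : 0 < y := hp.trans_le hy.1
  refine mul_nonpos_of_nonneg_of_nonpos (by positivity) (sub_nonpos.2 ?_)
  refine sin_sub_mul_cos_mul_le ha hy0.le ?_ ha0
  rcases h with h | h
  · exact Or.inl (hy.2.trans h)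
  · exact Or.inr ((pow_le_pow_left₀ hy0.le hy.2 2).trans h)

/-- Put g(b) = b²/sin² b - b²/(1 + cos a). Because sin² a = (1 - cos a)(1 + cos a), the quantity
(g(b) - g(a)) sin² a sin² b is the right side minus the left side without absolute values, so the
claim is the monotonicity of g. It allows the sines in the closed form of a discrete kernel to be
replaced by their arguments, uniformly in N. -/
theorem cos_mul_sin_sq_mul_le {a b : ℝ} (ha0 : 0 ≤ a) (ha : a ≤ Real.pi / 2) (hb0 : 0 < b)
    (hb : b ^ 2 ≤ 0.89) :
    Real.cos a * Real.sin b ^ 2 * |a ^ 2 - b ^ 2| ≤ b ^ 2 * |Real.sin a ^ 2 - Real.sin b ^ 2| := by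
  have hb1 : b ≤ Real.pi / 2 := by nlinarith [Real.pi_gt_three]
  have hsb : 0 < Real.sin b := Real.sin_pos_of_pos_of_lt_pi hb0 (by linarith [Real.pi_pos])
  have hca : 0 ≤ Real.cos a := Real.cos_nonneg_of_mem_Icc ⟨by linarith [Real.pi_pos], ha⟩
  rcases ha0.eq_or_lt with rfl | ha0'
  · simp; nlinarith [sq_nonneg (b * Real.sin b)]
  have hsa : 0 < Real.sin a := Real.sin_pos_of_pos_of_lt_pi ha0' (by linarith [Real.pi_pos])
  have hcs : Real.sin a ^ 2 = (1 - Real.cos a) * (1 + Real.cos a) := by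
    have := Real.sin_sq_add_cos_sq a
    linear_combination this
  have key : ∀ g : ℝ, g * (Real.sin a ^ 2 * Real.sin b ^ 2) = Real.sin a ^ 2 * b ^ 2 -
      Real.sin b ^ 2 * (a ^ 2 * Real.cos a + b ^ 2 * (1 - Real.cos a)) ↔
      g = (b ^ 2 / Real.sin b ^ 2 - b ^ 2 / (1 + Real.cos a)) -
        (a ^ 2 / Real.sin a ^ 2 - a ^ 2 / (1 + Real.cos a)) := by
    intro g
    have h1 : b ^ 2 / (1 + Real.cos a) = b ^ 2 * (1 - Real.cos a) / Real.sin a ^ 2 := by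
      rw [hcs]; field_simp
      by_cases h : 1 - Real.cos a = 0
      · rw [h] at hcs; nlinarith
      · field_simp
    have h2 : a ^ 2 / (1 + Real.cos a) = a ^ 2 * (1 - Real.cos a) / Real.sin a ^ 2 := by
      rw [hcs]
      by_cases h : 1 - Real.cos a = 0
      · rw [h] at hcs; nlinarith
      · field_simp
    rw [h1, h2]
    have e : b ^ 2 / Real.sin b ^ 2 - b ^ 2 * (1 - Real.cos a) / Real.sin a ^ 2 -
        (a ^ 2 / Real.sin a ^ 2 - a ^ 2 * (1 - Real.cos a) / Real.sin a ^ 2) =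
        (Real.sin a ^ 2 * b ^ 2 - Real.sin b ^ 2 * (a ^ 2 * Real.cos a + b ^ 2 * (1 - Real.cos a))) /
          (Real.sin a ^ 2 * Real.sin b ^ 2) := by
      field_simp
      ring
    rw [e, eq_div_iff (by positivity)]
  obtain hg := (key _).2 rfl
  rcases le_total b a with hba | hab
  · have hmono := antitoneOn_div_sin_sq ha0 ha hb0 ha (Or.inl le_rfl) ⟨le_rfl, hba⟩ ⟨hba, le_rfl⟩ hba
    simp only at hmono
    have hs : Real.sin b ≤ Real.sin a := Real.sin_le_sin_of_le_of_le_pi_div_two (by linarith [Real.pi_pos]) ha hba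
    rw [abs_of_nonneg (by nlinarith), abs_of_nonneg (by nlinarith)]
    have := mul_nonneg (sub_nonneg.2 hmono) (by positivity : 0 ≤ Real.sin a ^ 2 * Real.sin b ^ 2)
    nlinarith
  · have hmono := antitoneOn_div_sin_sq ha0 ha ha0' hb1 (Or.inr hb) ⟨le_rfl, hab⟩ ⟨hab, le_rfl⟩ hab
    simp only at hmono
    have hs : Real.sin a ≤ Real.sin b := Real.sin_le_sin_of_le_of_le_pi_div_two (by linarith [Real.pi_pos]) hb1 hab
    rw [abs_of_nonpos (by nlinarith), abs_of_nonpos (by nlinarith)]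
    have := mul_nonneg (sub_nonneg.2 hmono) (by positivity : 0 ≤ Real.sin a ^ 2 * Real.sin b ^ 2)
    nlinarith

/-! ### Cosine kernels on the centred nodes and their limit kernels -/

/-- The centred sample points `π (k - (N - 1) / 2) / N`. -/
noncomputable def node (N : ℕ) (k : Fin N) : ℝ := Real.pi * ((k : ℕ) - ((N : ℝ) - 1) / 2) / N

theorem sum_cos_node_mul_sin {N : ℕ} (hN : 0 < N) (v : ℝ) :
    (∑ k : Fin N, Real.cos (2 * v * node N k)) * Real.sin (Real.pi * v / N) = Real.sin (Real.pi * v) := by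
  have hN0 : (N : ℝ) ≠ 0 := by positivity
  have h : ∀ k : ℕ, Real.cos (2 * v * (Real.pi * (k - ((N : ℝ) - 1) / 2) / N)) * Real.sin (Real.pi * v / N) =
      Real.sin (2 * v * Real.pi / N * ((k + 1 : ℕ) - (N : ℝ) / 2)) / 2 -
        Real.sin (2 * v * Real.pi / N * ((k : ℕ) - (N : ℝ) / 2)) / 2 := by
    intro k
    have e1 : 2 * v * Real.pi / N * ((k + 1 : ℕ) - (N : ℝ) / 2) =
        2 * v * (Real.pi * (k - ((N : ℝ) - 1) / 2) / N) + Real.pi * v / N := by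
      push_cast; field_simp; ring
    have e2 : 2 * v * Real.pi / N * ((k : ℕ) - (N : ℝ) / 2) =
        2 * v * (Real.pi * (k - ((N : ℝ) - 1) / 2) / N) - Real.pi * v / N := by
      field_simp; ring
    rw [e1, e2, Real.sin_add, Real.sin_sub]
    ring
  unfold node
  rw [Finset.sum_mul, Fin.sum_univ_eq_sum_range
    (fun k => Real.cos (2 * v * (Real.pi * ((k : ℕ) - ((N : ℝ) - 1) / 2) / N)) * Real.sin (Real.pi * v / N)) N]
  rw [Finset.sum_congr rfl fun k _ => h k,
    Finset.sum_range_sub (fun k : ℕ => Real.sin (2 * v * Real.pi / N * ((k : ℕ) - (N : ℝ) / 2)) / 2)]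
  have e1 : 2 * v * Real.pi / N * ((N : ℕ) - (N : ℝ) / 2) = Real.pi * v := by field_simp; ring
  have e2 : 2 * v * Real.pi / N * ((0 : ℕ) - (N : ℝ) / 2) = -(Real.pi * v) := by push_cast; field_simp; ring
  rw [e1, e2, Real.sin_neg]
  ring

/-- The kernels `k_m(u) = ± sin (m ε) ∑ cos (m ψ) cos (2 u ψ)`, normalised by `k_m(0) = 1`. -/
noncomputable def ker (σ m : ℝ) (N : ℕ) (u : ℝ) : ℝ :=
  σ * Real.sin (m * (Real.pi / (2 * N))) *
    ∑ k : Fin N, Real.cos (m * node N k) * Real.cos (2 * u * node N k)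

/-- The product of cosines splits into Dirichlet sums at u + m/2 and u - m/2. Hypothesis `h1`
encodes that m is odd with sign σ (used for m = 1, σ = 1 and m = 3, σ = -1) and turns both
numerators into ± cos πu. Without division the formula also holds at the removable singularities u =
± m/2. -/
theorem ker_mul {σ m : ℝ} {N : ℕ} (hN : 0 < N) (hσ : σ ^ 2 = 1)
    (h1 : ∀ x, Real.sin (x + Real.pi * (m / 2)) = σ * Real.cos x) (u : ℝ) :
    ker σ m N u * (Real.sin (Real.pi * u / N) ^ 2 - Real.sin (m * (Real.pi / (2 * N))) ^ 2) =
      -(Real.cos (Real.pi * u) * Real.cos (Real.pi * u / N) *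
        Real.sin (m * (Real.pi / (2 * N))) ^ 2) := by
  have hN0 : (N : ℝ) ≠ 0 := by positivity
  have h2 : ∀ x, Real.sin (x - Real.pi * (m / 2)) = -(σ * Real.cos x) := by
    intro x
    have := h1 (-x)
    rw [Real.cos_neg, show -x + Real.pi * (m / 2) = -(x - Real.pi * (m / 2)) by ring,
      Real.sin_neg] at this
    linarith
  set a := Real.pi * u / N
  set b := m * (Real.pi / (2 * N))
  have e1 := sum_cos_node_mul_sin hN (u + m / 2)
  have e2 := sum_cos_node_mul_sin hN (u - m / 2)
  rw [mul_add Real.pi u, h1] at e1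
  rw [mul_sub Real.pi u, h2] at e2
  have f1 : (Real.pi * u + Real.pi * (m / 2)) / N = a + b := by
    simp only [a, b]; field_simp
  have f2 : (Real.pi * u - Real.pi * (m / 2)) / N = a - b := by
    simp only [a, b]; field_simp
  rw [f1] at e1
  rw [f2] at e2
  have hsum : ∑ k : Fin N, Real.cos (m * node N k) * Real.cos (2 * u * node N k) =
      ((∑ k : Fin N, Real.cos (2 * (u + m / 2) * node N k)) +
        ∑ k : Fin N, Real.cos (2 * (u - m / 2) * node N k)) / 2 := by
    rw [← Finset.sum_add_distrib, Finset.sum_div]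
    refine Finset.sum_congr rfl fun k _ => ?_
    rw [show 2 * (u + m / 2) * node N k = 2 * u * node N k + m * node N k by ring,
      show 2 * (u - m / 2) * node N k = 2 * u * node N k - m * node N k by ring,
      Real.cos_add, Real.cos_sub]
    ring
  have hS : Real.sin a ^ 2 - Real.sin b ^ 2 = Real.sin (a + b) * Real.sin (a - b) := by
    rw [Real.sin_add, Real.sin_sub]
    have h3 := Real.sin_sq_add_cos_sq a
    have h4 := Real.sin_sq_add_cos_sq b
    linear_combination Real.sin b ^ 2 * h3 - Real.sin a ^ 2 * h4
  have hab : Real.sin (a - b) - Real.sin (a + b) = -(2 * Real.cos a * Real.sin b) := by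
    rw [Real.sin_add, Real.sin_sub]; ring
  unfold ker
  rw [hsum, hS]
  linear_combination (σ * Real.sin b / 2 * Real.sin (a - b)) * e1 +
    (σ * Real.sin b / 2 * Real.sin (a + b)) * e2 +
    (Real.sin b * Real.cos (Real.pi * u) / 2) * (σ ^ 2) * hab -
    (Real.cos (Real.pi * u) * Real.cos a * Real.sin b ^ 2) * hσ

/-- Combining `ker_mul` with `cos_mul_sin_sq_mul_le` shows that, on a period, the discrete kernel is
dominated by m² |cos πu| / |4u² - m²|, the kernel of the limit N → ∞. -/
theorem abs_ker_mul_le {σ m : ℝ} {N : ℕ} (hN : 0 < N) (hσ : σ ^ 2 = 1) (hm : 0 < m)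
    (h1 : ∀ x, Real.sin (x + Real.pi * (m / 2)) = σ * Real.cos x)
    (hmN : (m * (Real.pi / (2 * N))) ^ 2 ≤ 0.89) {u : ℝ} (hu : |u| ≤ N / 2) :
    |ker σ m N u| * |4 * u ^ 2 - m ^ 2| ≤ m ^ 2 * |Real.cos (Real.pi * u)| := by
  have hN0 : (0 : ℝ) < N := by positivity
  have hf := ker_mul hN hσ h1 u
  set a := Real.pi * u / N with ha
  set b := m * (Real.pi / (2 * N)) with hb
  have hb0 : 0 < b := by positivity
  have hb1 : b < Real.pi := by nlinarith [Real.pi_gt_three]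
  have hsb : 0 < Real.sin b := Real.sin_pos_of_pos_of_lt_pi hb0 hb1
  have habs : |a| ≤ Real.pi / 2 := by
    rw [ha, abs_div, abs_mul, abs_of_pos Real.pi_pos, Nat.abs_cast, div_le_iff₀ hN0]
    nlinarith [Real.pi_pos]
  have hkey := cos_mul_sin_sq_mul_le (abs_nonneg a) habs hb0 hmN
  rw [Real.cos_abs, sq_abs] at hkey
  have hsa : Real.sin |a| ^ 2 = Real.sin a ^ 2 := by
    rcases abs_choice a with h | h <;> rw [h]
    rw [Real.sin_neg, neg_sq]
  rw [hsa] at hkey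
  have hca : 0 ≤ Real.cos a := Real.cos_nonneg_of_mem_Icc (abs_le.1 habs)
  set c := Real.pi / (2 * N) with hc
  have hc0 : 0 < c := by positivity
  have e1 : a ^ 2 - b ^ 2 = c ^ 2 * (4 * u ^ 2 - m ^ 2) := by
    rw [ha, hb, hc]; field_simp; ring
  rw [e1, abs_mul, abs_of_pos (by positivity : 0 < c ^ 2)] at hkey
  have hkey2 : Real.cos a * Real.sin b ^ 2 * |4 * u ^ 2 - m ^ 2| ≤
      m ^ 2 * |Real.sin a ^ 2 - Real.sin b ^ 2| := by
    rw [hb] at hkey ⊢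
    have : 0 < c ^ 2 := by positivity
    refine le_of_mul_le_mul_left ?_ this
    calc _ = _ := by ring
      _ ≤ _ := hkey
      _ = _ := by ring
  -- When the denominator vanishes nothing can be cancelled, but then 4u² = m² and the left side is
  -- zero.
  by_cases h0 : Real.sin a ^ 2 - Real.sin b ^ 2 = 0
  · rw [h0, abs_zero, mul_zero] at hkey
    rw [h0, mul_zero] at hf
    have h3 : Real.cos a * |4 * u ^ 2 - m ^ 2| ≤ 0 := by
      by_contra hcon
      push Not at hcon
      have := mul_pos (by positivity : 0 < Real.sin b ^ 2 * c ^ 2) hcon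
      nlinarith
    have h4 : Real.cos a ≠ 0 := by
      intro h4
      have h5 := Real.sin_sq_add_cos_sq a
      have h6 := Real.sin_sq_add_cos_sq b
      have h7 : Real.cos b = 0 := by
        have : Real.cos b ^ 2 = 0 := by rw [h4] at h5; linarith
        exact pow_eq_zero_iff (two_ne_zero) |>.1 this
      have : 0 < Real.cos b := Real.cos_pos_of_mem_Ioo ⟨by linarith [Real.pi_pos], by
        nlinarith [Real.pi_gt_three]⟩
      linarith
    have h5 : 0 < Real.cos a := lt_of_le_of_ne hca (Ne.symm h4)
    have h6 : |4 * u ^ 2 - m ^ 2| = 0 := by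
      have := abs_nonneg (4 * u ^ 2 - m ^ 2)
      nlinarith
    rw [h6, mul_zero]; positivity
  · have h3 : 0 < |Real.sin a ^ 2 - Real.sin b ^ 2| := abs_pos.2 h0
    refine le_of_mul_le_mul_right ?_ h3
    have h4 : |ker σ m N u| * |Real.sin a ^ 2 - Real.sin b ^ 2| =
        |Real.cos (Real.pi * u)| * (Real.cos a * Real.sin b ^ 2) := by
      rw [← abs_mul, hf, abs_neg, mul_assoc, abs_mul,
        abs_of_nonneg (mul_nonneg hca (sq_nonneg (Real.sin b)))]
    calc |ker σ m N u| * |4 * u ^ 2 - m ^ 2| * |Real.sin a ^ 2 - Real.sin b ^ 2|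
        = |Real.cos (Real.pi * u)| * (Real.cos a * Real.sin b ^ 2 * |4 * u ^ 2 - m ^ 2|) := by
          linear_combination |4 * u ^ 2 - m ^ 2| * h4
      _ ≤ |Real.cos (Real.pi * u)| * (m ^ 2 * |Real.sin a ^ 2 - Real.sin b ^ 2|) :=
          mul_le_mul_of_nonneg_left hkey2 (abs_nonneg _)
      _ = _ := by ring

/-! ### Majorants adapted to the zeros of the limit kernels -/

theorem sin_pi_mul_le_parabola {v : ℝ} (h0 : 0 ≤ v) (h1 : v ≤ 1) :
    Real.sin (Real.pi * v) ≤ 4 * v * (1 - v) := by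
  wlog h : v ≤ 1 / 2 generalizing v
  · have := this (v := 1 - v) (by linarith) (by linarith) (by linarith)
    rw [mul_sub, mul_one, Real.sin_pi_sub] at this
    linarith
  have hp := Real.pi_lt_d2
  have hp1 := Real.pi_gt_d2
  rcases le_total v (1 / 5) with hv | hv
  · have := Real.sin_le (mul_nonneg Real.pi_pos.le h0)
    nlinarith
  · have e : Real.sin (Real.pi * v) = Real.cos (Real.pi * (1 / 2 - v)) := by
      rw [← Real.cos_pi_div_two_sub]; congr 1; ring
    rw [e]
    have := cos_le_quartic (Real.pi * (1 / 2 - v))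
    set w := 1 / 2 - v with hw
    have hw0 : 0 ≤ w := by linarith
    have hw1 : w ≤ 0.3 := by linarith
    have e2 : 4 * v * (1 - v) = 1 - 4 * w ^ 2 := by rw [hw]; ring
    rw [e2]
    have h2 : w ^ 2 ≤ 0.09 := by nlinarith
    have h3 : 9.85 ≤ Real.pi ^ 2 := by nlinarith
    have h4 : Real.pi ^ 2 ≤ 9.93 := by nlinarith
    have h5 : (Real.pi * w) ^ 4 ≤ 9.93 ^ 2 * 0.09 * w ^ 2 := by
      have : (Real.pi * w) ^ 4 = (Real.pi ^ 2) ^ 2 * w ^ 2 * w ^ 2 := by ring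
      rw [this]
      have h6 : (Real.pi ^ 2) ^ 2 ≤ 9.93 ^ 2 := pow_le_pow_left₀ (by positivity) h4 2
      have h7 : (Real.pi ^ 2) ^ 2 * w ^ 2 ≤ 9.93 ^ 2 * 0.09 :=
        mul_le_mul h6 h2 (by positivity) (by norm_num)
      exact mul_le_mul_of_nonneg_right h7 (by positivity)
    have h6 : 9.85 * w ^ 2 ≤ (Real.pi * w) ^ 2 := by
      rw [mul_pow]; exact mul_le_mul_of_nonneg_right h3 (by positivity)
    nlinarith [sq_nonneg w]

theorem sin_pi_mul_le_cubic {v : ℝ} (h0 : 0 ≤ v) (h1 : v ≤ 1) :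
    Real.sin (Real.pi * v) ≤ Real.pi * v * (1 - v ^ 2) := by
  have hp := Real.pi_lt_d2
  have hp1 := Real.pi_gt_d2
  rcases le_total v (4 / 5) with hv | hv
  · have h2 := sin_le_quintic (mul_nonneg Real.pi_pos.le h0)
    have h3 : 9.85 ≤ Real.pi ^ 2 := by nlinarith
    have h4 : Real.pi ^ 2 ≤ 9.93 := by nlinarith
    have h5 : v ^ 2 ≤ 16 / 25 := by nlinarith
    have h6 : (Real.pi ^ 2) ^ 2 * v ^ 2 ≤ 9.93 ^ 2 * (16 / 25) :=
      mul_le_mul (pow_le_pow_left₀ (by positivity) h4 2) h5 (by positivity) (by norm_num)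
    have e : Real.pi * v - (Real.pi * v) ^ 3 / 6 + (Real.pi * v) ^ 5 / 120 =
        Real.pi * v * (1 - v ^ 2 * (Real.pi ^ 2 / 6 - (Real.pi ^ 2) ^ 2 * v ^ 2 / 120)) := by ring
    rw [e] at h2
    refine h2.trans (mul_le_mul_of_nonneg_left ?_ (by positivity))
    nlinarith [sq_nonneg v]
  · have e : Real.sin (Real.pi * v) = Real.sin (Real.pi * (1 - v)) := by
      rw [mul_sub, mul_one, Real.sin_pi_sub]
    rw [e]
    have := Real.sin_le (mul_nonneg Real.pi_pos.le (sub_nonneg.2 h1))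
    have h2 : Real.pi * (1 - v) * 1 ≤ Real.pi * (1 - v) * (v * (1 + v)) :=
      mul_le_mul_of_nonneg_left (by nlinarith) (mul_nonneg Real.pi_pos.le (sub_nonneg.2 h1))
    calc Real.sin (Real.pi * (1 - v)) ≤ Real.pi * (1 - v) * 1 := by linarith
      _ ≤ _ := h2
      _ = _ := by ring

/-- The factor 1 - 4u² is the denominator of the limit kernel for m = 1; dividing it out leaves the
bound 1 - 0.8u² for the kernel near its peak. Close to u = 1/2 the cosine is expanded around its
zero, otherwise around 0. -/
theorem cos_pi_mul_le {u : ℝ} (h0 : 0 ≤ u) (h1 : u ≤ 1 / 2) :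
    Real.cos (Real.pi * u) ≤ (1 - 4 * u ^ 2) * (1 - 0.8 * u ^ 2) := by
  have hp := Real.pi_lt_d4
  have hp1 := Real.pi_gt_d4
  have h3 : 9.869 ≤ Real.pi ^ 2 := by nlinarith
  have h4 : Real.pi ^ 2 ≤ 9.87 := by nlinarith
  rcases le_total u (3 / 10) with hu | hu
  · have h2 := cos_le_quartic (Real.pi * u)
    have h5 : (Real.pi * u) ^ 4 ≤ 9.87 ^ 2 * u ^ 4 := by
      have : (Real.pi * u) ^ 4 = (Real.pi ^ 2) ^ 2 * u ^ 4 := by ring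
      rw [this]
      exact mul_le_mul_of_nonneg_right (pow_le_pow_left₀ (by positivity) h4 2) (by positivity)
    have h6 : 9.869 * u ^ 2 ≤ (Real.pi * u) ^ 2 := by
      rw [mul_pow]; exact mul_le_mul_of_nonneg_right h3 (by positivity)
    have h7 : u ^ 4 ≤ 0.09 * u ^ 2 := by
      have : u ^ 2 ≤ 0.09 := by nlinarith
      nlinarith [sq_nonneg u]
    nlinarith [sq_nonneg u]
  · have e : Real.cos (Real.pi * u) = Real.sin (Real.pi * (1 / 2 - u)) := by
      rw [← Real.sin_pi_div_two_sub]; congr 1; ring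
    rw [e]
    set v := 1 / 2 - u with hv
    have hv0 : 0 ≤ v := by linarith
    have hv1 : v ≤ 1 / 5 := by linarith
    have h2 := sin_le_quintic (mul_nonneg Real.pi_pos.le hv0)
    have e1 : (1 - 4 * u ^ 2) * (1 - 0.8 * u ^ 2) =
        v * (4 * (1 - v) * (0.8 + 0.8 * v - 0.8 * v ^ 2)) := by
      rw [show u = 1 / 2 - v by rw [hv]; ring]; ring
    have e2 : Real.pi * v - (Real.pi * v) ^ 3 / 6 + (Real.pi * v) ^ 5 / 120 =
        v * (Real.pi * (1 - Real.pi ^ 2 * v ^ 2 / 6 + (Real.pi ^ 2) ^ 2 * v ^ 4 / 120)) := by ring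
    rw [e1]
    rw [e2] at h2
    refine h2.trans (mul_le_mul_of_nonneg_left ?_ hv0)
    have h5 : (Real.pi ^ 2) ^ 2 * v ^ 4 ≤ 9.87 ^ 2 * (v ^ 2 * (1 / 25)) := by
      refine mul_le_mul (pow_le_pow_left₀ (by positivity) h4 2) ?_ (by positivity) (by norm_num)
      have : v ^ 2 ≤ 1 / 25 := by nlinarith
      nlinarith [sq_nonneg v]
    have h6 : 9.869 * v ^ 2 ≤ Real.pi ^ 2 * v ^ 2 := mul_le_mul_of_nonneg_right h3 (by positivity)
    have h7 : 1 - Real.pi ^ 2 * v ^ 2 / 6 + (Real.pi ^ 2) ^ 2 * v ^ 4 / 120 ≤ 1 - 1.612 * v ^ 2 := by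
      nlinarith [sq_nonneg v]
    have h8 : 0 ≤ 1 - 1.612 * v ^ 2 := by nlinarith
    have h9 : Real.pi * (1 - Real.pi ^ 2 * v ^ 2 / 6 + (Real.pi ^ 2) ^ 2 * v ^ 4 / 120) ≤
        3.1416 * (1 - 1.612 * v ^ 2) :=
      (mul_le_mul_of_nonneg_left h7 Real.pi_pos.le).trans (mul_le_mul_of_nonneg_right hp.le h8)
    refine h9.trans ?_
    nlinarith [mul_nonneg hv0 hv0, mul_nonneg (mul_nonneg hv0 hv0) hv0]

/-! ### Two windows and the decay of their kernels -/

/-- The window `(1 - θ) sin ε cos ψ - θ sin 3ε cos 3ψ`, with `ε = π / (2 N)`. -/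
noncomputable def wt (θ : ℝ) (N : ℕ) (k : Fin N) : ℝ :=
  (1 - θ) * (Real.sin (1 * (Real.pi / (2 * N))) * Real.cos (1 * node N k)) -
    θ * (Real.sin (3 * (Real.pi / (2 * N))) * Real.cos (3 * node N k))

/-- The kernel of the window `wt`. -/
noncomputable def kap (θ : ℝ) (N : ℕ) (u : ℝ) : ℝ := ∑ k, wt θ N k * Real.cos (2 * u * node N k)

theorem kap_eq (θ : ℝ) (N : ℕ) (u : ℝ) : kap θ N u = (1 - θ) * ker 1 1 N u + θ * ker (-1) 3 N u := by
  unfold kap ker wt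
  simp only [Finset.mul_sum]
  rw [← Finset.sum_add_distrib]
  refine Finset.sum_congr rfl fun k _ => by ring

theorem kap_zero_left (N : ℕ) (u : ℝ) : kap 0 N u = ker 1 1 N u := by rw [kap_eq]; ring

theorem sin_add_pi_half (x : ℝ) : Real.sin (x + Real.pi * (1 / 2)) = 1 * Real.cos x := by
  rw [← Real.sin_add_pi_div_two, one_mul]; congr 1; ring

theorem sin_add_three_pi_half (x : ℝ) : Real.sin (x + Real.pi * (3 / 2)) = -1 * Real.cos x := by
  have := Real.sin_add_pi_div_two (x + Real.pi)
  rw [Real.cos_add_pi] at this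
  rw [neg_one_mul, ← this]; congr 1; ring

theorem eps_sq_le {N : ℕ} (hN : 5 ≤ N) {m : ℝ} (hm0 : 0 ≤ m) (hm : m ≤ 3) :
    (m * (Real.pi / (2 * N))) ^ 2 ≤ 0.89 := by
  have hN' : (5 : ℝ) ≤ N := by exact_mod_cast hN
  have h1 : Real.pi / (2 * N) ≤ 0.31416 := by
    rw [div_le_iff₀ (by positivity)]
    nlinarith [Real.pi_lt_d4]
  have h0 : 0 ≤ Real.pi / (2 * N) := by positivity
  have h2 : m * (Real.pi / (2 * N)) ≤ 3 * 0.31416 := mul_le_mul hm h1 h0 (by norm_num)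
  calc _ ≤ (3 * 0.31416 : ℝ) ^ 2 := pow_le_pow_left₀ (mul_nonneg hm0 h0) h2 2
    _ ≤ 0.89 := by norm_num

theorem ker_neg (σ m : ℝ) (N : ℕ) (u : ℝ) : ker σ m N (-u) = ker σ m N u := by
  unfold ker
  congr 1
  refine Finset.sum_congr rfl fun k _ => ?_
  rw [← Real.cos_neg (2 * u * node N k)]
  congr 2; ring

theorem kap_neg (θ : ℝ) (N : ℕ) (u : ℝ) : kap θ N (-u) = kap θ N u := by
  rw [kap_eq, kap_eq, ker_neg, ker_neg]

theorem kap_abs (θ : ℝ) (N : ℕ) (u : ℝ) : kap θ N |u| = kap θ N u := by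
  rcases abs_choice u with h | h <;> rw [h]
  exact kap_neg _ _ _

theorem continuous_kap (θ : ℝ) (N : ℕ) : Continuous (kap θ N) := by
  unfold kap; fun_prop

theorem ker_zero {σ m : ℝ} {N : ℕ} (hN : 5 ≤ N) (hσ : σ ^ 2 = 1) (hm : 0 < m) (hm3 : m ≤ 3)
    (h1 : ∀ x, Real.sin (x + Real.pi * (m / 2)) = σ * Real.cos x) : ker σ m N 0 = 1 := by
  have h := ker_mul (N := N) (by omega) hσ h1 0
  have hb := eps_sq_le hN hm.le hm3
  have hN0 : (0 : ℝ) < N := by exact_mod_cast (by omega : 0 < N)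
  have hs : 0 < Real.sin (m * (Real.pi / (2 * N))) :=
    Real.sin_pos_of_pos_of_lt_pi (by positivity) (by nlinarith [Real.pi_gt_three])
  simp only [mul_zero, zero_div, Real.sin_zero, Real.cos_zero] at h
  have : (ker σ m N 0 - 1) * Real.sin (m * (Real.pi / (2 * N))) ^ 2 = 0 := by linear_combination -h
  rcases mul_eq_zero.1 this with h | h
  · linarith
  · exact absurd h (pow_ne_zero 2 hs.ne')

theorem kap_zero {N : ℕ} (hN : 5 ≤ N) (θ : ℝ) : kap θ N 0 = 1 := by
  rw [kap_eq, ker_zero hN (by norm_num) (by norm_num) (by norm_num) sin_add_pi_half,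
    ker_zero hN (by norm_num) (by norm_num) (by norm_num) sin_add_three_pi_half]
  ring

theorem sum_wt {N : ℕ} (hN : 5 ≤ N) (θ : ℝ) : ∑ k, wt θ N k = 1 := by
  have := kap_zero hN θ
  unfold kap at this
  simpa using this

theorem abs_node_le {N : ℕ} (k : Fin N) : |node N k| ≤ Real.pi / 2 := by
  have hN : 0 < N := k.pos
  have hN0 : (0 : ℝ) < N := by exact_mod_cast hN
  have hk : ((k : ℕ) : ℝ) ≤ N - 1 := by
    have : (k : ℕ) + 1 ≤ N := k.2
    have : ((k : ℕ) : ℝ) + 1 ≤ N := by exact_mod_cast this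
    linarith
  have hk0 : (0 : ℝ) ≤ (k : ℕ) := by positivity
  unfold node
  rw [abs_div, abs_mul, abs_of_pos Real.pi_pos, abs_of_pos hN0, div_le_iff₀ hN0]
  have : |((k : ℕ) : ℝ) - ((N : ℝ) - 1) / 2| ≤ N / 2 := by
    rw [abs_le]; constructor <;> linarith
  nlinarith [Real.pi_pos]

theorem cos_node_nonneg {N : ℕ} (k : Fin N) : 0 ≤ Real.cos (node N k) :=
  Real.cos_nonneg_of_mem_Icc (abs_le.1 (abs_node_le k))

theorem wt_eq (θ : ℝ) {N : ℕ} (k : Fin N) : wt θ N k =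
    Real.sin (Real.pi / (2 * N)) * Real.cos (node N k) *
      ((1 - θ) - θ * (3 - 4 * Real.sin (Real.pi / (2 * N)) ^ 2) * (4 * Real.cos (node N k) ^ 2 - 3)) := by
  unfold wt
  rw [one_mul, one_mul, Real.sin_three_mul, Real.cos_three_mul]
  ring

theorem sin_eps_nonneg {N : ℕ} (hN : 5 ≤ N) : 0 ≤ Real.sin (Real.pi / (2 * N)) := by
  have h := eps_sq_le hN zero_le_one (by norm_num : (1 : ℝ) ≤ 3)
  rw [one_mul] at h
  have hN0 : (0 : ℝ) < N := by exact_mod_cast (by omega : 0 < N)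
  exact Real.sin_nonneg_of_nonneg_of_le_pi (by positivity) (by nlinarith [Real.pi_gt_three])

theorem sin_eps_sq_le {N : ℕ} (hN : 5 ≤ N) : Real.sin (Real.pi / (2 * N)) ^ 2 ≤ 1 / 10 := by
  have hN' : (5 : ℝ) ≤ N := by exact_mod_cast hN
  have h1 : Real.pi / (2 * N) ≤ 0.315 := by
    rw [div_le_iff₀ (by positivity)]
    nlinarith [Real.pi_lt_d2]
  have h0 : 0 ≤ Real.pi / (2 * N) := by positivity
  have h2 := Real.sin_le h0
  calc _ ≤ (0.315 : ℝ) ^ 2 := pow_le_pow_left₀ (sin_eps_nonneg hN) (h2.trans h1) 2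
    _ ≤ _ := by norm_num

theorem wt_nonneg {θ : ℝ} (h0 : 0 ≤ θ) (h1 : θ ≤ 1 / 28) {N : ℕ} (hN : 5 ≤ N) (k : Fin N) :
    0 ≤ wt θ N k := by
  rw [wt_eq]
  refine mul_nonneg (mul_nonneg (sin_eps_nonneg hN) (cos_node_nonneg k)) ?_
  set g := 3 - 4 * Real.sin (Real.pi / (2 * N)) ^ 2 with hg
  have hg0 : 0 ≤ g := by have := sin_eps_sq_le hN; linarith
  have hg3 : g ≤ 3 := by rw [hg]; nlinarith [sq_nonneg (Real.sin (Real.pi / (2 * N)))]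
  have hc : Real.cos (node N k) ^ 2 ≤ 1 := Real.cos_sq_le_one _
  have : g * (4 * Real.cos (node N k) ^ 2 - 3) ≤ 3 := by nlinarith
  nlinarith

theorem wt_zero_le {N : ℕ} (hN : 5 ≤ N) (k : Fin N) : wt 0 N k ≤ Real.pi / 2 / N := by
  rw [wt_eq]
  have hN0 : (0 : ℝ) < N := by exact_mod_cast (by omega : 0 < N)
  have h1 : Real.sin (Real.pi / (2 * N)) ≤ Real.pi / 2 / N := by
    rw [div_div]; exact Real.sin_le (by positivity)
  have h2 := Real.cos_le_one (node N k)
  have h3 := cos_node_nonneg k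
  have h4 := sin_eps_nonneg hN
  nlinarith

/-- In the limit of small ε the window divided by ε is (1 - θ)c - 3θ(4c³ - 3c) with c = cos ψ, and
its slope at c = 1 is 1 - 28θ. Hence θ = 1/28 is the largest value for which the maximum stays at
the centre; it equals 6ε/7 = 3π/(7N), compared with at most π/(2N) for θ = 0. -/
theorem wt_le {N : ℕ} (hN : 5 ≤ N) (k : Fin N) : wt (1 / 28) N k ≤ 3 * Real.pi / 7 / N := by
  rw [wt_eq]
  have hN0 : (0 : ℝ) < N := by exact_mod_cast (by omega : 0 < N)
  set ε := Real.pi / (2 * N) with hε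
  have hε0 : 0 ≤ ε := by positivity
  have hs := sin_eps_nonneg hN
  rw [← hε] at hs
  have hE := sin_eps_sq_le hN
  rw [← hε] at hE
  set c := Real.cos (node N k)
  have hc0 : 0 ≤ c := cos_node_nonneg k
  have hc1 : c ≤ 1 := Real.cos_le_one _
  set g := 3 - 4 * Real.sin ε ^ 2 with hg
  have hg0 : 0 ≤ g := by linarith
  have hg3 : g ≤ 3 := by rw [hg]; nlinarith [sq_nonneg (Real.sin ε)]
  have h1 : c * (27 + 3 * g - 4 * g * c ^ 2) ≤ 27 - g := by
    have : 0 ≤ (1 - c) * (27 + 3 * g - 4 * g * (1 + c + c ^ 2)) := by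
      refine mul_nonneg (by linarith) ?_
      nlinarith [mul_nonneg hg0 (sub_nonneg.2 hc1), mul_nonneg hg0 (mul_nonneg hc0 (sub_nonneg.2 hc1))]
    nlinarith
  -- Since 27 - g = 24 + 4 sin² ε, the value at the centre is sin ε (6 + sin² ε)/7. In (ε - ε³/6)(6
  -- + ε²) the cubic terms cancel, so the limit 6ε/7 is a bound for every N.
  have h2 : Real.sin ε * (6 + Real.sin ε ^ 2) ≤ 6 * ε := by
    have h3 := sin_le_quintic hε0
    have h4 : Real.sin ε ^ 2 ≤ ε ^ 2 := pow_le_pow_left₀ hs (Real.sin_le hε0) 2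
    have hε1 : ε ^ 2 ≤ 1 := by
      have := eps_sq_le hN zero_le_one (by norm_num : (1 : ℝ) ≤ 3)
      rw [one_mul] at this
      linarith
    calc Real.sin ε * (6 + Real.sin ε ^ 2) ≤ Real.sin ε * (6 + ε ^ 2) :=
          mul_le_mul_of_nonneg_left (by linarith) hs
      _ ≤ (ε - ε ^ 3 / 6 + ε ^ 5 / 120) * (6 + ε ^ 2) := mul_le_mul_of_nonneg_right h3 (by positivity)
      _ = 6 * ε - ε ^ 5 * (7 / 60 - ε ^ 2 / 120) := by ring
      _ ≤ 6 * ε := by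
          have : 0 ≤ ε ^ 5 * (7 / 60 - ε ^ 2 / 120) := mul_nonneg (by positivity) (by linarith)
          linarith
  have e : 3 * Real.pi / 7 / N = 6 * ε / 7 := by rw [hε]; field_simp; ring
  rw [e]
  calc _ = Real.sin ε / 28 * (c * (27 + 3 * g - 4 * g * c ^ 2)) := by ring
    _ ≤ Real.sin ε / 28 * (27 - g) := mul_le_mul_of_nonneg_left h1 (by positivity)
    _ = Real.sin ε * (6 + Real.sin ε ^ 2) / 7 := by rw [hg]; ring
    _ ≤ _ := by linarith

theorem abs_kap_le_one {θ : ℝ} (h0 : 0 ≤ θ) (h1 : θ ≤ 1 / 28) {N : ℕ} (hN : 5 ≤ N) (u : ℝ) :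
    |kap θ N u| ≤ 1 := by
  rw [← sum_wt hN θ]
  refine (Finset.abs_sum_le_sum_abs _ _).trans (Finset.sum_le_sum fun k _ => ?_)
  rw [abs_mul, abs_of_nonneg (wt_nonneg h0 h1 hN k)]
  exact mul_le_of_le_one_right (wt_nonneg h0 h1 hN k) (Real.abs_cos_le_one _)

theorem abs_kap_sub_le {θ : ℝ} (h0 : 0 ≤ θ) (h1 : θ ≤ 1 / 28) {N : ℕ} (hN : 5 ≤ N) (u v : ℝ) :
    |kap θ N u - kap θ N v| ≤ Real.pi * |u - v| := by
  unfold kap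
  rw [← Finset.sum_sub_distrib]
  calc |∑ k, (wt θ N k * Real.cos (2 * u * node N k) - wt θ N k * Real.cos (2 * v * node N k))|
      ≤ ∑ k, wt θ N k * (Real.pi * |u - v|) := by
        refine (Finset.abs_sum_le_sum_abs _ _).trans (Finset.sum_le_sum fun k _ => ?_)
        rw [← mul_sub, abs_mul, abs_of_nonneg (wt_nonneg h0 h1 hN k)]
        refine mul_le_mul_of_nonneg_left ?_ (wt_nonneg h0 h1 hN k)
        refine (Real.abs_cos_sub_cos_le _ _).trans ?_
        rw [← sub_mul, ← mul_sub, abs_mul, abs_mul, abs_two]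
        nlinarith [abs_node_le k, abs_nonneg (u - v)]
    _ = Real.pi * |u - v| := by rw [← Finset.sum_mul, sum_wt hN, one_mul]

/-- The number 2Nψ_k is π times an integer of the parity of N - 1, so translation by N only changes
the sign; |kap| is N-periodic and depends on the points of the torus alone. -/
theorem kap_add_nat (θ : ℝ) {N : ℕ} (hN : 0 < N) (u : ℝ) :
    kap θ N (u + N) = (-1) ^ (N - 1) * kap θ N u := by
  have hN0 : (N : ℝ) ≠ 0 := by positivity
  unfold kap
  rw [Finset.mul_sum]
  refine Finset.sum_congr rfl fun k _ => ?_
  have e : 2 * (u + N) * node N k = 2 * u * node N k + ((((k : ℕ) : ℤ) * 2 - ((N - 1 : ℕ) : ℤ) : ℤ) : ℝ) * Real.pi := by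
    unfold node
    push_cast [Nat.cast_sub (show 1 ≤ N by omega)]
    field_simp
  rw [e, Real.cos_add_int_mul_pi, zpow_sub₀ (by norm_num), _root_.zpow_mul, zpow_natCast, zpow_natCast]
  have h1 : ((-1 : ℝ) ^ (k : ℕ)) ^ (2 : ℤ) = 1 := by
    rw [zpow_ofNat, ← pow_mul, mul_comm, pow_mul]; norm_num
  have h2 : (1 : ℝ) / (-1) ^ (N - 1) = (-1) ^ (N - 1) := by
    rcases neg_one_pow_eq_or ℝ (N - 1) with h | h <;> rw [h] <;> norm_num
  rw [h1, h2]
  ring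

theorem abs_kap_add_int_mul (θ : ℝ) {N : ℕ} (hN : 0 < N) (u : ℝ) (m : ℤ) :
    |kap θ N (u + m * N)| = |kap θ N u| := by
  have h : ∀ v, |kap θ N (v + N)| = |kap θ N v| := fun v => by
    rw [kap_add_nat θ hN, abs_mul, abs_pow, abs_neg, abs_one, one_pow, one_mul]
  induction m using Int.induction_on with
  | zero => simp
  | succ i ih =>
    rw [← ih, ← h (u + ((i : ℕ) : ℤ) * N)]; congr 2; push_cast; ring
  | pred i ih =>
    rw [← ih, ← h (u + ((-(i : ℕ) - 1 : ℤ) : ℝ) * N)]; congr 2; push_cast; ring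

theorem abs_ker_one_mul_le {N : ℕ} (hN : 5 ≤ N) {u : ℝ} (hu : |u| ≤ N / 2) :
    |ker 1 1 N u| * |4 * u ^ 2 - 1| ≤ |Real.cos (Real.pi * u)| := by
  have := abs_ker_mul_le (σ := 1) (m := 1) (N := N) (by omega) (by norm_num) one_pos
    sin_add_pi_half (eps_sq_le hN zero_le_one (by norm_num)) hu
  simpa using this

theorem abs_ker_three_mul_le {N : ℕ} (hN : 5 ≤ N) {u : ℝ} (hu : |u| ≤ N / 2) :
    |ker (-1) 3 N u| * |4 * u ^ 2 - 9| ≤ 9 * |Real.cos (Real.pi * u)| := by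
  have := abs_ker_mul_le (σ := -1) (m := 3) (N := N) (by omega) (by norm_num) (by norm_num)
    sin_add_three_pi_half (eps_sq_le hN (by norm_num) le_rfl) hu
  norm_num at this
  exact this

theorem abs_ker_one_le {N : ℕ} (hN : 5 ≤ N) {u : ℝ} (hu : |u| ≤ N / 2) (h1 : 1 < 4 * u ^ 2) :
    |ker 1 1 N u| ≤ 1 / (4 * u ^ 2 - 1) := by
  have h := (abs_ker_one_mul_le hN hu).trans (Real.abs_cos_le_one _)
  rw [abs_of_pos (by linarith : 0 < 4 * u ^ 2 - 1)] at h
  rwa [le_div_iff₀ (by linarith)]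

theorem abs_ker_three_le {N : ℕ} (hN : 5 ≤ N) {u : ℝ} (hu : |u| ≤ N / 2) (h1 : 9 < 4 * u ^ 2) :
    |ker (-1) 3 N u| ≤ 9 / (4 * u ^ 2 - 9) := by
  have h := (abs_ker_three_mul_le hN hu).trans
    (mul_le_mul_of_nonneg_left (Real.abs_cos_le_one _) (by norm_num))
  rw [abs_of_pos (by linarith : 0 < 4 * u ^ 2 - 9), mul_one] at h
  rwa [le_div_iff₀ (by linarith)]

theorem sin_sq_sub_sin_sq_pos {N : ℕ} (hN : 5 ≤ N) {u m : ℝ} (hu : u ≤ N / 2) (hm : 0 < m)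
    (h : m / 2 < u) :
    0 < Real.sin (Real.pi * u / N) ^ 2 - Real.sin (m * (Real.pi / (2 * N))) ^ 2 := by
  have hN0 : (0 : ℝ) < N := by exact_mod_cast (by omega : 0 < N)
  have hp := Real.pi_pos
  have h1 : Real.pi * u / N ≤ Real.pi / 2 := by
    rw [div_le_iff₀ hN0]; nlinarith
  have e : m * (Real.pi / (2 * N)) = Real.pi * (m / 2) / N := by field_simp
  rw [e]
  have h2 : Real.pi * (m / 2) / N < Real.pi * u / N := by gcongr
  have h3 : Real.sin (Real.pi * (m / 2) / N) < Real.sin (Real.pi * u / N) :=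
    Real.sin_lt_sin_of_lt_of_le_pi_div_two (by
      have : 0 ≤ Real.pi * (m / 2) / N := by positivity
      linarith) h1 h2
  have h4 : 0 ≤ Real.sin (Real.pi * (m / 2) / N) :=
    Real.sin_nonneg_of_nonneg_of_le_pi (by positivity) (by linarith)
  nlinarith

theorem sin_sq_sub_sin_sq_neg {N : ℕ} (hN : 5 ≤ N) {u m : ℝ} (hu : 0 ≤ u) (hm : m ≤ 3)
    (h : u < m / 2) :
    Real.sin (Real.pi * u / N) ^ 2 - Real.sin (m * (Real.pi / (2 * N))) ^ 2 < 0 := by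
  have hN0 : (0 : ℝ) < N := by exact_mod_cast (by omega : 0 < N)
  have hp := Real.pi_pos
  have h0 := eps_sq_le hN (by linarith : 0 ≤ m) hm
  have e : m * (Real.pi / (2 * N)) = Real.pi * (m / 2) / N := by field_simp
  rw [e] at h0 ⊢
  have h2 : Real.pi * u / N < Real.pi * (m / 2) / N := by gcongr
  have h5 : 0 ≤ Real.pi * u / N := by positivity
  have h3 : Real.sin (Real.pi * u / N) < Real.sin (Real.pi * (m / 2) / N) :=
    Real.sin_lt_sin_of_lt_of_le_pi_div_two (by linarith) (by nlinarith [Real.pi_gt_three]) h2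
  have h4 : 0 ≤ Real.sin (Real.pi * u / N) :=
    Real.sin_nonneg_of_nonneg_of_le_pi h5 (by nlinarith [Real.pi_gt_three])
  nlinarith

theorem cos_pi_mul_div_nonneg {N : ℕ} (hN : 5 ≤ N) {u : ℝ} (hu : |u| ≤ N / 2) :
    0 ≤ Real.cos (Real.pi * u / N) := by
  have hN0 : (0 : ℝ) < N := by exact_mod_cast (by omega : 0 < N)
  refine Real.cos_nonneg_of_mem_Icc (abs_le.1 ?_)
  rw [abs_div, abs_mul, abs_of_pos Real.pi_pos, Nat.abs_cast, div_le_iff₀ hN0]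
  nlinarith [Real.pi_pos]

theorem cos_pi_mul_nonpos {u : ℝ} (h0 : 1 / 2 ≤ u) (h1 : u ≤ 3 / 2) : Real.cos (Real.pi * u) ≤ 0 := by
  have hp := Real.pi_pos
  exact Real.cos_nonpos_of_pi_div_two_le_of_le (by nlinarith) (by nlinarith)

theorem abs_cos_pi_mul {u : ℝ} (h0 : 1 / 2 ≤ u) (h1 : u ≤ 3 / 2) :
    |Real.cos (Real.pi * u)| = Real.sin (Real.pi * (u - 1 / 2)) := by
  rw [abs_of_nonpos (cos_pi_mul_nonpos h0 h1), ← Real.cos_pi_div_two_sub, ← Real.cos_sub_pi,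
    ← Real.cos_neg]
  congr 1; ring

theorem ker_one_nonneg {N : ℕ} (hN : 5 ≤ N) {u : ℝ} (h0 : |u| ≤ 1 / 2) : 0 ≤ ker 1 1 N u := by
  rw [← kap_zero_left]
  refine Finset.sum_nonneg fun k _ => mul_nonneg (wt_nonneg le_rfl (by norm_num) hN k) ?_
  refine Real.cos_nonneg_of_mem_Icc (abs_le.1 ?_)
  rw [abs_mul, abs_mul, abs_two]
  nlinarith [abs_node_le k, abs_nonneg (node N k), abs_nonneg u]

theorem ker_one_nonneg' {N : ℕ} (hN : 5 ≤ N) {u : ℝ} (h0 : 1 / 2 < u) (h1 : u ≤ 3 / 2) :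
    0 ≤ ker 1 1 N u := by
  have hN' : (5 : ℝ) ≤ N := by exact_mod_cast hN
  have hu : |u| ≤ N / 2 := by rw [abs_of_nonneg (by linarith)]; linarith
  have h2 := ker_mul (N := N) (by omega) (by norm_num) sin_add_pi_half u
  have h3 := sin_sq_sub_sin_sq_pos hN (le_of_abs_le hu) one_pos h0
  have h4 := cos_pi_mul_nonpos h0.le h1
  have h5 := cos_pi_mul_div_nonneg hN hu
  have h6 : 0 ≤ -(Real.cos (Real.pi * u) * Real.cos (Real.pi * u / N) *
        Real.sin (1 * (Real.pi / (2 * N))) ^ 2) := by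
    have := mul_nonneg (mul_nonneg (neg_nonneg.2 h4) h5) (sq_nonneg (Real.sin (1 * (Real.pi / (2 * N)))))
    linarith
  rw [← h2] at h6
  exact nonneg_of_mul_nonneg_left h6 h3

/-- The kernel bounds come from quotients that degenerate at half-integers; continuity recovers
those points. -/
theorem le_of_forall_Ioc {f : ℝ → ℝ} (hf : Continuous f) {a b c : ℝ} (hab : a < b)
    (h : ∀ x, a < x → x ≤ b → f x ≤ c) : f a ≤ c := by
  have h1 : Tendsto f (𝓝[>] a) (𝓝 (f a)) := hf.continuousWithinAt
  refine le_of_tendsto h1 ?_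
  filter_upwards [Ioc_mem_nhdsGT hab] with x hx
  exact h x hx.1 hx.2

theorem continuous_ker (σ m : ℝ) (N : ℕ) : Continuous (ker σ m N) := by
  unfold ker; fun_prop

/-- With v = u - 1/2 one has 4u² - 1 = 4v(1 + v) and |cos πu| = sin πv. The cubic and the parabolic
majorant of sin πv both contain the factor v, which cancels. -/
theorem ker_one_le_mid {N : ℕ} (hN : 5 ≤ N) {u : ℝ} (h0 : 1 / 2 < u) (h1 : u ≤ 3 / 2) :
    ker 1 1 N u ≤ Real.pi / 4 * (3 / 2 - u) ∧ ker 1 1 N u ≤ (3 / 2 - u) / (1 / 2 + u) := by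
  have hN' : (5 : ℝ) ≤ N := by exact_mod_cast hN
  have hu : |u| ≤ N / 2 := by rw [abs_of_nonneg (by linarith)]; linarith
  have h2 := abs_ker_one_mul_le hN hu
  rw [abs_of_nonneg (ker_one_nonneg' hN h0 h1), abs_cos_pi_mul h0.le h1,
    abs_of_pos (by nlinarith : 0 < 4 * u ^ 2 - 1)] at h2
  set v := u - 1 / 2 with hv
  have hv0 : 0 < v := by linarith
  have hv1 : v ≤ 1 := by linarith
  have e : 4 * u ^ 2 - 1 = 4 * v * (1 + v) := by
    rw [show u = v + 1 / 2 by rw [hv]; ring]; ring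
  rw [e] at h2
  have h3 := sin_pi_mul_le_cubic hv0.le hv1
  have h4 := sin_pi_mul_le_parabola hv0.le hv1
  constructor
  · have h5 : ker 1 1 N u * (4 * v * (1 + v)) ≤ Real.pi / 4 * (3 / 2 - u) * (4 * v * (1 + v)) := by
      refine (h2.trans h3).trans (le_of_eq ?_)
      rw [show u = v + 1 / 2 by rw [hv]; ring]; ring
    exact le_of_mul_le_mul_right h5 (by positivity)
  · rw [le_div_iff₀ (by linarith)]
    have h5 : ker 1 1 N u * (1 / 2 + u) * (4 * v) ≤ (3 / 2 - u) * (4 * v) := by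
      calc _ = ker 1 1 N u * (4 * v * (1 + v)) := by rw [show u = v + 1 / 2 by rw [hv]; ring]; ring
        _ ≤ _ := h2.trans h4
        _ = _ := by rw [show u = v + 1 / 2 by rw [hv]; ring]; ring
    exact le_of_mul_le_mul_right h5 (by positivity)

theorem ker_one_le_mid' {N : ℕ} (hN : 5 ≤ N) {u : ℝ} (h0 : 1 / 2 ≤ u) (h1 : u ≤ 3 / 2) :
    0 ≤ ker 1 1 N u ∧ ker 1 1 N u ≤ Real.pi / 4 * (3 / 2 - u) := by
  rcases h0.eq_or_lt with rfl | h0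
  · refine ⟨ker_one_nonneg hN (by norm_num), ?_⟩
    have := le_of_forall_Ioc (f := fun u => ker 1 1 N u - Real.pi / 4 * (3 / 2 - u)) (c := 0)
      ((continuous_ker 1 1 N).sub (by fun_prop)) (by norm_num : (1 / 2 : ℝ) < 3 / 2)
      fun x hx hx1 => by linarith [(ker_one_le_mid hN hx hx1).1]
    linarith
  · exact ⟨ker_one_nonneg' hN h0 h1, (ker_one_le_mid hN h0 h1).1⟩

theorem ker_one_le_of_le_half {N : ℕ} (hN : 5 ≤ N) {u : ℝ} (h0 : |u| ≤ 1 / 2) :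
    ker 1 1 N u ≤ 1 - 0.8 * u ^ 2 := by
  wlog hu0 : 0 ≤ u generalizing u
  · have := this (u := -u) (by rwa [abs_neg]) (by linarith)
    rwa [ker_neg, neg_sq] at this
  rw [abs_of_nonneg hu0] at h0
  rcases h0.eq_or_lt with rfl | h0
  · have := (ker_one_le_mid' hN (le_refl (1 / 2)) (by norm_num)).2
    have := Real.pi_lt_d2
    norm_num at *; linarith
  · have hN' : (5 : ℝ) ≤ N := by exact_mod_cast hN
    have hu : |u| ≤ N / 2 := by rw [abs_of_nonneg hu0]; linarith
    have h2 := abs_ker_one_mul_le hN hu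
    have h3 := cos_pi_mul_le hu0 h0.le
    have h5 : 0 < 1 - 4 * u ^ 2 := by nlinarith
    rw [abs_of_neg (by linarith : 4 * u ^ 2 - 1 < 0), abs_of_nonneg (a := Real.cos _)
      (Real.cos_nonneg_of_mem_Icc ⟨by nlinarith [Real.pi_pos], by nlinarith [Real.pi_pos]⟩)] at h2
    have h4 := le_abs_self (ker 1 1 N u)
    refine h4.trans (le_of_mul_le_mul_right ?_ h5)
    linarith

/-- Between 1/2 and 3/2 both cos πu and the denominator of the closed form are nonpositive, so the
third harmonic is nonpositive there and lowers the mixed kernel. The second bound limits how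
negative it can become. -/
theorem ker_three_mid {N : ℕ} (hN : 5 ≤ N) {u : ℝ} (h0 : 1 / 2 ≤ u) (h1 : u < 3 / 2) :
    ker (-1) 3 N u ≤ Real.cos (Real.pi * u) * Real.cos (Real.pi * u / N) ∧
      -(9 * Real.pi / 4 * ((3 / 2 - u) / (9 / 4 - u ^ 2))) ≤ ker (-1) 3 N u := by
  have hN' : (5 : ℝ) ≤ N := by exact_mod_cast hN
  have hu : |u| ≤ N / 2 := by rw [abs_of_nonneg (by linarith)]; linarith
  have h2 := ker_mul (N := N) (by omega) (by norm_num) sin_add_three_pi_half u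
  have h3 := sin_sq_sub_sin_sq_neg hN (by linarith : 0 ≤ u) le_rfl h1
  have h4 := cos_pi_mul_nonpos h0 h1.le
  have h5 := cos_pi_mul_div_nonneg hN hu
  constructor
  · set S := Real.sin (Real.pi * u / N) ^ 2
    set E' := Real.sin (3 * (Real.pi / (2 * N))) ^ 2
    have hS : 0 ≤ S := sq_nonneg _
    have h6 : 0 ≤ -(Real.cos (Real.pi * u)) * Real.cos (Real.pi * u / N) :=
      mul_nonneg (neg_nonneg.2 h4) h5
    have h7 : (Real.cos (Real.pi * u) * Real.cos (Real.pi * u / N)) * (S - E') ≤ ker (-1) 3 N u * (S - E') := by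
      rw [h2]
      nlinarith
    exact (mul_le_mul_right_of_neg h3).1 h7
  · have h6 := abs_ker_three_mul_le hN hu
    have h8 : Real.sin (Real.pi * (u - 1 / 2)) ≤ Real.pi * (3 / 2 - u) := by
      rw [← Real.sin_pi_sub]
      refine (Real.sin_le ?_).trans (le_of_eq (by ring))
      nlinarith [Real.pi_pos]
    have h7 : 0 < 9 / 4 - u ^ 2 := by nlinarith
    rw [abs_cos_pi_mul h0 h1.le, abs_of_neg (by linarith : 4 * u ^ 2 - 9 < 0)] at h6
    have h9 : |ker (-1) 3 N u| ≤ 9 * Real.pi / 4 * ((3 / 2 - u) / (9 / 4 - u ^ 2)) := by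
      rw [← mul_div_assoc, le_div_iff₀ h7]
      linarith
    exact (abs_le.1 h9).1

/-- Bounds for the kernel of the improved window. -/
theorem abs_kap_le_far {N : ℕ} (hN : 5 ≤ N) {u : ℝ} (hu : |u| ≤ N / 2) (h2 : 2 ≤ |u|) :
    |kap (1 / 28) N u| ≤ 1 / (3 * (u ^ 2 - 1)) := by
  have hu2 : 4 ≤ u ^ 2 := by rw [← sq_abs]; nlinarith
  have h3 := abs_ker_one_le hN hu (by linarith)
  have h4 := abs_ker_three_le hN hu (by linarith)
  rw [kap_eq]
  have h5 : |(1 - 1 / 28) * ker 1 1 N u + 1 / 28 * ker (-1) 3 N u| ≤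
      27 / 28 * (1 / (4 * u ^ 2 - 1)) + 1 / 28 * (9 / (4 * u ^ 2 - 9)) := by
    refine (abs_add_le _ _).trans ?_
    rw [abs_mul, abs_mul, abs_of_pos (by norm_num : (0 : ℝ) < 1 - 1 / 28),
      abs_of_pos (by norm_num : (0 : ℝ) < 1 / 28)]
    linarith
  refine h5.trans ?_
  set y := u ^ 2
  rw [show 27 / 28 * (1 / (4 * y - 1)) + 1 / 28 * (9 / (4 * y - 9)) =
    (144 * y - 252) / (28 * ((4 * y - 1) * (4 * y - 9))) by
      have : 4 * y - 1 ≠ 0 := by linarith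
      have : 4 * y - 9 ≠ 0 := by linarith
      field_simp; ring]
  rw [div_le_div_iff₀ (by
    have : 0 < (4 * y - 1) * (4 * y - 9) := mul_pos (by linarith) (by linarith)
    linarith) (by linarith)]
  nlinarith

theorem abs_kap_le_Ioc {N : ℕ} (hN : 5 ≤ N) {u : ℝ} (h0 : 3 / 2 < u) (h1 : u ≤ 2) :
    |kap (1 / 28) N u| ≤ 0.135 := by
  have hN' : (5 : ℝ) ≤ N := by exact_mod_cast hN
  have hu : |u| ≤ N / 2 := by rw [abs_of_nonneg (by linarith)]; linarith
  have h3 := abs_ker_one_mul_le hN hu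
  have h4 := abs_ker_three_mul_le hN hu
  set t := u - 3 / 2 with ht
  have hu' : u = t + 3 / 2 := by rw [ht]; ring
  have ht0 : 0 < t := by linarith
  have ht1 : t ≤ 1 / 2 := by linarith
  have hc : |Real.cos (Real.pi * u)| = Real.sin (Real.pi * t) := by
    have e : Real.cos (Real.pi * u) = Real.sin (Real.pi * t) := by
      rw [hu', ← Real.cos_pi_div_two_sub, ← Real.cos_neg (Real.pi / 2 - _),
        ← Real.cos_add_two_pi (-(Real.pi / 2 - _))]
      congr 1; ring
    rw [e, abs_of_nonneg]
    exact Real.sin_nonneg_of_nonneg_of_le_pi (by positivity) (by nlinarith [Real.pi_pos])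
  have e1 : 4 * u ^ 2 - 1 = 4 * ((1 + t) * (2 + t)) := by rw [hu']; ring
  have e2 : 4 * u ^ 2 - 9 = 4 * (t * (3 + t)) := by rw [hu']; ring
  rw [hc, e1, abs_of_pos (a := 4 * ((1 + t) * (2 + t))) (by positivity)] at h3
  rw [hc, e2, abs_of_pos (a := 4 * (t * (3 + t))) (by positivity)] at h4
  set s := Real.sin (Real.pi * t) with hs
  have hs1 : s ≤ t * (3.1416 - 4.529 * t ^ 2) := by
    have hp := Real.pi_lt_d4
    have hp1 := Real.pi_gt_d4
    have h5 := sin_le_quintic (mul_nonneg Real.pi_pos.le ht0.le)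
    have e : Real.pi * t - (Real.pi * t) ^ 3 / 6 + (Real.pi * t) ^ 5 / 120 =
        t * (Real.pi - Real.pi ^ 3 / 6 * t ^ 2 + Real.pi ^ 5 / 120 * t ^ 4) := by ring
    rw [e] at h5
    refine h5.trans (mul_le_mul_of_nonneg_left ?_ ht0.le)
    have h6 : 31.003 ≤ Real.pi ^ 3 := by
      calc (31.003 : ℝ) ≤ 3.1415 ^ 3 := by norm_num
        _ ≤ _ := pow_le_pow_left₀ (by norm_num) hp1.le 3
    have h7 : Real.pi ^ 5 ≤ 306.024 := by
      calc _ ≤ (3.1416 : ℝ) ^ 5 := pow_le_pow_left₀ Real.pi_pos.le hp.le 5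
        _ ≤ _ := by norm_num
    have h8 : t ^ 2 ≤ 1 / 4 := by nlinarith
    have h9 : t ^ 4 ≤ 1 / 4 * t ^ 2 := by nlinarith [sq_nonneg t]
    have h10 : Real.pi ^ 5 / 120 * t ^ 4 ≤ 306.024 / 120 * (1 / 4 * t ^ 2) :=
      mul_le_mul (by linarith) h9 (by positivity) (by norm_num)
    have h11 : 31.003 / 6 * t ^ 2 ≤ Real.pi ^ 3 / 6 * t ^ 2 :=
      mul_le_mul_of_nonneg_right (by linarith) (sq_nonneg t)
    linarith [sq_nonneg t]
  rw [kap_eq]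
  refine (abs_add_le _ _).trans ?_
  rw [abs_mul, abs_mul, abs_of_pos (by norm_num : (0 : ℝ) < 1 - 1 / 28),
      abs_of_pos (by norm_num : (0 : ℝ) < 1 / 28)]
  have hD : 0 < (1 + t) * (2 + t) * (3 + t) := by positivity
  have h5 : |ker 1 1 N u| * (4 * ((1 + t) * (2 + t) * (3 + t))) ≤
      (t * (3.1416 - 4.529 * t ^ 2)) * (3 + t) := by
    nlinarith
  have h6 : |ker (-1) 3 N u| * (4 * ((1 + t) * (2 + t) * (3 + t))) ≤
      9 * (3.1416 - 4.529 * t ^ 2) * ((1 + t) * (2 + t)) := by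
    have h7 : |ker (-1) 3 N u| * (4 * (3 + t)) ≤ 9 * (3.1416 - 4.529 * t ^ 2) := by
      refine le_of_mul_le_mul_left ?_ ht0
      nlinarith
    have := mul_le_mul_of_nonneg_right h7 (by positivity : 0 ≤ (1 + t) * (2 + t))
    linarith
  refine le_of_mul_le_mul_right ?_ (by positivity : 0 < 112 * ((1 + t) * (2 + t) * (3 + t)))
  -- Here 15.12 = 112 · 0.135. The two sides are closest near t = 0.287, which explains the squares
  -- offered to `nlinarith`.
  have h7 : (3.1416 - 4.529 * t ^ 2) * (36 * t ^ 2 + 108 * t + 18) ≤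
      15.12 * ((1 + t) * (2 + t) * (3 + t)) := by
    nlinarith [mul_nonneg (sq_nonneg (t - 0.287)) (by linarith : 0 ≤ t + 0.574),
      sq_nonneg (t - 0.287), sq_nonneg (t ^ 2 - 0.0824)]
  calc _ = 27 * (|ker 1 1 N u| * (4 * ((1 + t) * (2 + t) * (3 + t)))) +
        |ker (-1) 3 N u| * (4 * ((1 + t) * (2 + t) * (3 + t))) := by ring
    _ ≤ 27 * ((t * (3.1416 - 4.529 * t ^ 2)) * (3 + t)) +
        9 * (3.1416 - 4.529 * t ^ 2) * ((1 + t) * (2 + t)) := by linarith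
    _ = (3.1416 - 4.529 * t ^ 2) * (36 * t ^ 2 + 108 * t + 18) := by ring
    _ ≤ _ := by linarith

theorem kap_mid {N : ℕ} (hN : 5 ≤ N) {u : ℝ} (h0 : 1 / 2 ≤ u) (h1 : u < 3 / 2) :
    kap (1 / 28) N u ≤ 27 / 28 * ker 1 1 N u + 1 / 28 *
        (Real.cos (Real.pi * u) * Real.cos (Real.pi * u / N)) ∧
      -(9 * Real.pi / 112 / (u + 3 / 2)) ≤ kap (1 / 28) N u := by
  have h2 := ker_three_mid hN h0 h1
  have h3 := ker_one_le_mid' hN h0 h1.le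
  rw [kap_eq]
  refine ⟨by linarith [h2.1], ?_⟩
  have h4 : (3 / 2 - u) / (9 / 4 - u ^ 2) = 1 / (u + 3 / 2) := by
    have : 3 / 2 - u ≠ 0 := by linarith
    have : 3 / 2 + u ≠ 0 := by linarith
    rw [show 9 / 4 - u ^ 2 = (3 / 2 - u) * (u + 3 / 2) by ring, div_mul_eq_div_div, div_self (by linarith)]
  rw [h4] at h2
  have h5 : 9 * Real.pi / 112 / (u + 3 / 2) = 1 / 28 * (9 * Real.pi / 4 * (1 / (u + 3 / 2))) := by
    field_simp; ring
  rw [h5]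
  linarith [h2.2, h3.1]

/-- The slope 0.7575 exceeds (27/28)(π/4); the third harmonic can be dropped from above. The
available lower bound for the kernel does not tend to 0 at u = 3/2, hence the restriction to u ≤
1.31. -/
theorem abs_kap_le_mid {N : ℕ} (hN : 5 ≤ N) {u : ℝ} (h0 : 1 / 2 ≤ u) (h1 : u ≤ 1.31) :
    |kap (1 / 28) N u| ≤ 0.7575 * (3 / 2 - u) := by
  have hN' : (5 : ℝ) ≤ N := by exact_mod_cast hN
  have h2 := kap_mid hN h0 (by linarith)
  have h3 := ker_one_le_mid' hN h0 (by linarith)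
  have hp := Real.pi_lt_d4
  have hc := cos_pi_mul_nonpos h0 (by linarith)
  have hc2 := cos_pi_mul_div_nonneg hN (u := u) (by rw [abs_of_nonneg (by linarith)]; linarith)
  rw [abs_le]
  constructor
  · refine le_trans (neg_le_neg ?_) h2.2
    rw [div_le_iff₀ (by linarith)]
    nlinarith
  · nlinarith [mul_nonneg (neg_nonneg.2 hc) hc2]

theorem abs_kap_le_const {N : ℕ} (hN : 5 ≤ N) {u : ℝ} (hu : |u| ≤ N / 2) (h0 : 1.3 ≤ |u|) :
    |kap (1 / 28) N u| ≤ 0.135 := by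
  rw [← kap_abs]
  set x := |u|
  rcases le_or_gt 2 x with h2 | h2
  · have hx : |x| = x := abs_of_nonneg (by linarith)
    refine (abs_kap_le_far hN (u := x) (by rwa [hx]) (by rwa [hx])).trans ?_
    rw [div_le_iff₀ (by nlinarith)]
    nlinarith
  rcases lt_or_ge (3 / 2) x with h3 | h3
  · exact abs_kap_le_Ioc hN h3 h2.le
  rcases h3.eq_or_lt with h3 | h3
  · rw [h3]
    exact le_of_forall_Ioc (continuous_abs.comp (continuous_kap (1 / 28) N)) (by norm_num)
      fun x hx hx1 => abs_kap_le_Ioc hN hx hx1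
  · have h4 := kap_mid hN (by linarith) h3
    have h5 := (ker_one_le_mid hN (by linarith) h3.le).2
    have hp := Real.pi_lt_d4
    have hc := cos_pi_mul_nonpos (by linarith : 1 / 2 ≤ x) h3.le
    have hc2 := cos_pi_mul_div_nonneg hN (u := x) (by rwa [abs_of_nonneg (by linarith)])
    have h6 : (3 / 2 - x) / (1 / 2 + x) ≤ 1 / 9 := by
      rw [div_le_iff₀ (by linarith)]; linarith
    rw [abs_le]
    constructor
    · refine le_trans (neg_le_neg ?_) h4.2
      rw [div_le_iff₀ (by linarith)]
      linarith
    · nlinarith [mul_nonneg (neg_nonneg.2 hc) hc2]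

/-! ### Weighted Gram matrices and the distance to the span -/

/-- The centred exponential vector at the point with coordinates `v i / N`. -/
noncomputable def Evec {d N : ℕ} (v : Fin d → ℝ) (k : Fin d → Fin N) : ℂ :=
  ∏ i, Complex.exp (-(((2 * v i * node N (k i) : ℝ) : ℂ) * Complex.I))

theorem norm_Evec {d N : ℕ} (v : Fin d → ℝ) (k : Fin d → Fin N) : ‖Evec v k‖ = 1 := by
  unfold Evec
  rw [norm_prod]
  refine Finset.prod_eq_one fun i _ => ?_
  rw [← neg_mul, ← Complex.ofReal_neg, Complex.norm_exp_ofReal_mul_I]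

theorem conj_Evec_mul {d N : ℕ} (v v' : Fin d → ℝ) (k : Fin d → Fin N) :
    (starRingEnd ℂ) (Evec v' k) * Evec v k =
      ∏ i, Complex.exp (-(((2 * (v i - v' i) * node N (k i) : ℝ) : ℂ) * Complex.I)) := by
  unfold Evec
  rw [map_prod, ← Finset.prod_mul_distrib]
  refine Finset.prod_congr rfl fun i _ => ?_
  rw [← Complex.exp_conj, ← Complex.exp_add]
  congr 1
  rw [map_neg, map_mul, Complex.conj_I, Complex.conj_ofReal]
  push_cast
  ring

/-- Centring the frequencies multiplies the whole vector by a unimodular constant independent of k.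
Spans and norms do not change, and the kernels of symmetric windows become real. -/
theorem exists_phase {d n : ℕ} {x : UnitAddTorus (Fin d)} {v : Fin d → ℝ}
    (hv : ∀ i, ((v i / ((n : ℝ) + 1) : ℝ) : UnitAddCircle) = x i) :
    ∃ z : ℂ, ‖z‖ = 1 ∧ ∀ k : Fin d → Fin (n + 1), expVec n x k = z * Evec v k := by
  refine ⟨∏ i, Complex.exp (((-(Real.pi * v i * n / (n + 1)) : ℝ) : ℂ) * Complex.I), ?_, fun k => ?_⟩
  · rw [norm_prod]
    exact Finset.prod_eq_one fun i _ => Complex.norm_exp_ofReal_mul_I _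
  · rw [expVec_eq_prod hv]
    unfold Evec
    rw [← Finset.prod_mul_distrib]
    refine Finset.prod_congr rfl fun i _ => ?_
    unfold ech
    rw [← Complex.exp_add]
    congr 1
    have hn : (n : ℂ) + 1 ≠ 0 := by exact_mod_cast Nat.succ_ne_zero n
    unfold node
    push_cast
    field_simp
    ring

/-- A weight on `{0, …, N-1}` that is symmetric under reversal. -/
def IsSymm {N : ℕ} (w : Fin N → ℝ) : Prop := ∀ k, w k.rev = w k

/-- The kernel of a weight. -/
noncomputable def kr {N : ℕ} (w : Fin N → ℝ) (u : ℝ) : ℝ := ∑ k, w k * Real.cos (2 * u * node N k)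

theorem node_rev {N : ℕ} (k : Fin N) : node N k.rev = -node N k := by
  have h : ((k.rev : ℕ) : ℝ) = N - ((k : ℕ) + 1) := by
    rw [Fin.val_rev, Nat.cast_sub (by have := k.2; omega)]; push_cast; ring
  unfold node
  rw [h]; ring

theorem isSymm_wt (θ : ℝ) (N : ℕ) : IsSymm (wt θ N) := fun k => by
  unfold wt
  simp only [node_rev, mul_neg, Real.cos_neg]

theorem kr_neg {N : ℕ} (w : Fin N → ℝ) (u : ℝ) : kr w (-u) = kr w u := by
  unfold kr
  refine Finset.sum_congr rfl fun k _ => ?_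
  rw [← Real.cos_neg (2 * u * node N k)]
  congr 2; ring

theorem sum_exp_eq_kr {N : ℕ} {w : Fin N → ℝ} (hw : IsSymm w) (u : ℝ) :
    ∑ k, (w k : ℂ) * Complex.exp (-(((2 * u * node N k : ℝ) : ℂ) * Complex.I)) = (kr w u : ℂ) := by
  have h1 : ∑ k, (w k : ℂ) * Complex.exp (-(((2 * u * node N k : ℝ) : ℂ) * Complex.I)) =
      ∑ k, (w k : ℂ) * Complex.exp (((2 * u * node N k : ℝ) : ℂ) * Complex.I) := by
    rw [← Equiv.sum_comp Fin.revPerm]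
    refine Finset.sum_congr rfl fun k _ => ?_
    rw [Fin.revPerm_apply, hw, node_rev]
    congr 2; push_cast; ring
  have h2 : (2 : ℂ) * ∑ k, (w k : ℂ) * Complex.exp (-(((2 * u * node N k : ℝ) : ℂ) * Complex.I)) =
      2 * (kr w u : ℂ) := by
    rw [two_mul]
    nth_rewrite 2 [h1]
    rw [← Finset.sum_add_distrib]
    unfold kr
    push_cast
    rw [Finset.mul_sum]
    refine Finset.sum_congr rfl fun k _ => ?_
    have := Complex.two_cos ((2 * u * node N k : ℝ) : ℂ)
    push_cast at this ⊢
    rw [mul_left_comm, this]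
    rw [neg_mul]; ring
  exact mul_left_cancel₀ two_ne_zero h2

theorem gram_eq {d N : ℕ} {w : Fin N → ℝ} (hw : IsSymm w) (v v' : Fin d → ℝ) :
    ∑ k : Fin d → Fin N, ((∏ i, w (k i) : ℝ) : ℂ) * ((starRingEnd ℂ) (Evec v' k) * Evec v k) =
      ((∏ i, kr w (v i - v' i) : ℝ) : ℂ) := by
  classical
  push_cast
  simp only [← sum_exp_eq_kr hw]
  rw [Finset.prod_univ_sum, Fintype.piFinset_univ]
  refine Finset.sum_congr rfl fun k _ => ?_
  rw [conj_Evec_mul, ← Finset.prod_mul_distrib]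

/-- Because the Gram matrix is real, the real and the imaginary parts of the coefficients decouple.
Once the matrix is known to be positive, the imaginary part can be discarded. -/
theorem sum_weight_norm_sq {ι κ : Type*} [Fintype ι] [Fintype κ] (W : κ → ℝ) (A : ι → κ → ℂ)
    (G : ι → ι → ℝ) (hG : ∀ a b, ∑ k, (W k : ℂ) * ((starRingEnd ℂ) (A a k) * A b k) = (G a b : ℂ))
    (c : ι → ℂ) :
    ∑ k, W k * ‖∑ a, c a * A a k‖ ^ 2 =
      (∑ a, ∑ b, (c a).re * (c b).re * G a b) + ∑ a, ∑ b, (c a).im * (c b).im * G a b := by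
  have h : ((∑ k, W k * ‖∑ a, c a * A a k‖ ^ 2 : ℝ) : ℂ) =
      ∑ a, ∑ b, (starRingEnd ℂ) (c a) * c b * (G a b : ℂ) := by
    simp only [← hG]
    push_cast
    have : ∀ k, (W k : ℂ) * (‖∑ a, c a * A a k‖ : ℂ) ^ 2 =
        ∑ a, ∑ b, (starRingEnd ℂ) (c a) * c b * ((W k : ℂ) * ((starRingEnd ℂ) (A a k) * A b k)) := by
      intro k
      rw [← Complex.conj_mul', map_sum, Finset.sum_mul_sum, Finset.mul_sum]
      refine Finset.sum_congr rfl fun a _ => ?_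
      rw [Finset.mul_sum]
      refine Finset.sum_congr rfl fun b _ => ?_
      rw [map_mul]; ring
    simp only [this, Finset.mul_sum]
    rw [Finset.sum_comm]
    refine Finset.sum_congr rfl fun a _ => ?_
    rw [Finset.sum_comm]
  have h2 := congrArg Complex.re h
  rw [Complex.ofReal_re] at h2
  rw [h2, Complex.re_sum, ← Finset.sum_add_distrib]
  refine Finset.sum_congr rfl fun a _ => ?_
  rw [Complex.re_sum, ← Finset.sum_add_distrib]
  refine Finset.sum_congr rfl fun b _ => ?_
  rw [Complex.re_mul_ofReal]
  simp only [Complex.mul_re, Complex.conj_re, Complex.conj_im]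
  ring

theorem sum_option_quadratic {r : ℕ} (K : Fin r → ℝ) (M : Fin r → Fin r → ℝ) (t : ℝ) (b : Fin r → ℝ) :
    ∑ a : Option (Fin r), ∑ a' : Option (Fin r),
      (a.elim t fun l => -b l) * (a'.elim t fun l => -b l) *
        (a.elim (a'.elim 1 K) fun l => a'.elim (K l) (M l)) =
      t ^ 2 - 2 * t * ∑ l, b l * K l + ∑ l, ∑ m, b l * b m * M l m := by
  simp only [Fintype.sum_option, Option.elim]
  rw [Finset.sum_add_distrib]
  have h1 : ∑ l, t * -b l * K l = -(t * ∑ l, b l * K l) := by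
    rw [Finset.mul_sum, ← Finset.sum_neg_distrib]
    exact Finset.sum_congr rfl fun l _ => by ring
  have h2 : ∑ l, -b l * t * K l = -(t * ∑ l, b l * K l) := by
    rw [Finset.mul_sum, ← Finset.sum_neg_distrib]
    exact Finset.sum_congr rfl fun l _ => by ring
  have h3 : ∑ l, ∑ m, -b l * -b m * M l m = ∑ l, ∑ m, b l * b m * M l m :=
    Finset.sum_congr rfl fun l _ => Finset.sum_congr rfl fun m _ => by ring
  rw [h1, h2, h3]
  ring

/-- The normalised squared distance of `Evec X` to the span, in terms of a weight. -/
theorem quadratic_le {d r N : ℕ} (hN : 0 < N) {w : Fin N → ℝ} (hw : IsSymm w) (hw0 : ∀ k, 0 ≤ w k)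
    {ω : ℝ} (hω : ∀ k, w k ≤ ω / N) (h1 : kr w 0 = 1) (X : Fin d → ℝ) (Ξ : Fin r → Fin d → ℝ)
    (c : Fin r → ℂ) :
    (1 - 2 * ∑ l, (c l).re * ∏ i, kr w (X i - Ξ l i) +
        ∑ l, ∑ m, (c l).re * (c m).re * ∏ i, kr w (Ξ l i - Ξ m i)) +
      ∑ l, ∑ m, (c l).im * (c m).im * ∏ i, kr w (Ξ l i - Ξ m i) ≤
    ω ^ d * (1 / (N : ℝ) ^ d * ∑ k : Fin d → Fin N, ‖Evec X k - ∑ l, c l * Evec (Ξ l) k‖ ^ 2) := by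
  have hN0 : (0 : ℝ) < N := by exact_mod_cast hN
  -- The index `none` stands for the point x with coefficient 1, and `some l` for the l-th node with
  -- coefficient -c_l.
  let A : Option (Fin r) → (Fin d → Fin N) → ℂ := fun a => a.elim (Evec X) fun l => Evec (Ξ l)
  let cc : Option (Fin r) → ℂ := fun a => a.elim 1 fun l => -c l
  let G : Option (Fin r) → Option (Fin r) → ℝ := fun a a' =>
    a.elim (a'.elim 1 fun l => ∏ i, kr w (X i - Ξ l i)) fun l =>
      a'.elim (∏ i, kr w (X i - Ξ l i)) fun m => ∏ i, kr w (Ξ l i - Ξ m i)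
  have hG : ∀ a b, ∑ k, ((∏ i, w (k i) : ℝ) : ℂ) * ((starRingEnd ℂ) (A a k) * A b k) = (G a b : ℂ) := by
    intro a b
    cases a with
    | none =>
      cases b with
      | none => simp only [A, G, Option.elim]; rw [gram_eq hw]; simp [h1]
      | some l =>
        simp only [A, G, Option.elim]; rw [gram_eq hw]; congr 1
        exact Finset.prod_congr rfl fun i _ => by rw [← kr_neg]; congr 1; ring
    | some l =>
      cases b with
      | none => simp only [A, G, Option.elim]; rw [gram_eq hw]
      | some m =>
        simp only [A, G, Option.elim]; rw [gram_eq hw]; congr 1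
        exact Finset.prod_congr rfl fun i _ => by rw [← kr_neg]; congr 1; ring
  have h2 := sum_weight_norm_sq (fun k : Fin d → Fin N => ∏ i, w (k i)) A G hG cc
  have e1 : ∀ a, (cc a).re = a.elim 1 fun l => -(c l).re := by
    intro a; cases a <;> simp [cc]
  have e2 : ∀ a, (cc a).im = a.elim 0 fun l => -(c l).im := by
    intro a; cases a <;> simp [cc]
  simp only [e1, e2, G] at h2
  rw [sum_option_quadratic, sum_option_quadratic] at h2
  have h3 : ∀ k, ∑ a, cc a * A a k = Evec X k - ∑ l, c l * Evec (Ξ l) k := by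
    intro k
    rw [Fintype.sum_option]
    simp only [cc, A, Option.elim, one_mul, neg_mul, Finset.sum_neg_distrib]
    ring
  simp only [h3] at h2
  have h4 : ∑ k : Fin d → Fin N, (∏ i, w (k i)) * ‖Evec X k - ∑ l, c l * Evec (Ξ l) k‖ ^ 2 ≤
      ω ^ d * (1 / (N : ℝ) ^ d * ∑ k : Fin d → Fin N, ‖Evec X k - ∑ l, c l * Evec (Ξ l) k‖ ^ 2) := by
    rw [← mul_assoc, Finset.mul_sum]
    refine Finset.sum_le_sum fun k _ => mul_le_mul_of_nonneg_right ?_ (by positivity)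
    calc ∏ i, w (k i) ≤ ∏ _i : Fin d, ω / N := Finset.prod_le_prod (fun i _ => hw0 _) fun i _ => hω _
      _ = ω ^ d * (1 / (N : ℝ) ^ d) := by
        rw [Finset.prod_const, Finset.card_univ, Fintype.card_fin, div_pow]; ring
  rw [h2] at h4
  refine le_trans (le_of_eq ?_) h4
  ring

/-- The quadratic form, minimised. -/
theorem sub_le_quadratic {r : ℕ} {K : Fin r → ℝ} {M : Fin r → Fin r → ℝ} {lam : ℝ} (hl : 0 < lam)
    (hM : ∀ l m, M l m = M m l) (hpos : ∀ b : Fin r → ℝ, lam * ∑ l, b l ^ 2 ≤ ∑ l, ∑ m, b l * b m * M l m)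
    {l₀ : Fin r} (h1 : M l₀ l₀ = 1) (b : Fin r → ℝ) :
    1 - K l₀ ^ 2 - (∑ l, (K l - K l₀ * M l₀ l) ^ 2) / lam ≤
      1 - 2 * ∑ l, b l * K l + ∑ l, ∑ m, b l * b m * M l m := by
  classical
  set t := K l₀
  -- The form is expanded around the trial coefficients t = K l₀ at the nearest node and 0
  -- elsewhere. The residual K_l - t M_{l₀ l} then vanishes at l₀, and completing the square with
  -- lam bounds the remaining minimum.
  let b' : Fin r → ℝ := fun l => b l - if l = l₀ then t else 0
  have hb : ∀ l, b l = b' l + if l = l₀ then t else 0 := fun l => by simp [b']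
  have e1 : ∑ l, b l * K l = t * t + ∑ l, b' l * K l := by
    simp only [hb, add_mul, Finset.sum_add_distrib, ite_mul, zero_mul, Finset.sum_ite_eq',
      Finset.mem_univ, if_true]
    ring
  have e2 : ∑ l, ∑ m, b l * b m * M l m =
      t ^ 2 + 2 * t * ∑ l, b' l * M l₀ l + ∑ l, ∑ m, b' l * b' m * M l m := by
    have h : ∀ l, ∑ m, b l * b m * M l m = b l * (∑ m, b' m * M l m + t * M l l₀) := by
      intro l
      rw [mul_add, Finset.mul_sum]
      simp only [hb, mul_add, add_mul, Finset.sum_add_distrib, mul_ite, ite_mul, zero_mul, mul_zero,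
        Finset.sum_ite_eq', Finset.mem_univ, if_true, mul_assoc]
    simp only [h]
    have h' : ∀ l, b l * (∑ m, b' m * M l m + t * M l l₀) = b' l * (∑ m, b' m * M l m) + t * (b' l * M l₀ l) +
        if l = l₀ then t * (∑ m, b' m * M l m + t * M l l₀) else 0 := by
      intro l
      rw [hb l, hM l l₀]
      split_ifs <;> ring
    simp only [h', Finset.sum_add_distrib, Finset.sum_ite_eq', Finset.mem_univ, if_true, h1,
      ← Finset.mul_sum]
    have h'' : ∀ l, b' l * ∑ m, b' m * M l m = ∑ m, b' l * b' m * M l m := fun l => by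
      rw [Finset.mul_sum]; exact Finset.sum_congr rfl fun m _ => by ring
    simp only [h'']
    ring
  rw [e1, e2]
  have h2 := hpos b'
  have h3 : -((∑ l, (K l - t * M l₀ l) ^ 2) / lam) ≤
      lam * ∑ l, b' l ^ 2 - 2 * ∑ l, b' l * (K l - t * M l₀ l) := by
    rw [Finset.sum_div, ← Finset.sum_neg_distrib, Finset.mul_sum, Finset.mul_sum,
      ← Finset.sum_sub_distrib]
    refine Finset.sum_le_sum fun l _ => ?_
    set η := K l - t * M l₀ l
    have : 0 ≤ (lam * b' l - η) ^ 2 / lam := by positivity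
    have e : (lam * b' l - η) ^ 2 / lam = lam * b' l ^ 2 - 2 * (b' l * η) + η ^ 2 / lam := by
      field_simp; ring
    linarith
  have h4 : ∑ l, b' l * (K l - t * M l₀ l) = ∑ l, b' l * K l - t * ∑ l, b' l * M l₀ l := by
    rw [Finset.mul_sum, ← Finset.sum_sub_distrib]
    exact Finset.sum_congr rfl fun l _ => by ring
  rw [h4] at h3
  linarith

/-- A Gershgorin bound for real symmetric matrices with unit diagonal. -/
theorem le_quadratic_of_row_sum {r : ℕ} {M : Fin r → Fin r → ℝ} {lam : ℝ} (hM : ∀ l m, M l m = M m l)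
    (h1 : ∀ l, M l l = 1) (hrow : ∀ l, ∑ m ∈ Finset.univ.erase l, |M l m| ≤ 1 - lam) (b : Fin r → ℝ) :
    lam * ∑ l, b l ^ 2 ≤ ∑ l, ∑ m, b l * b m * M l m := by
  classical
  have h2 : ∀ l, ∑ m, b l * b m * M l m = b l ^ 2 + ∑ m ∈ Finset.univ.erase l, b l * b m * M l m := by
    intro l
    rw [← Finset.add_sum_erase _ _ (Finset.mem_univ l), h1]; ring
  have h3 : ∀ l, -(∑ m ∈ Finset.univ.erase l, (b l ^ 2 + b m ^ 2) / 2 * |M l m|) ≤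
      ∑ m ∈ Finset.univ.erase l, b l * b m * M l m := by
    intro l
    rw [← Finset.sum_neg_distrib]
    refine Finset.sum_le_sum fun m _ => ?_
    have h4 : |b l * b m * M l m| ≤ (b l ^ 2 + b m ^ 2) / 2 * |M l m| := by
      rw [abs_mul]
      refine mul_le_mul_of_nonneg_right ?_ (abs_nonneg _)
      rw [abs_le]; constructor <;> nlinarith [sq_nonneg (b l - b m), sq_nonneg (b l + b m)]
    exact (abs_le.1 h4).1
  have h5 : ∑ l, ∑ m ∈ Finset.univ.erase l, (b l ^ 2 + b m ^ 2) / 2 * |M l m| =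
      ∑ l, b l ^ 2 * ∑ m ∈ Finset.univ.erase l, |M l m| := by
    have e : ∀ l m, (b l ^ 2 + b m ^ 2) / 2 * |M l m| = b l ^ 2 / 2 * |M l m| + b m ^ 2 / 2 * |M m l| := by
      intro l m; rw [hM m l]; ring
    simp only [e, Finset.sum_add_distrib]
    have hs : ∑ l, ∑ m ∈ Finset.univ.erase l, b m ^ 2 / 2 * |M m l| =
        ∑ l, ∑ m ∈ Finset.univ.erase l, b l ^ 2 / 2 * |M l m| := by
      rw [Finset.sum_comm' (t' := Finset.univ) (s' := fun m => Finset.univ.erase m)]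
      intro l m; simp [eq_comm]
    rw [hs, ← Finset.sum_add_distrib]
    refine Finset.sum_congr rfl fun l _ => ?_
    rw [← Finset.mul_sum]; ring
  have h6 : ∑ l, b l ^ 2 * ∑ m ∈ Finset.univ.erase l, |M l m| ≤ ∑ l, b l ^ 2 * (1 - lam) :=
    Finset.sum_le_sum fun l _ => mul_le_mul_of_nonneg_left (hrow l) (sq_nonneg _)
  have h7 := Finset.sum_le_sum fun l (_ : l ∈ Finset.univ) => h3 l
  rw [Finset.sum_neg_distrib, h5] at h7
  simp only [h2, Finset.sum_add_distrib]
  rw [← Finset.sum_mul] at h6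
  linarith

/-- Pythagoras converts the bound by the norm of the projection into 1 minus the squared distance,
and the phases are absorbed into the coefficients. The orthogonality relations are kept for the
lower bound on the coefficients. -/
theorem exists_coeff {d r n : ℕ} (w : Fin r → ℂ) (ξ : Fin r → UnitAddTorus (Fin d))
    (S : SVD ((n + 1) ^ d) (momentMatrix (discreteMeasure w ξ) n)) (x : UnitAddTorus (Fin d))
    {X : Fin d → ℝ} (hX : ∀ i, ((X i / ((n : ℝ) + 1) : ℝ) : UnitAddCircle) = x i)
    {Ξ : Fin r → Fin d → ℝ} (hΞ : ∀ l i, ((Ξ l i / ((n : ℝ) + 1) : ℝ) : UnitAddCircle) = ξ l i) :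
    ∃ c : Fin r → ℂ,
      (∀ l, ∑ k : Fin d → Fin (n + 1), (starRingEnd ℂ) (Evec (Ξ l) k) *
        (Evec X k - ∑ m, c m * Evec (Ξ m) k) = 0) ∧
      signalFun S x ≤ 1 - 1 / ((n : ℝ) + 1) ^ d *
        ∑ k : Fin d → Fin (n + 1), ‖Evec X k - ∑ l, c l * Evec (Ξ l) k‖ ^ 2 := by
  obtain ⟨c, horth, hle⟩ := exists_signalFun_le w ξ S x
  obtain ⟨z, hz, hzE⟩ := exists_phase hX
  choose y hy hyE using fun l => exists_phase (n := n) (hΞ l)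
  have hz0 : z ≠ 0 := by rw [← norm_pos_iff, hz]; exact one_pos
  have hy0 : ∀ l, y l ≠ 0 := fun l => by rw [← norm_pos_iff, hy]; exact one_pos
  have hF : ∀ k, (expVec n x - ∑ j, c j • expVec n (ξ j)) k =
      z * (Evec X k - ∑ m, (c m * y m / z) * Evec (Ξ m) k) := by
    intro k
    simp only [Pi.sub_apply, Finset.sum_apply, Pi.smul_apply, smul_eq_mul, hzE, hyE]
    rw [mul_sub, Finset.mul_sum]
    congr 1
    exact Finset.sum_congr rfl fun m _ => by field_simp
  refine ⟨fun m => c m * y m / z, fun l => ?_, hle.trans ?_⟩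
  · have h := horth l
    simp only [dotProduct, Pi.star_apply, hF, hyE] at h
    have h2 : (starRingEnd ℂ) (y l) * z * ∑ k : Fin d → Fin (n + 1), (starRingEnd ℂ) (Evec (Ξ l) k) *
        (Evec X k - ∑ m, c m * y m / z * Evec (Ξ m) k) = 0 := by
      rw [← h, Finset.mul_sum]
      refine Finset.sum_congr rfl fun k _ => ?_
      rw [star_mul']
      simp only [RCLike.star_def]
      ring
    refine (mul_eq_zero.1 h2).resolve_left (mul_ne_zero ?_ hz0)
    rw [Ne, map_eq_zero]; exact hy0 l
  · set a := expVec n x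
    set H := ∑ j, c j • expVec n (ξ j) with hH
    have h0 : star H ⬝ᵥ (a - H) = 0 := by
      rw [hH, star_sum_smul_dotProduct]
      exact Finset.sum_eq_zero fun j _ => by rw [horth, mul_zero]
    have h1 : ((∑ k, ‖a k‖ ^ 2 : ℝ) : ℂ) = ((∑ k, ‖(a - H) k‖ ^ 2 : ℝ) : ℂ) + ((∑ k, ‖H k‖ ^ 2 : ℝ) : ℂ) := by
      rw [sq_sum_eq_star_dotProduct, sq_sum_eq_star_dotProduct, sq_sum_eq_star_dotProduct]
      have h2 : star (a - H) ⬝ᵥ H = 0 := by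
        rw [Matrix.star_dotProduct, h0, star_zero]
      have e : a = (a - H) + H := by simp
      nth_rewrite 1 [e]
      nth_rewrite 2 [e]
      rw [star_add, add_dotProduct, dotProduct_add, dotProduct_add, h0, h2]
      ring
    have h3 : ∑ k, ‖a k‖ ^ 2 = ∑ k, ‖(a - H) k‖ ^ 2 + ∑ k, ‖H k‖ ^ 2 := by exact_mod_cast h1
    have h4 : ∑ k, ‖a k‖ ^ 2 = ((n : ℝ) + 1) ^ d := by
      simp [a, norm_expVec]
    have h5 : ∀ k, ‖(a - H) k‖ ^ 2 = ‖Evec X k - ∑ l, c l * y l / z * Evec (Ξ l) k‖ ^ 2 := by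
      intro k; rw [hF, norm_mul, hz, one_mul]
    simp only [h5] at h3
    rw [h4] at h3
    have hN : (0 : ℝ) < ((n : ℝ) + 1) ^ d := by positivity
    rw [le_sub_iff_add_le, ← mul_add, add_comm (∑ k, ‖H k‖ ^ 2), ← h3, one_div, inv_mul_cancel₀ hN.ne']

/-! ### Sums over separated nodes by sorting into cells -/

/-- `f` is dominated by a summable-type majorant on cells that separate points at distance `s`. -/
def Celled {ι : Type*} (F : Finset ι) (s : ℝ) (p f : ι → ℝ) (B : ℝ) : Prop :=
  ∃ (J : ι → Option (Bool × ℕ)) (Φ : Option (Bool × ℕ) → ℝ),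
    (∀ l ∈ F, ∀ m ∈ F, J l = J m → |p l - p m| < s) ∧ (∀ l ∈ F, 0 ≤ f l ∧ f l ≤ Φ (J l)) ∧
    (∀ k, 0 ≤ Φ k) ∧ ∀ T : Finset (Option (Bool × ℕ)), ∑ k ∈ T, Φ k ≤ B

/-- Two distinct nodes are at distance at least s in some coordinate and lie in different cells
there. So the map to d-tuples of cells is injective, and the sum over the nodes is at most the sum
over all tuples, which factors. -/
theorem sum_prod_le_of_celled {ι : Type*} {d : ℕ} {F : Finset ι} {s : ℝ} {p f : Fin d → ι → ℝ}
    {B : Fin d → ℝ} (hc : ∀ i, Celled F s (p i) (f i) (B i))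
    (hsep : ∀ l ∈ F, ∀ m ∈ F, l ≠ m → ∃ i, s ≤ |p i l - p i m|) :
    ∑ l ∈ F, ∏ i, f i l ≤ ∏ i, B i := by
  classical
  choose J Φ hJ hf hΦ hB using hc
  have hinj : Set.InjOn (fun l i => J i l) (F : Set ι) := by
    intro l hl m hm h
    by_contra hne
    obtain ⟨i, hi⟩ := hsep l hl m hm hne
    exact absurd (hJ i l hl m hm (congrFun h i)) (not_lt.2 hi)
  calc ∑ l ∈ F, ∏ i, f i l ≤ ∑ l ∈ F, ∏ i, Φ i (J i l) :=
        Finset.sum_le_sum fun l hl => Finset.prod_le_prod (fun i _ => (hf i l hl).1) fun i _ => (hf i l hl).2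
    _ = ∑ k ∈ F.image (fun l i => J i l), ∏ i, Φ i (k i) := by
        rw [Finset.sum_image fun a ha b hb h => hinj ha hb h]
    _ ≤ ∑ k ∈ Fintype.piFinset (fun i => F.image (J i)), ∏ i, Φ i (k i) := by
        refine Finset.sum_le_sum_of_subset_of_nonneg ?_ fun k _ _ => Finset.prod_nonneg fun i _ => hΦ i _
        intro k hk
        obtain ⟨l, hl, rfl⟩ := Finset.mem_image.1 hk
        exact Fintype.mem_piFinset.2 fun i => Finset.mem_image_of_mem _ hl
    _ = ∏ i, ∑ k ∈ F.image (J i), Φ i k := (Finset.prod_univ_sum _ _).symm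
    _ ≤ ∏ i, B i := Finset.prod_le_prod (fun i _ => Finset.sum_nonneg fun k _ => hΦ i k) fun i _ => hB i _

theorem abs_sub_lt_of_floor_eq {s a b : ℝ} (hs : 0 < s) (ha : 0 ≤ a) (hb : 0 ≤ b)
    (h : ⌊a / s⌋₊ = ⌊b / s⌋₊) : |a - b| < s := by
  have h1 := Nat.floor_le (div_nonneg ha hs.le)
  have h2 := Nat.lt_floor_add_one (a / s)
  have h3 := Nat.floor_le (div_nonneg hb hs.le)
  have h4 := Nat.lt_floor_add_one (b / s)
  rw [h] at h1 h2
  have h5 : |a / s - b / s| < 1 := by rw [abs_lt]; constructor <;> linarith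
  rw [← sub_div, abs_div, abs_of_pos hs, div_lt_one hs] at h5
  exact h5

/-- The line is cut into a central cell (-Am, Ap) and half-open cells of length s to the right of Ap
and to the left of -Am. The outer cells separate points automatically; the central one needs the
hypothesis `hcen`. -/
theorem celled_of_bounds {ι : Type*} {F : Finset ι} {s : ℝ} (hs : 0 < s) {p f : ι → ℝ} (Ap Am : ℝ)
    {c Gp Gm : ℝ} {gp gm : ℕ → ℝ}
    (hcen : ∀ l ∈ F, ∀ m ∈ F, p l < Ap → -Am < p l → p m < Ap → -Am < p m → |p l - p m| < s)
    (hf0 : ∀ l ∈ F, 0 ≤ f l) (hfc : ∀ l ∈ F, p l < Ap → -Am < p l → f l ≤ c)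
    (hfp : ∀ l ∈ F, ∀ j : ℕ, Ap + s * j ≤ p l → f l ≤ gp j)
    (hfm : ∀ l ∈ F, ∀ j : ℕ, Am + s * j ≤ -p l → f l ≤ gm j)
    (hc : 0 ≤ c) (hgp : ∀ j, 0 ≤ gp j) (hgm : ∀ j, 0 ≤ gm j)
    (hGp : ∀ n, ∑ j ∈ Finset.range n, gp j ≤ Gp) (hGm : ∀ n, ∑ j ∈ Finset.range n, gm j ≤ Gm) :
    Celled F s p f (c + (Gp + Gm)) := by
  classical
  let J : ι → Option (Bool × ℕ) := fun l =>
    if Ap ≤ p l then some (true, ⌊(p l - Ap) / s⌋₊)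
    else if Am ≤ -p l then some (false, ⌊(-p l - Am) / s⌋₊) else none
  let Φ : Option (Bool × ℕ) → ℝ := fun k => k.elim c fun a => bif a.1 then gp a.2 else gm a.2
  have hΦ : ∀ k, 0 ≤ Φ k := by
    intro k
    rcases k with _ | ⟨_ | _, j⟩
    · exact hc
    · exact hgm j
    · exact hgp j
  refine ⟨J, Φ, fun l hl m hm h => ?_, fun l hl => ⟨hf0 l hl, ?_⟩, hΦ, fun T => ?_⟩
  · by_cases h1 : Ap ≤ p l <;> by_cases h2 : Ap ≤ p m <;> by_cases h3 : Am ≤ -p l <;>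
      by_cases h4 : Am ≤ -p m <;> simp only [J, h1, h2, h3, h4, if_true, if_false, reduceCtorEq,
        Option.some.injEq, Prod.mk.injEq, true_and, false_and, Bool.false_eq_true, Bool.true_eq_false] at h
    any_goals
      have := abs_sub_lt_of_floor_eq hs (sub_nonneg.2 h1) (sub_nonneg.2 h2) h
      rwa [show p l - Ap - (p m - Ap) = p l - p m by ring] at this
    · have := abs_sub_lt_of_floor_eq hs (sub_nonneg.2 h3) (sub_nonneg.2 h4) h
      rwa [show -p l - Am - (-p m - Am) = -(p l - p m) by ring, abs_neg] at this
    · exact hcen l hl m hm (by linarith) (by linarith) (by linarith) (by linarith)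
  · by_cases h1 : Ap ≤ p l
    · have h5 := Nat.floor_le (div_nonneg (sub_nonneg.2 h1) hs.le)
      rw [le_div_iff₀ hs] at h5
      simpa [J, Φ, h1] using hfp l hl _ (by linarith)
    · by_cases h3 : Am ≤ -p l
      · have h5 := Nat.floor_le (div_nonneg (sub_nonneg.2 h3) hs.le)
        rw [le_div_iff₀ hs] at h5
        simpa [J, Φ, h1, h3] using hfm l hl _ (by linarith)
      · simpa [J, Φ, h1, h3] using hfc l hl (by linarith) (by linarith)
  · set n := (T.eraseNone.sup fun a => a.2) + 1
    have hT : T ⊆ (Finset.univ ×ˢ Finset.range n : Finset (Bool × ℕ)).insertNone := by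
      intro k hk
      rcases k with _ | a
      · simp
      · simp only [Finset.some_mem_insertNone, Finset.mem_product, Finset.mem_univ, true_and,
          Finset.mem_range]
        exact Nat.lt_succ_of_le (Finset.le_sup (f := fun a : Bool × ℕ => a.2) (Finset.mem_eraseNone.2 hk))
    refine (Finset.sum_le_sum_of_subset_of_nonneg hT fun k _ _ => hΦ k).trans ?_
    rw [Finset.sum_insertNone, Finset.sum_product]
    simp only [Fintype.sum_bool, Φ, Option.elim, cond_true, cond_false]
    exact add_le_add le_rfl (add_le_add (hGp n) (hGm n))

/-- Reduction modulo `N` to the interval `[-N/2, N/2]`. -/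
noncomputable def red (N : ℕ) (v : ℝ) : ℝ := v - N * round (v / N)

theorem abs_red_le {N : ℕ} (hN : 0 < N) (v : ℝ) : |red N v| ≤ N / 2 := by
  have hN0 : (0 : ℝ) < N := by exact_mod_cast hN
  have h := abs_sub_round (v / N)
  have e : red N v = N * (v / N - round (v / N)) := by unfold red; field_simp
  rw [e, abs_mul, abs_of_pos hN0]
  nlinarith

theorem abs_kap_red (θ : ℝ) {N : ℕ} (hN : 0 < N) (v : ℝ) : |kap θ N (red N v)| = |kap θ N v| := by
  rw [← abs_kap_add_int_mul θ hN v (-round (v / N))]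
  congr 2
  unfold red
  push_cast; ring

/-- Points with coordinates `Ξ l i / N` on the torus have pairwise distance at least `s / N`. -/
def Sep {r d : ℕ} (s : ℝ) (N : ℕ) (Ξ : Fin r → Fin d → ℝ) : Prop :=
  ∀ l m, l ≠ m → ∃ i, ∀ k : ℤ, s ≤ |Ξ l i - Ξ m i + N * k|

theorem le_abs_red_sub_red {s : ℝ} {N : ℕ} {a b : ℝ} (h : ∀ k : ℤ, s ≤ |a - b + N * k|) (y : ℝ) :
    s ≤ |red N (y - a) - red N (y - b)| := by
  have := h (round ((y - a) / N) - round ((y - b) / N))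
  rw [← abs_neg]
  convert this using 2
  unfold red; push_cast; ring

theorem le_abs_red_sub {s : ℝ} {N : ℕ} {a b : ℝ} (h : ∀ k : ℤ, s ≤ |a - b + N * k|) (y : ℝ) :
    s ≤ |red N (y - b) - (y - a)| := by
  have := h (-round ((y - b) / N))
  convert this using 2
  unfold red; push_cast; ring

/-- In the coordinate i₀ the displacement u = Y - Ξ l₀ satisfies |u| ≤ δ, and every reduced
difference is at least s away from u. It is therefore at least s in size on the side to which u
points and at least s - δ on the other side: there is no central cell, only one tail of each kind.
In every other coordinate there is a central cell of length s and two tails beginning at s/2. -/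
theorem class_sum_le {r d N : ℕ} {s δ : ℝ} (hs : 0 < s) {Ξ : Fin r → Fin d → ℝ} (hsep : Sep s N Ξ)
    (l₀ : Fin r) {Y : Fin d → ℝ} (hY : ∀ i, |Y i - Ξ l₀ i| ≤ δ) (i₀ : Fin d) {F : Finset (Fin r)}
    (hF : ∀ l ∈ F, ∀ k : ℤ, s ≤ |Ξ l₀ i₀ - Ξ l i₀ + N * k|) {f : Fin d → Fin r → ℝ}
    (hf0 : ∀ i l, 0 ≤ f i l) {c G : Fin d → ℝ} {g : Fin d → ℕ → ℝ} {t₁ t₂ : ℕ → ℝ} {T₁ T₂ : ℝ}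
    (hfc : ∀ i, i ≠ i₀ → ∀ l, f i l ≤ c i) (hc : ∀ i, 0 ≤ c i)
    (hfg : ∀ i, i ≠ i₀ → ∀ l (j : ℕ), s / 2 + s * j ≤ |red N (Y i - Ξ l i)| → f i l ≤ g i j)
    (hg : ∀ i j, 0 ≤ g i j) (hG : ∀ i n, ∑ j ∈ Finset.range n, g i j ≤ G i)
    (hft₁ : ∀ l (j : ℕ), s + s * j ≤ |red N (Y i₀ - Ξ l i₀)| → f i₀ l ≤ t₁ j)
    (hft₂ : ∀ l (j : ℕ), s - δ + s * j ≤ |red N (Y i₀ - Ξ l i₀)| → f i₀ l ≤ t₂ j)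
    (ht₁ : ∀ j, 0 ≤ t₁ j) (ht₂ : ∀ j, 0 ≤ t₂ j)
    (hT₁ : ∀ n, ∑ j ∈ Finset.range n, t₁ j ≤ T₁) (hT₂ : ∀ n, ∑ j ∈ Finset.range n, t₂ j ≤ T₂) :
    ∑ l ∈ F, ∏ i, f i l ≤ (T₁ + T₂) * ∏ i ∈ Finset.univ.erase i₀, (c i + (G i + G i)) := by
  classical
  have key : ∀ i, Celled F s (fun l => red N (Y i - Ξ l i)) (f i)
      (if i = i₀ then T₁ + T₂ else c i + (G i + G i)) := by
    intro i
    by_cases hi : i = i₀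
    · subst hi
      rw [if_pos rfl]
      have hd : ∀ l ∈ F, s ≤ |red N (Y i - Ξ l i) - (Y i - Ξ l₀ i)| := fun l hl =>
        le_abs_red_sub (hF l hl) _
      have hu := abs_le.1 (hY i)
      rcases le_total 0 (Y i - Ξ l₀ i) with h0 | h0
      · have h := celled_of_bounds (F := F) (c := 0) hs (p := fun l => red N (Y i - Ξ l i)) (f := f i)
          (gp := t₁) (gm := t₂) (Gp := T₁) (Gm := T₂) s (s - δ) ?_ (fun l _ => hf0 i l) ?_
          (fun l _ j hj => hft₁ l j (hj.trans (le_abs_self _)))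
          (fun l _ j hj => hft₂ l j (hj.trans (neg_le_abs _))) le_rfl ht₁ ht₂ hT₁ hT₂
        · simpa using h
        · intro l hl m _ h1 h2
          exfalso
          rcases le_abs.1 (hd l hl) with h | h <;> linarith
        · intro l hl h1 h2
          exfalso
          rcases le_abs.1 (hd l hl) with h | h <;> linarith
      · have h := celled_of_bounds (F := F) (c := 0) hs (p := fun l => red N (Y i - Ξ l i)) (f := f i)
          (gp := t₂) (gm := t₁) (Gp := T₂) (Gm := T₁) (s - δ) s ?_ (fun l _ => hf0 i l) ?_
          (fun l _ j hj => hft₂ l j (hj.trans (le_abs_self _)))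
          (fun l _ j hj => hft₁ l j (hj.trans (neg_le_abs _))) le_rfl ht₂ ht₁ hT₂ hT₁
        · rw [add_comm T₁]; simpa using h
        · intro l hl m _ h1 h2
          exfalso
          rcases le_abs.1 (hd l hl) with h | h <;> linarith
        · intro l hl h1 h2
          exfalso
          rcases le_abs.1 (hd l hl) with h | h <;> linarith
    · rw [if_neg hi]
      refine celled_of_bounds hs (s / 2) (s / 2) ?_ (fun l _ => hf0 i l) (fun l _ _ _ => hfc i hi l)
        (fun l _ j hj => hfg i hi l j (hj.trans (le_abs_self _)))
        (fun l _ j hj => hfg i hi l j (hj.trans (neg_le_abs _))) (hc i) (hg i) (hg i) (hG i) (hG i)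
      intro l _ m _ h1 h2 h3 h4
      rw [abs_lt]; constructor <;> linarith
  refine (sum_prod_le_of_celled key ?_).trans (le_of_eq ?_)
  · intro l _ m _ hlm
    obtain ⟨i, hi⟩ := hsep l m hlm
    exact ⟨i, le_abs_red_sub_red hi _⟩
  · rw [← Finset.mul_prod_erase Finset.univ _ (Finset.mem_univ i₀), if_pos rfl]
    congr 1
    exact Finset.prod_congr rfl fun i hi => if_neg (Finset.ne_of_mem_erase hi)

/-- A sum over the other nodes is split according to a coordinate in which they are far away. -/
theorem sum_erase_le_sum_class {r d N : ℕ} {s : ℝ} {Ξ : Fin r → Fin d → ℝ} (hsep : Sep s N Ξ)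
    (l₀ : Fin r) {f : Fin r → ℝ} (hf : ∀ l, 0 ≤ f l) {B : Fin d → ℝ}
    (hB : ∀ i (F : Finset (Fin r)), (∀ l ∈ F, ∀ k : ℤ, s ≤ |Ξ l₀ i - Ξ l i + N * k|) → ∑ l ∈ F, f l ≤ B i) :
    ∑ l ∈ Finset.univ.erase l₀, f l ≤ ∑ i, B i := by
  classical
  have h : ∑ l ∈ Finset.univ.erase l₀, f l ≤ ∑ i : Fin d,
      ∑ l ∈ Finset.univ.filter (fun l => ∀ k : ℤ, s ≤ |Ξ l₀ i - Ξ l i + N * k|), f l := by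
    simp only [Finset.sum_filter]
    rw [Finset.sum_comm]
    refine (Finset.sum_le_sum fun l hl => ?_).trans
      (Finset.sum_le_sum_of_subset_of_nonneg (Finset.erase_subset _ _) fun l _ _ => ?_)
    · obtain ⟨i, hi⟩ := hsep l₀ l (Finset.ne_of_mem_erase hl).symm
      refine le_trans (le_of_eq (if_pos hi).symm) (Finset.single_le_sum
        (f := fun i => if ∀ k : ℤ, s ≤ |Ξ l₀ i - Ξ l i + N * k| then f l else 0) (fun i _ => ?_)
        (Finset.mem_univ i))
      split_ifs
      exacts [hf l, le_rfl]
    · refine Finset.sum_nonneg fun i _ => ?_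
      split_ifs
      exacts [hf l, le_rfl]
  exact h.trans (Finset.sum_le_sum fun i _ => hB i _ fun l hl => (Finset.mem_filter.1 hl).2)

theorem threshold_sum_le {r d N : ℕ} {s δ : ℝ} (hs : 0 < s) {Ξ : Fin r → Fin d → ℝ} (hsep : Sep s N Ξ)
    (l₀ : Fin r) {Y : Fin d → ℝ} (hY : ∀ i, |Y i - Ξ l₀ i| ≤ δ) {a : ℝ → ℝ} (ha : ∀ u, 0 ≤ a u)
    (ha1 : ∀ u, a u ≤ 1) (hred : ∀ u, a (red N u) = a u) (hN : 0 < N)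
    {G T₁ T₂ : ℝ} {g t₁ t₂ : ℕ → ℝ}
    (hag : ∀ u : ℝ, |u| ≤ N / 2 → ∀ j : ℕ, s / 2 + s * j ≤ |u| → a u ≤ g j) (hg : ∀ j, 0 ≤ g j)
    (hG : ∀ n, ∑ j ∈ Finset.range n, g j ≤ G)
    (hat₁ : ∀ u : ℝ, |u| ≤ N / 2 → ∀ j : ℕ, s + s * j ≤ |u| → a u ≤ t₁ j) (ht₁ : ∀ j, 0 ≤ t₁ j)
    (hT₁ : ∀ n, ∑ j ∈ Finset.range n, t₁ j ≤ T₁)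
    (hat₂ : ∀ u : ℝ, |u| ≤ N / 2 → ∀ j : ℕ, s - δ + s * j ≤ |u| → a u ≤ t₂ j) (ht₂ : ∀ j, 0 ≤ t₂ j)
    (hT₂ : ∀ n, ∑ j ∈ Finset.range n, t₂ j ≤ T₂) :
    ∑ l ∈ Finset.univ.erase l₀, ∏ i, a (Y i - Ξ l i) ≤ d * ((T₁ + T₂) * (1 + 2 * G) ^ (d - 1)) := by
  refine (sum_erase_le_sum_class hsep l₀ (fun l => Finset.prod_nonneg fun i _ => ha _)
    (B := fun _ => (T₁ + T₂) * (1 + 2 * G) ^ (d - 1)) fun i₀ F hF => ?_).trans (le_of_eq (by simp))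
  refine (class_sum_le hs hsep l₀ hY i₀ hF (f := fun i l => a (Y i - Ξ l i)) (fun _ _ => ha _)
    (c := fun _ => 1) (G := fun _ => G) (g := fun _ => g) (t₁ := t₁) (t₂ := t₂)
    (fun i _ l => ha1 _) (fun _ => zero_le_one) (fun i _ l j h => ?_) (fun _ => hg) (fun _ => hG)
    (fun l j h => ?_) (fun l j h => ?_) ht₁ ht₂ hT₁ hT₂).trans (le_of_eq ?_)
  · rw [← hred]; exact hag _ (abs_red_le hN _) j h
  · rw [← hred]; exact hat₁ _ (abs_red_le hN _) j h
  · rw [← hred]; exact hat₂ _ (abs_red_le hN _) j h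
  · rw [Finset.prod_const, Finset.card_erase_of_mem (Finset.mem_univ _), Finset.card_univ, Fintype.card_fin]
    ring

theorem norm_coe_le_abs_add_int (t : ℝ) (k : ℤ) : ‖(t : UnitAddCircle)‖ ≤ |t + k| := by
  rw [UnitAddCircle.norm_eq]
  have := round_le t (-k)
  push_cast at this
  rwa [sub_neg_eq_add] at this

theorem exists_config {d r n : ℕ} {s : ℝ} (hs : 0 < s) (ξ : Fin r → UnitAddTorus (Fin d))
    (hξ : Function.Injective ξ) (hsep : ∀ j l, j ≠ l → s / ‖ξ j - ξ l‖ < (n : ℝ) + 1)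
    (x : UnitAddTorus (Fin d)) (l₀ : Fin r) :
    ∃ (X : Fin d → ℝ) (Ξ : Fin r → Fin d → ℝ),
      (∀ i, ((X i / ((n : ℝ) + 1) : ℝ) : UnitAddCircle) = x i) ∧
      (∀ l i, ((Ξ l i / ((n : ℝ) + 1) : ℝ) : UnitAddCircle) = ξ l i) ∧ Sep s (n + 1) Ξ ∧
      ∀ i, |X i - Ξ l₀ i| = ((n : ℝ) + 1) * ‖(x - ξ l₀) i‖ := by
  have hN : (0 : ℝ) < (n : ℝ) + 1 := by positivity
  choose τ hτ _ using fun l => exists_lift (ξ l)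
  obtain ⟨t, ht, ht'⟩ := exists_lift (x - ξ l₀)
  refine ⟨fun i => ((n : ℝ) + 1) * (τ l₀ i + t i), fun l i => ((n : ℝ) + 1) * τ l i, fun i => ?_,
    fun l i => ?_, fun l m hlm => ?_, fun i => ?_⟩
  · rw [mul_div_cancel_left₀ _ hN.ne', AddCircle.coe_add, ht, hτ]; simp
  · rw [mul_div_cancel_left₀ _ hN.ne', hτ]
  · have h0 : 0 < ‖ξ l - ξ m‖ := norm_pos_iff.2 (sub_ne_zero.2 (hξ.ne hlm))
    have h1 := hsep l m hlm
    rw [div_lt_iff₀ h0, mul_comm, ← div_lt_iff₀ hN] at h1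
    obtain ⟨i, hi⟩ := exists_le_norm_apply (div_pos hs hN) h1.le
    refine ⟨i, fun k => ?_⟩
    have h2 := norm_coe_le_abs_add_int (τ l i - τ m i) k
    rw [AddCircle.coe_sub, hτ, hτ] at h2
    rw [Pi.sub_apply] at hi
    have h3 := (hi.trans h2)
    rw [div_le_iff₀ hN, ← abs_of_pos hN, ← abs_mul] at h3
    refine h3.trans (le_of_eq (congrArg _ ?_))
    push_cast; ring
  · rw [← ht', ← mul_sub, add_sub_cancel_left, abs_mul, abs_of_pos hN]

/-- Minkowski's inequality in ℓ². -/
theorem sum_add_sq_le {ι : Type*} (F : Finset ι) {a b : ι → ℝ} {A B : ℝ} (hA : 0 ≤ A) (hB : 0 ≤ B)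
    (ha : ∑ l ∈ F, a l ^ 2 ≤ A ^ 2) (hb : ∑ l ∈ F, b l ^ 2 ≤ B ^ 2) :
    ∑ l ∈ F, (a l + b l) ^ 2 ≤ (A + B) ^ 2 := by
  have h1 : ∑ l ∈ F, a l * b l ≤ A * B := by
    refine le_of_sq_le_sq ?_ (mul_nonneg hA hB)
    refine (Finset.sum_mul_sq_le_sq_mul_sq F a b).trans ?_
    rw [mul_pow]
    exact mul_le_mul ha hb (Finset.sum_nonneg fun _ _ => sq_nonneg _) (sq_nonneg _)
  have e : ∑ l ∈ F, (a l + b l) ^ 2 = ∑ l ∈ F, a l ^ 2 + 2 * ∑ l ∈ F, a l * b l + ∑ l ∈ F, b l ^ 2 := by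
    rw [Finset.mul_sum, ← Finset.sum_add_distrib, ← Finset.sum_add_distrib]
    exact Finset.sum_congr rfl fun _ _ => by ring
  rw [e]
  nlinarith

theorem sum_one_div_add_one_sq_le (n : ℕ) : ∑ j ∈ Finset.range n, 1 / ((j : ℝ) + 1) ^ 2 ≤ 5 / 3 := by
  have h : ∀ n : ℕ, ∑ j ∈ Finset.range n, 1 / ((j : ℝ) + 1 + 1) ^ 2 ≤ 2 / 3 - 1 / ((n : ℝ) + 3 / 2) := by
    intro n
    induction n with
    | zero => norm_num
    | succ k ih =>
      rw [Finset.sum_range_succ]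
      have : 1 / ((k : ℝ) + 1 + 1) ^ 2 ≤ 1 / ((k : ℝ) + 3 / 2) - 1 / ((k : ℝ) + 1 + 3 / 2) := by
        rw [div_sub_div _ _ (by positivity) (by positivity), div_le_div_iff₀ (by positivity) (by positivity)]
        ring_nf; nlinarith
      push_cast; linarith
  rcases n with _ | n
  · norm_num
  · rw [Finset.sum_range_succ']
    have h1 := h n
    have : (0 : ℝ) ≤ 1 / ((n : ℝ) + 3 / 2) := by positivity
    push_cast
    have e : 1 / ((0 : ℝ) + 1) ^ 2 = 1 := by norm_num
    rw [e]
    linarith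

theorem sum_one_div_add_three_half_sq_le (n : ℕ) :
    ∑ j ∈ Finset.range n, 1 / ((j : ℝ) + 3 / 2) ^ 2 ≤ 1 := by
  have h : ∑ j ∈ Finset.range n, 1 / ((j : ℝ) + 3 / 2) ^ 2 ≤ 1 - 1 / ((n : ℝ) + 1) := by
    induction n with
    | zero => norm_num
    | succ k ih =>
      rw [Finset.sum_range_succ]
      have : 1 / ((k : ℝ) + 3 / 2) ^ 2 ≤ 1 / ((k : ℝ) + 1) - 1 / ((k : ℝ) + 1 + 1) := by
        rw [div_sub_div _ _ (by positivity) (by positivity), div_le_div_iff₀ (by positivity) (by positivity)]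
        ring_nf; nlinarith
      push_cast; linarith
  have : (0 : ℝ) ≤ 1 / ((n : ℝ) + 1) := by positivity
  linarith

/-! ### From kernel data to lower bounds for 1 - p -/

/-- Distance of a point to the span of the nodes, bounded below by kernel data. -/
theorem sub_le_mul_one_sub_signalFun {d r n : ℕ} (w : Fin r → ℂ) (ξ : Fin r → UnitAddTorus (Fin d))
    (S : SVD ((n + 1) ^ d) (momentMatrix (discreteMeasure w ξ) n)) (x : UnitAddTorus (Fin d))
    {X : Fin d → ℝ} (hX : ∀ i, ((X i / ((n : ℝ) + 1) : ℝ) : UnitAddCircle) = x i)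
    {Ξ : Fin r → Fin d → ℝ} (hΞ : ∀ l i, ((Ξ l i / ((n : ℝ) + 1) : ℝ) : UnitAddCircle) = ξ l i)
    {θ ω lam : ℝ} (h0 : 0 ≤ θ) (h1 : θ ≤ 1 / 28) (hN : 5 ≤ n + 1)
    (hω : ∀ k, wt θ (n + 1) k ≤ ω / (n + 1 : ℕ)) (hω0 : 0 ≤ ω) (hl : 0 < lam)
    (hrow : ∀ l, ∑ m ∈ Finset.univ.erase l, |∏ i, kap θ (n + 1) (Ξ l i - Ξ m i)| ≤ 1 - lam)
    (l₀ : Fin r) {E : ℝ}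
    (hE : ∑ l ∈ Finset.univ.erase l₀, (∏ i, kap θ (n + 1) (X i - Ξ l i) -
      (∏ i, kap θ (n + 1) (X i - Ξ l₀ i)) * ∏ i, kap θ (n + 1) (Ξ l₀ i - Ξ l i)) ^ 2 ≤ E) :
    1 - (∏ i, kap θ (n + 1) (X i - Ξ l₀ i)) ^ 2 - E / lam ≤ ω ^ d * (1 - signalFun S x) := by
  obtain ⟨c, -, hc⟩ := exists_coeff w ξ S x hX hΞ
  have hk : kr (wt θ (n + 1)) 0 = 1 := kap_zero hN θ
  have hq := quadratic_le (Nat.succ_pos n) (isSymm_wt θ (n + 1)) (fun k => wt_nonneg h0 h1 hN k) hω hk X Ξ c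
  have hM : ∀ l m, ∏ i, kr (wt θ (n + 1)) (Ξ l i - Ξ m i) = ∏ i, kr (wt θ (n + 1)) (Ξ m i - Ξ l i) :=
    fun l m => Finset.prod_congr rfl fun i _ => by rw [← kr_neg, neg_sub]
  have hM1 : ∀ l, ∏ i, kr (wt θ (n + 1)) (Ξ l i - Ξ l i) = 1 := fun l => by simp [hk]
  have hpos := le_quadratic_of_row_sum (M := fun l m => ∏ i, kr (wt θ (n + 1)) (Ξ l i - Ξ m i)) hM hM1 hrow
  have hs := sub_le_quadratic (K := fun l => ∏ i, kr (wt θ (n + 1)) (X i - Ξ l i)) hl hM hpos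
    (hM1 l₀) (fun l => (c l).re)
  have him := (mul_nonneg hl.le (Finset.sum_nonneg fun l _ => sq_nonneg _)).trans (hpos fun l => (c l).im)
  have hEl : (∑ l, (∏ i, kr (wt θ (n + 1)) (X i - Ξ l i) - (∏ i, kr (wt θ (n + 1)) (X i - Ξ l₀ i)) *
      ∏ i, kr (wt θ (n + 1)) (Ξ l₀ i - Ξ l i)) ^ 2) / lam ≤ E / lam := by
    refine div_le_div_of_nonneg_right ?_ hl.le
    rw [← Finset.add_sum_erase _ _ (Finset.mem_univ l₀), hM1]
    refine le_trans (le_of_eq ?_) hE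
    simp only [mul_one, sub_self]
    rw [zero_pow two_ne_zero, zero_add]
    rfl
  have h2 : ω ^ d * (1 / ((n + 1 : ℕ) : ℝ) ^ d * ∑ k : Fin d → Fin (n + 1),
      ‖Evec X k - ∑ l, c l * Evec (Ξ l) k‖ ^ 2) ≤ ω ^ d * (1 - signalFun S x) := by
    refine mul_le_mul_of_nonneg_left ?_ (by positivity)
    push_cast
    linarith
  change 1 - (∏ i, kr (wt θ (n + 1)) (X i - Ξ l₀ i)) ^ 2 - E / lam ≤ _
  linarith

/-- A summable majorant of `a` on the cells `[A + s j, A + s (j + 1))` up to `N / 2`. -/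
def TailBound (a : ℝ → ℝ) (N : ℕ) (s A T : ℝ) : Prop :=
  ∃ t : ℕ → ℝ, (∀ j, 0 ≤ t j) ∧ (∀ u : ℝ, |u| ≤ N / 2 → ∀ j : ℕ, A + s * j ≤ |u| → a u ≤ t j) ∧
    ∀ n, ∑ j ∈ Finset.range n, t j ≤ T

theorem TailBound.nonneg {a : ℝ → ℝ} {N : ℕ} {s A T : ℝ} (h : TailBound a N s A T) : 0 ≤ T := by
  obtain ⟨t, _, _, h3⟩ := h
  simpa using h3 0

theorem TailBound.mono {a : ℝ → ℝ} {N : ℕ} {s A T A' T' : ℝ} (h : TailBound a N s A T) (hA : A ≤ A')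
    (hT : T ≤ T') : TailBound a N s A' T' := by
  obtain ⟨t, h1, h2, h3⟩ := h
  exact ⟨t, h1, fun u hu j hj => h2 u hu j (by linarith), fun n => (h3 n).trans hT⟩

theorem TailBound.cons {a : ℝ → ℝ} {N : ℕ} {s A T h : ℝ} (h0 : 0 ≤ h)
    (hh : ∀ u : ℝ, |u| ≤ N / 2 → A ≤ |u| → a u ≤ h) (H : TailBound a N s (A + s) T) :
    TailBound a N s A (h + T) := by
  obtain ⟨t, h1, h2, h3⟩ := H
  refine ⟨fun j => if j = 0 then h else t (j - 1), fun j => ?_, fun u hu j hj => ?_, fun n => ?_⟩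
  · dsimp only; split_ifs; exacts [h0, h1 _]
  · rcases j with _ | j
    · exact hh u hu (by simpa using hj)
    · simp only [Nat.add_eq_zero_iff, one_ne_zero, and_false, if_false, Nat.add_sub_cancel]
      refine h2 u hu j ?_
      push_cast at hj; linarith
  · rcases n with _ | n
    · simpa using add_nonneg h0 (by simpa using h3 0)
    · rw [Finset.sum_range_succ']
      simp only [Nat.add_eq_zero_iff, one_ne_zero, and_false, if_false, Nat.add_sub_cancel, if_true]
      linarith [h3 n]

/-- Put y = (j + c)/c. From A ≤ cs one gets |u| ≥ A + sj ≥ Ay, hence αu² - β ≥ y²(αA² - β). The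
majorant on the j-th cell is thus its value at A times y^(-2p). The number c bounds the ratio of the
starting point to the cell length. -/
theorem tailBound_of_le {a : ℝ → ℝ} {N p : ℕ} {h A s α β c S : ℝ} (hA : 0 < A) (hc : 0 < c)
    (hAs : A ≤ c * s) (hβ : 0 ≤ β) (hpos : β < α * A ^ 2) (h0 : 0 ≤ h)
    (ha : ∀ u : ℝ, |u| ≤ N / 2 → A ≤ |u| → a u ≤ h / (α * u ^ 2 - β) ^ p)
    (hS : ∀ n, ∑ j ∈ Finset.range n, ((c / ((j : ℝ) + c)) ^ 2) ^ p ≤ S) :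
    TailBound a N s A (h * S / (α * A ^ 2 - β) ^ p) := by
  have hq : 0 < α * A ^ 2 - β := by linarith
  have hα : 0 < α := by
    by_contra hα
    nlinarith [mul_nonneg (neg_nonneg.2 (not_lt.1 hα)) (sq_nonneg A)]
  refine ⟨fun j => h / (α * A ^ 2 - β) ^ p * ((c / ((j : ℝ) + c)) ^ 2) ^ p, fun j => by positivity,
    fun u hu j hj => ?_, fun n => ?_⟩
  · have hj0 : (0 : ℝ) ≤ j := j.cast_nonneg
    have hsj : A * j ≤ c * (s * j) := by nlinarith
    have h1 : A ≤ |u| := by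
      have : 0 ≤ s * j := by
        have : 0 ≤ c * (s * j) := le_trans (by positivity) hsj
        exact nonneg_of_mul_nonneg_right this hc
      linarith
    refine (ha u hu h1).trans ?_
    have h2 : A * (j + c) ≤ c * |u| := by nlinarith
    set y := (j + c) / c with hy
    have hy1 : 1 ≤ y := by rw [hy, le_div_iff₀ hc]; linarith
    have h3 : A * y ≤ |u| := by rw [hy, ← mul_div_assoc, div_le_iff₀ hc]; linarith
    have h4 : y ^ 2 * (α * A ^ 2 - β) ≤ α * u ^ 2 - β := by
      have : (A * y) ^ 2 ≤ u ^ 2 := by rw [← sq_abs u]; exact pow_le_pow_left₀ (by positivity) h3 2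
      have hy2 : 1 ≤ y ^ 2 := one_le_pow₀ hy1
      nlinarith
    have e : c / ((j : ℝ) + c) = 1 / y := by rw [hy, one_div_div]
    dsimp only
    rw [e]
    have hy0 : 0 < y := by linarith
    calc h / (α * u ^ 2 - β) ^ p ≤ h / (y ^ 2 * (α * A ^ 2 - β)) ^ p := by
          refine div_le_div_of_nonneg_left h0 (by positivity) (pow_le_pow_left₀ (by positivity) h4 p)
      _ = _ := by
          rw [mul_pow, one_div, inv_pow, inv_pow, div_eq_mul_inv, div_eq_mul_inv, mul_inv]; ring
  · rw [← Finset.mul_sum, mul_div_right_comm]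
    exact mul_le_mul_of_nonneg_left (hS n) (by positivity)

theorem sum_sq_one_le (n : ℕ) : ∑ j ∈ Finset.range n, (((1 : ℝ) / ((j : ℝ) + 1)) ^ 2) ^ 1 ≤ 5 / 3 := by
  refine le_trans (le_of_eq (Finset.sum_congr rfl fun j _ => ?_)) (sum_one_div_add_one_sq_le n)
  rw [pow_one, div_pow, one_pow]

theorem sum_sq_half_le (n : ℕ) :
    ∑ j ∈ Finset.range n, (((1 / 2 : ℝ) / ((j : ℝ) + 1 / 2)) ^ 2) ^ 1 ≤ 5 / 4 := by
  rcases n with _ | n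
  · norm_num
  rw [Finset.sum_range_succ']
  have h := sum_one_div_add_three_half_sq_le n
  have : ∑ j ∈ Finset.range n, (((1 / 2 : ℝ) / (((j + 1 : ℕ) : ℝ) + 1 / 2)) ^ 2) ^ 1 =
      1 / 4 * ∑ j ∈ Finset.range n, 1 / ((j : ℝ) + 3 / 2) ^ 2 := by
    rw [Finset.mul_sum]
    refine Finset.sum_congr rfl fun j _ => ?_
    push_cast
    rw [pow_one, div_pow, show (j : ℝ) + 1 + 1 / 2 = j + 3 / 2 by ring]; ring
  rw [this]
  norm_num at h ⊢
  linarith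

theorem sum_pow_four_one_le (n : ℕ) :
    ∑ j ∈ Finset.range n, (((1 : ℝ) / ((j : ℝ) + 1)) ^ 2) ^ 2 ≤ 7 / 6 := by
  rcases n with _ | n
  · norm_num
  rw [Finset.sum_range_succ']
  have h := sum_sq_one_le (n + 1)
  rw [Finset.sum_range_succ'] at h
  have : ∑ j ∈ Finset.range n, (((1 : ℝ) / (((j + 1 : ℕ) : ℝ) + 1)) ^ 2) ^ 2 ≤
      1 / 4 * ∑ j ∈ Finset.range n, (((1 : ℝ) / (((j + 1 : ℕ) : ℝ) + 1)) ^ 2) ^ 1 := by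
    rw [Finset.mul_sum]
    refine Finset.sum_le_sum fun j _ => ?_
    have h1 : ((1 : ℝ) / (((j + 1 : ℕ) : ℝ) + 1)) ^ 2 ≤ 1 / 4 := by
      rw [div_pow, one_pow, div_le_div_iff₀ (by positivity) (by norm_num)]
      push_cast
      nlinarith [(Nat.cast_nonneg j : (0 : ℝ) ≤ j)]
    rw [pow_one, sq]
    exact mul_le_mul_of_nonneg_right h1 (by positivity)
  norm_num at h this ⊢
  linarith

theorem sum_pow_four_half_le (n : ℕ) :
    ∑ j ∈ Finset.range n, (((1 / 2 : ℝ) / ((j : ℝ) + 1 / 2)) ^ 2) ^ 2 ≤ 37 / 36 := by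
  rcases n with _ | n
  · norm_num
  rw [Finset.sum_range_succ']
  have h := sum_sq_half_le (n + 1)
  rw [Finset.sum_range_succ'] at h
  have : ∑ j ∈ Finset.range n, (((1 / 2 : ℝ) / (((j + 1 : ℕ) : ℝ) + 1 / 2)) ^ 2) ^ 2 ≤
      1 / 9 * ∑ j ∈ Finset.range n, (((1 / 2 : ℝ) / (((j + 1 : ℕ) : ℝ) + 1 / 2)) ^ 2) ^ 1 := by
    rw [Finset.mul_sum]
    refine Finset.sum_le_sum fun j _ => ?_
    have h1 : ((1 / 2 : ℝ) / (((j + 1 : ℕ) : ℝ) + 1 / 2)) ^ 2 ≤ 1 / 9 := by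
      rw [div_pow, div_le_div_iff₀ (by positivity) (by norm_num)]
      push_cast
      nlinarith [(Nat.cast_nonneg j : (0 : ℝ) ≤ j)]
    rw [pow_one, sq]
    exact mul_le_mul_of_nonneg_right h1 (by positivity)
  norm_num at h this ⊢
  linarith

theorem row_sum_le {θ : ℝ} (h0 : 0 ≤ θ) (h1 : θ ≤ 1 / 28) {r d N : ℕ} (hN : 5 ≤ N) {s : ℝ} (hs : 0 < s)
    {Ξ : Fin r → Fin d → ℝ} (hsep : Sep s N Ξ) {G T : ℝ}
    (hG : TailBound (fun u => |kap θ N u|) N s (s / 2) G)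
    (hT : TailBound (fun u => |kap θ N u|) N s s T) (l : Fin r) :
    ∑ m ∈ Finset.univ.erase l, |∏ i, kap θ N (Ξ l i - Ξ m i)| ≤
      d * ((T + T) * (1 + 2 * G) ^ (d - 1)) := by
  obtain ⟨g, hg0, hg, hgG⟩ := hG
  obtain ⟨t, ht0, ht, htT⟩ := hT
  simp only [Finset.abs_prod]
  exact threshold_sum_le hs hsep l (Y := Ξ l) (δ := 0) (fun i => by simp)
    (a := fun u => |kap θ N u|) (fun _ => abs_nonneg _) (fun u => abs_kap_le_one h0 h1 hN u)
    (fun u => abs_kap_red θ (by omega) u) (by omega) hg hg0 hgG ht ht0 htT (by simpa using ht) ht0 htT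

theorem sq_sum_le {θ : ℝ} (h0 : 0 ≤ θ) (h1 : θ ≤ 1 / 28) {r d N : ℕ} (hN : 5 ≤ N) {s δ : ℝ} (hs : 0 < s)
    {Ξ : Fin r → Fin d → ℝ} (hsep : Sep s N Ξ) {l₀ : Fin r} {Y : Fin d → ℝ}
    (hY : ∀ i, |Y i - Ξ l₀ i| ≤ δ) {G T₁ T₂ : ℝ}
    (hG : TailBound (fun u => kap θ N u ^ 2) N s (s / 2) G)
    (hT₁ : TailBound (fun u => kap θ N u ^ 2) N s s T₁)
    (hT₂ : TailBound (fun u => kap θ N u ^ 2) N s (s - δ) T₂) :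
    ∑ l ∈ Finset.univ.erase l₀, (∏ i, kap θ N (Y i - Ξ l i)) ^ 2 ≤
      d * ((T₁ + T₂) * (1 + 2 * G) ^ (d - 1)) := by
  obtain ⟨g, hg0, hg, hgG⟩ := hG
  obtain ⟨t, ht0, ht, htT⟩ := hT₁
  obtain ⟨t', ht0', ht', htT'⟩ := hT₂
  simp only [← Finset.prod_pow]
  exact threshold_sum_le hs hsep l₀ (Y := Y) (δ := δ) hY
    (a := fun u => kap θ N u ^ 2) (fun _ => sq_nonneg _)
    (fun u => by rw [← sq_abs]; exact pow_le_one₀ (abs_nonneg _) (abs_kap_le_one h0 h1 hN u))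
    (fun u => by rw [← sq_abs, abs_kap_red θ (by omega) u, sq_abs]) (by omega) hg hg0 hgG ht ht0 htT
    ht' ht0' htT'

/-- Real coordinates, in units of `1 / (n + 1)`, for a point `x` at distance `δ` from the node `ξ l₀`
of a family of nodes with pairwise distances at least `s`. -/
structure IsConfig {d r : ℕ} (n : ℕ) (ξ : Fin r → UnitAddTorus (Fin d)) (x : UnitAddTorus (Fin d))
    (s δ : ℝ) (l₀ : Fin r) (X : Fin d → ℝ) (Ξ : Fin r → Fin d → ℝ) : Prop where
  coe_left : ∀ i, ((X i / ((n : ℝ) + 1) : ℝ) : UnitAddCircle) = x i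
  coe_right : ∀ l i, ((Ξ l i / ((n : ℝ) + 1) : ℝ) : UnitAddCircle) = ξ l i
  sep : Sep s (n + 1) Ξ
  near : ∀ i, |X i - Ξ l₀ i| ≤ δ
  attained : ∃ i, |X i - Ξ l₀ i| = δ

/-- The residual at a node l ≠ l₀ is K_l - K M_{l₀ l}. Minkowski splits its ℓ² norm into the kernel
values seen from x, bounded by A, and K times those seen from the nearest node, bounded by B. -/
theorem energy_bound {d r n : ℕ} (w : Fin r → ℂ) {ξ : Fin r → UnitAddTorus (Fin d)}
    (S : SVD ((n + 1) ^ d) (momentMatrix (discreteMeasure w ξ) n)) {x : UnitAddTorus (Fin d)}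
    {s δ : ℝ} {l₀ : Fin r} {X : Fin d → ℝ} {Ξ : Fin r → Fin d → ℝ} (hC : IsConfig n ξ x s δ l₀ X Ξ)
    (hs : 0 < s) {θ ω lam : ℝ} (h0 : 0 ≤ θ) (h1 : θ ≤ 1 / 28) (hN : 5 ≤ n + 1)
    (hω : ∀ k, wt θ (n + 1) k ≤ ω / (n + 1 : ℕ)) (hω0 : 0 ≤ ω) (hl : 0 < lam)
    (hrow : ∀ l, ∑ m ∈ Finset.univ.erase l, |∏ i, kap θ (n + 1) (Ξ l i - Ξ m i)| ≤ 1 - lam)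
    {G T₁ T₂ A B K : ℝ} (hA : 0 ≤ A) (hB : 0 ≤ B)
    (hG : TailBound (fun u => kap θ (n + 1) u ^ 2) (n + 1) s (s / 2) G)
    (hT₁ : TailBound (fun u => kap θ (n + 1) u ^ 2) (n + 1) s s T₁)
    (hT₂ : TailBound (fun u => kap θ (n + 1) u ^ 2) (n + 1) s (s - δ) T₂)
    (hkk : d * ((T₁ + T₂) * (1 + 2 * G) ^ (d - 1)) ≤ A ^ 2)
    (hmm : d * ((T₁ + T₁) * (1 + 2 * G) ^ (d - 1)) ≤ B ^ 2)
    (hK : |∏ i, kap θ (n + 1) (X i - Ξ l₀ i)| ≤ K) :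
    1 - (∏ i, kap θ (n + 1) (X i - Ξ l₀ i)) ^ 2 - (A + K * B) ^ 2 / lam ≤ ω ^ d * (1 - signalFun S x) := by
  have hK0 : 0 ≤ K := (abs_nonneg _).trans hK
  refine sub_le_mul_one_sub_signalFun w ξ S x hC.coe_left hC.coe_right h0 h1 hN hω hω0 hl hrow l₀ ?_
  have ha := (sq_sum_le h0 h1 hN hs hC.sep hC.near hG hT₁ hT₂).trans hkk
  have hb := (sq_sum_le h0 h1 hN hs hC.sep (l₀ := l₀) (Y := Ξ l₀) (δ := 0) (fun i => by simp) hG hT₁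
    (by simpa using hT₁)).trans hmm
  simp only [sub_eq_add_neg _ (_ * _)]
  refine sum_add_sq_le _ hA (mul_nonneg hK0 hB) ha ?_
  have : ∀ l, (-((∏ i, kap θ (n + 1) (X i - Ξ l₀ i)) * ∏ i, kap θ (n + 1) (Ξ l₀ i - Ξ l i))) ^ 2 ≤
      K ^ 2 * (∏ i, kap θ (n + 1) (Ξ l₀ i - Ξ l i)) ^ 2 := by
    intro l
    rw [neg_sq, mul_pow, ← sq_abs (∏ i, kap θ (n + 1) (X i - Ξ l₀ i))]
    exact mul_le_mul_of_nonneg_right (pow_le_pow_left₀ (abs_nonneg _) hK 2) (sq_nonneg _)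
  refine (Finset.sum_le_sum fun l _ => this l).trans ?_
  rw [← Finset.mul_sum, mul_pow]
  exact mul_le_mul_of_nonneg_left hb (sq_nonneg _)

theorem abs_prod_kap_le {θ : ℝ} (h0 : 0 ≤ θ) (h1 : θ ≤ 1 / 28) {d N : ℕ} (hN : 5 ≤ N) {v : Fin d → ℝ}
    (i : Fin d) : |∏ j, kap θ N (v j)| ≤ |kap θ N (v i)| := by
  rw [Finset.abs_prod, ← Finset.mul_prod_erase Finset.univ _ (Finset.mem_univ i)]
  exact mul_le_of_le_one_right (abs_nonneg _)
    (Finset.prod_le_one (fun _ _ => abs_nonneg _) fun j _ => abs_kap_le_one h0 h1 hN _)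

theorem IsConfig.abs_prod_kap_le {d r n : ℕ} {ξ : Fin r → UnitAddTorus (Fin d)} {x : UnitAddTorus (Fin d)}
    {s δ : ℝ} {l₀ : Fin r} {X : Fin d → ℝ} {Ξ : Fin r → Fin d → ℝ} (hC : IsConfig n ξ x s δ l₀ X Ξ)
    {θ : ℝ} (h0 : 0 ≤ θ) (h1 : θ ≤ 1 / 28) (hN : 5 ≤ n + 1) :
    |∏ i, kap θ (n + 1) (X i - Ξ l₀ i)| ≤ |kap θ (n + 1) δ| := by
  obtain ⟨i, hi⟩ := hC.attained
  refine (TrigMoment.abs_prod_kap_le h0 h1 hN i).trans (le_of_eq ?_)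
  rw [← hi, kap_abs]

theorem one_add_pow_le_exp {y : ℝ} (hy : 0 ≤ 1 + y) (k : ℕ) : (1 + y) ^ k ≤ Real.exp (k * y) := by
  rw [Real.exp_nat_mul]
  exact pow_le_pow_left₀ hy (by linarith [Real.add_one_le_exp y]) k

theorem exp_le_inv_one_sub {y : ℝ} (hy : y < 1) : Real.exp y ≤ 1 / (1 - y) := by
  have h := Real.add_one_le_exp (-y)
  rw [Real.exp_neg] at h
  rw [le_div_iff₀ (by linarith)]
  have := Real.exp_pos y
  calc Real.exp y * (1 - y) ≤ Real.exp y * (Real.exp y)⁻¹ := by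
        refine mul_le_mul_of_nonneg_left (by linarith) this.le
    _ = 1 := mul_inv_cancel₀ this.ne'

/-- The powers `(1 + y / d ^ 2) ^ (d - 1)` are bounded. -/
theorem one_add_div_sq_pow_le {y : ℝ} (hy : 0 ≤ y) (hy4 : y < 4) {d : ℕ} (hd : 1 ≤ d) :
    (1 + y / (d : ℝ) ^ 2) ^ (d - 1) ≤ 1 / (1 - y / 4) := by
  refine (one_add_pow_le_exp (by positivity) _).trans
    ((Real.exp_le_exp.2 ?_).trans (exp_le_inv_one_sub (by linarith)))
  have hd' : (1 : ℝ) ≤ d := by exact_mod_cast hd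
  rw [Nat.cast_sub hd, ← mul_div_assoc, div_le_div_iff₀ (by positivity) (by norm_num)]
  push_cast
  nlinarith [mul_nonneg hy (sq_nonneg ((d : ℝ) - 2))]

theorem sum_sq_two_le (n : ℕ) : ∑ j ∈ Finset.range n, (((2 : ℝ) / ((j : ℝ) + 2)) ^ 2) ^ 1 ≤ 8 / 3 := by
  have h := sum_sq_one_le (n + 1)
  rw [Finset.sum_range_succ'] at h
  have : ∑ j ∈ Finset.range n, (((2 : ℝ) / ((j : ℝ) + 2)) ^ 2) ^ 1 =
      4 * ∑ j ∈ Finset.range n, (((1 : ℝ) / (((j + 1 : ℕ) : ℝ) + 1)) ^ 2) ^ 1 := by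
    rw [Finset.mul_sum]
    refine Finset.sum_congr rfl fun j _ => ?_
    push_cast
    rw [pow_one, pow_one, div_pow, div_pow, show (j : ℝ) + 1 + 1 = j + 2 by ring]; ring
  rw [this]
  norm_num at h ⊢
  linarith

theorem sum_sq_three_half_le (n : ℕ) :
    ∑ j ∈ Finset.range n, (((3 / 2 : ℝ) / ((j : ℝ) + 3 / 2)) ^ 2) ^ 1 ≤ 9 / 4 := by
  have h := sum_one_div_add_three_half_sq_le n
  have : ∑ j ∈ Finset.range n, (((3 / 2 : ℝ) / ((j : ℝ) + 3 / 2)) ^ 2) ^ 1 =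
      9 / 4 * ∑ j ∈ Finset.range n, 1 / ((j : ℝ) + 3 / 2) ^ 2 := by
    rw [Finset.mul_sum]
    refine Finset.sum_congr rfl fun j _ => ?_
    rw [pow_one, div_pow]; ring
  rw [this]
  linarith

theorem sum_pow_four_three_half_le (n : ℕ) :
    ∑ j ∈ Finset.range n, (((3 / 2 : ℝ) / ((j : ℝ) + 3 / 2)) ^ 2) ^ 2 ≤ 9 / 4 := by
  refine (Finset.sum_le_sum fun j _ => ?_).trans (sum_sq_three_half_le n)
  have : (3 / 2 : ℝ) / ((j : ℝ) + 3 / 2) ≤ 1 := by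
    rw [div_le_one (by positivity)]; linarith [(j.cast_nonneg : (0 : ℝ) ≤ j)]
  exact pow_le_pow_of_le_one (by positivity) (pow_le_one₀ (by positivity) this) (by norm_num)

theorem sqrt_pos_of_one_le {d : ℕ} (hd : 1 ≤ d) : 0 < √(d : ℝ) :=
  Real.sqrt_pos.2 (by exact_mod_cast hd)

/-! ### Tails and row sums at separation 2√d -/

theorem tailBound_kap {N : ℕ} (hN : 5 ≤ N) {s A c S : ℝ} (hA : 2 ≤ A) (hc : 0 < c) (hAs : A ≤ c * s)
    (hS : ∀ n, ∑ j ∈ Finset.range n, ((c / ((j : ℝ) + c)) ^ 2) ^ 1 ≤ S) :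
    TailBound (fun u => |kap (1 / 28) N u|) N s A (S / (3 * A ^ 2 - 3)) := by
  have h := tailBound_of_le (a := fun u => |kap (1 / 28) N u|) (N := N) (p := 1) (h := 1) (α := 3)
    (β := 3) (by linarith : 0 < A) hc hAs (by norm_num) (by nlinarith) zero_le_one
    (fun u hu hAu => ?_) hS
  · simpa using h
  · refine (abs_kap_le_far hN hu (hA.trans hAu)).trans (le_of_eq ?_)
    rw [pow_one]; congr 1; ring

theorem tailBound_kap_sq {N : ℕ} (hN : 5 ≤ N) {s A c S : ℝ} (hA : 2 ≤ A) (hc : 0 < c) (hAs : A ≤ c * s)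
    (hS : ∀ n, ∑ j ∈ Finset.range n, ((c / ((j : ℝ) + c)) ^ 2) ^ 2 ≤ S) :
    TailBound (fun u => kap (1 / 28) N u ^ 2) N s A (S / (3 * A ^ 2 - 3) ^ 2) := by
  have h := tailBound_of_le (a := fun u => kap (1 / 28) N u ^ 2) (N := N) (p := 2) (h := 1) (α := 3)
    (β := 3) (by linarith : 0 < A) hc hAs (by norm_num) (by nlinarith) zero_le_one
    (fun u hu hAu => ?_) hS
  · simpa using h
  · rw [← sq_abs (kap _ _ _)]
    refine (pow_le_pow_left₀ (abs_nonneg _) (abs_kap_le_far hN hu (hA.trans hAu)) 2).trans (le_of_eq ?_)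
    rw [div_pow, one_pow]; congr 2; ring

theorem tailBound_ker {N : ℕ} (hN : 5 ≤ N) {s A c S : ℝ} (hA0 : 0 < A) (hA : 1 < 4 * A ^ 2) (hc : 0 < c)
    (hAs : A ≤ c * s) (hS : ∀ n, ∑ j ∈ Finset.range n, ((c / ((j : ℝ) + c)) ^ 2) ^ 1 ≤ S) :
    TailBound (fun u => |kap 0 N u|) N s A (S / (4 * A ^ 2 - 1)) := by
  have h := tailBound_of_le (a := fun u => |kap 0 N u|) (N := N) (p := 1) (h := 1) (α := 4)
    (β := 1) hA0 hc hAs (by norm_num) hA zero_le_one (fun u hu hAu => ?_) hS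
  · simpa using h
  · rw [kap_zero_left, pow_one]
    refine abs_ker_one_le hN hu (hA.trans_le ?_)
    rw [← sq_abs u]
    linarith [pow_le_pow_left₀ hA0.le hAu 2]

theorem tailBound_ker_sq {N : ℕ} (hN : 5 ≤ N) {s A c S : ℝ} (hA0 : 0 < A) (hA : 1 < 4 * A ^ 2) (hc : 0 < c)
    (hAs : A ≤ c * s) (hS : ∀ n, ∑ j ∈ Finset.range n, ((c / ((j : ℝ) + c)) ^ 2) ^ 2 ≤ S) :
    TailBound (fun u => kap 0 N u ^ 2) N s A (S / (4 * A ^ 2 - 1) ^ 2) := by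
  have h := tailBound_of_le (a := fun u => kap 0 N u ^ 2) (N := N) (p := 2) (h := 1) (α := 4)
    (β := 1) hA0 hc hAs (by norm_num) hA zero_le_one (fun u hu hAu => ?_) hS
  · simpa using h
  · rw [kap_zero_left, ← sq_abs (ker _ _ _ _), ← _root_.one_div_pow]
    refine pow_le_pow_left₀ (abs_nonneg _) (abs_ker_one_le hN hu (hA.trans_le ?_)) 2
    rw [← sq_abs u]
    linarith [pow_le_pow_left₀ hA0.le hAu 2]

theorem two_mul_sqrt_sq (d : ℕ) : (2 * √(d : ℝ)) ^ 2 = 4 * d := by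
  rw [mul_pow, Real.sq_sqrt d.cast_nonneg]; norm_num

theorem row_sum_ker_le {r d N : ℕ} (hN : 5 ≤ N) (hd : 1 ≤ d) {Ξ : Fin r → Fin d → ℝ}
    (hsep : Sep (2 * √(d : ℝ)) N Ξ) (l : Fin r) :
    ∑ m ∈ Finset.univ.erase l, |∏ i, kap 0 N (Ξ l i - Ξ m i)| ≤
      d * (10 / 3 / (16 * d - 1) * (1 + 5 / 2 / (4 * d - 1)) ^ (d - 1)) := by
  have hs := sqrt_pos_of_one_le hd
  have hsq := two_mul_sqrt_sq d
  have hd' : (1 : ℝ) ≤ d := by exact_mod_cast hd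
  have hG := tailBound_ker hN (s := 2 * √(d : ℝ)) (A := 2 * √(d : ℝ) / 2) (c := 1 / 2) (by positivity)
    (by rw [div_pow, hsq]; linarith) (by norm_num) (by linarith) sum_sq_half_le
  have hT := tailBound_ker hN (s := 2 * √(d : ℝ)) (A := 2 * √(d : ℝ)) (c := 1) (by positivity)
    (by rw [hsq]; linarith) (by norm_num) (by linarith) sum_sq_one_le
  refine (row_sum_le le_rfl (by norm_num) hN (by positivity) hsep hG hT l).trans (le_of_eq ?_)
  rw [div_pow, hsq, show (4 : ℝ) * (4 * d / 2 ^ 2) - 1 = 4 * d - 1 by ring,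
    show (4 : ℝ) * (4 * d) - 1 = 16 * d - 1 by ring]
  congr 2
  · ring
  · congr 1; ring

/-- Values of the improved kernel. -/
theorem abs_kap_le_frac {N : ℕ} (hN : 5 ≤ N) {u : ℝ} (h0 : 1 / 2 < u) (h1 : u ≤ 1.3) :
    |kap (1 / 28) N u| ≤ 27 / 28 * ((3 / 2 - u) / (1 / 2 + u)) := by
  have hN' : (5 : ℝ) ≤ N := by exact_mod_cast hN
  have h2 := kap_mid hN h0.le (by linarith)
  have h3 := (ker_one_le_mid hN h0 (by linarith)).2
  have hp := Real.pi_lt_d4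
  have hc := cos_pi_mul_nonpos h0.le (by linarith)
  have hc2 := cos_pi_mul_div_nonneg hN (u := u) (by rw [abs_of_nonneg (by linarith)]; linarith)
  rw [abs_le]
  constructor
  · refine le_trans (neg_le_neg ?_) h2.2
    rw [← mul_div_assoc, div_le_div_iff₀ (by linarith) (by linarith)]
    nlinarith
  · nlinarith [mul_nonneg (neg_nonneg.2 hc) hc2]

/-- Close to u = 1 the third harmonic contributes at most -0.95 · 0.761 / 28, a gain of 0.0258 that
is kept here. It is used for δ near 1 in dimension one. -/
theorem abs_kap_le_near {N : ℕ} (hN : 5 ≤ N) {u : ℝ} (h0 : 0.9 ≤ u) (h1 : u ≤ 1.1) :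
    |kap (1 / 28) N u| ≤ 27 / 28 * ((3 / 2 - u) / (1 / 2 + u)) - 0.0258 := by
  have hN' : (5 : ℝ) ≤ N := by exact_mod_cast hN
  have h2 := kap_mid hN (by linarith : 1 / 2 ≤ u) (by linarith)
  have h3 := (ker_one_le_mid hN (by linarith : 1 / 2 < u) (by linarith)).2
  have hp := Real.pi_lt_d4
  have hp1 := Real.pi_pos
  have hc : Real.cos (Real.pi * u) ≤ -0.95 := by
    have e : Real.cos (Real.pi * u) = -Real.cos (Real.pi * (1 - u)) := by
      rw [← Real.cos_pi_sub]; congr 1; ring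
    have := Real.one_sub_sq_div_two_le_cos (x := Real.pi * (1 - u))
    rw [e]
    have h5 : (Real.pi * (1 - u)) ^ 2 ≤ 0.3142 ^ 2 := by
      rw [sq_le_sq, abs_of_pos (by norm_num : (0 : ℝ) < 0.3142), abs_le]
      constructor <;> nlinarith
    linarith
  have hc2 : 0.761 ≤ Real.cos (Real.pi * u / N) := by
    have := Real.one_sub_sq_div_two_le_cos (x := Real.pi * u / N)
    have h5 : Real.pi * u / N ≤ 0.6912 := by
      rw [div_le_iff₀ (by linarith)]; nlinarith
    have h6 : (Real.pi * u / N) ^ 2 ≤ 0.6912 ^ 2 :=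
      pow_le_pow_left₀ (by positivity) h5 2
    linarith
  rw [abs_le]
  constructor
  · refine le_trans ?_ h2.2
    have h5 : 9 * Real.pi / 112 / (u + 3 / 2) ≤ 0.106 := by
      rw [div_le_iff₀ (by linarith)]; nlinarith
    have h6 : 0.25 ≤ (3 / 2 - u) / (1 / 2 + u) := by
      rw [le_div_iff₀ (by linarith)]; linarith
    linarith
  · nlinarith

/-- The fractional majorant decreases in u, so its value at A serves up to 1.3; from there on the
constant 0.135 takes over. -/
theorem abs_kap_le_of_frac {N : ℕ} (hN : 5 ≤ N) {A h : ℝ} (h0 : 1 / 2 < A)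
    (hA : 27 / 28 * ((3 / 2 - A) / (1 / 2 + A)) ≤ h) (hh : 0.135 ≤ h) {u : ℝ} (hu : |u| ≤ N / 2)
    (hAu : A ≤ |u|) : |kap (1 / 28) N u| ≤ h := by
  rcases le_or_gt 1.3 |u| with h2 | h2
  · exact (abs_kap_le_const hN hu h2).trans hh
  · rw [← kap_abs]
    refine (abs_kap_le_frac hN (h0.trans_le hAu) h2.le).trans (le_trans ?_ hA)
    refine mul_le_mul_of_nonneg_left ?_ (by norm_num)
    rw [div_le_div_iff₀ (by linarith) (by linarith)]
    nlinarith

theorem abs_kap_le_of_near {N : ℕ} (hN : 5 ≤ N) {A h : ℝ} (h0 : 0.9 ≤ A)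
    (hA : 27 / 28 * ((3 / 2 - A) / (1 / 2 + A)) - 0.0258 ≤ h) (hh : 0.2412 ≤ h) {u : ℝ}
    (hu : |u| ≤ N / 2) (hAu : A ≤ |u|) : |kap (1 / 28) N u| ≤ h := by
  rcases le_or_gt 1.1 |u| with h2 | h2
  · refine abs_kap_le_of_frac hN (A := 1.1) (by norm_num) (le_trans ?_ hh) (by linarith) hu h2
    norm_num
  · rw [← kap_abs]
    refine (abs_kap_le_near hN (h0.trans hAu) h2.le).trans (le_trans ?_ hA)
    refine sub_le_sub_right (mul_le_mul_of_nonneg_left ?_ (by norm_num)) _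
    rw [div_le_div_iff₀ (by linarith) (by linarith)]
    nlinarith

theorem abs_kap_le_of_mid {N : ℕ} (hN : 5 ≤ N) {A h : ℝ} (h0 : 1 / 2 ≤ A)
    (hA : 0.7575 * (3 / 2 - A) ≤ h) (hh : 0.135 ≤ h) {u : ℝ} (hu : |u| ≤ N / 2)
    (hAu : A ≤ |u|) : |kap (1 / 28) N u| ≤ h := by
  rcases le_or_gt 1.3 |u| with h2 | h2
  · exact (abs_kap_le_const hN hu h2).trans hh
  · rw [← kap_abs]
    exact (abs_kap_le_mid hN (h0.trans hAu) (by linarith)).trans (by linarith)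

theorem sq_le_of_abs_le {a b : ℝ} (h : |a| ≤ b) : a ^ 2 ≤ b ^ 2 := by
  rw [← sq_abs]; exact pow_le_pow_left₀ (abs_nonneg _) h 2

section Window

variable {r d N : ℕ}

theorem tailBound_kap_sep (hN : 5 ≤ N) (hd : 1 ≤ d) :
    TailBound (fun u => |kap (1 / 28) N u|) N (2 * √(d : ℝ)) (2 * √(d : ℝ))
      (1 / (12 * d - 3) + 8 / 3 / (48 * d - 3)) := by
  have hs := sqrt_pos_of_one_le hd
  have hsq := two_mul_sqrt_sq d
  have hd' : (1 : ℝ) ≤ d := by exact_mod_cast hd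
  have h2 : 2 ≤ 2 * √(d : ℝ) := by nlinarith [Real.one_le_sqrt.2 hd']
  refine TailBound.cons (by
    have : (0 : ℝ) < 12 * d - 3 := by linarith
    positivity) (fun u hu h => ?_) ?_
  · refine (abs_kap_le_far hN hu (h2.trans h)).trans ?_
    have := pow_le_pow_left₀ (by positivity) h 2
    rw [hsq, sq_abs] at this
    exact div_le_div_of_nonneg_left zero_le_one (by linarith) (by linarith)
  · have h := tailBound_kap hN (s := 2 * √(d : ℝ)) (A := 2 * √(d : ℝ) + 2 * √(d : ℝ)) (c := 2)
      (by linarith) (by norm_num) (by linarith) sum_sq_two_le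
    rwa [show (3 : ℝ) * (2 * √(d : ℝ) + 2 * √(d : ℝ)) ^ 2 - 3 = 12 * (2 * √(d : ℝ)) ^ 2 - 3 by ring, hsq,
      show (12 : ℝ) * (4 * d) - 3 = 48 * d - 3 by ring] at h

theorem tailBound_kap_half (hN : 5 ≤ N) (hd : 2 ≤ d) :
    TailBound (fun u => |kap (1 / 28) N u|) N (2 * √(d : ℝ)) (2 * √(d : ℝ) / 2)
      (0.135 + 9 / 4 / (27 * d - 3)) := by
  have hd' : (2 : ℝ) ≤ d := by exact_mod_cast hd
  have hs : 1.4 ≤ √(d : ℝ) := Real.le_sqrt_of_sq_le (by norm_num; linarith)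
  refine TailBound.cons (by norm_num) (fun u hu h => abs_kap_le_const hN hu (by linarith)) ?_
  have h := tailBound_kap hN (s := 2 * √(d : ℝ)) (A := 2 * √(d : ℝ) / 2 + 2 * √(d : ℝ)) (c := 3 / 2)
    (by linarith) (by norm_num) (by linarith) sum_sq_three_half_le
  rwa [show (3 : ℝ) * (2 * √(d : ℝ) / 2 + 2 * √(d : ℝ)) ^ 2 - 3 = 27 * √(d : ℝ) ^ 2 - 3 by ring,
    Real.sq_sqrt d.cast_nonneg] at h

theorem tailBound_kap_sq_sep (hN : 5 ≤ N) (hd : 1 ≤ d) :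
    TailBound (fun u => kap (1 / 28) N u ^ 2) N (2 * √(d : ℝ)) (2 * √(d : ℝ)) (7 / 6 / (12 * d - 3) ^ 2) := by
  have hsq := two_mul_sqrt_sq d
  have hd' : (1 : ℝ) ≤ d := by exact_mod_cast hd
  have h := tailBound_kap_sq hN (s := 2 * √(d : ℝ)) (A := 2 * √(d : ℝ)) (c := 1)
    (by nlinarith [Real.one_le_sqrt.2 hd']) (by norm_num) (by linarith) sum_pow_four_one_le
  rwa [hsq, show (3 : ℝ) * (4 * d) - 3 = 12 * d - 3 by ring] at h

/-- A bound for the first cell gives a tail bound beyond half the separation. -/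
theorem tailBound_kap_sq_cons (hN : 5 ≤ N) (hd : 1 ≤ d) {A h : ℝ} (hA : √(d : ℝ) ≤ A)
    (hh : ∀ u : ℝ, |u| ≤ N / 2 → A ≤ |u| → |kap (1 / 28) N u| ≤ h) :
    TailBound (fun u => kap (1 / 28) N u ^ 2) N (2 * √(d : ℝ)) A (h ^ 2 + 9 / 4 / (27 * d - 3) ^ 2) := by
  have hd' : (1 : ℝ) ≤ d := by exact_mod_cast hd
  have hs := Real.one_le_sqrt.2 hd'
  refine TailBound.cons (sq_nonneg _) (fun u hu h => sq_le_of_abs_le (hh u hu h)) ?_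
  have h := tailBound_kap_sq hN (s := 2 * √(d : ℝ)) (A := √(d : ℝ) + 2 * √(d : ℝ)) (c := 3 / 2)
    (by linarith) (by norm_num) (by linarith) sum_pow_four_three_half_le
  rw [show (3 : ℝ) * (√(d : ℝ) + 2 * √(d : ℝ)) ^ 2 - 3 = 27 * √(d : ℝ) ^ 2 - 3 by ring,
    Real.sq_sqrt d.cast_nonneg] at h
  exact h.mono (by linarith) le_rfl

theorem tailBound_kap_sq_of_two_le (hN : 5 ≤ N) {s A : ℝ} (hA : 2 ≤ A) (hAs : A ≤ s) :
    TailBound (fun u => kap (1 / 28) N u ^ 2) N s A (7 / 6 / (3 * A ^ 2 - 3) ^ 2) :=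
  tailBound_kap_sq hN hA one_pos (by linarith) sum_pow_four_one_le

end Window

/-- For δ between b' and b every quantity is replaced by its worst endpoint: the central kernel by
its bound beyond b', the tail threshold s - δ by s - b, and Rδ² by Rb². The range of δ is covered by
finitely many such intervals. -/
theorem mul_sq_le_of_energy {d r n : ℕ} (w : Fin r → ℂ) {ξ : Fin r → UnitAddTorus (Fin d)}
    (S : SVD ((n + 1) ^ d) (momentMatrix (discreteMeasure w ξ) n)) {x : UnitAddTorus (Fin d)}
    {δ : ℝ} {l₀ : Fin r} {X : Fin d → ℝ} {Ξ : Fin r → Fin d → ℝ} (hd : 1 ≤ d)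
    (hC : IsConfig n ξ x (2 * √(d : ℝ)) δ l₀ X Ξ) (hδ : 0 ≤ δ) (hδN : δ ≤ ((n + 1 : ℕ) : ℝ) / 2)
    {lam : ℝ} (hN : 5 ≤ n + 1) (hl : 0 < lam)
    (hrow : ∀ l, ∑ m ∈ Finset.univ.erase l, |∏ i, kap (1 / 28) (n + 1) (Ξ l i - Ξ m i)| ≤ 1 - lam)
    {G T₂ A B K b b' R : ℝ}
    (hG : TailBound (fun u => kap (1 / 28) (n + 1) u ^ 2) (n + 1) (2 * √(d : ℝ)) (2 * √(d : ℝ) / 2) G)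
    (hT₂ : TailBound (fun u => kap (1 / 28) (n + 1) u ^ 2) (n + 1) (2 * √(d : ℝ)) (2 * √(d : ℝ) - b) T₂)
    (hb : b' ≤ δ ∧ δ ≤ b)
    (hK : ∀ u : ℝ, |u| ≤ ((n + 1 : ℕ) : ℝ) / 2 → b' ≤ |u| → |kap (1 / 28) (n + 1) u| ≤ K)
    (hA : 0 ≤ A) (hB : 0 ≤ B) (hR : 0 ≤ R)
    (hkk : d * ((7 / 6 / (12 * d - 3) ^ 2 + T₂) * (1 + 2 * G) ^ (d - 1)) ≤ A ^ 2)
    (hmm : d * ((7 / 6 / (12 * d - 3) ^ 2 + 7 / 6 / (12 * d - 3) ^ 2) * (1 + 2 * G) ^ (d - 1)) ≤ B ^ 2)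
    (hfin : R * b ^ 2 ≤ 1 - K ^ 2 - (A + K * B) ^ 2 / lam) :
    R * δ ^ 2 ≤ (3 * Real.pi / 7) ^ d * (1 - signalFun S x) := by
  have hs := sqrt_pos_of_one_le hd
  have hK' : |kap (1 / 28) (n + 1) δ| ≤ K := hK δ (by rwa [abs_of_nonneg hδ]) (by
    rw [abs_of_nonneg hδ]; exact hb.1)
  have hKK := (hC.abs_prod_kap_le (by norm_num) le_rfl hN).trans hK'
  have h := energy_bound w S hC (by positivity) (by norm_num) le_rfl hN (wt_le hN)
    (by positivity) hl hrow hA hB hG (tailBound_kap_sq_sep hN hd) (hT₂.mono (by linarith [hb.2]) le_rfl)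
    hkk hmm hKK
  have h2 := sq_le_of_abs_le hKK
  have h3 := mul_le_mul_of_nonneg_left (pow_le_pow_left₀ hδ hb.2 2) hR
  linarith

/-! ### The range δ ≥ 1/2 with the improved window -/

section Mid

variable {r n : ℕ} (w : Fin r → ℂ)

/-- The constant 0.6733 exceeds (1/2)(3π/7), the target constant for d = 1 times ω. The row sums are
at most 2(1/9 + 8/135) < 0.341, which gives lam = 0.659. In dimension one the factor containing G
has exponent 0, so the bound 1 for the first cell costs nothing. -/
theorem mid_one_of_mem_Icc {ξ : Fin r → UnitAddTorus (Fin 1)}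
    (S : SVD ((n + 1) ^ 1) (momentMatrix (discreteMeasure w ξ) n)) {x : UnitAddTorus (Fin 1)}
    {δ : ℝ} {l₀ : Fin r} {X : Fin 1 → ℝ} {Ξ : Fin r → Fin 1 → ℝ}
    (hC : IsConfig n ξ x (2 * √((1 : ℕ) : ℝ)) δ l₀ X Ξ) (hN : 5 ≤ n + 1) {b' b K h A : ℝ}
    (hb : b' ≤ δ ∧ δ ≤ b) (hb0 : 0 ≤ b') (hb1 : b ≤ 1)
    (hK : ∀ u : ℝ, |u| ≤ ((n + 1 : ℕ) : ℝ) / 2 → b' ≤ |u| → |kap (1 / 28) (n + 1) u| ≤ K)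
    (hh : ∀ u : ℝ, |u| ≤ ((n + 1 : ℕ) : ℝ) / 2 → 2 - b ≤ |u| → |kap (1 / 28) (n + 1) u| ≤ h)
    (hA0 : 0 ≤ A) (hA : h ^ 2 + 0.0184 ≤ A ^ 2)
    (hfin : 0.6733 * b ^ 2 ≤ 1 - K ^ 2 - (A + K * 0.17) ^ 2 / 0.659) :
    0.6733 * δ ^ 2 ≤ (3 * Real.pi / 7) ^ 1 * (1 - signalFun S x) := by
  have hN' : (5 : ℝ) ≤ ((n + 1 : ℕ) : ℝ) := by exact_mod_cast hN
  have e1 : √((1 : ℕ) : ℝ) = 1 := by simp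
  have hG1 : TailBound (fun u => |kap (1 / 28) (n + 1) u|) (n + 1) (2 * √((1 : ℕ) : ℝ))
      (2 * √((1 : ℕ) : ℝ) / 2) (1 + (1 / (12 * (1 : ℕ) - 3) + 8 / 3 / (48 * (1 : ℕ) - 3))) :=
    TailBound.cons zero_le_one (fun u _ _ => abs_kap_le_one (by norm_num) le_rfl hN u)
      ((tailBound_kap_sep hN le_rfl).mono (by rw [e1]; norm_num) le_rfl)
  have hG2 := tailBound_kap_sq_cons hN (d := 1) le_rfl (A := 2 * √((1 : ℕ) : ℝ) / 2) (h := 1)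
    (by rw [e1]; norm_num) (fun u _ _ => abs_kap_le_one (by norm_num) le_rfl hN u)
  refine mul_sq_le_of_energy w S le_rfl hC (hb0.trans hb.1) (by linarith [hb.2]) hN
    (lam := 0.659) (by norm_num) (fun l => ?_) hG2 (tailBound_kap_sq_cons hN (d := 1) le_rfl (h := h)
      (by rw [e1]; linarith) (by rw [e1]; simpa using hh)) hb hK hA0 (by norm_num) (by norm_num) ?_ ?_ hfin
  · refine (row_sum_le (by norm_num) le_rfl hN (by rw [e1]; norm_num) hC.sep hG1
      (tailBound_kap_sep hN le_rfl) l).trans ?_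
    norm_num
  · norm_num at hA ⊢; linarith
  · norm_num

/-- Another node may be as close as 2 - δ, so the situation tightens as δ approaches 1: the
intervals get shorter and the sharper bounds near u = 1 come in. -/
theorem mid_one {ξ : Fin r → UnitAddTorus (Fin 1)}
    (S : SVD ((n + 1) ^ 1) (momentMatrix (discreteMeasure w ξ) n)) {x : UnitAddTorus (Fin 1)}
    {δ : ℝ} {l₀ : Fin r} {X : Fin 1 → ℝ} {Ξ : Fin r → Fin 1 → ℝ}
    (hC : IsConfig n ξ x (2 * √((1 : ℕ) : ℝ)) δ l₀ X Ξ) (hN : 5 ≤ n + 1) (h0 : 1 / 2 ≤ δ) (h1 : δ ≤ 1) :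
    0.6733 * δ ^ 2 ≤ (3 * Real.pi / 7) ^ 1 * (1 - signalFun S x) := by
  rcases le_total δ 0.6 with h | h
  · exact mid_one_of_mem_Icc w S hC hN ⟨h0, h⟩ (by norm_num) (by norm_num)
      (fun u => abs_kap_le_of_mid hN (h := 0.7575) le_rfl (by norm_num) (by norm_num))
      (fun u hu hu' => abs_kap_le_const hN hu (by linarith)) (A := 0.1914)
      (by norm_num) (by norm_num) (by norm_num)
  rcases le_total δ 0.7 with h' | h'
  · exact mid_one_of_mem_Icc w S hC hN ⟨h, h'⟩ (by norm_num) (by norm_num)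
      (fun u => abs_kap_le_of_mid hN (h := 0.6818) (by norm_num) (by norm_num) (by norm_num))
      (fun u hu hu' => abs_kap_le_const hN hu (by linarith)) (A := 0.1914)
      (by norm_num) (by norm_num) (by norm_num)
  clear h
  rcases le_total δ 0.8 with h | h
  · exact mid_one_of_mem_Icc w S hC hN ⟨h', h⟩ (by norm_num) (by norm_num)
      (fun u => abs_kap_le_of_mid hN (h := 0.606) (by norm_num) (by norm_num) (by norm_num))
      (fun u => abs_kap_le_of_frac hN (h := 0.1702) (by norm_num) (by norm_num) (by norm_num))
      (A := 0.2177) (by norm_num) (by norm_num) (by norm_num)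
  clear h'
  rcases le_total δ 0.85 with h' | h'
  · exact mid_one_of_mem_Icc w S hC hN ⟨h, h'⟩ (by norm_num) (by norm_num)
      (fun u => abs_kap_le_of_frac hN (h := 0.5193) (by norm_num) (by norm_num) (by norm_num))
      (fun u => abs_kap_le_of_frac hN (h := 0.2046) (by norm_num) (by norm_num) (by norm_num))
      (A := 0.2455) (by norm_num) (by norm_num) (by norm_num)
  clear h
  rcases le_total δ 0.9 with h | h
  · exact mid_one_of_mem_Icc w S hC hN ⟨h', h⟩ (by norm_num) (by norm_num)
      (fun u => abs_kap_le_of_frac hN (h := 0.4643) (by norm_num) (by norm_num) (by norm_num))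
      (fun u => abs_kap_le_of_frac hN (h := 0.2412) (by norm_num) (by norm_num) (by norm_num))
      (A := 0.2768) (by norm_num) (by norm_num) (by norm_num)
  clear h'
  rcases le_total δ 0.95 with h' | h'
  · exact mid_one_of_mem_Icc w S hC hN ⟨h, h'⟩ (by norm_num) (by norm_num)
      (fun u => abs_kap_le_of_near hN (h := 0.3875) (by norm_num) (by norm_num) (by norm_num))
      (fun u => abs_kap_le_of_near hN (h := 0.2542) (by norm_num) (by norm_num) (by norm_num))
      (A := 0.2882) (by norm_num) (by norm_num) (by norm_num)
  clear h
  rcases le_total δ 0.98 with h | h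
  · exact mid_one_of_mem_Icc w S hC hN ⟨h', h⟩ (by norm_num) (by norm_num)
      (fun u => abs_kap_le_of_near hN (h := 0.34) (by norm_num) (by norm_num) (by norm_num))
      (fun u => abs_kap_le_of_near hN (h := 0.2788) (by norm_num) (by norm_num) (by norm_num))
      (A := 0.3101) (by norm_num) (by norm_num) (by norm_num)
  · exact mid_one_of_mem_Icc w S hC hN ⟨h, h1⟩ (by norm_num) (by norm_num)
      (fun u => abs_kap_le_of_near hN (h := 0.3131) (by norm_num) (by norm_num) (by norm_num))
      (fun u => abs_kap_le_of_near hN (h := 0.2957) (by norm_num) (by norm_num) (by norm_num))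
      (A := 0.3254) (by norm_num) (by norm_num) (by norm_num)

theorem row_sum_kap_le {d N : ℕ} (hN : 5 ≤ N) (hd : 2 ≤ d) {Ξ : Fin r → Fin d → ℝ}
    (hsep : Sep (2 * √(d : ℝ)) N Ξ) (l : Fin r) :
    ∑ m ∈ Finset.univ.erase l, |∏ i, kap (1 / 28) N (Ξ l i - Ξ m i)| ≤
      d * (((1 / (12 * d - 3) + 8 / 3 / (48 * d - 3)) + (1 / (12 * d - 3) + 8 / 3 / (48 * d - 3))) *
        (1 + 2 * (0.135 + 9 / 4 / (27 * d - 3))) ^ (d - 1)) :=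
  row_sum_le (by norm_num) le_rfl hN (by have := sqrt_pos_of_one_le (d := d) (by omega); positivity) hsep
    (tailBound_kap_half hN hd) (tailBound_kap_sep hN (by omega)) l

theorem tailBound_kap_sq_half {d N : ℕ} (hN : 5 ≤ N) (hd : 2 ≤ d) :
    TailBound (fun u => kap (1 / 28) N u ^ 2) N (2 * √(d : ℝ)) (2 * √(d : ℝ) / 2)
      (0.135 ^ 2 + 9 / 4 / (27 * d - 3) ^ 2) := by
  have hd' : (2 : ℝ) ≤ d := by exact_mod_cast hd
  have hs : 1.4 ≤ √(d : ℝ) := Real.le_sqrt_of_sq_le (by norm_num; linarith)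
  exact tailBound_kap_sq_cons hN (by omega) (by linarith)
    fun u hu h => abs_kap_le_const hN hu (by linarith)

theorem row_sum_two_le {N : ℕ} (hN : 5 ≤ N) {Ξ : Fin r → Fin 2 → ℝ}
    (hsep : Sep (2 * √((2 : ℕ) : ℝ)) N Ξ) (l : Fin r) :
    ∑ m ∈ Finset.univ.erase l, |∏ i, kap (1 / 28) N (Ξ l i - Ξ m i)| ≤ 1 - 0.585 := by
  refine (row_sum_kap_le hN le_rfl hsep l).trans ?_
  norm_num

theorem row_sum_three_le {N : ℕ} (hN : 5 ≤ N) {Ξ : Fin r → Fin 3 → ℝ}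
    (hsep : Sep (2 * √((3 : ℕ) : ℝ)) N Ξ) (l : Fin r) :
    ∑ m ∈ Finset.univ.erase l, |∏ i, kap (1 / 28) N (Ξ l i - Ξ m i)| ≤ 1 - 0.479 := by
  refine (row_sum_kap_le hN (by norm_num) hsep l).trans ?_
  norm_num

/-- The constant 0.5099 exceeds (9/32)(3π/7)², the target constant for d = 2 times ω². -/
theorem mid_two_of_mem_Icc {ξ : Fin r → UnitAddTorus (Fin 2)}
    (S : SVD ((n + 1) ^ 2) (momentMatrix (discreteMeasure w ξ) n)) {x : UnitAddTorus (Fin 2)}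
    {δ : ℝ} {l₀ : Fin r} {X : Fin 2 → ℝ} {Ξ : Fin r → Fin 2 → ℝ}
    (hC : IsConfig n ξ x (2 * √((2 : ℕ) : ℝ)) δ l₀ X Ξ) (hN : 5 ≤ n + 1) {b' b K A T₂ : ℝ}
    (hb : b' ≤ δ ∧ δ ≤ b) (hb0 : 1 / 2 ≤ b') (hb1 : b ≤ 1.35)
    (hK : 0.7575 * (3 / 2 - b') ≤ K) (hK' : 0.135 ≤ K)
    (hT₂ : TailBound (fun u => kap (1 / 28) (n + 1) u ^ 2) (n + 1) (2 * √((2 : ℕ) : ℝ))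
      (2 * √((2 : ℕ) : ℝ) - b) T₂) (hA0 : 0 ≤ A) (hA : 2.0764 * (0.0026456 + T₂) ≤ A ^ 2)
    (hfin : 0.5099 * b ^ 2 ≤ 1 - K ^ 2 - (A + K * 0.105) ^ 2 / 0.585) :
    0.5099 * δ ^ 2 ≤ (3 * Real.pi / 7) ^ 2 * (1 - signalFun S x) := by
  have hN' : (5 : ℝ) ≤ ((n + 1 : ℕ) : ℝ) := by exact_mod_cast hN
  refine mul_sq_le_of_energy w S (by norm_num) hC (by linarith [hb.1]) (by linarith [hb.2]) hN
    (lam := 0.585) (by norm_num) (row_sum_two_le hN hC.sep) (tailBound_kap_sq_half hN le_rfl) hT₂ hb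
    (fun u => abs_kap_le_of_mid hN hb0 hK hK') hA0 (by norm_num) (by norm_num) ?_ (by norm_num) hfin
  have := hT₂.nonneg
  norm_num at hA ⊢; linarith

theorem mid_two {ξ : Fin r → UnitAddTorus (Fin 2)}
    (S : SVD ((n + 1) ^ 2) (momentMatrix (discreteMeasure w ξ) n)) {x : UnitAddTorus (Fin 2)}
    {δ : ℝ} {l₀ : Fin r} {X : Fin 2 → ℝ} {Ξ : Fin r → Fin 2 → ℝ}
    (hC : IsConfig n ξ x (2 * √((2 : ℕ) : ℝ)) δ l₀ X Ξ) (hN : 5 ≤ n + 1) (h0 : 1 / 2 ≤ δ) (h1 : δ ≤ 1.3) :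
    0.5099 * δ ^ 2 ≤ (3 * Real.pi / 7) ^ 2 * (1 - signalFun S x) := by
  have hs : 1.4142 ≤ √((2 : ℕ) : ℝ) := Real.le_sqrt_of_sq_le (by norm_num)
  have hT1 : TailBound (fun u => kap (1 / 28) (n + 1) u ^ 2) (n + 1) (2 * √((2 : ℕ) : ℝ))
      (2 * √((2 : ℕ) : ℝ) - 0.8) 0.0134 :=
    (tailBound_kap_sq_of_two_le hN (s := 2 * √((2 : ℕ) : ℝ)) (A := 2.028) (by norm_num)
      (by linarith)).mono (by linarith) (by norm_num)
  have hT2 : TailBound (fun u => kap (1 / 28) (n + 1) u ^ 2) (n + 1) (2 * √((2 : ℕ) : ℝ))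
      (2 * √((2 : ℕ) : ℝ) - 1.3) 0.0191 :=
    (tailBound_kap_sq_half hN le_rfl).mono (by linarith) (by norm_num)
  rcases le_total δ 0.8 with h | h
  · rcases le_total δ 0.7 with h' | h'
    · exact mid_two_of_mem_Icc w S hC hN ⟨h0, h'⟩ le_rfl (by norm_num) (K := 0.7575) (by norm_num)
        (by norm_num) (hT1.mono (by linarith) le_rfl) (A := 0.1826) (by norm_num) (by norm_num) (by norm_num)
    · exact mid_two_of_mem_Icc w S hC hN ⟨h', h⟩ (by norm_num) (by norm_num) (K := 0.606) (by norm_num)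
        (by norm_num) hT1 (A := 0.1826) (by norm_num) (by norm_num) (by norm_num)
  rcases le_total δ 0.95 with h' | h'
  · exact mid_two_of_mem_Icc w S hC hN ⟨h, h'⟩ (by norm_num) (by norm_num) (K := 0.5303) (by norm_num)
      (by norm_num) (hT2.mono (by linarith) le_rfl) (A := 0.2125) (by norm_num) (by norm_num) (by norm_num)
  clear h
  rcases le_total δ 1.1 with h | h
  · exact mid_two_of_mem_Icc w S hC hN ⟨h', h⟩ (by norm_num) (by norm_num) (K := 0.4167) (by norm_num)
      (by norm_num) (hT2.mono (by linarith) le_rfl) (A := 0.2125) (by norm_num) (by norm_num) (by norm_num)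
  clear h'
  rcases le_total δ 1.2 with h' | h'
  · exact mid_two_of_mem_Icc w S hC hN ⟨h, h'⟩ (by norm_num) (by norm_num) (K := 0.303) (by norm_num)
      (by norm_num) (hT2.mono (by linarith) le_rfl) (A := 0.2125) (by norm_num) (by norm_num) (by norm_num)
  clear h
  rcases le_total δ 1.25 with h | h
  · exact mid_two_of_mem_Icc w S hC hN ⟨h', h⟩ (by norm_num) (by norm_num) (K := 0.2273) (by norm_num)
      (by norm_num) (hT2.mono (by linarith) le_rfl) (A := 0.2125) (by norm_num) (by norm_num) (by norm_num)
  · exact mid_two_of_mem_Icc w S hC hN ⟨h, h1⟩ (by norm_num) (by norm_num) (K := 0.1894) (by norm_num)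
      (by norm_num) hT2 (A := 0.2125) (by norm_num) (by norm_num) (by norm_num)

/-- The constant 0.2936 exceeds `gapConst 3` times (3π/7)³. -/
theorem mid_three_of_mem_Icc {ξ : Fin r → UnitAddTorus (Fin 3)}
    (S : SVD ((n + 1) ^ 3) (momentMatrix (discreteMeasure w ξ) n)) {x : UnitAddTorus (Fin 3)}
    {δ : ℝ} {l₀ : Fin r} {X : Fin 3 → ℝ} {Ξ : Fin r → Fin 3 → ℝ}
    (hC : IsConfig n ξ x (2 * √((3 : ℕ) : ℝ)) δ l₀ X Ξ) (hN : 5 ≤ n + 1) {b' b K A T₂ : ℝ}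
    (hb : b' ≤ δ ∧ δ ≤ b) (hb0 : 1 / 2 ≤ b') (hb1 : b ≤ 1.7)
    (hK : 0.7575 * (3 / 2 - b') ≤ K) (hK' : 0.135 ≤ K)
    (hT₂ : TailBound (fun u => kap (1 / 28) (n + 1) u ^ 2) (n + 1) (2 * √((3 : ℕ) : ℝ))
      (2 * √((3 : ℕ) : ℝ) - b) T₂) (hA0 : 0 ≤ A) (hA : 3.2274 * (0.00107133 + T₂) ≤ A ^ 2)
    (hfin : 0.2936 * b ^ 2 ≤ 1 - K ^ 2 - (A + K * 0.0832) ^ 2 / 0.479) :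
    0.2936 * δ ^ 2 ≤ (3 * Real.pi / 7) ^ 3 * (1 - signalFun S x) := by
  have hN' : (5 : ℝ) ≤ ((n + 1 : ℕ) : ℝ) := by exact_mod_cast hN
  refine mul_sq_le_of_energy w S (by norm_num) hC (by linarith [hb.1]) (by linarith [hb.2]) hN
    (lam := 0.479) (by norm_num) (row_sum_three_le hN hC.sep) (tailBound_kap_sq_half hN (by norm_num)) hT₂ hb
    (fun u => abs_kap_le_of_mid hN hb0 hK hK') hA0 (by norm_num) (by norm_num) ?_ (by norm_num) hfin
  have := hT₂.nonneg
  norm_num at hA ⊢; linarith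

theorem mid_three {ξ : Fin r → UnitAddTorus (Fin 3)}
    (S : SVD ((n + 1) ^ 3) (momentMatrix (discreteMeasure w ξ) n)) {x : UnitAddTorus (Fin 3)}
    {δ : ℝ} {l₀ : Fin r} {X : Fin 3 → ℝ} {Ξ : Fin r → Fin 3 → ℝ}
    (hC : IsConfig n ξ x (2 * √((3 : ℕ) : ℝ)) δ l₀ X Ξ) (hN : 5 ≤ n + 1) (h0 : 1 / 2 ≤ δ) (h1 : δ ≤ 1.68) :
    0.2936 * δ ^ 2 ≤ (3 * Real.pi / 7) ^ 3 * (1 - signalFun S x) := by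
  have hs : 1.732 ≤ √((3 : ℕ) : ℝ) := Real.le_sqrt_of_sq_le (by norm_num)
  have hs' : 3.464 ≤ 2 * √((3 : ℕ) : ℝ) := by linarith
  have hT : ∀ {b A : ℝ}, 2 ≤ A → A ≤ 3.464 - b → 0 ≤ b → TailBound (fun u => kap (1 / 28) (n + 1) u ^ 2)
      (n + 1) (2 * √((3 : ℕ) : ℝ)) (2 * √((3 : ℕ) : ℝ) - b) (7 / 6 / (3 * A ^ 2 - 3) ^ 2) :=
    fun {b A} h2 hA hb => (tailBound_kap_sq_of_two_le hN h2 ((hA.trans (by linarith)).trans hs')).mono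
      (hA.trans (sub_le_sub_right hs' b)) le_rfl
  have hT2 : TailBound (fun u => kap (1 / 28) (n + 1) u ^ 2) (n + 1) (2 * √((3 : ℕ) : ℝ))
      (2 * √((3 : ℕ) : ℝ) - 1.68) 0.0186 :=
    (tailBound_kap_sq_half hN (by norm_num)).mono (by linarith) (by norm_num)
  rcases le_total δ 1 with h | h
  · exact mid_three_of_mem_Icc w S hC hN ⟨h0, h⟩ le_rfl (by norm_num) (K := 0.7575) (by norm_num)
      (by norm_num) (hT (A := 2.264) (by norm_num) (by norm_num) (by norm_num)) (A := 0.1675) (by norm_num)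
      (by norm_num) (by norm_num)
  rcases le_total δ 1.2 with h' | h'
  · exact mid_three_of_mem_Icc w S hC hN ⟨h, h'⟩ (by norm_num) (by norm_num) (K := 0.379) (by norm_num)
      (by norm_num) (hT (A := 2.264) (by norm_num) (by norm_num) (by norm_num)) (A := 0.1675) (by norm_num)
      (by norm_num) (by norm_num)
  rcases le_total δ 1.4 with h | h
  · exact mid_three_of_mem_Icc w S hC hN ⟨h', h⟩ (by norm_num) (by norm_num) (K := 0.2273) (by norm_num)
      (by norm_num) (hT (A := 2.064) (by norm_num) (by norm_num) (by norm_num)) (A := 0.207) (by norm_num)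
      (by norm_num) (by norm_num)
  · exact mid_three_of_mem_Icc w S hC hN ⟨h, h1⟩ (by norm_num) (by norm_num) (K := 0.135) (by norm_num)
      (by norm_num) hT2 (A := 0.252) (by norm_num) (by norm_num) (by norm_num)

theorem exp_five_sixths_le : Real.exp (5 / 6) ≤ 2.302 := by
  refine le_of_pow_le_pow_left₀ (n := 6) (by norm_num) (by norm_num) ?_
  rw [← Real.exp_nat_mul, show ((6 : ℕ) : ℝ) * (5 / 6) = (5 : ℕ) * 1 by norm_num, Real.exp_nat_mul]
  refine (pow_le_pow_left₀ (Real.exp_pos _).le Real.exp_one_lt_d9.le 5).trans ?_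
  norm_num

/-- The product factor is (1 + (5/6)/(d - 1))^(d-1) ≤ e^(5/6), and d times each tail term decreases
in d, so the case d = 4 dominates. -/
theorem row_sum_kap_le_of_four_le {d N : ℕ} (hN : 5 ≤ N) (hd : 4 ≤ d) {Ξ : Fin r → Fin d → ℝ}
    (hsep : Sep (2 * √(d : ℝ)) N Ξ) (l : Fin r) :
    ∑ m ∈ Finset.univ.erase l, |∏ i, kap (1 / 28) N (Ξ l i - Ξ m i)| ≤ 1 - 0.33 := by
  have hd' : (4 : ℝ) ≤ d := by exact_mod_cast hd
  have hs : 2 ≤ √(d : ℝ) := Real.le_sqrt_of_sq_le (by norm_num; linarith)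
  have hG := tailBound_kap hN (s := 2 * √(d : ℝ)) (A := 2 * √(d : ℝ) / 2) (c := 1 / 2)
    (by linarith) (by norm_num) (by linarith) sum_sq_half_le
  rw [div_pow, two_mul_sqrt_sq, show (3 : ℝ) * (4 * d / 2 ^ 2) - 3 = 3 * ((d : ℝ) - 1) by ring] at hG
  refine (row_sum_le (by norm_num) le_rfl hN (by linarith) hsep hG
    (tailBound_kap_sep hN (by omega)) l).trans ?_
  have h1 : (1 + 2 * (5 / 4 / (3 * ((d : ℝ) - 1)))) ^ (d - 1) ≤ 2.302 := by
    have h0 : 0 ≤ 5 / 4 / (3 * ((d : ℝ) - 1)) := div_nonneg (by norm_num) (by linarith)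
    refine (one_add_pow_le_exp (by linarith) _).trans (le_trans (le_of_eq ?_) exp_five_sixths_le)
    congr 1
    rw [Nat.cast_sub (by omega)]
    have : (d : ℝ) - 1 ≠ 0 := by linarith
    push_cast
    field_simp; norm_num
  have h2 : (d : ℝ) * (1 / (12 * d - 3)) ≤ 4 / 45 := by
    rw [mul_one_div, div_le_div_iff₀ (by linarith) (by norm_num)]; linarith
  have h3 : (d : ℝ) * (8 / 3 / (48 * d - 3)) ≤ 32 / 567 := by
    rw [← mul_div_assoc, div_le_div_iff₀ (by linarith) (by norm_num)]; linarith
  have h4 : (0 : ℝ) ≤ (1 + 2 * (5 / 4 / (3 * ((d : ℝ) - 1)))) ^ (d - 1) := by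
    have h0 : 0 ≤ 5 / 4 / (3 * ((d : ℝ) - 1)) := div_nonneg (by norm_num) (by linarith)
    positivity
  rw [← mul_assoc]
  refine (mul_le_mul (b := 2 * (4 / 45 + 32 / 567)) (by linarith) h1 h4 (by norm_num)).trans (by norm_num)

/-- All d ≥ 4 are handled at once: the squared tails are of order d⁻², there are d classes, and the
product factor is bounded by `one_add_div_sq_pow_le`. Three intervals of δ suffice; in the last one
δ² ≤ d, so the hypothesis on R d is what is needed. -/
theorem mid_of_four_le {d : ℕ} (hd : 4 ≤ d) {ξ : Fin r → UnitAddTorus (Fin d)}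
    (S : SVD ((n + 1) ^ d) (momentMatrix (discreteMeasure w ξ) n)) {x : UnitAddTorus (Fin d)}
    {δ : ℝ} {l₀ : Fin r} {X : Fin d → ℝ} {Ξ : Fin r → Fin d → ℝ}
    (hC : IsConfig n ξ x (2 * √(d : ℝ)) δ l₀ X Ξ) (hN : 4 * √(d : ℝ) ≤ (n : ℝ) + 1) (h0 : 1 / 2 ≤ δ)
    (h1 : δ ≤ √(d : ℝ)) {R : ℝ} (hR0 : 0 ≤ R) (hR : R * d ≤ 0.7) :
    R * δ ^ 2 ≤ (3 * Real.pi / 7) ^ d * (1 - signalFun S x) := by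
  have hd' : (4 : ℝ) ≤ d := by exact_mod_cast hd
  have hs : 2 ≤ √(d : ℝ) := Real.le_sqrt_of_sq_le (by norm_num; linarith)
  have hN5 : 5 ≤ n + 1 := by
    have : (8 : ℝ) ≤ ((n + 1 : ℕ) : ℝ) := by push_cast; linarith
    have : 8 ≤ n + 1 := by exact_mod_cast this
    omega
  have hG : TailBound (fun u => kap (1 / 28) (n + 1) u ^ 2) (n + 1) (2 * √(d : ℝ)) (2 * √(d : ℝ) / 2)
      (0.20302 / d ^ 2) := by
    refine (tailBound_kap_sq hN5 (s := 2 * √(d : ℝ)) (A := 2 * √(d : ℝ) / 2) (c := 1 / 2)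
      (by linarith) (by norm_num) (by linarith) sum_pow_four_half_le).mono le_rfl ?_
    rw [div_pow, two_mul_sqrt_sq, show (3 : ℝ) * (4 * d / 2 ^ 2) - 3 = 3 * ((d : ℝ) - 1) by ring]
    rw [div_le_div_iff₀ (by nlinarith) (by positivity)]
    nlinarith
  have hP := one_add_div_sq_pow_le (y := 2 * 0.20302) (by norm_num) (by norm_num) (d := d) (by omega)
  rw [show 1 + 2 * 0.20302 / (d : ℝ) ^ 2 = 1 + 2 * (0.20302 / (d : ℝ) ^ 2) by ring] at hP
  have hT1 : 7 / 6 / (12 * (d : ℝ) - 3) ^ 2 ≤ 0.00922 / d ^ 2 := by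
    rw [div_le_div_iff₀ (by nlinarith) (by positivity)]
    nlinarith
  have key : ∀ {T a c : ℝ}, T ≤ a / d ^ 2 → 0 ≤ a → a * 1.113 / 4 ≤ c →
      d * (T * (1 + 2 * (0.20302 / (d : ℝ) ^ 2)) ^ (d - 1)) ≤ c := by
    intro T a c hT ha hc
    have h2 : d * (T * (1 + 2 * (0.20302 / (d : ℝ) ^ 2)) ^ (d - 1)) ≤ d * (a / d ^ 2 * 1.113) :=
      mul_le_mul_of_nonneg_left (mul_le_mul hT (hP.trans (by norm_num)) (by positivity) (by positivity))
        (by positivity)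
    have h3 : d * (a / (d : ℝ) ^ 2 * 1.113) = a * 1.113 / d := by field_simp
    rw [h3] at h2
    exact h2.trans ((div_le_div_of_nonneg_left (by positivity) (by norm_num) hd').trans hc)
  have main : ∀ {b' b K : ℝ}, b' ≤ δ ∧ δ ≤ b → 1 / 2 ≤ b' → b ≤ √(d : ℝ) → 0.7575 * (3 / 2 - b') ≤ K →
      0.135 ≤ K → R * b ^ 2 ≤ 1 - K ^ 2 - (0.2431 + K * 0.0717) ^ 2 / 0.33 →
      R * δ ^ 2 ≤ (3 * Real.pi / 7) ^ d * (1 - signalFun S x) := by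
    intro b' b K hb hb0 hb1 hK hK' hfin
    refine mul_sq_le_of_energy w S (by omega) hC (by linarith) (by push_cast; linarith) hN5
      (lam := 0.33) (by norm_num) (row_sum_kap_le_of_four_le hN5 hd hC.sep) hG
      (hG.mono (by linarith) le_rfl) hb (fun u => abs_kap_le_of_mid hN5 hb0 hK hK') (by norm_num)
      (by norm_num) hR0 ?_ ?_ hfin
    · exact key (a := 0.21224) (by rw [show (0.21224 : ℝ) = 0.00922 + 0.20302 by norm_num, add_div]; linarith)
        (by norm_num) (by norm_num)
    · exact key (a := 0.01844) (by rw [show (0.01844 : ℝ) = 0.00922 + 0.00922 by norm_num, add_div]; linarith)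
        (by norm_num) (by norm_num)
  have hR' : R ≤ 0.175 := by nlinarith
  rcases le_total δ 0.8 with h | h
  · refine main ⟨h0, h⟩ le_rfl (by linarith) (K := 0.7575) (by norm_num) (by norm_num) ?_
    norm_num; linarith
  rcases le_total δ 1.3 with h' | h'
  · refine main ⟨h, h'⟩ (by norm_num) (by linarith) (K := 0.5303) (by norm_num) (by norm_num) ?_
    norm_num; linarith
  · refine main ⟨h', h1⟩ (by norm_num) le_rfl (K := 0.1516) (by norm_num) (by norm_num) ?_
    rw [Real.sq_sqrt d.cast_nonneg]
    norm_num; linarith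

end Mid

/-! ### The derivative of the cosine kernel -/

theorem differentiable_kap (θ : ℝ) (N : ℕ) : Differentiable ℝ (kap θ N) := by
  unfold kap; fun_prop

theorem abs_deriv_kap_neg (θ : ℝ) (N : ℕ) (u : ℝ) : |deriv (kap θ N) (-u)| = |deriv (kap θ N) u| := by
  have h := deriv_comp_neg (f := kap θ N) u
  simp only [kap_neg] at h
  rw [h, abs_neg]

theorem abs_deriv_kap_add_int_mul (θ : ℝ) {N : ℕ} (hN : 0 < N) (u : ℝ) (m : ℤ) :
    |deriv (kap θ N) (u + m * N)| = |deriv (kap θ N) u| := by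
  have h : ∀ v, |deriv (kap θ N) (v + N)| = |deriv (kap θ N) v| := fun v => by
    have h := deriv_comp_add_const (f := kap θ N) (N : ℝ) v
    simp only [kap_add_nat θ hN] at h
    rw [← h, deriv_const_mul _ (differentiable_kap θ N v), abs_mul, abs_pow, abs_neg, abs_one, one_pow,
      one_mul]
  induction m using Int.induction_on with
  | zero => simp
  | succ i ih =>
    rw [← ih, ← h (u + ((i : ℕ) : ℤ) * N)]; congr 2; push_cast; ring
  | pred i ih =>
    rw [← ih, ← h (u + ((-(i : ℕ) - 1 : ℤ) : ℝ) * N)]; congr 2; push_cast; ring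

/-- Cauchy–Schwarz against the unit vector (c, s): after multiplication by P the two components are
at most 3.1416 and 1.8435 + 1.4325 = 3.276, and the root of the sum of their squares is below 4.6.
-/
theorem abs_deriv_ker_le_aux {k' c s ρ τ σ P u : ℝ} (hcs : c ^ 2 + s ^ 2 = 1)
    (hk : k' = s * (Real.pi * ρ) + c * (τ + σ)) (hP : P = 4 * u ^ 2 - 1) (hu : 1.6 ≤ u)
    (hρ0 : 0 ≤ ρ) (hτ0 : 0 ≤ τ) (hσ0 : 0 ≤ σ)
    (hρ : ρ * P ≤ 1) (hτ : τ * (4 * u ^ 2 - 2.4675) ≤ 1.5505) (hσ : σ ≤ ρ ^ 2 * (8.271 * u)) :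
    |k'| ≤ 4.6 / P := by
  have hP0 : 9.24 ≤ P := by rw [hP]; nlinarith
  have h1 : Real.pi * ρ * P ≤ 3.1416 := by
    have := Real.pi_lt_d4
    calc Real.pi * ρ * P = Real.pi * (ρ * P) := by ring
      _ ≤ 3.1416 * 1 := mul_le_mul this.le hρ (by positivity) (by norm_num)
      _ = _ := by ring
  have h2 : τ * P ≤ 1.8435 := by
    have h3 : 7.7725 ≤ 4 * u ^ 2 - 2.4675 := by nlinarith
    have h4 : τ * 7.7725 ≤ 1.5505 := (mul_le_mul_of_nonneg_left h3 hτ0).trans hτ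
    have : τ * P = τ * (4 * u ^ 2 - 2.4675) + 1.4675 * τ := by rw [hP]; ring
    rw [this]; linarith
  have h3 : σ * P ≤ 1.4325 := by
    have h4 : 8.271 * u ≤ 1.4325 * P := by rw [hP]; nlinarith
    calc σ * P ≤ ρ ^ 2 * (8.271 * u) * P := mul_le_mul_of_nonneg_right hσ (by linarith)
      _ ≤ ρ ^ 2 * (1.4325 * P) * P := by gcongr
      _ = 1.4325 * (ρ * P) ^ 2 := by ring
      _ ≤ 1.4325 * 1 ^ 2 := by gcongr
      _ = _ := by ring
  rw [le_div_iff₀ (by linarith), ← abs_of_pos (by linarith : 0 < P), ← abs_mul]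
  refine abs_le_of_sq_le_sq ?_ (by norm_num)
  have e : k' * P = s * (Real.pi * ρ * P) + c * (τ * P + σ * P) := by rw [hk]; ring
  rw [e]
  set x := Real.pi * ρ * P
  set y := τ * P + σ * P
  have hx0 : 0 ≤ x := by have := Real.pi_pos; positivity
  have hy0 : 0 ≤ y := by positivity
  have hx : x ^ 2 ≤ 3.1416 ^ 2 := pow_le_pow_left₀ hx0 h1 2
  have hy : y ^ 2 ≤ 3.276 ^ 2 := pow_le_pow_left₀ hy0 (by simp only [y]; linarith) 2
  have : (s * x + c * y) ^ 2 ≤ (c ^ 2 + s ^ 2) * (x ^ 2 + y ^ 2) := by nlinarith [sq_nonneg (s * y - c * x)]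
  rw [hcs] at this
  norm_num at hx hy ⊢
  linarith

set_option maxHeartbeats 1000000 in
-- The closed formula `ker_mul` with m = 1 is differentiated rather than the sum. Writing the kernel
-- as -ρ cos πu, where ρ = E cos a / H, the three terms come from differentiating cos πu, cos(πu/N)
-- and the denominator H.
theorem abs_deriv_kap_le {N : ℕ} (hN : 5 ≤ N) {u : ℝ} (h0 : 1.6 ≤ u) (hu : u ≤ N / 2) :
    |deriv (kap 0 N) u| ≤ 4.6 / (4 * u ^ 2 - 1) := by
  have hN' : (5 : ℝ) ≤ N := by exact_mod_cast hN
  have hN0 : (0 : ℝ) < N := by linarith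
  have hp := Real.pi_pos
  have hp4 := Real.pi_lt_d4
  have hp3 := Real.pi_gt_d4
  set b := Real.pi / (2 * N) with hb
  set E := Real.sin b ^ 2 with hE
  have hb0 : 0 < b := by positivity
  have hb1 : b ≤ 0.31416 := by rw [hb, div_le_iff₀ (by positivity)]; nlinarith
  have hk : ∀ v, kap 0 N v * (Real.sin (Real.pi * v / N) ^ 2 - E) =
      -(Real.cos (Real.pi * v) * Real.cos (Real.pi * v / N) * E) := by
    intro v
    have h := ker_mul (σ := 1) (m := 1) (N := N) (by omega) (by norm_num) sin_add_pi_half v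
    rw [one_mul] at h
    rw [kap_zero_left]
    exact h
  have hH : 0 < Real.sin (Real.pi * u / N) ^ 2 - E := by
    have := sin_sq_sub_sin_sq_pos hN hu (m := 1) one_pos (by linarith)
    rwa [one_mul] at this
  set a := Real.pi * u / N with ha
  have hd : HasDerivAt (fun v => kap 0 N v * (Real.sin (Real.pi * v / N) ^ 2 - E))
      (deriv (kap 0 N) u * (Real.sin a ^ 2 - E) +
        kap 0 N u * (2 * Real.sin a * (Real.cos a * (Real.pi / N)))) u := by
    have h1 : HasDerivAt (fun v : ℝ => Real.pi * v / N) (Real.pi / N) u := by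
      simpa using ((hasDerivAt_id u).const_mul Real.pi).div_const (N : ℝ)
    have h2 := ((h1.sin.pow 2).sub_const E)
    have h3 : HasDerivAt (fun v => kap 0 N v * (Real.sin (Real.pi * v / N) ^ 2 - E)) _ u :=
      (differentiable_kap 0 N u).hasDerivAt.mul h2
    refine h3.congr_deriv ?_
    simp [ha]
  have hg : HasDerivAt (fun v => kap 0 N v * (Real.sin (Real.pi * v / N) ^ 2 - E))
      (-((-Real.sin (Real.pi * u) * Real.pi * Real.cos a +
        Real.cos (Real.pi * u) * (-Real.sin a * (Real.pi / N))) * E)) u := by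
    have h1 : HasDerivAt (fun v : ℝ => Real.pi * v / N) (Real.pi / N) u := by
      simpa using ((hasDerivAt_id u).const_mul Real.pi).div_const (N : ℝ)
    have h0 : HasDerivAt (fun v : ℝ => Real.pi * v) Real.pi u := by
      simpa using (hasDerivAt_id u).const_mul Real.pi
    have h2 := ((h0.cos.mul h1.cos).mul_const E).neg
    refine h2.congr_of_eventuallyEq (Eventually.of_forall fun v => ?_)
    exact hk v
  have heq := hd.unique hg
  have hku := hk u
  have ha0 : 0 < a := by positivity
  have ha1 : a ≤ Real.pi / 2 := by
    rw [ha, div_le_div_iff₀ hN0 two_pos]; nlinarith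
  have hca : 0 ≤ Real.cos a := Real.cos_nonneg_of_mem_Icc ⟨by linarith, ha1⟩
  have hsa : 0 ≤ Real.sin a := Real.sin_nonneg_of_nonneg_of_le_pi ha0.le (by linarith)
  have hab : a = 2 * u * b := by rw [ha, hb]; field_simp
  have hE1 : E ≤ b ^ 2 := pow_le_pow_left₀
    (Real.sin_nonneg_of_nonneg_of_le_pi hb0.le (by linarith)) (Real.sin_le hb0.le) 2
  have hsb : b - b ^ 3 / 6 ≤ Real.sin b := Real.sin_ge_sub_cube hb0.le
  have hE2 : 0.96728 * b ^ 2 ≤ E := by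
    have h1 : 0.98354 * b ≤ Real.sin b := by
      have : b ^ 2 ≤ 0.31416 ^ 2 := pow_le_pow_left₀ hb0.le hb1 2
      nlinarith
    have := pow_le_pow_left₀ (by positivity) h1 2
    rw [mul_pow] at this
    nlinarith [sq_nonneg b]
  have hE0 : 0 < E := lt_of_lt_of_le (by positivity) hE2
  set H := Real.sin a ^ 2 - E with hHd
  refine abs_deriv_ker_le_aux (c := Real.cos (Real.pi * u)) (s := Real.sin (Real.pi * u))
    (ρ := E * Real.cos a / H) (τ := E / H * (Real.pi / N) * Real.sin a)
    (σ := (E * Real.cos a / H) ^ 2 * (2 * (Real.pi / N) * Real.sin a / E)) (u := u)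
    (by rw [add_comm]; exact Real.sin_sq_add_cos_sq _) ?_ rfl h0 (by positivity) (by positivity) (by positivity)
    ?_ ?_ ?_
  · have hk1 : kap 0 N u = -(Real.cos (Real.pi * u) * Real.cos a * E) / H := by
      rw [eq_div_iff hH.ne']; exact hku
    rw [hk1] at heq
    have : deriv (kap 0 N) u = (-((-Real.sin (Real.pi * u) * Real.pi * Real.cos a +
        Real.cos (Real.pi * u) * (-Real.sin a * (Real.pi / N))) * E) -
        -(Real.cos (Real.pi * u) * Real.cos a * E) / H * (2 * Real.sin a * (Real.cos a * (Real.pi / N)))) / H := by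
      rw [eq_div_iff hH.ne']; linarith
    rw [this]
    field_simp
    ring
  · have h := cos_mul_sin_sq_mul_le ha0.le ha1 hb0 (by nlinarith)
    rw [abs_of_pos hH, hab, show (2 * u * b) ^ 2 - b ^ 2 = b ^ 2 * (4 * u ^ 2 - 1) by ring, ← hab,
      abs_of_nonneg (mul_nonneg (sq_nonneg b) (by nlinarith))] at h
    rw [div_mul_eq_mul_div, div_le_one hH]
    have hb2 : 0 < b ^ 2 := by positivity
    refine le_of_mul_le_mul_left ?_ hb2
    calc b ^ 2 * (E * Real.cos a * (4 * u ^ 2 - 1)) = Real.cos a * E * (b ^ 2 * (4 * u ^ 2 - 1)) := by ring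
      _ ≤ _ := h
  -- Jordan's inequality bounds H from below by (4u² - π²/4)/N²; the constant 2.4675 exceeds π²/4.
  · have hj := Real.mul_le_sin ha0.le ha1
    have h1 : 2 / Real.pi * a = 2 * u / N := by rw [ha]; field_simp
    rw [h1] at hj
    have h2 : (2 * u / N) ^ 2 - b ^ 2 ≤ H := by
      have := pow_le_pow_left₀ (by positivity) hj 2
      simp only [hHd]; linarith
    have h3 : (2 * u / N) ^ 2 - b ^ 2 = (4 * u ^ 2 - Real.pi ^ 2 / 4) / N ^ 2 := by
      rw [hb]; field_simp; ring
    have hpi2 : Real.pi ^ 2 / 4 ≤ 2.4675 := by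
      have := pow_le_pow_left₀ hp.le hp4.le 2
      norm_num at this ⊢; linarith
    have h4 : (4 * u ^ 2 - 2.4675) / N ^ 2 ≤ H := by
      refine le_trans (div_le_div_of_nonneg_right (by linarith) (by positivity)) (h3 ▸ h2)
    have h5 : E * N ^ 2 ≤ 2.4675 := by
      calc E * N ^ 2 ≤ b ^ 2 * N ^ 2 := by gcongr
        _ = Real.pi ^ 2 / 4 := by rw [hb]; field_simp; norm_num
        _ ≤ _ := hpi2
    have h6 : E / H * (4 * u ^ 2 - 2.4675) ≤ 2.4675 := by
      rw [div_mul_eq_mul_div, div_le_iff₀ hH]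
      rw [div_le_iff₀ (by positivity)] at h4
      calc E * (4 * u ^ 2 - 2.4675) ≤ E * (H * N ^ 2) := by gcongr
        _ = (E * N ^ 2) * H := by ring
        _ ≤ 2.4675 * H := by gcongr
    have h7 : Real.pi / N * Real.sin a ≤ 0.62832 := by
      have : Real.pi / N ≤ 0.62832 := by rw [div_le_iff₀ hN0]; nlinarith
      calc Real.pi / N * Real.sin a ≤ 0.62832 * 1 :=
            mul_le_mul this (Real.sin_le_one a) hsa (by norm_num)
        _ = _ := by ring
    have hu2 : 0 ≤ 4 * u ^ 2 - 2.4675 := by nlinarith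
    calc E / H * (Real.pi / N) * Real.sin a * (4 * u ^ 2 - 2.4675) =
          (E / H * (4 * u ^ 2 - 2.4675)) * (Real.pi / N * Real.sin a) := by ring
      _ ≤ 2.4675 * 0.62832 := mul_le_mul h6 h7 (by positivity) (by norm_num)
      _ ≤ 1.5505 := by norm_num
  · refine mul_le_mul_of_nonneg_left ?_ (sq_nonneg _)
    rw [div_le_iff₀ hE0]
    have h1 : Real.sin a ≤ 2 * u * b := by rw [← hab]; exact Real.sin_le ha0.le
    have h2 : Real.pi / N = 2 * b := by rw [hb]; field_simp
    rw [h2]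
    calc 2 * (2 * b) * Real.sin a ≤ 2 * (2 * b) * (2 * u * b) := by gcongr
      _ = 8 * u * b ^ 2 := by ring
      _ ≤ 8.271 * u * (0.96728 * b ^ 2) := by
          have : 0 ≤ u * b ^ 2 := by positivity
          linarith
      _ ≤ 8.271 * u * E := by gcongr

theorem abs_red_le_abs_red_add {N : ℕ} (hN : 0 < N) (a t : ℝ) : |red N a| ≤ |red N t| + |a - t| := by
  have hN0 : (0 : ℝ) < N := by exact_mod_cast hN
  have h := round_le (a / N) (round (t / N))
  have e1 : red N a = N * (a / N - round (a / N)) := by unfold red; field_simp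
  have e2 : red N t + (a - t) = N * (a / N - round (t / N)) := by unfold red; field_simp; ring
  refine le_trans ?_ (abs_add_le _ _)
  rw [e1, e2, abs_mul, abs_mul]
  exact mul_le_mul_of_nonneg_left h (abs_nonneg _)

theorem abs_kap_le_of_red {N : ℕ} (hN : 5 ≤ N) {m u : ℝ} (hm : 1 ≤ m) (hu : m ≤ |red N u|) :
    |kap 0 N u| ≤ 1 / (4 * m ^ 2 - 1) := by
  rw [← abs_kap_red 0 (by omega), kap_zero_left]
  have h : m ^ 2 ≤ red N u ^ 2 := by rw [← sq_abs (red N u)]; exact pow_le_pow_left₀ (by linarith) hu 2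
  refine (abs_ker_one_le hN (abs_red_le (by omega) u) (by nlinarith)).trans ?_
  exact div_le_div_of_nonneg_left zero_le_one (by nlinarith) (by linarith)

theorem abs_deriv_kap_le_of_red {N : ℕ} (hN : 5 ≤ N) {m u : ℝ} (hm : 1.6 ≤ m) (hu : m ≤ |red N u|) :
    |deriv (kap 0 N) u| ≤ 4.6 / (4 * m ^ 2 - 1) := by
  have e : |deriv (kap 0 N) (|red N u|)| = |deriv (kap 0 N) u| := by
    have h1 : |deriv (kap 0 N) (red N u)| = |deriv (kap 0 N) u| := by
      rw [← abs_deriv_kap_add_int_mul 0 (by omega : 0 < N) u (-round (u / N))]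
      congr 2
      unfold red; push_cast; ring
    rcases abs_choice (red N u) with h | h
    · rw [h, h1]
    · rw [h, abs_deriv_kap_neg, h1]
  rw [← e]
  have h : m ^ 2 ≤ |red N u| ^ 2 := pow_le_pow_left₀ (by linarith) hu 2
  refine (abs_deriv_kap_le hN (hm.trans hu) (abs_red_le (by omega) u)).trans ?_
  exact div_le_div_of_nonneg_left (by norm_num) (by nlinarith) (by linarith)

/-- Mean value inequality on the segment from a to b. Along it the reduced argument loses at most h,
hence the derivative bound at m - h. -/
theorem abs_kap_sub_le_of_red {N : ℕ} (hN : 5 ≤ N) {m h a b : ℝ} (hm : 1.6 ≤ m - h)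
    (ha : m ≤ |red N a|) (hb : |b - a| ≤ h) :
    |kap 0 N b - kap 0 N a| ≤ 4.6 / (4 * (m - h) ^ 2 - 1) * |b - a| := by
  have h1 : ∀ t ∈ segment ℝ a b, ‖deriv (kap 0 N) t‖ ≤ 4.6 / (4 * (m - h) ^ 2 - 1) := by
    intro t ht
    refine abs_deriv_kap_le_of_red hN hm ?_
    have h2 := abs_red_le_abs_red_add (by omega : 0 < N) a t
    have h3 : |a - t| ≤ |b - a| := by
      rw [segment_eq_uIcc] at ht
      rw [abs_sub_comm a t]
      exact Set.abs_sub_left_of_mem_uIcc ht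
    linarith
  have := (convex_segment a b).norm_image_sub_le_of_norm_deriv_le
    (fun t _ => differentiable_kap 0 N t) h1 (left_mem_segment ℝ a b) (right_mem_segment ℝ a b)
  simpa [Real.norm_eq_abs] using this

/-! ### The range δ ≤ 1/2 away from the node -/

theorem one_add_sum_le_prod {ι : Type*} (F : Finset ι) {a : ι → ℝ} (ha : ∀ i, 0 ≤ a i) :
    1 + ∑ i ∈ F, a i ≤ ∏ i ∈ F, (1 + a i) := by
  classical
  induction F using Finset.induction_on with
  | empty => simp
  | insert i F hi ih =>
    rw [Finset.sum_insert hi, Finset.prod_insert hi]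
    nlinarith [ha i, Finset.sum_nonneg fun j (_ : j ∈ F) => ha j]

theorem prod_kap_nonneg {d N : ℕ} (hN : 5 ≤ N) {u : Fin d → ℝ} (hu : ∀ i, |u i| ≤ 1 / 2) :
    0 ≤ ∏ i, kap 0 N (u i) :=
  Finset.prod_nonneg fun i _ => by rw [kap_zero_left]; exact ker_one_nonneg hN (hu i)

/-- In each coordinate (1 - 0.8t)²(1 + 1.6t) ≤ 1 for t = u_i² ≤ 1/4. Multiplying over the
coordinates controls K by the Euclidean displacement Σ u_i², although the distance is the maximum
norm. -/
theorem prod_kap_sq_mul_le {d N : ℕ} (hN : 5 ≤ N) {u : Fin d → ℝ} (hu : ∀ i, |u i| ≤ 1 / 2) :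
    (∏ i, kap 0 N (u i)) ^ 2 * (1 + 1.6 * ∑ i, u i ^ 2) ≤ 1 := by
  have h1 : ∀ i, kap 0 N (u i) ^ 2 * (1 + 1.6 * u i ^ 2) ≤ 1 := by
    intro i
    rw [kap_zero_left]
    have h0 := ker_one_nonneg hN (hu i)
    have h2 := pow_le_pow_left₀ h0 (ker_one_le_of_le_half hN (hu i)) 2
    have h3 : u i ^ 2 ≤ 1 / 4 := by
      rw [← sq_abs]; nlinarith [hu i, abs_nonneg (u i)]
    have h4 : 0 ≤ u i ^ 2 := sq_nonneg _
    refine (mul_le_mul_of_nonneg_right h2 (by linarith)).trans ?_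
    generalize u i ^ 2 = t at *
    nlinarith [mul_nonneg h4 h4, mul_nonneg (mul_nonneg h4 h4) h4, mul_nonneg (mul_nonneg h4 h4) (sub_nonneg.2 h3)]
  have h2 := one_add_sum_le_prod Finset.univ (a := fun i => 1.6 * u i ^ 2) fun i => by positivity
  rw [← Finset.mul_sum] at h2
  refine (mul_le_mul_of_nonneg_left h2 (sq_nonneg _)).trans ?_
  rw [← Finset.prod_pow, ← Finset.prod_mul_distrib]
  exact Finset.prod_le_one (fun i _ => by positivity) fun i _ => h1 i

theorem exp_five_eighths_le : Real.exp (5 / 8) ≤ 1.87 := by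
  refine le_of_pow_le_pow_left₀ (n := 8) (by norm_num) (by norm_num) ?_
  rw [← Real.exp_nat_mul, show ((8 : ℕ) : ℝ) * (5 / 8) = (5 : ℕ) * 1 by norm_num, Real.exp_nat_mul]
  refine (pow_le_pow_left₀ (Real.exp_pos _).le Real.exp_one_lt_d9.le 5).trans ?_
  norm_num

theorem row_sum_ker_le_of_three_le {r d N : ℕ} (hN : 5 ≤ N) (hd : 3 ≤ d) {Ξ : Fin r → Fin d → ℝ}
    (hsep : Sep (2 * √(d : ℝ)) N Ξ) (l : Fin r) :
    ∑ m ∈ Finset.univ.erase l, |∏ i, kap 0 N (Ξ l i - Ξ m i)| ≤ 1 - 0.6 := by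
  have hd' : (3 : ℝ) ≤ d := by exact_mod_cast hd
  refine (row_sum_ker_le hN (by omega) hsep l).trans ?_
  have h0 : 0 ≤ 5 / 2 / (4 * (d : ℝ) - 1) := div_nonneg (by norm_num) (by linarith)
  have h1 : (1 + 5 / 2 / (4 * (d : ℝ) - 1)) ^ (d - 1) ≤ 1.87 := by
    refine (one_add_pow_le_exp (by linarith) _).trans ((Real.exp_le_exp.2 ?_).trans exp_five_eighths_le)
    rw [Nat.cast_sub (by omega), ← mul_div_assoc, div_le_div_iff₀ (by linarith) (by norm_num)]
    push_cast; linarith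
  have h2 : (d : ℝ) * (10 / 3 / (16 * d - 1)) ≤ 10 / 47 := by
    rw [← mul_div_assoc, div_le_div_iff₀ (by linarith) (by norm_num)]; linarith
  rw [← mul_assoc]
  exact (mul_le_mul h2 h1 (by positivity) (by norm_num)).trans (by norm_num)

theorem row_sum_ker_two_le {r N : ℕ} (hN : 5 ≤ N) {Ξ : Fin r → Fin 2 → ℝ}
    (hsep : Sep (2 * √((2 : ℕ) : ℝ)) N Ξ) (l : Fin r) :
    ∑ m ∈ Finset.univ.erase l, |∏ i, kap 0 N (Ξ l i - Ξ m i)| ≤ 1 - 0.708 := by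
  refine (row_sum_ker_le hN (by norm_num) hsep l).trans ?_
  norm_num

theorem row_sum_ker_one_le {r N : ℕ} (hN : 5 ≤ N) {Ξ : Fin r → Fin 1 → ℝ}
    (hsep : Sep (2 * √((1 : ℕ) : ℝ)) N Ξ) (l : Fin r) :
    ∑ m ∈ Finset.univ.erase l, |∏ i, kap 0 N (Ξ l i - Ξ m i)| ≤ 1 - 0.7777 := by
  refine (row_sum_ker_le hN (by norm_num) hsep l).trans ?_
  norm_num

theorem tailBound_ker_sq_sep {d N : ℕ} (hN : 5 ≤ N) (hd : 1 ≤ d) :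
    TailBound (fun u => kap 0 N u ^ 2) N (2 * √(d : ℝ)) (2 * √(d : ℝ)) (7 / 6 / (16 * d - 1) ^ 2) := by
  have hs := sqrt_pos_of_one_le hd
  have hd' : (1 : ℝ) ≤ d := by exact_mod_cast hd
  have hsq := two_mul_sqrt_sq d
  have h := tailBound_ker_sq hN (s := 2 * √(d : ℝ)) (A := 2 * √(d : ℝ)) (c := 1)
    (by positivity) (by rw [hsq]; linarith) (by norm_num) (by linarith) sum_pow_four_one_le
  rwa [hsq, show (4 : ℝ) * (4 * d) - 1 = 16 * d - 1 by ring] at h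

theorem tailBound_ker_sq_half {d N : ℕ} (hN : 5 ≤ N) (hd : 1 ≤ d) :
    TailBound (fun u => kap 0 N u ^ 2) N (2 * √(d : ℝ)) (2 * √(d : ℝ) / 2) (37 / 36 / (4 * d - 1) ^ 2) := by
  have hs := sqrt_pos_of_one_le hd
  have hd' : (1 : ℝ) ≤ d := by exact_mod_cast hd
  have hsq := two_mul_sqrt_sq d
  have h := tailBound_ker_sq hN (s := 2 * √(d : ℝ)) (A := 2 * √(d : ℝ) / 2) (c := 1 / 2)
    (by positivity) (by rw [div_pow, hsq]; linarith) (by norm_num) (by linarith) sum_pow_four_half_le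
  rwa [div_pow, hsq, show (4 : ℝ) * (4 * d / 2 ^ 2) - 1 = 4 * d - 1 by ring] at h

theorem sqrt_le_of_two_le {d : ℕ} (hd : 2 ≤ d) : √(d : ℝ) ≤ 0.70711 * d := by
  have hd' : (2 : ℝ) ≤ d := by exact_mod_cast hd
  rw [Real.sqrt_le_left (by positivity)]
  nlinarith

/-- Sums `d (T (1 + 2 G) ^ (d - 1))` with `T` and `G` of order `d ^ (-2)`. -/
theorem mul_mul_pow_le {d d₀ : ℕ} (hd0 : 1 ≤ d₀) (hd : d₀ ≤ d) {T G a g P c : ℝ} (hT : T ≤ a / d ^ 2)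
    (hG0 : 0 ≤ G) (hG : G ≤ g / d ^ 2) (ha : 0 ≤ a) (hg : 2 * g < 4)
    (hP : 1 / (1 - 2 * g / 4) ≤ P) (hc : a * P / d₀ ≤ c) :
    d * (T * (1 + 2 * G) ^ (d - 1)) ≤ c := by
  have hd0' : (1 : ℝ) ≤ d₀ := by exact_mod_cast hd0
  have hd' : (d₀ : ℝ) ≤ d := by exact_mod_cast hd
  have hg0 : 0 ≤ g := by
    by_contra h
    have : g / (d : ℝ) ^ 2 ≤ 0 := div_nonpos_of_nonpos_of_nonneg (by linarith) (by positivity)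
    have h2 : 0 < (d : ℝ) ^ 2 := pow_pos (by linarith) 2
    have h3 : g / (d : ℝ) ^ 2 < 0 := div_neg_of_neg_of_pos (by linarith) h2
    linarith
  have h1 := (one_add_div_sq_pow_le (y := 2 * g) (by linarith) hg (d := d) (by omega)).trans hP
  have h2 : (1 + 2 * G) ^ (d - 1) ≤ (1 + 2 * g / (d : ℝ) ^ 2) ^ (d - 1) :=
    pow_le_pow_left₀ (by linarith) (by rw [mul_div_assoc]; linarith) _
  have hP0 : 0 ≤ P := le_trans (by positivity) (h2.trans h1)
  have h3 : d * (T * (1 + 2 * G) ^ (d - 1)) ≤ d * (a / d ^ 2 * P) :=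
    mul_le_mul_of_nonneg_left (mul_le_mul hT (h2.trans h1) (by positivity) (by positivity))
      (by positivity)
  have h4 : d * (a / (d : ℝ) ^ 2 * P) = a * P / d := by
    have : (d : ℝ) ≠ 0 := by linarith
    field_simp
  rw [h4] at h3
  exact h3.trans ((div_le_div_of_nonneg_left (by positivity) (by linarith) hd').trans hc)

section Small

variable {d r n : ℕ} (w : Fin r → ℂ)

/-- The function 1/(1 + 1.6t) is convex, so comparing it with a line at the two ends of [1/16, 1/4]
is enough. -/
theorem le_of_mul_one_add_mul_le_one {k t : ℝ} (hk : k * (1 + 1.6 * t) ≤ 1) (h1 : 1 / 16 ≤ t) (h2 : t ≤ 1 / 4) :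
    k ≤ 1 - 0.0373 - 0.7 * t := by
  refine le_of_mul_le_mul_right (hk.trans ?_) (by linarith : 0 < 1 + 1.6 * t)
  have : 0 ≤ (t - 1 / 16) * (1 / 4 - t) := mul_nonneg (by linarith) (by linarith)
  nlinarith

/-- With q ≥ 1/16 the deficit 1 - K² stays away from 0. The residual can then be treated crudely,
with K ≤ 1 in front of B, at a total cost of 0.0373. -/
theorem small_gap {ξ : Fin r → UnitAddTorus (Fin d)}
    (S : SVD ((n + 1) ^ d) (momentMatrix (discreteMeasure w ξ) n)) {x : UnitAddTorus (Fin d)}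
    {δ : ℝ} {l₀ : Fin r} {X : Fin d → ℝ} {Ξ : Fin r → Fin d → ℝ} (hd : 2 ≤ d)
    (hC : IsConfig n ξ x (2 * √(d : ℝ)) δ l₀ X Ξ) (hN : 5 ≤ n + 1) (hδ : δ ≤ 1 / 2) {q R : ℝ}
    (hq : q = ∑ i, (X i - Ξ l₀ i) ^ 2) (hq0 : 1 / 16 ≤ q) (hR : R ≤ 0.7) :
    R * δ ^ 2 ≤ (Real.pi / 2) ^ d * (1 - signalFun S x) := by
  have hd' : (2 : ℝ) ≤ d := by exact_mod_cast hd
  have hs := sqrt_pos_of_one_le (d := d) (by omega)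
  have hsq := sqrt_le_of_two_le hd
  have hu : ∀ i, |X i - Ξ l₀ i| ≤ 1 / 2 := fun i => (hC.near i).trans hδ
  have hT₁ := tailBound_ker_sq_sep hN (d := d) (by omega)
  have hG := tailBound_ker_sq_half hN (d := d) (by omega)
  have h2s : 1.414 ≤ √(d : ℝ) := Real.le_sqrt_of_sq_le (by norm_num; linarith)
  have e1 : 4 * (2 * √(d : ℝ) - 1 / 2) ^ 2 - 1 = 16 * d - 8 * √(d : ℝ) := by
    have := Real.sq_sqrt (d.cast_nonneg : (0 : ℝ) ≤ d)
    linear_combination 16 * this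
  have hT₂ : TailBound (fun u => kap 0 (n + 1) u ^ 2) (n + 1) (2 * √(d : ℝ)) (2 * √(d : ℝ) - δ)
      (7 / 6 / (16 * d - 8 * √(d : ℝ)) ^ 2) := by
    have h := tailBound_ker_sq hN (s := 2 * √(d : ℝ)) (A := 2 * √(d : ℝ) - 1 / 2) (c := 1)
      (by linarith) (by linarith) (by norm_num) (by linarith) sum_pow_four_one_le
    rw [e1] at h
    exact h.mono (by linarith) le_rfl
  have b1 : 7 / 6 / (16 * (d : ℝ) - 1) ^ 2 ≤ 0.00486 / d ^ 2 := by
    rw [div_le_div_iff₀ (by nlinarith) (by positivity)]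
    nlinarith
  have b2 : 7 / 6 / (16 * (d : ℝ) - 8 * √(d : ℝ)) ^ 2 ≤ 0.01092 / d ^ 2 := by
    have h : 10.343 * (d : ℝ) ≤ 16 * (d : ℝ) - 8 * √(d : ℝ) := by linarith
    have h' := pow_le_pow_left₀ (by positivity) h 2
    rw [div_le_div_iff₀ (by nlinarith) (by positivity)]
    nlinarith
  have b3 : 37 / 36 / (4 * (d : ℝ) - 1) ^ 2 ≤ 0.0840 / d ^ 2 := by
    rw [div_le_div_iff₀ (by nlinarith) (by positivity)]
    nlinarith
  have hE : ∀ {lam A B : ℝ} {d₀ : ℕ}, 2 ≤ d₀ → d₀ ≤ d → 0 < lam →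
      (∀ l, ∑ m ∈ Finset.univ.erase l, |∏ i, kap 0 (n + 1) (Ξ l i - Ξ m i)| ≤ 1 - lam) →
      0 ≤ A → 0 ≤ B → 0.01648 / d₀ ≤ A ^ 2 → 0.01016 / d₀ ≤ B ^ 2 → (A + B) ^ 2 / lam ≤ 0.0373 →
      1 - (∏ i, kap 0 (n + 1) (X i - Ξ l₀ i)) ^ 2 - 0.0373 ≤ (Real.pi / 2) ^ d * (1 - signalFun S x) := by
    intro lam A B d₀ h2 hdd hl hrow hA hB hA' hB' hf
    have h := energy_bound w S hC (by linarith) le_rfl (by norm_num) hN (wt_zero_le hN)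
      (by positivity) hl hrow hA hB hG hT₁ hT₂ (K := 1) ?_ ?_ ?_
    · rw [one_mul] at h; linarith
    · refine mul_mul_pow_le (d₀ := d₀) (by omega) hdd (a := 0.01578) (g := 0.0840) (P := 1.0439) ?_
        (by positivity) b3 (by norm_num) (by norm_num) (by norm_num) (le_trans ?_ hA')
      · rw [show (0.01578 : ℝ) = 0.00486 + 0.01092 by norm_num, add_div]; linarith
      · exact div_le_div_of_nonneg_right (by norm_num) (by positivity)
    · refine mul_mul_pow_le (d₀ := d₀) (by omega) hdd (a := 0.00972) (g := 0.0840) (P := 1.0439) ?_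
        (by positivity) b3 (by norm_num) (by norm_num) (by norm_num) (le_trans ?_ hB')
      · rw [show (0.00972 : ℝ) = 0.00486 + 0.00486 by norm_num, add_div]; linarith
      · exact div_le_div_of_nonneg_right (by norm_num) (by positivity)
    · rw [abs_of_nonneg (prod_kap_nonneg hN hu)]
      exact Finset.prod_le_one (fun i _ => by rw [kap_zero_left]; exact ker_one_nonneg hN (hu i))
        fun i _ => (le_abs_self _).trans (abs_kap_le_one le_rfl (by norm_num) hN _)
  have hE' : 1 - (∏ i, kap 0 (n + 1) (X i - Ξ l₀ i)) ^ 2 - 0.0373 ≤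
      (Real.pi / 2) ^ d * (1 - signalFun S x) := by
    rcases hd.eq_or_lt with h | h
    · subst h
      exact hE (lam := 0.708) (A := 0.0908) (B := 0.0713) le_rfl le_rfl (by norm_num)
        (row_sum_ker_two_le hN hC.sep) (by norm_num) (by norm_num) (by norm_num) (by norm_num) (by norm_num)
    · exact hE (lam := 0.6) (A := 0.0742) (B := 0.0583) (d₀ := 3) (by norm_num) h (by norm_num)
        (row_sum_ker_le_of_three_le hN h hC.sep) (by norm_num) (by norm_num) (by norm_num) (by norm_num)
        (by norm_num)
  refine le_trans ?_ hE'
  have hK := prod_kap_sq_mul_le hN hu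
  rw [← hq] at hK
  set k := (∏ i, kap 0 (n + 1) (X i - Ξ l₀ i)) ^ 2
  have hk0 : 0 ≤ k := sq_nonneg _
  obtain ⟨i, hi⟩ := hC.attained
  have hδ0 : 0 ≤ δ := hi ▸ abs_nonneg _
  have hδq : δ ^ 2 ≤ q := by
    rw [hq, ← hi, sq_abs]
    exact Finset.single_le_sum (f := fun i => (X i - Ξ l₀ i) ^ 2) (fun i _ => sq_nonneg _) (Finset.mem_univ i)
  have hδ4 : δ ^ 2 ≤ 1 / 4 := by nlinarith
  have hRδ : R * δ ^ 2 ≤ 0.7 * δ ^ 2 := mul_le_mul_of_nonneg_right hR (sq_nonneg _)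
  -- Since δ² may be much smaller than q, the estimate is applied at a value t between the two that
  -- lies in [1/16, 1/4].
  set t := max (δ ^ 2) (1 / 16)
  have ht1 : δ ^ 2 ≤ t := le_max_left _ _
  have ht2 : 1 / 16 ≤ t := le_max_right _ _
  have ht3 : t ≤ q := max_le hδq hq0
  have ht4 : t ≤ 1 / 4 := max_le hδ4 (by norm_num)
  have hkt : k * (1 + 1.6 * t) ≤ 1 := le_trans (by gcongr) hK
  have : k ≤ 1 - 0.0373 - 0.7 * t := by
    exact le_of_mul_one_add_mul_le_one hkt ht2 ht4
  linarith

/-- The constant 0.7855 exceeds π/4 = (1/2)(π/2). In dimension one the slack is smaller, so K ≤ 1 -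
0.8δ² is kept in both places and the result is a polynomial inequality in δ². -/
theorem small_gap_one {ξ : Fin r → UnitAddTorus (Fin 1)}
    (S : SVD ((n + 1) ^ 1) (momentMatrix (discreteMeasure w ξ) n)) {x : UnitAddTorus (Fin 1)}
    {δ : ℝ} {l₀ : Fin r} {X : Fin 1 → ℝ} {Ξ : Fin r → Fin 1 → ℝ}
    (hC : IsConfig n ξ x (2 * √((1 : ℕ) : ℝ)) δ l₀ X Ξ) (hN : 5 ≤ n + 1) (h0 : 0.3 ≤ δ) (h1 : δ ≤ 1 / 2) :
    0.7855 * δ ^ 2 ≤ (Real.pi / 2) ^ 1 * (1 - signalFun S x) := by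
  have e1 : √((1 : ℕ) : ℝ) = 1 := by simp
  have hT₁ := tailBound_ker_sq_sep hN (d := 1) le_rfl
  have hG := tailBound_ker_sq_half hN (d := 1) le_rfl
  have hK := hC.abs_prod_kap_le (θ := 0) le_rfl (by norm_num) hN
  have hδ : |δ| ≤ 1 / 2 := by rw [abs_of_nonneg (by linarith)]; exact h1
  have hK1 : |kap 0 (n + 1) δ| ≤ 1 - 0.8 * δ ^ 2 := by
    rw [kap_zero_left, abs_of_nonneg (ker_one_nonneg hN hδ)]
    exact ker_one_le_of_le_half hN hδ
  have hKK := hK.trans hK1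
  have key : ∀ {b A : ℝ}, δ ≤ b → b ≤ 1 / 2 → 0 ≤ A → 7 / 6 / (4 * (2 - b) ^ 2 - 1) ^ 2 + 0.005186 ≤ A ^ 2 →
      1 - (1 - 0.8 * δ ^ 2) ^ 2 - (A + (1 - 0.8 * δ ^ 2) * 0.1019) ^ 2 / 0.7777 ≤
        (Real.pi / 2) ^ 1 * (1 - signalFun S x) := by
    intro b A hb hb1 hA hA'
    have hT₂ : TailBound (fun u => kap 0 (n + 1) u ^ 2) (n + 1) (2 * √((1 : ℕ) : ℝ)) (2 * √((1 : ℕ) : ℝ) - δ)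
        (7 / 6 / (4 * (2 - b) ^ 2 - 1) ^ 2) := by
      have h := tailBound_ker_sq hN (s := 2 * √((1 : ℕ) : ℝ)) (A := 2 - b) (c := 1)
        (by linarith) (by nlinarith) (by norm_num) (by rw [e1]; linarith) sum_pow_four_one_le
      exact h.mono (by rw [e1]; linarith) le_rfl
    have h := energy_bound w S hC (by rw [e1]; norm_num) le_rfl (by norm_num) hN (wt_zero_le hN)
      (by positivity) (lam := 0.7777) (by norm_num) (row_sum_ker_one_le hN hC.sep) hA
      (B := 0.1019) (by norm_num) hG hT₁ hT₂ ?_ (by norm_num) hKK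
    · have := sq_le_of_abs_le hKK
      linarith
    · refine le_trans ?_ hA'
      norm_num
      linarith
  rcases le_total δ 0.35 with h | h
  · refine le_trans ?_ (key (A := 0.1309) h (by norm_num) (by norm_num) (by norm_num))
    have h2 : 0.09 ≤ δ ^ 2 := by nlinarith
    have h3 : δ ^ 2 ≤ 0.1225 := by nlinarith
    generalize δ ^ 2 = q at *
    have : 0 ≤ (q - 0.09) * (0.1225 - q) := mul_nonneg (by linarith) (by linarith)
    norm_num at this ⊢
    nlinarith
  · refine le_trans ?_ (key (A := 0.1531) h1 le_rfl (by norm_num) (by norm_num))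
    have h2 : 0.1225 ≤ δ ^ 2 := by nlinarith
    have h3 : δ ^ 2 ≤ 0.25 := by nlinarith
    generalize δ ^ 2 = q at *
    have : 0 ≤ (q - 0.1225) * (0.25 - q) := mul_nonneg (by linarith) (by linarith)
    norm_num at this ⊢
    nlinarith

end Small

/-! ### Quadratic behaviour at the node -/

theorem abs_prod_sub_prod_le {ι : Type*} [DecidableEq ι] (F : Finset ι) {a b m : ι → ℝ}
    (ha : ∀ i, |a i| ≤ m i) (hb : ∀ i, |b i| ≤ m i) :
    |∏ i ∈ F, a i - ∏ i ∈ F, b i| ≤ ∑ i ∈ F, |a i - b i| * ∏ j ∈ F.erase i, m j := by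
  have hm : ∀ i, 0 ≤ m i := fun i => (abs_nonneg _).trans (ha i)
  induction F using Finset.induction_on with
  | empty => simp
  | insert k F hk ih =>
    rw [Finset.prod_insert hk, Finset.prod_insert hk, Finset.sum_insert hk, Finset.erase_insert hk]
    have e : ∑ i ∈ F, |a i - b i| * ∏ j ∈ (insert k F).erase i, m j =
        m k * ∑ i ∈ F, |a i - b i| * ∏ j ∈ F.erase i, m j := by
      rw [Finset.mul_sum]
      refine Finset.sum_congr rfl fun i hi => ?_
      have hik : k ≠ i := fun h => hk (h ▸ hi)
      rw [Finset.erase_insert_of_ne hik, Finset.prod_insert fun h => hk (Finset.mem_of_mem_erase h)]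
      ring
    rw [e, show a k * ∏ i ∈ F, a i - b k * ∏ i ∈ F, b i =
      (a k - b k) * ∏ i ∈ F, a i + b k * (∏ i ∈ F, a i - ∏ i ∈ F, b i) by ring]
    refine (abs_add_le _ _).trans (add_le_add ?_ ?_)
    · rw [abs_mul, Finset.abs_prod]
      exact mul_le_mul_of_nonneg_left (Finset.prod_le_prod (fun _ _ => abs_nonneg _) fun i _ => ha i)
        (abs_nonneg _)
    · rw [abs_mul]
      exact mul_le_mul (hb k) ih (abs_nonneg _) (hm k)

/-- The change of the products `∏ κ (X - Ξ l)` when `X` moves away from `Ξ l₀`. -/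
theorem sum_sq_prod_sub_le {r d N : ℕ} (hN : 0 < N) {s θ : ℝ} (hs : 0 < s) {Ξ : Fin r → Fin d → ℝ}
    (hsep : Sep s N Ξ) (l₀ : Fin r) {X : Fin d → ℝ} {φ ψ : ℝ → ℝ} {C : ℝ} (hφ0 : ∀ v, 0 ≤ φ v)
    (hψ0 : ∀ v, 0 ≤ ψ v) (hφC : ∀ v, φ v ≤ C) (hψ1 : ∀ v, ψ v ≤ 1)
    (hφ : ∀ l i, (kap θ N (X i - Ξ l i) - kap θ N (Ξ l₀ i - Ξ l i)) ^ 2 ≤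
      (X i - Ξ l₀ i) ^ 2 * φ (red N (Ξ l₀ i - Ξ l i)))
    (hψX : ∀ l i, kap θ N (X i - Ξ l i) ^ 2 ≤ ψ (red N (Ξ l₀ i - Ξ l i)))
    (hψΞ : ∀ l i, kap θ N (Ξ l₀ i - Ξ l i) ^ 2 ≤ ψ (red N (Ξ l₀ i - Ξ l i)))
    {Tφ Tψ Gφ Gψ α β : ℝ} (hTφ : TailBound φ N s s Tφ) (hTψ : TailBound ψ N s s Tψ)
    (hGφ : TailBound φ N s (s / 2) Gφ) (hGψ : TailBound ψ N s (s / 2) Gψ) (hα0 : 0 < α) (hβ0 : 0 < β)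
    (hα : (Tφ + Tφ) * (1 + 2 * Gψ) ^ (d - 1) ≤ α ^ 2)
    (hβ : (Tψ + Tψ) * ((C + 2 * Gφ) * (1 + 2 * Gψ) ^ (d - 2)) ≤ β ^ 2) :
    ∑ l ∈ Finset.univ.erase l₀, (∏ i, kap θ N (X i - Ξ l i) - ∏ i, kap θ N (Ξ l₀ i - Ξ l i)) ^ 2 ≤
      (α + (d - 1) * β) ^ 2 * ∑ i, (X i - Ξ l₀ i) ^ 2 := by
  obtain ⟨tφ, htφ0, htφ, hsφ⟩ := hTφ
  obtain ⟨tψ, htψ0, htψ, hsψ⟩ := hTψ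
  obtain ⟨gφ, hgφ0, hgφ, hSφ⟩ := hGφ
  obtain ⟨gψ, hgψ0, hgψ, hSψ⟩ := hGψ
  have hC0 : 0 ≤ C := (hφ0 0).trans (hφC 0)
  have hX : ∀ i : Fin d, |Ξ l₀ i - Ξ l₀ i| ≤ 0 := fun i => by simp
  set p : Fin r → Fin d → ℝ := fun l i => red N (Ξ l₀ i - Ξ l i) with hp
  have hpN : ∀ l i, |p l i| ≤ N / 2 := fun l i => abs_red_le hN _
  set u : Fin d → ℝ := fun i => X i - Ξ l₀ i with hu
  -- a single class
  have hclass : ∀ (i₀ i : Fin d) (F : Finset (Fin r)),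
      (∀ l ∈ F, ∀ k : ℤ, s ≤ |Ξ l₀ i₀ - Ξ l i₀ + N * k|) →
      ∑ l ∈ F, (φ (p l i) * ∏ j ∈ Finset.univ.erase i, ψ (p l j)) ≤ if i = i₀ then α ^ 2 else β ^ 2 := by
    intro i₀ i F hF
    have e : ∀ l, φ (p l i) * ∏ j ∈ Finset.univ.erase i, ψ (p l j) =
        ∏ j, (if j = i then φ (p l j) else ψ (p l j)) := by
      intro l
      rw [← Finset.mul_prod_erase Finset.univ _ (Finset.mem_univ i), if_pos rfl]
      congr 1
      exact Finset.prod_congr rfl fun j hj => (if_neg (Finset.ne_of_mem_erase hj)).symm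
    simp only [e]
    have h := class_sum_le hs hsep l₀ (Y := Ξ l₀) hX i₀ hF
      (f := fun j l => if j = i then φ (p l j) else ψ (p l j))
      (fun j l => by split_ifs; exacts [hφ0 _, hψ0 _])
      (c := fun j => if j = i then C else 1) (G := fun j => if j = i then Gφ else Gψ)
      (g := fun j => if j = i then gφ else gψ) (t₁ := if i₀ = i then tφ else tψ)
      (t₂ := if i₀ = i then tφ else tψ) (T₁ := if i₀ = i then Tφ else Tψ) (T₂ := if i₀ = i then Tφ else Tψ)
      (fun j _ l => by split_ifs; exacts [hφC _, hψ1 _])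
      (fun j => by split_ifs; exacts [hC0, zero_le_one])
      (fun j _ l k hk => by split_ifs; exacts [hgφ _ (hpN l j) k hk, hgψ _ (hpN l j) k hk])
      (fun j k => by split_ifs; exacts [hgφ0 k, hgψ0 k])
      (fun j k => by split_ifs; exacts [hSφ k, hSψ k])
      (fun l k hk => by split_ifs; exacts [htφ _ (hpN l i₀) k hk, htψ _ (hpN l i₀) k hk])
      (fun l k hk => by
        rw [sub_zero] at hk
        split_ifs; exacts [htφ _ (hpN l i₀) k hk, htψ _ (hpN l i₀) k hk])
      (fun k => by split_ifs; exacts [htφ0 k, htψ0 k]) (fun k => by split_ifs; exacts [htφ0 k, htψ0 k])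
      (fun k => by split_ifs; exacts [hsφ k, hsψ k]) (fun k => by split_ifs; exacts [hsφ k, hsψ k])
    refine h.trans ?_
    by_cases hi : i = i₀
    · subst hi
      simp only [if_true]
      refine le_trans (le_of_eq ?_) hα
      congr 1
      rw [Finset.prod_congr rfl (g := fun _ => 1 + 2 * Gψ) fun j hj => by
        rw [if_neg (Finset.ne_of_mem_erase hj), if_neg (Finset.ne_of_mem_erase hj)]; ring]
      rw [Finset.prod_const, Finset.card_erase_of_mem (Finset.mem_univ _), Finset.card_univ, Fintype.card_fin]
    · rw [if_neg (Ne.symm hi), if_neg hi]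
      refine le_trans (le_of_eq ?_) hβ
      congr 1
      rw [← Finset.mul_prod_erase _ _ (Finset.mem_erase.2 ⟨hi, Finset.mem_univ i⟩), if_pos rfl, if_pos rfl]
      rw [Finset.prod_congr rfl (g := fun _ => 1 + 2 * Gψ) fun j hj => by
        rw [if_neg (Finset.ne_of_mem_erase hj), if_neg (Finset.ne_of_mem_erase hj)]; ring]
      rw [Finset.prod_const, Finset.card_erase_of_mem (Finset.mem_erase.2 ⟨hi, Finset.mem_univ i⟩),
        Finset.card_erase_of_mem (Finset.mem_univ _), Finset.card_univ, Fintype.card_fin, Nat.sub_sub]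
      ring
  set W : ℝ := α + (d - 1) * β with hW
  have hwt : ∀ i₀ : Fin d, ∑ i : Fin d, (if i = i₀ then α else β) = W := by
    intro i₀
    rw [← Finset.add_sum_erase _ _ (Finset.mem_univ i₀), if_pos rfl,
      Finset.sum_congr rfl (g := fun _ => β) fun j hj => if_neg (Finset.ne_of_mem_erase hj),
      Finset.sum_const, Finset.card_erase_of_mem (Finset.mem_univ _), Finset.card_univ, Fintype.card_fin,
      nsmul_eq_mul, Nat.cast_sub (Fin.pos i₀)]
    push_cast; rfl
  have hd1 : 0 < d → (1 : ℝ) ≤ d := fun h => by exact_mod_cast h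
  refine (sum_erase_le_sum_class hsep l₀ (fun l => sq_nonneg _)
    (B := fun i₀ => W * ∑ i, (if i = i₀ then α else β) * u i ^ 2) fun i₀ F hF => ?_).trans (le_of_eq ?_)
  · have hW0 : 0 < W := by
      have := hd1 (Fin.pos i₀)
      have := mul_nonneg (sub_nonneg.2 this) hβ0.le
      linarith
    have hpt : ∀ l, (∏ i, kap θ N (X i - Ξ l i) - ∏ i, kap θ N (Ξ l₀ i - Ξ l i)) ^ 2 ≤
        W * ∑ i, u i ^ 2 / (if i = i₀ then α else β) * (φ (p l i) * ∏ j ∈ Finset.univ.erase i, ψ (p l j)) := by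
      intro l
      have h1 := abs_prod_sub_prod_le Finset.univ (a := fun i => kap θ N (X i - Ξ l i))
        (b := fun i => kap θ N (Ξ l₀ i - Ξ l i)) (m := fun i => √(ψ (p l i)))
        (fun i => Real.abs_le_sqrt (hψX l i)) (fun i => Real.abs_le_sqrt (hψΞ l i))
      rw [← sq_abs]
      refine (pow_le_pow_left₀ (abs_nonneg _) h1 2).trans ?_
      have hg0 : ∀ i, 0 < (if i = i₀ then α else β) := fun i => by split_ifs; exacts [hα0, hβ0]
      -- Weighted Cauchy–Schwarz, with weight α for the coordinate i₀ in which the class is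
      -- separated and β for the others. For i = i₀ the difference factor φ sits in the tail itself;
      -- for i ≠ i₀ the tail is that of ψ, multiplied by the full mass C + 2Gφ.
      have h2 := Finset.sq_sum_div_le_sum_sq_div Finset.univ
        (fun i => |kap θ N (X i - Ξ l i) - kap θ N (Ξ l₀ i - Ξ l i)| *
          ∏ j ∈ Finset.univ.erase i, √(ψ (p l j))) (g := fun i => if i = i₀ then α else β) fun i _ => hg0 i
      rw [hwt, div_le_iff₀ hW0, mul_comm _ W] at h2
      refine h2.trans (mul_le_mul_of_nonneg_left (Finset.sum_le_sum fun i _ => ?_) hW0.le)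
      rw [mul_pow, sq_abs, ← Finset.prod_pow]
      simp only [Real.sq_sqrt (hψ0 _)]
      rw [div_mul_eq_mul_div]
      refine div_le_div_of_nonneg_right ?_ (hg0 i).le
      rw [← mul_assoc]
      exact mul_le_mul_of_nonneg_right (hφ l i) (Finset.prod_nonneg fun _ _ => hψ0 _)
    refine (Finset.sum_le_sum fun l _ => hpt l).trans ?_
    rw [← Finset.mul_sum, Finset.sum_comm]
    refine mul_le_mul_of_nonneg_left (Finset.sum_le_sum fun i _ => ?_) hW0.le
    rw [← Finset.mul_sum]
    have h3 := hclass i₀ i F hF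
    refine (mul_le_mul_of_nonneg_left h3 ?_).trans (le_of_eq ?_)
    · split_ifs <;> positivity
    · split_ifs <;> field_simp
  -- Summing over the d classes, each squared displacement collects the total weight W once more,
  -- whence the square of W.
  · rw [← Finset.mul_sum, Finset.sum_comm]
    have : ∀ i : Fin d, ∑ i₀ : Fin d, (if i = i₀ then α else β) * u i ^ 2 = W * u i ^ 2 := by
      intro i
      rw [← Finset.sum_mul, ← hwt i]
      congr 1
      exact Finset.sum_congr rfl fun j _ => by simp only [eq_comm]
    simp only [this]
    rw [← Finset.mul_sum]; ring

/-- The majorant `h / (4 (|v| - 3 / 10) ^ 2 - 1) ^ 2` away from the origin. -/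
noncomputable def shiftedTail (h t C v : ℝ) : ℝ :=
  if t ≤ |v| then h / (4 * (|v| - 0.3) ^ 2 - 1) ^ 2 else C

theorem shiftedTail_nonneg {h t C : ℝ} (h0 : 0 ≤ h) (hC : 0 ≤ C) (v : ℝ) : 0 ≤ shiftedTail h t C v := by
  unfold shiftedTail
  split_ifs
  exacts [by positivity, hC]

theorem shiftedTail_le {h t C : ℝ} (h0 : 0 ≤ h) (ht : 1.3 ≤ t) (hC : h / (4 * (t - 0.3) ^ 2 - 1) ^ 2 ≤ C) (v : ℝ) :
    shiftedTail h t C v ≤ C := by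
  unfold shiftedTail
  split_ifs with hv
  · refine le_trans (div_le_div_of_nonneg_left h0 ?_ ?_) hC
    · have : 0 < 4 * (t - 0.3) ^ 2 - 1 := by nlinarith
      positivity
    · exact pow_le_pow_left₀ (by nlinarith) (by nlinarith) 2
  · exact le_rfl

theorem tailBound_shiftedTail {N : ℕ} {h t C A s c S : ℝ} (h0 : 0 ≤ h) (ht : 1.3 ≤ t) (htA : t ≤ A) (hc : 0 < c)
    (hAs : A ≤ c * s) (hS : ∀ n, ∑ j ∈ Finset.range n, ((c / ((j : ℝ) + c)) ^ 2) ^ 2 ≤ S) :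
    TailBound (shiftedTail h t C) N s A (h * S / (4 * (A - 0.3) ^ 2 - 1) ^ 2) := by
  have hA : 0 < A := by linarith
  have e : 4 * ((A - 0.3) / A) ^ 2 * A ^ 2 = 4 * (A - 0.3) ^ 2 := by field_simp
  rw [← e]
  refine tailBound_of_le hA hc hAs zero_le_one (by rw [e]; nlinarith) h0 (fun u _ hu => ?_) hS
  rw [shiftedTail, if_pos (htA.trans hu)]
  have h1 : (A - 0.3) / A * |u| ≤ |u| - 0.3 := by
    rw [div_mul_eq_mul_div, div_le_iff₀ hA]; nlinarith
  have h2 : 4 * ((A - 0.3) / A) ^ 2 * u ^ 2 ≤ 4 * (|u| - 0.3) ^ 2 := by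
    rw [← sq_abs u, mul_assoc, ← mul_pow]
    have : 0 ≤ (A - 0.3) / A := div_nonneg (by linarith) hA.le
    exact mul_le_mul_of_nonneg_left (pow_le_pow_left₀ (by positivity) h1 2) (by norm_num)
  have h3 : 1 < 4 * ((A - 0.3) / A) ^ 2 * u ^ 2 := by
    have : A ^ 2 ≤ u ^ 2 := by rw [← sq_abs u]; exact pow_le_pow_left₀ hA.le hu 2
    have h4 : 4 * ((A - 0.3) / A) ^ 2 * A ^ 2 ≤ 4 * ((A - 0.3) / A) ^ 2 * u ^ 2 := by gcongr
    rw [e] at h4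
    nlinarith
  exact div_le_div_of_nonneg_left h0 (pow_pos (by linarith) 2) (pow_le_pow_left₀ (by linarith) (by linarith) 2)

/-- The shift by 0.3 absorbs the displacement of x from its node, so one majorant evaluated at the
difference of the nodes covers both arguments. -/
theorem kap_sq_le_shiftedTail {N : ℕ} (hN : 5 ≤ N) {a b : ℝ} (hab : |b - a| ≤ 0.3) :
    kap 0 N a ^ 2 ≤ shiftedTail 1 1.3 1 (red N b) := by
  unfold shiftedTail
  rw [← sq_abs (kap 0 N a)]
  split_ifs with h
  · have h1 := abs_red_le_abs_red_add (by omega : 0 < N) b a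
    have h2 := abs_kap_le_of_red hN (m := |red N b| - 0.3) (u := a) (by linarith) (by linarith)
    refine (pow_le_pow_left₀ (abs_nonneg _) h2 2).trans (le_of_eq ?_)
    rw [div_pow, one_pow]
  · exact pow_le_one₀ (abs_nonneg _) (abs_kap_le_one le_rfl (by norm_num) hN a)

/-- The constant 21.16 = 4.6² comes from the derivative bound, which is available from 1.6 = 1.9 -
0.3 on; closer to the origin the global Lipschitz constant π is used, and π² < 10. -/
theorem kap_sub_sq_le_shiftedTail {N : ℕ} (hN : 5 ≤ N) {a b : ℝ} (hab : |a - b| ≤ 0.3) :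
    (kap 0 N a - kap 0 N b) ^ 2 ≤ (a - b) ^ 2 * shiftedTail 21.16 1.9 10 (red N b) := by
  unfold shiftedTail
  rw [← sq_abs (kap 0 N a - kap 0 N b), ← sq_abs (a - b)]
  split_ifs with h
  · have h2 := abs_kap_sub_le_of_red hN (m := |red N b|) (h := 0.3) (a := b) (b := a) (by linarith) le_rfl hab
    refine (pow_le_pow_left₀ (abs_nonneg _) h2 2).trans (le_of_eq ?_)
    rw [mul_pow, div_pow]; ring
  · refine (pow_le_pow_left₀ (abs_nonneg _) (abs_kap_sub_le le_rfl (by norm_num) hN a b) 2).trans ?_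
    rw [mul_pow, mul_comm]
    have := Real.pi_lt_d4
    have h3 := pow_le_pow_left₀ Real.pi_pos.le this.le 2
    exact mul_le_mul_of_nonneg_left (by norm_num at h3 ⊢; linarith) (sq_nonneg _)

/-- Hypothesis `hm` makes Z ↦ Z - (Wt + Zb)²/lam nondecreasing between ζq and 1, so Z may be lowered
to ζq. What remains is q times a factor that is smallest at t = t₀. -/
theorem le_sub_sq_div {Z ζ t t₀ q W b lam R : ℝ} (hl : 0 < lam) (hb : 0 ≤ b) (hW : 0 ≤ W) (hζ : 0 ≤ ζ)
    (ht : 0 ≤ t) (hq : q = t ^ 2) (ht₀ : t ≤ t₀) (hZ : ζ * q ≤ Z) (hZ1 : Z ≤ 1)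
    (hR : R ≤ ζ - (W + ζ * t₀ * b) ^ 2 / lam) (hm : b * (2 * W * t₀ + 2 * b) ≤ lam) :
    R * q ≤ Z - (W * t + Z * b) ^ 2 / lam := by
  have hq0 : 0 ≤ q := hq ▸ sq_nonneg t
  have h1 : (W + ζ * t * b) ^ 2 ≤ (W + ζ * t₀ * b) ^ 2 := by
    have : 0 ≤ ζ * t * b := by positivity
    gcongr
  have h2 : (W * t + Z * b) ^ 2 - (W * t + ζ * q * b) ^ 2 ≤ (Z - ζ * q) * lam := by
    have e : (W * t + Z * b) ^ 2 - (W * t + ζ * q * b) ^ 2 =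
        (Z - ζ * q) * (b * (2 * W * t + (Z + ζ * q) * b)) := by ring
    rw [e]
    refine mul_le_mul_of_nonneg_left (le_trans ?_ hm) (by linarith)
    have h3 : W * t ≤ W * t₀ := by gcongr
    have h4 : (Z + ζ * q) * b ≤ 2 * b := mul_le_mul_of_nonneg_right (by linarith) hb
    exact mul_le_mul_of_nonneg_left (by linarith) hb
  have h5 : (W * t + ζ * q * b) ^ 2 = q * (W + ζ * t * b) ^ 2 := by rw [hq]; ring
  have h6 : (W * t + Z * b) ^ 2 ≤ q * (W + ζ * t₀ * b) ^ 2 + (Z - ζ * q) * lam := by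
    have := mul_le_mul_of_nonneg_left h1 hq0
    linarith
  have h7 : (W * t + Z * b) ^ 2 / lam ≤ q * ((W + ζ * t₀ * b) ^ 2 / lam) + (Z - ζ * q) := by
    rw [div_le_iff₀ hl, add_mul, mul_assoc, div_mul_cancel₀ _ hl.ne']
    exact h6
  have h8 := mul_le_mul_of_nonneg_right hR hq0
  linarith

section Center

variable {d r n : ℕ} (w : Fin r → ℂ)

/-- As x approaches the node, 1 - K² and the error are both of order q, so their constants have to
be compared. The residual is written as (K_l - M_{l₀ l}) + (1 - K) M_{l₀ l}: the first part is at
most W√q in ℓ² because the kernel is differentiable, and the second is at most (1 - K²) b because 0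
≤ K ≤ 1. -/
theorem center_gap {ξ : Fin r → UnitAddTorus (Fin d)}
    (S : SVD ((n + 1) ^ d) (momentMatrix (discreteMeasure w ξ) n)) {x : UnitAddTorus (Fin d)}
    {s δ : ℝ} {l₀ : Fin r} {X : Fin d → ℝ} {Ξ : Fin r → Fin d → ℝ}
    (hC : IsConfig n ξ x s δ l₀ X Ξ) (hN : 5 ≤ n + 1) {q R lam b W ζ t₀ : ℝ}
    (hq : q = ∑ i, (X i - Ξ l₀ i) ^ 2) (hl : 0 < lam)
    (hrow : ∀ l, ∑ m ∈ Finset.univ.erase l, |∏ i, kap 0 (n + 1) (Ξ l i - Ξ m i)| ≤ 1 - lam)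
    (hW : 0 ≤ W) (hb : 0 ≤ b) (hζ : 0 ≤ ζ)
    (hΔ : ∑ l ∈ Finset.univ.erase l₀, (∏ i, kap 0 (n + 1) (X i - Ξ l i) -
      ∏ i, kap 0 (n + 1) (Ξ l₀ i - Ξ l i)) ^ 2 ≤ W ^ 2 * q)
    (hM : ∑ l ∈ Finset.univ.erase l₀, (∏ i, kap 0 (n + 1) (Ξ l₀ i - Ξ l i)) ^ 2 ≤ b ^ 2)
    (hu : ∀ i, |X i - Ξ l₀ i| ≤ 1 / 2)
    (hZ : ζ * q ≤ 1 - (∏ i, kap 0 (n + 1) (X i - Ξ l₀ i)) ^ 2) (ht : 0 ≤ t₀) (hqt : q ≤ t₀ ^ 2)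
    (hR : R ≤ ζ - (W + ζ * t₀ * b) ^ 2 / lam) (hm : b * (2 * W * t₀ + 2 * b) ≤ lam) :
    R * q ≤ (Real.pi / 2) ^ d * (1 - signalFun S x) := by
  set K := ∏ i, kap 0 (n + 1) (X i - Ξ l₀ i)
  have hK0 : 0 ≤ K := prod_kap_nonneg hN hu
  have hK1 : K ≤ 1 := Finset.prod_le_one (fun i _ => by rw [kap_zero_left]; exact ker_one_nonneg hN (hu i))
    fun i _ => (le_abs_self _).trans (abs_kap_le_one le_rfl (by norm_num) hN _)
  have hq0 : 0 ≤ q := hq ▸ Finset.sum_nonneg fun i _ => sq_nonneg _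
  have hZ0 : 0 ≤ 1 - K ^ 2 := by nlinarith
  have hsq := Real.sq_sqrt hq0
  refine (le_sub_sq_div hl hb hW hζ (Real.sqrt_nonneg q) hsq.symm (Real.sqrt_le_iff.2 ⟨ht, hqt⟩) hZ
    (by linarith [sq_nonneg K]) hR hm).trans ?_
  refine sub_le_mul_one_sub_signalFun w ξ S x hC.coe_left hC.coe_right le_rfl (by norm_num) hN (wt_zero_le hN)
    (by positivity) hl hrow l₀ ?_
  have h1 := sum_add_sq_le (Finset.univ.erase l₀) (A := W * √q) (B := (1 - K ^ 2) * b)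
    (a := fun l => ∏ i, kap 0 (n + 1) (X i - Ξ l i) - ∏ i, kap 0 (n + 1) (Ξ l₀ i - Ξ l i))
    (b := fun l => (1 - K) * ∏ i, kap 0 (n + 1) (Ξ l₀ i - Ξ l i)) (by positivity) (mul_nonneg hZ0 hb)
    (by rw [mul_pow, hsq]; exact hΔ) ?_
  · refine le_trans (le_of_eq (Finset.sum_congr rfl fun l _ => ?_)) h1
    ring
  · simp only [mul_pow]
    rw [← Finset.mul_sum]
    refine mul_le_mul ?_ hM (Finset.sum_nonneg fun _ _ => sq_nonneg _) (sq_nonneg _)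
    exact pow_le_pow_left₀ (by linarith) (by nlinarith) 2

theorem center_gap_one {ξ : Fin r → UnitAddTorus (Fin 1)}
    (S : SVD ((n + 1) ^ 1) (momentMatrix (discreteMeasure w ξ) n)) {x : UnitAddTorus (Fin 1)}
    {δ : ℝ} {l₀ : Fin r} {X : Fin 1 → ℝ} {Ξ : Fin r → Fin 1 → ℝ}
    (hC : IsConfig n ξ x (2 * √((1 : ℕ) : ℝ)) δ l₀ X Ξ) (hN : 5 ≤ n + 1) (h1 : δ ≤ 0.3) :
    0.7855 * δ ^ 2 ≤ (Real.pi / 2) ^ 1 * (1 - signalFun S x) := by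
  have e1 : √((1 : ℕ) : ℝ) = 1 := by simp
  have hT₁ := tailBound_ker_sq_sep hN (d := 1) le_rfl
  have hG := tailBound_ker_sq_half hN (d := 1) le_rfl
  have hu : ∀ i, |X i - Ξ l₀ i| ≤ 0.3 := fun i => (hC.near i).trans h1
  have hqs : ∑ i, (X i - Ξ l₀ i) ^ 2 = (X 0 - Ξ l₀ 0) ^ 2 := by simp
  have hδq : (X 0 - Ξ l₀ 0) ^ 2 = δ ^ 2 := by
    obtain ⟨i, hi⟩ := hC.attained
    rw [Subsingleton.elim 0 i, ← hi, sq_abs]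
  have hδ2 : (X 0 - Ξ l₀ 0) ^ 2 ≤ 0.09 := by
    rw [← sq_abs]; nlinarith [hu 0, abs_nonneg (X 0 - Ξ l₀ 0)]
  rw [← hδq, ← hqs]
  -- The value ζ = 1.54 comes from 1 - (1 - 0.8p)² = 1.6p - 0.64p² with p ≤ 0.09.
  refine center_gap w S hC hN rfl (lam := 0.7777) (b := 0.1019) (W := 0.6655)
    (ζ := 1.54) (t₀ := 0.3) (by norm_num) (row_sum_ker_one_le hN hC.sep) (by norm_num) (by norm_num)
    (by norm_num) ?_ ?_ (fun i => (hu i).trans (by norm_num)) ?_ (by norm_num)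
    (by rw [hqs]; norm_num at hδ2 ⊢; linarith) (by norm_num) (by norm_num)
  · have hφ2 : TailBound (shiftedTail 21.16 1.9 10) (n + 1) (2 * √((1 : ℕ) : ℝ)) (2 * √((1 : ℕ) : ℝ)) _ :=
      tailBound_shiftedTail (c := 1) (by norm_num) (by norm_num) (by rw [e1]; norm_num) one_pos (by linarith)
        sum_pow_four_one_le
    have hψ2 : TailBound (shiftedTail 1 1.3 1) (n + 1) (2 * √((1 : ℕ) : ℝ)) (2 * √((1 : ℕ) : ℝ)) _ :=
      tailBound_shiftedTail (c := 1) (by norm_num) (by norm_num) (by rw [e1]; norm_num) one_pos (by linarith)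
        sum_pow_four_one_le
    have hφ3 : TailBound (shiftedTail 21.16 1.9 10) (n + 1) (2 * √((1 : ℕ) : ℝ))
        (2 * √((1 : ℕ) : ℝ) / 2) _ := TailBound.cons (h := 10) (by norm_num)
      (fun u _ _ => shiftedTail_le (by norm_num) (by norm_num) (by norm_num) u)
      (tailBound_shiftedTail (c := 3 / 2) (by norm_num) (by norm_num) (by rw [e1]; norm_num) (by norm_num)
        (by linarith) sum_pow_four_three_half_le)
    have hψ3 : TailBound (shiftedTail 1 1.3 1) (n + 1) (2 * √((1 : ℕ) : ℝ))
        (2 * √((1 : ℕ) : ℝ) / 2) _ := TailBound.cons (h := 1) (by norm_num)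
      (fun u _ _ => shiftedTail_le (by norm_num) (by norm_num) (by norm_num) u)
      (tailBound_shiftedTail (c := 3 / 2) (by norm_num) (by norm_num) (by rw [e1]; norm_num) (by norm_num)
        (by linarith) sum_pow_four_three_half_le)
    have h := sum_sq_prod_sub_le (Nat.succ_pos n) (θ := 0) (by rw [e1]; norm_num) hC.sep l₀ (X := X)
      (φ := shiftedTail 21.16 1.9 10) (ψ := shiftedTail 1 1.3 1) (C := 10)
      (shiftedTail_nonneg (by norm_num) (by norm_num)) (shiftedTail_nonneg (by norm_num) (by norm_num))
      (shiftedTail_le (by norm_num) (by norm_num) (by norm_num))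
      (shiftedTail_le (by norm_num) (by norm_num) (by norm_num))
      (fun l i => ?_) (fun l i => kap_sq_le_shiftedTail hN ?_) (fun l i => kap_sq_le_shiftedTail hN ?_)
      hφ2 hψ2 hφ3 hψ3 (α := 0.6655) (β := 1) (by norm_num) (by norm_num) ?_ ?_
    · refine h.trans (le_of_eq ?_)
      norm_num
    · have := kap_sub_sq_le_shiftedTail hN (a := X i - Ξ l i) (b := Ξ l₀ i - Ξ l i)
        (by rw [sub_sub_sub_cancel_right]; exact hu i)
      rwa [sub_sub_sub_cancel_right] at this
    · rw [sub_sub_sub_cancel_right, abs_sub_comm]; exact hu i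
    · rw [sub_self, abs_zero]; norm_num
    · norm_num
    · norm_num
  · have h := sq_sum_le le_rfl (by norm_num) hN (by rw [e1]; norm_num) hC.sep (l₀ := l₀) (Y := Ξ l₀)
      (δ := 0) (fun i => by simp) hG hT₁ (by simpa using hT₁)
    refine h.trans ?_
    norm_num
  · rw [hqs]
    have h2 := ker_one_le_of_le_half hN ((hu 0).trans (by norm_num : (0.3 : ℝ) ≤ 1 / 2))
    have h3 := ker_one_nonneg hN ((hu 0).trans (by norm_num : (0.3 : ℝ) ≤ 1 / 2))
    simp only [Finset.univ_unique, Fin.default_eq_zero, Finset.prod_singleton, kap_zero_left]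
    have h4 := pow_le_pow_left₀ h3 h2 2
    have h5 : 0 ≤ (X 0 - Ξ l₀ 0) ^ 2 := sq_nonneg _
    generalize (X 0 - Ξ l₀ 0) ^ 2 = p at *
    nlinarith [mul_nonneg h5 (sub_nonneg.2 hδ2)]

end Center

section Center

variable {d r n : ℕ} (w : Fin r → ℂ)

/-- The tails at 2√d are of order d⁻², so α and β can be taken of order 1/d and α + (d - 1)β stays
bounded. -/
theorem sum_sq_prod_sub_le_of_two_le {ξ : Fin r → UnitAddTorus (Fin d)} {x : UnitAddTorus (Fin d)}
    {δ : ℝ} {l₀ : Fin r} {X : Fin d → ℝ} {Ξ : Fin r → Fin d → ℝ} (hd : 2 ≤ d)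
    (hC : IsConfig n ξ x (2 * √(d : ℝ)) δ l₀ X Ξ) (hN : 5 ≤ n + 1) (hu : ∀ i, |X i - Ξ l₀ i| ≤ 0.3) :
    ∑ l ∈ Finset.univ.erase l₀, (∏ i, kap 0 (n + 1) (X i - Ξ l i) -
      ∏ i, kap 0 (n + 1) (Ξ l₀ i - Ξ l i)) ^ 2 ≤
      ((0.614 + 0.732 * (d - 1)) / d) ^ 2 * ∑ i, (X i - Ξ l₀ i) ^ 2 := by
  have hd' : (2 : ℝ) ≤ d := by exact_mod_cast hd
  have hs := sqrt_pos_of_one_le (d := d) (by omega)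
  have hsq := sqrt_le_of_two_le hd
  have h2s : 1.414 ≤ √(d : ℝ) := Real.le_sqrt_of_sq_le (by norm_num; linarith)
  have hsd := Real.sq_sqrt (d.cast_nonneg : (0 : ℝ) ≤ d)
  have hd0 : (0 : ℝ) < d := by linarith
  have e1 : 12.28 * (d : ℝ) ≤ 4 * (2 * √(d : ℝ) - 0.3) ^ 2 - 1 := by nlinarith
  have e2 : 1.98 * (d : ℝ) ≤ 4 * (2 * √(d : ℝ) / 2 - 0.3) ^ 2 - 1 := by nlinarith
  have e3 : 61 ≤ 4 * (2 * √(d : ℝ) / 2 + 2 * √(d : ℝ) - 0.3) ^ 2 - 1 := by nlinarith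
  have hφ2 : TailBound (shiftedTail 21.16 1.9 10) (n + 1) (2 * √(d : ℝ)) (2 * √(d : ℝ)) (0.16371 / d ^ 2) :=
    (tailBound_shiftedTail (c := 1) (by norm_num) (by norm_num) (by linarith) one_pos (by linarith)
        sum_pow_four_one_le).mono le_rfl (by
      have := pow_le_pow_left₀ (by positivity) e1 2
      rw [div_le_div_iff₀ (by nlinarith) (by positivity)]
      nlinarith)
  have hψ2 : TailBound (shiftedTail 1 1.3 1) (n + 1) (2 * √(d : ℝ)) (2 * √(d : ℝ)) (0.00774 / d ^ 2) :=
    (tailBound_shiftedTail (c := 1) (by norm_num) (by norm_num) (by linarith) one_pos (by linarith)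
        sum_pow_four_one_le).mono le_rfl (by
      have := pow_le_pow_left₀ (by positivity) e1 2
      rw [div_le_div_iff₀ (by nlinarith) (by positivity)]
      nlinarith)
  have hφ3 : TailBound (shiftedTail 21.16 1.9 10) (n + 1) (2 * √(d : ℝ)) (2 * √(d : ℝ) / 2) (10 + 0.0129) :=
    TailBound.cons (by norm_num)
      (fun u _ _ => shiftedTail_le (by norm_num) (by norm_num) (by norm_num) u)
      ((tailBound_shiftedTail (c := 3 / 2) (by norm_num) (by norm_num) (by linarith) (by norm_num)
        (by linarith) sum_pow_four_three_half_le).mono le_rfl (by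
      have := pow_le_pow_left₀ (by norm_num) e3 2
      rw [div_le_iff₀ (by nlinarith)]
      nlinarith))
  have hψ1 : TailBound (shiftedTail 1 1.3 1) (n + 1) (2 * √(d : ℝ)) (2 * √(d : ℝ) / 2) (0.2622 / d ^ 2) :=
    (tailBound_shiftedTail (c := 1 / 2) (by norm_num) (by norm_num) (by linarith) (by norm_num) (by linarith)
        sum_pow_four_half_le).mono le_rfl (by
      have := pow_le_pow_left₀ (by positivity) e2 2
      rw [div_le_div_iff₀ (by nlinarith) (by positivity)]
      nlinarith)
  have hP := one_add_div_sq_pow_le (y := 0.5244) (by norm_num) (by norm_num) (d := d) (by omega)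
  have hP1 : (1 + 2 * (0.2622 / (d : ℝ) ^ 2)) ^ (d - 1) ≤ 1.1509 := by
    rw [show 2 * (0.2622 / (d : ℝ) ^ 2) = 0.5244 / d ^ 2 by ring]
    exact hP.trans (by norm_num)
  have hP2 : (1 + 2 * (0.2622 / (d : ℝ) ^ 2)) ^ (d - 2) ≤ 1.1509 :=
    (pow_le_pow_right₀ (le_add_of_nonneg_right (by positivity)) (by omega)).trans hP1
  have h := sum_sq_prod_sub_le (Nat.succ_pos n) (θ := 0) (by linarith) hC.sep l₀ (X := X)
    (φ := shiftedTail 21.16 1.9 10) (ψ := shiftedTail 1 1.3 1) (C := 10)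
    (shiftedTail_nonneg (by norm_num) (by norm_num)) (shiftedTail_nonneg (by norm_num) (by norm_num))
    (shiftedTail_le (by norm_num) (by norm_num) (by norm_num))
    (shiftedTail_le (by norm_num) (by norm_num) (by norm_num))
    (fun l i => ?_) (fun l i => kap_sq_le_shiftedTail hN ?_) (fun l i => kap_sq_le_shiftedTail hN ?_)
    hφ2 hψ2 hφ3 hψ1 (α := 0.614 / d) (β := 0.732 / d) (by positivity) (by positivity) ?_ ?_
  · refine h.trans (le_of_eq ?_)
    congr 2
    field_simp
  · have := kap_sub_sq_le_shiftedTail hN (a := X i - Ξ l i) (b := Ξ l₀ i - Ξ l i)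
      (by rw [sub_sub_sub_cancel_right]; exact hu i)
    rwa [sub_sub_sub_cancel_right] at this
  · rw [sub_sub_sub_cancel_right, abs_sub_comm]; exact hu i
  · rw [sub_self, abs_zero]; norm_num
  · refine (mul_le_mul_of_nonneg_left hP1 (by positivity)).trans ?_
    rw [div_pow, ← add_div, div_mul_eq_mul_div]
    exact div_le_div_of_nonneg_right (by norm_num) (by positivity)
  · refine (mul_le_mul_of_nonneg_left (mul_le_mul_of_nonneg_left hP2 (by norm_num)) (by positivity)).trans ?_
    rw [div_pow, ← add_div, div_mul_eq_mul_div]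
    exact div_le_div_of_nonneg_right (by norm_num) (by positivity)

theorem sum_sq_prod_le_of_two_le {ξ : Fin r → UnitAddTorus (Fin d)} {x : UnitAddTorus (Fin d)}
    {δ b : ℝ} {d₀ : ℕ} {l₀ : Fin r} {X : Fin d → ℝ} {Ξ : Fin r → Fin d → ℝ} (hd₀ : 2 ≤ d₀) (hd : d₀ ≤ d)
    (hC : IsConfig n ξ x (2 * √(d : ℝ)) δ l₀ X Ξ) (hN : 5 ≤ n + 1) (hb : 0.01016 / d₀ ≤ b ^ 2) :
    ∑ l ∈ Finset.univ.erase l₀, (∏ i, kap 0 (n + 1) (Ξ l₀ i - Ξ l i)) ^ 2 ≤ b ^ 2 := by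
  have hd' : (2 : ℝ) ≤ d := by exact_mod_cast hd₀.trans hd
  have hs := sqrt_pos_of_one_le (d := d) (by omega)
  have hT := tailBound_ker_sq_sep hN (d := d) (by omega)
  have hG := tailBound_ker_sq_half hN (d := d) (by omega)
  refine (sq_sum_le le_rfl (by norm_num) hN (by linarith) hC.sep (l₀ := l₀) (Y := Ξ l₀) (δ := 0)
    (fun i => by simp) hG hT (by simpa using hT)).trans ?_
  have b1 : 7 / 6 / (16 * (d : ℝ) - 1) ^ 2 ≤ 0.00486 / d ^ 2 := by
    rw [div_le_div_iff₀ (by nlinarith) (by positivity)]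
    nlinarith
  have b3 : 37 / 36 / (4 * (d : ℝ) - 1) ^ 2 ≤ 0.0840 / d ^ 2 := by
    rw [div_le_div_iff₀ (by nlinarith) (by positivity)]
    nlinarith
  refine mul_mul_pow_le (d₀ := d₀) (by omega) hd (a := 0.00972) (g := 0.0840) (P := 1.0439) ?_
    (by positivity) b3 (by norm_num) (by norm_num) (by norm_num) (le_trans ?_ hb)
  · rw [show (0.00972 : ℝ) = 0.00486 + 0.00486 by norm_num, add_div]; linarith
  · exact div_le_div_of_nonneg_right (by norm_num) (by positivity)

theorem center_gap_of_two_le {ξ : Fin r → UnitAddTorus (Fin d)}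
    (S : SVD ((n + 1) ^ d) (momentMatrix (discreteMeasure w ξ) n)) {x : UnitAddTorus (Fin d)}
    {δ : ℝ} {l₀ : Fin r} {X : Fin d → ℝ} {Ξ : Fin r → Fin d → ℝ} (hd : 2 ≤ d)
    (hC : IsConfig n ξ x (2 * √(d : ℝ)) δ l₀ X Ξ) (hN : 5 ≤ n + 1) {q R : ℝ}
    (hq : q = ∑ i, (X i - Ξ l₀ i) ^ 2) (hq0 : q ≤ 1 / 16) (hR0 : 0 ≤ R) (hR : R ≤ 0.694)
    (hR3 : 3 ≤ d → R ≤ 0.4662) :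
    R * δ ^ 2 ≤ (Real.pi / 2) ^ d * (1 - signalFun S x) := by
  have hd' : (2 : ℝ) ≤ d := by exact_mod_cast hd
  have huq : ∀ i, (X i - Ξ l₀ i) ^ 2 ≤ q := fun i => by
    rw [hq]
    exact Finset.single_le_sum (f := fun i => (X i - Ξ l₀ i) ^ 2) (fun i _ => sq_nonneg _) (Finset.mem_univ i)
  have hu : ∀ i, |X i - Ξ l₀ i| ≤ 0.25 := fun i =>
    abs_le_of_sq_le_sq ((huq i).trans (hq0.trans (by norm_num))) (by norm_num)
  have hδq : δ ^ 2 ≤ q := by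
    obtain ⟨i, hi⟩ := hC.attained
    rw [← hi, sq_abs]; exact huq i
  have hq00 : 0 ≤ q := (sq_nonneg δ).trans hδq
  refine (mul_le_mul_of_nonneg_left hδq hR0).trans ?_
  have hΔ := sum_sq_prod_sub_le_of_two_le hd hC hN fun i => (hu i).trans (by norm_num)
  rw [← hq] at hΔ
  have hu2 : ∀ i, |X i - Ξ l₀ i| ≤ 1 / 2 := fun i => (hu i).trans (by norm_num)
  -- For q ≤ 1/16 one has 1 - 1/(1 + 1.6q) ≥ (1.6/1.1) q, and 1.4545 < 1.6/1.1.
  have hZ : 1.4545 * q ≤ 1 - (∏ i, kap 0 (n + 1) (X i - Ξ l₀ i)) ^ 2 := by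
    have hK := prod_kap_sq_mul_le hN hu2
    rw [← hq] at hK
    generalize (∏ i, kap 0 (n + 1) (X i - Ξ l₀ i)) ^ 2 = k at *
    have : k ≤ 1 - 1.4545 * q := by
      refine le_of_mul_le_mul_right (hK.trans ?_) (by linarith : 0 < 1 + 1.6 * q)
      nlinarith
    linarith
  rcases hd.eq_or_lt with h | h
  · subst h
    refine center_gap w S hC hN hq (lam := 0.708) (b := 0.0713) (W := 0.673) (ζ := 1.4545) (t₀ := 1 / 4)
      (by norm_num) (row_sum_ker_two_le hN hC.sep) (by norm_num) (by norm_num) (by norm_num)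
      (hΔ.trans (le_of_eq (by norm_num))) (sum_sq_prod_le_of_two_le le_rfl le_rfl hC hN (by norm_num))
      hu2 hZ (by norm_num) (hq0.trans (by norm_num)) (hR.trans (by norm_num)) (by norm_num)
  · refine center_gap w S hC hN hq (lam := 0.6) (b := 0.0583) (W := 0.732) (ζ := 1.4545) (t₀ := 1 / 4)
      (by norm_num) (row_sum_ker_le_of_three_le hN h hC.sep) (by norm_num) (by norm_num) (by norm_num)
      (hΔ.trans ?_) (sum_sq_prod_le_of_two_le (d₀ := 3) (by norm_num) h hC hN (by norm_num))
      hu2 hZ (by norm_num) (hq0.trans (by norm_num)) ((hR3 h).trans (by norm_num)) (by norm_num)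
    refine mul_le_mul_of_nonneg_right (pow_le_pow_left₀ (div_nonneg (by linarith) (by linarith)) ?_ 2) hq00
    rw [div_le_iff₀ (by linarith)]
    linarith

end Center

/-! ### Size of the projection coefficients -/

theorem kr_add_nat {N : ℕ} (hN : 0 < N) (w : Fin N → ℝ) (u : ℝ) :
    kr w (u + N) = (-1) ^ (N - 1) * kr w u := by
  have hN0 : (N : ℝ) ≠ 0 := by positivity
  unfold kr
  rw [Finset.mul_sum]
  refine Finset.sum_congr rfl fun k _ => ?_
  have e : 2 * (u + N) * node N k = 2 * u * node N k + ((((k : ℕ) : ℤ) * 2 - ((N - 1 : ℕ) : ℤ) : ℤ) : ℝ) * Real.pi := by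
    unfold node
    push_cast [Nat.cast_sub (show 1 ≤ N by omega)]
    field_simp
  rw [e, Real.cos_add_int_mul_pi, zpow_sub₀ (by norm_num), _root_.zpow_mul, zpow_natCast, zpow_natCast]
  have h1 : ((-1 : ℝ) ^ (k : ℕ)) ^ (2 : ℤ) = 1 := by
    rw [zpow_ofNat, ← pow_mul, mul_comm, pow_mul]; norm_num
  have h2 : (1 : ℝ) / (-1) ^ (N - 1) = (-1) ^ (N - 1) := by
    rcases neg_one_pow_eq_or ℝ (N - 1) with h | h <;> rw [h] <;> norm_num
  rw [h1, h2]; ring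

theorem kr_sq_red {N : ℕ} (hN : 0 < N) (w : Fin N → ℝ) (v : ℝ) : kr w (red N v) ^ 2 = kr w v ^ 2 := by
  have h : ∀ v, kr w (v + N) ^ 2 = kr w v ^ 2 := fun v => by
    have h1 : ((-1 : ℝ) ^ (N - 1)) ^ 2 = 1 := by rw [← pow_mul, mul_comm, pow_mul]; norm_num
    rw [kr_add_nat hN, mul_pow, h1, one_mul]
  have h' : ∀ (m : ℤ) (u : ℝ), kr w (u + m * N) ^ 2 = kr w u ^ 2 := by
    intro m u
    induction m using Int.induction_on with
    | zero => simp
    | succ i ih =>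
      rw [← ih, ← h (u + ((i : ℕ) : ℤ) * N)]; congr 2; push_cast; ring
    | pred i ih =>
      rw [← ih, ← h (u + ((-(i : ℕ) - 1 : ℤ) : ℝ) * N)]; congr 2; push_cast; ring
  rw [← h' (-round (v / N)) v]
  congr 2
  unfold red
  push_cast; ring

theorem kr_sq_abs {N : ℕ} (w : Fin N → ℝ) (u : ℝ) : kr w |u| ^ 2 = kr w u ^ 2 := by
  rcases abs_choice u with h | h
  · rw [h]
  · rw [h, kr_neg]

theorem abs_kr_le {N : ℕ} {w : Fin N → ℝ} (hw : ∀ k, 0 ≤ w k) (u : ℝ) : |kr w u| ≤ ∑ k, w k := by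
  unfold kr
  refine (Finset.abs_sum_le_sum_abs _ _).trans (Finset.sum_le_sum fun k _ => ?_)
  rw [abs_mul, abs_of_nonneg (hw k)]
  exact mul_le_of_le_one_right (hw k) (Real.abs_cos_le_one _)

theorem kr_zero {N : ℕ} (w : Fin N → ℝ) : kr w 0 = ∑ k, w k := by simp [kr]

/-- A window for which the coefficients of a projection can be bounded from below. -/
theorem one_sub_sub_le_mul_of_orthogonal {d r N : ℕ} (hN : 0 < N) {w : Fin N → ℝ} (hw : IsSymm w)
    (h1 : ∑ k, w k = 1) {ν : ℝ} (hν0 : 0 ≤ ν) (hν : (N * ∑ k, w k ^ 2) ^ d - 1 ≤ ν ^ 2) (X : Fin d → ℝ)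
    (Ξ : Fin r → Fin d → ℝ) {c : Fin r → ℂ} {q κ C : ℝ}
    (horth : ∀ l, ∑ k : Fin d → Fin N, (starRingEnd ℂ) (Evec (Ξ l) k) *
        (Evec X k - ∑ m, c m * Evec (Ξ m) k) = 0)
    (hq : q = 1 / (N : ℝ) ^ d * ∑ k : Fin d → Fin N, ‖Evec X k - ∑ l, c l * Evec (Ξ l) k‖ ^ 2)
    (hκ : 0 ≤ κ) (hC : 0 ≤ C) (hK : ∑ l, (∏ i, kr w (X i - Ξ l i)) ^ 2 ≤ κ ^ 2)
    (hc : ∑ l, ‖c l‖ ^ 2 ≤ C ^ 2) :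
    1 - q - ν / 2 ≤ κ * C := by
  have hN0 : (0 : ℝ) < N := by exact_mod_cast hN
  set M : ℝ := (N : ℝ) ^ d with hM
  have hM0 : 0 < M := by positivity
  set e : (Fin d → Fin N) → ℂ := Evec X with he
  set F : (Fin d → Fin N) → ℂ := fun k => Evec X k - ∑ m, c m * Evec (Ξ m) k with hF
  set W : (Fin d → Fin N) → ℝ := fun k => ∏ i, w (k i) with hW
  have hqM : ∑ k, ‖F k‖ ^ 2 = M * q := by rw [hq]; field_simp; rfl
  have hcard : ∑ _k : Fin d → Fin N, (1 : ℝ) = M := by simp [hM]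
  have hW1 : ∑ k, W k = 1 := by
    have := (Finset.prod_univ_sum (fun _ : Fin d => Finset.univ) fun _ k => w k).symm
    rw [Fintype.piFinset_univ] at this
    rw [hW, this]; simp [h1]
  have hW2 : ∑ k, W k ^ 2 = (∑ k, w k ^ 2) ^ d := by
    have := (Finset.prod_univ_sum (fun _ : Fin d => Finset.univ) fun _ k => w k ^ 2).symm
    rw [Fintype.piFinset_univ] at this
    simp only [hW, ← Finset.prod_pow]
    rw [this]; simp
  have hee : ∀ k, (starRingEnd ℂ) (e k) * e k = 1 := fun k => by
    rw [Complex.conj_mul', norm_Evec]; simp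
  -- The residual F is orthogonal to the span, so ⟨e, F⟩ = ⟨F, F⟩: the uniform mean of conj(e)F is
  -- q.
  have heF : ∑ k, (starRingEnd ℂ) (e k) * F k = ((M * q : ℝ) : ℂ) := by
    have h2 : ∑ k, (starRingEnd ℂ) (F k) * F k = ((M * q : ℝ) : ℂ) := by
      rw [← hqM]; push_cast
      exact Finset.sum_congr rfl fun k _ => by rw [Complex.conj_mul']
    rw [← h2]
    have h3 : ∀ k, (starRingEnd ℂ) (F k) * F k = (starRingEnd ℂ) (e k) * F k -
        ∑ m, (starRingEnd ℂ) (c m) * ((starRingEnd ℂ) (Evec (Ξ m) k) * F k) := by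
      intro k
      have : (starRingEnd ℂ) (F k) = (starRingEnd ℂ) (e k) -
          ∑ m, (starRingEnd ℂ) (c m) * (starRingEnd ℂ) (Evec (Ξ m) k) := by
        simp only [hF, map_sub, map_sum, map_mul, he]
      rw [this, sub_mul, Finset.sum_mul]
      congr 1
      exact Finset.sum_congr rfl fun m _ => by ring
    simp only [h3]
    rw [Finset.sum_sub_distrib, Finset.sum_comm]
    have h4 : ∀ m, ∑ k, (starRingEnd ℂ) (c m) * ((starRingEnd ℂ) (Evec (Ξ m) k) * F k) = 0 := fun m => by
      rw [← Finset.mul_sum, horth, mul_zero]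
    simp only [h4, Finset.sum_const_zero, sub_zero]
  have hWF : ∑ k, (W k : ℂ) * ((starRingEnd ℂ) (e k) * F k) =
      1 - ∑ l, c l * ((∏ i, kr w (X i - Ξ l i) : ℝ) : ℂ) := by
    have h3 : ∀ k, (W k : ℂ) * ((starRingEnd ℂ) (e k) * F k) = (W k : ℂ) -
        ∑ l, c l * ((W k : ℂ) * ((starRingEnd ℂ) (e k) * Evec (Ξ l) k)) := by
      intro k
      have : (W k : ℂ) * ((starRingEnd ℂ) (e k) * F k) = (W k : ℂ) * ((starRingEnd ℂ) (e k) * e k) -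
          (W k : ℂ) * ((starRingEnd ℂ) (e k) * ∑ m, c m * Evec (Ξ m) k) := by
        simp only [hF, he]; ring
      rw [this, hee, mul_one, Finset.mul_sum, Finset.mul_sum]
      congr 1
      exact Finset.sum_congr rfl fun m _ => by ring
    simp only [h3]
    rw [Finset.sum_sub_distrib, Finset.sum_comm]
    simp only [← Finset.mul_sum]
    congr 1
    · rw [← Complex.ofReal_sum, hW1]; simp
    · refine Finset.sum_congr rfl fun l _ => ?_
      rw [gram_eq hw (Ξ l) X]
      congr 2
      exact Finset.prod_congr rfl fun i _ => by rw [← kr_neg, neg_sub]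
  set D : (Fin d → Fin N) → ℂ := fun k => (starRingEnd ℂ) (e k) * F k - (q : ℂ) with hD
  -- Under the uniform mean, conj(e)F has mean q and second moment q, hence variance q - q² ≤ 1/4.
  have hD2 : ∑ k, ‖D k‖ ^ 2 ≤ M / 4 := by
    have h3 : ∀ k, ‖D k‖ ^ 2 = ‖F k‖ ^ 2 - 2 * q * ((starRingEnd ℂ) (e k) * F k).re + q ^ 2 * 1 := by
      intro k
      have hn : ‖(starRingEnd ℂ) (e k) * F k‖ = ‖F k‖ := by
        rw [norm_mul, RCLike.norm_conj, norm_Evec, one_mul]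
      rw [← hn]
      simp only [hD]
      generalize (starRingEnd ℂ) (e k) * F k = z
      rw [← Complex.normSq_eq_norm_sq, ← Complex.normSq_eq_norm_sq, Complex.normSq_apply, Complex.normSq_apply]
      simp only [Complex.sub_re, Complex.sub_im, Complex.ofReal_re, Complex.ofReal_im]
      ring
    simp only [h3]
    rw [Finset.sum_add_distrib, Finset.sum_sub_distrib, ← Finset.mul_sum, ← Finset.mul_sum, hqM, hcard,
      ← Complex.re_sum, heF, Complex.ofReal_re]
    nlinarith [sq_nonneg (q - 1 / 2)]
  -- The mean of conj(e)F with weight W is 1 - Σ c_l K_l and the uniform mean is q; they differ by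
  -- the mean of the centred function D against W - 1/M, which is small when the window is nearly
  -- uniform.
  have hkey : (1 - q : ℂ) = ∑ l, c l * ((∏ i, kr w (X i - Ξ l i) : ℝ) : ℂ) +
      ∑ k, ((W k - 1 / M : ℝ) : ℂ) * D k := by
    have : ∑ k, ((W k - 1 / M : ℝ) : ℂ) * D k = (∑ k, (W k : ℂ) * ((starRingEnd ℂ) (e k) * F k) -
        ((1 / M : ℝ) : ℂ) * ∑ k, (starRingEnd ℂ) (e k) * F k) -
        (q : ℂ) * (((∑ k, W k : ℝ) : ℂ) - ((1 / M : ℝ) : ℂ) * ((∑ _k : Fin d → Fin N, (1 : ℝ) : ℝ) : ℂ)) := by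
      simp only [hD]
      rw [Complex.ofReal_sum, Complex.ofReal_sum, Finset.mul_sum, Finset.mul_sum, ← Finset.sum_sub_distrib,
        ← Finset.sum_sub_distrib, Finset.mul_sum, ← Finset.sum_sub_distrib]
      refine Finset.sum_congr rfl fun k _ => ?_
      push_cast; ring
    rw [this, hWF, heF, hW1, hcard, ← Complex.ofReal_mul, ← Complex.ofReal_mul, one_div_mul_cancel hM0.ne',
      ← mul_assoc, one_div_mul_cancel hM0.ne']
    push_cast; ring
  have hA : ‖∑ l, c l * ((∏ i, kr w (X i - Ξ l i) : ℝ) : ℂ)‖ ≤ κ * C := by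
    refine (norm_sum_le _ _).trans ?_
    refine abs_le_of_sq_le_sq ?_ (by positivity) |> fun h => (le_abs_self _).trans h
    simp only [norm_mul, Complex.norm_real, Real.norm_eq_abs]
    refine (Finset.sum_mul_sq_le_sq_mul_sq _ _ _).trans ?_
    simp only [sq_abs]
    rw [mul_pow, mul_comm]
    exact mul_le_mul hK hc (Finset.sum_nonneg fun _ _ => sq_nonneg _) (sq_nonneg _)
  have hB : ‖∑ k, ((W k - 1 / M : ℝ) : ℂ) * D k‖ ≤ ν / 2 := by
    refine (norm_sum_le _ _).trans ?_
    refine abs_le_of_sq_le_sq ?_ (by positivity) |> fun h => (le_abs_self _).trans h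
    simp only [norm_mul, Complex.norm_real, Real.norm_eq_abs]
    refine (Finset.sum_mul_sq_le_sq_mul_sq _ _ _).trans ?_
    simp only [sq_abs]
    have h3 : ∑ k, (W k - 1 / M) ^ 2 ≤ ν ^ 2 / M := by
      have : ∀ k, (W k - 1 / M) ^ 2 = W k ^ 2 - 2 / M * W k + (1 / M) ^ 2 * 1 := fun k => by ring
      simp only [this]
      rw [Finset.sum_add_distrib, Finset.sum_sub_distrib, ← Finset.mul_sum, ← Finset.mul_sum, hW1, hW2, hcard,
        le_div_iff₀ hM0]
      rw [mul_pow] at hν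
      have e1 : ((∑ k, w k ^ 2) ^ d - 2 / M * 1 + (1 / M) ^ 2 * M) * M = M * (∑ k, w k ^ 2) ^ d - 1 := by
        field_simp; ring
      rw [e1]; exact hν
    calc _ ≤ ν ^ 2 / M * (M / 4) := mul_le_mul h3 hD2 (Finset.sum_nonneg fun _ _ => sq_nonneg _) (by positivity)
      _ = (ν / 2) ^ 2 := by field_simp; norm_num
  have := congrArg (fun z : ℂ => ‖z‖) hkey
  have h5 : 1 - q ≤ ‖(1 - q : ℂ)‖ := by
    have := Complex.re_le_norm (1 - q : ℂ)
    simpa using this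
  have h6 := norm_add_le (∑ l, c l * ((∏ i, kr w (X i - Ξ l i) : ℝ) : ℂ)) (∑ k, ((W k - 1 / M : ℝ) : ℂ) * D k)
  rw [← hkey] at h6
  linarith

/-- The normalised squared distance, bounded from below in terms of the size of the coefficients. -/
theorem one_add_sub_le_of_quadratic {d r N : ℕ} (hN : 0 < N) {w : Fin N → ℝ} (hw : IsSymm w)
    (hw0 : ∀ k, 0 ≤ w k) {ω : ℝ} (hω : ∀ k, w k ≤ ω / N) (h1 : kr w 0 = 1) (X : Fin d → ℝ)
    (Ξ : Fin r → Fin d → ℝ) (c : Fin r → ℂ) {lam κ : ℝ}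
    (hrow : ∀ l, ∑ m ∈ Finset.univ.erase l, |∏ i, kr w (Ξ l i - Ξ m i)| ≤ 1 - lam) (hκ : 0 ≤ κ)
    (hK : ∑ l, (∏ i, kr w (X i - Ξ l i)) ^ 2 ≤ κ ^ 2) :
    1 + lam * √(∑ l, ‖c l‖ ^ 2) ^ 2 - 2 * κ * √(∑ l, ‖c l‖ ^ 2) ≤
      ω ^ d * (1 / (N : ℝ) ^ d * ∑ k : Fin d → Fin N, ‖Evec X k - ∑ l, c l * Evec (Ξ l) k‖ ^ 2) := by
  have hq := quadratic_le hN hw hw0 hω h1 X Ξ c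
  have hM : ∀ l m, ∏ i, kr w (Ξ l i - Ξ m i) = ∏ i, kr w (Ξ m i - Ξ l i) :=
    fun l m => Finset.prod_congr rfl fun i _ => by rw [← kr_neg, neg_sub]
  have hpos := le_quadratic_of_row_sum (M := fun l m => ∏ i, kr w (Ξ l i - Ξ m i)) hM (fun l => by simp [h1]) hrow
  have h2 := hpos fun l => (c l).re
  have h3 := hpos fun l => (c l).im
  have hn : ∑ l, ‖c l‖ ^ 2 = ∑ l, (c l).re ^ 2 + ∑ l, (c l).im ^ 2 := by
    rw [← Finset.sum_add_distrib]
    refine Finset.sum_congr rfl fun l _ => ?_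
    rw [← Complex.normSq_eq_norm_sq, Complex.normSq_apply]; ring
  have hs0 : 0 ≤ ∑ l, ‖c l‖ ^ 2 := Finset.sum_nonneg fun _ _ => sq_nonneg _
  have h4 : ∑ l, (c l).re * ∏ i, kr w (X i - Ξ l i) ≤ κ * √(∑ l, ‖c l‖ ^ 2) := by
    refine (le_abs_self _).trans (abs_le_of_sq_le_sq ?_ (by positivity))
    refine (Finset.sum_mul_sq_le_sq_mul_sq _ _ _).trans ?_
    rw [mul_pow, Real.sq_sqrt hs0, mul_comm]
    refine mul_le_mul hK ?_ (Finset.sum_nonneg fun _ _ => sq_nonneg _) (sq_nonneg _)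
    rw [hn]
    exact le_add_of_nonneg_right (Finset.sum_nonneg fun _ _ => sq_nonneg _)
  rw [Real.sq_sqrt hs0]
  rw [hn] at h4 ⊢
  linarith

/-! ### The raised cosine window -/

/-- The raised cosine window `(1 + (3 / 8) cos 2ψ) / N`. -/
noncomputable def raisedCos (N : ℕ) (k : Fin N) : ℝ := (1 + 3 / 8 * Real.cos (2 * 1 * node N k)) / N

theorem sum_cos_node_eq_zero {N m : ℕ} (hm : 0 < m) (hN : m < N) : ∑ k : Fin N, Real.cos (2 * m * node N k) = 0 := by
  have h := sum_cos_node_mul_sin (by omega : 0 < N) (m : ℝ)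
  rw [mul_comm Real.pi (m : ℝ), Real.sin_nat_mul_pi] at h
  refine (mul_eq_zero.1 h).resolve_right (Real.sin_pos_of_pos_of_lt_pi ?_ ?_).ne'
  · have : (0 : ℝ) < N := by exact_mod_cast (by omega : 0 < N)
    positivity
  · have : (0 : ℝ) < N := by exact_mod_cast (by omega : 0 < N)
    rw [div_lt_iff₀ this, mul_comm]
    exact mul_lt_mul_of_pos_left (by exact_mod_cast hN) Real.pi_pos

theorem raisedCos_nonneg (N : ℕ) (k : Fin N) : 0 ≤ raisedCos N k := by
  unfold raisedCos
  refine div_nonneg ?_ N.cast_nonneg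
  have h := Real.neg_one_le_cos (2 * 1 * node N k)
  generalize Real.cos (2 * 1 * node N k) = c at *
  linarith

theorem isSymm_raisedCos (N : ℕ) : IsSymm (raisedCos N) := fun k => by
  unfold raisedCos
  simp only [node_rev, mul_neg, Real.cos_neg]

theorem sum_raisedCos {N : ℕ} (hN : 2 ≤ N) : ∑ k, raisedCos N k = 1 := by
  have h := sum_cos_node_eq_zero one_pos (by omega : 1 < N)
  have hN0 : (N : ℝ) ≠ 0 := by exact_mod_cast (by omega : N ≠ 0)
  unfold raisedCos
  rw [← Finset.sum_div, Finset.sum_add_distrib, ← Finset.mul_sum]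
  push_cast at h
  rw [h]
  simp [hN0]

/-- For N ≥ 3 the means of cos 2ψ and cos 4ψ vanish, and 1 + (3/8)²/2 remains. That this is close to
1 keeps ν small in `one_sub_sub_le_mul_of_orthogonal`. -/
theorem mul_sum_raisedCos_sq {N : ℕ} (hN : 3 ≤ N) : N * ∑ k, raisedCos N k ^ 2 = 1.0703125 := by
  have h := sum_cos_node_eq_zero one_pos (by omega : 1 < N)
  have h2 := sum_cos_node_eq_zero two_pos (by omega : 2 < N)
  have hN0 : (N : ℝ) ≠ 0 := by exact_mod_cast (by omega : N ≠ 0)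
  have e : ∀ k, raisedCos N k ^ 2 = (1.0703125 * 1 + 0.75 * Real.cos (2 * (1 : ℕ) * node N k) +
      0.0703125 * Real.cos (2 * (2 : ℕ) * node N k)) / N ^ 2 := by
    intro k
    have h3 : Real.cos (2 * (2 : ℕ) * node N k) = 2 * Real.cos (2 * 1 * node N k) ^ 2 - 1 := by
      rw [← Real.cos_two_mul]; congr 1; push_cast; ring
    unfold raisedCos
    rw [h3, div_pow]
    push_cast; ring
  simp only [e]
  rw [← Finset.sum_div, Finset.sum_add_distrib, Finset.sum_add_distrib, ← Finset.mul_sum, ← Finset.mul_sum,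
    ← Finset.mul_sum, h, h2]
  simp only [Finset.sum_const, Finset.card_univ, Fintype.card_fin, nsmul_eq_mul]
  field_simp
  ring

theorem kr_raisedCos_eq {N : ℕ} (hN : 0 < N) {u : ℝ} (h0 : 0 < Real.sin (Real.pi * u / N))
    (h1 : Real.sin (Real.pi * u / N) ^ 2 - Real.sin (Real.pi / N) ^ 2 ≠ 0) :
    kr (raisedCos N) u = Real.sin (Real.pi * u) / (N * Real.sin (Real.pi * u / N)) *
      (1 - 3 / 8 * Real.cos (Real.pi / N) * Real.sin (Real.pi * u / N) ^ 2 /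
        (Real.sin (Real.pi * u / N) ^ 2 - Real.sin (Real.pi / N) ^ 2)) := by
  have hN0 : (N : ℝ) ≠ 0 := by positivity
  have hS := sum_cos_node_mul_sin hN u
  have hP := sum_cos_node_mul_sin hN (u + 1)
  have hM := sum_cos_node_mul_sin hN (u - 1)
  rw [show Real.pi * (u + 1) = Real.pi * u + Real.pi by ring, Real.sin_add_pi,
    show (Real.pi * u + Real.pi) / N = Real.pi * u / N + Real.pi / N by ring, Real.sin_add] at hP
  rw [show Real.pi * (u - 1) = Real.pi * u - Real.pi by ring, Real.sin_sub_pi,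
    show (Real.pi * u - Real.pi) / N = Real.pi * u / N - Real.pi / N by ring, Real.sin_sub] at hM
  have hk : kr (raisedCos N) u = (∑ k : Fin N, Real.cos (2 * u * node N k) +
      3 / 16 * (∑ k : Fin N, Real.cos (2 * (u + 1) * node N k) +
        ∑ k : Fin N, Real.cos (2 * (u - 1) * node N k))) / N := by
    unfold kr raisedCos
    rw [← Finset.sum_add_distrib, Finset.mul_sum, ← Finset.sum_add_distrib, Finset.sum_div]
    refine Finset.sum_congr rfl fun k _ => ?_
    rw [show 2 * (u + 1) * node N k = 2 * u * node N k + 2 * 1 * node N k by ring,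
      show 2 * (u - 1) * node N k = 2 * u * node N k - 2 * 1 * node N k by ring, Real.cos_add, Real.cos_sub]
    ring
  rw [hk]
  have hca := Real.sin_sq_add_cos_sq (Real.pi * u / N)
  have hcb := Real.sin_sq_add_cos_sq (Real.pi / N)
  generalize ∑ k : Fin N, Real.cos (2 * u * node N k) = A at *
  generalize ∑ k : Fin N, Real.cos (2 * (u + 1) * node N k) = P at *
  generalize ∑ k : Fin N, Real.cos (2 * (u - 1) * node N k) = M at *
  generalize Real.sin (Real.pi * u) = σ at *
  generalize Real.sin (Real.pi * u / N) = s at *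
  generalize Real.cos (Real.pi * u / N) = c at *
  generalize Real.sin (Real.pi / N) = s' at *
  generalize Real.cos (Real.pi / N) = c' at *
  have hc2 : c ^ 2 = 1 - s ^ 2 := by linarith
  have hc2' : c' ^ 2 = 1 - s' ^ 2 := by linarith
  have e : (s * c' + c * s') * (s * c' - c * s') = s ^ 2 - s' ^ 2 := by
    rw [show (s * c' + c * s') * (s * c' - c * s') = s ^ 2 * c' ^ 2 - c ^ 2 * s' ^ 2 by ring, hc2, hc2']; ring
  have hPM : (P + M) * (s ^ 2 - s' ^ 2) = -σ * (2 * s * c') := by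
    calc (P + M) * (s ^ 2 - s' ^ 2) = P * (s * c' + c * s') * (s * c' - c * s') +
          M * (s * c' - c * s') * (s * c' + c * s') := by rw [← e]; ring
      _ = _ := by rw [hP, hM]; ring
  have hA : A = σ / s := by rw [eq_div_iff h0.ne', hS]
  have hPM' : P + M = -σ * (2 * s * c') / (s ^ 2 - s' ^ 2) := by rw [eq_div_iff h1, hPM]
  rw [hA, hPM']
  have := h0.ne'
  field_simp
  ring

theorem one_div_sin_sq_le {a : ℝ} (h0 : 0 < a) (h1 : a ≤ Real.pi / 2) : 1 / Real.sin a ^ 2 ≤ 1 / a ^ 2 + 1 := by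
  have hs : 0 < Real.sin a := Real.sin_pos_of_pos_of_lt_pi h0 (by linarith [Real.pi_pos])
  have h2 : a * Real.cos a ≤ Real.sin a := by
    rcases h1.eq_or_lt with h | h
    · rw [h, Real.cos_pi_div_two, mul_zero, Real.sin_pi_div_two]; exact zero_le_one
    · have hc : 0 < Real.cos a := Real.cos_pos_of_mem_Ioo ⟨by linarith, h⟩
      have := Real.le_tan h0.le h
      rwa [Real.tan_eq_sin_div_cos, le_div_iff₀ hc] at this
  have hc0 : 0 ≤ Real.cos a := Real.cos_nonneg_of_mem_Icc ⟨by linarith, h1⟩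
  have h3 := pow_le_pow_left₀ (by positivity) h2 2
  have h4 := Real.sin_sq_add_cos_sq a
  rw [div_add_one (by positivity), div_le_div_iff₀ (by positivity) (by positivity)]
  nlinarith

section Kernel

variable {N : ℕ} {β u : ℝ}

/-- The third conclusion says that the bracket in the closed form of the kernel is nonnegative. The
worst case u = 1.3 is reduced to an inequality in cos(π/N) by the addition formula. -/
theorem raisedCos_aux (hN : 6 ≤ N) (h0 : 1.3 ≤ u) (hu : u ≤ N / 2) :
    0 < Real.sin (Real.pi * u / N) ∧ 0 < Real.sin (Real.pi / N) ∧
      Real.sin (Real.pi / N) ^ 2 ≤ (1 - 3 / 8 * Real.cos (Real.pi / N)) * Real.sin (Real.pi * u / N) ^ 2 ∧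
      0 < Real.sin (Real.pi * u / N) ^ 2 - Real.sin (Real.pi / N) ^ 2 := by
  have hN' : (6 : ℝ) ≤ N := by exact_mod_cast hN
  have hN0 : (0 : ℝ) < N := by linarith
  have hp := Real.pi_pos
  set b := Real.pi / N with hb
  have hb0 : 0 < b := by positivity
  have hb1 : b ≤ 0.52361 := by rw [hb, div_le_iff₀ hN0]; nlinarith [Real.pi_lt_d4]
  have hb2 : b ^ 2 ≤ 0.27417 := (pow_le_pow_left₀ hb0.le hb1 2).trans (by norm_num)
  have ha : Real.pi * u / N = u * b := by rw [hb]; ring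
  have hub : u * b ≤ Real.pi / 2 := by
    rw [hb, ← mul_div_assoc, div_le_div_iff₀ hN0 two_pos]; nlinarith
  rw [ha]
  have h4 : 0 < Real.sin b := Real.sin_pos_of_pos_of_lt_pi hb0 (by nlinarith [Real.pi_gt_three])
  have hc1 : 0.8629 ≤ Real.cos b := by
    have := Real.one_sub_sq_div_two_le_cos (x := b)
    linarith
  have hc2 := Real.cos_le_one b
  have h5 : (0.9876 + 0.2987 * Real.cos b) * Real.sin b ≤ Real.sin (u * b) := by
    have h1 : Real.sin (1.3 * b) ≤ Real.sin (u * b) := Real.sin_le_sin_of_le_of_le_pi_div_two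
      (by nlinarith) hub (by nlinarith)
    have e : Real.sin (1.3 * b) = Real.sin b * Real.cos (0.3 * b) + Real.cos b * Real.sin (0.3 * b) := by
      rw [← Real.sin_add]; congr 1; ring
    have h2 := Real.one_sub_sq_div_two_le_cos (x := 0.3 * b)
    have h3 : 0.3 * b - (0.3 * b) ^ 3 / 6 ≤ Real.sin (0.3 * b) := Real.sin_ge_sub_cube (by positivity)
    have h6 : 0.9876 ≤ Real.cos (0.3 * b) := by nlinarith
    have h7 : 0.2987 * Real.sin b ≤ Real.sin (0.3 * b) := by
      have : Real.sin b ≤ b := Real.sin_le hb0.le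
      nlinarith
    rw [e] at h1
    nlinarith [mul_le_mul_of_nonneg_left h6 h4.le, mul_le_mul_of_nonneg_left h7 (by linarith : 0 ≤ Real.cos b)]
  have h6 := pow_le_pow_left₀ (by positivity) h5 2
  rw [mul_pow] at h6
  have h7 : 0 < Real.sin b ^ 2 := by positivity
  have h8 : 1 ≤ (1 - 3 / 8 * Real.cos b) * (0.9876 + 0.2987 * Real.cos b) ^ 2 := by
    generalize Real.cos b = c at *
    have := mul_nonneg (sub_nonneg.2 hc1) (sub_nonneg.2 hc2)
    nlinarith
  have h9 : 0 < 1 - 3 / 8 * Real.cos b := by linarith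
  refine ⟨lt_of_lt_of_le (by positivity) h5, h4, ?_, ?_⟩
  · calc Real.sin b ^ 2 ≤ (1 - 3 / 8 * Real.cos b) * (0.9876 + 0.2987 * Real.cos b) ^ 2 * Real.sin b ^ 2 :=
          le_mul_of_one_le_left h7.le h8
      _ ≤ _ := by rw [mul_assoc]; exact mul_le_mul_of_nonneg_left h6 h9.le
  · have : 1.4 ≤ (0.9876 + 0.2987 * Real.cos b) ^ 2 := by nlinarith
    nlinarith

/-- The bracket is nonnegative and decreases in the coefficient of the cosine part, so (3/8)
cos(π/N) may be replaced by a smaller constant ρ. -/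
theorem kr_raisedCos_sq_le (hN : 6 ≤ N) (h0 : 1.3 ≤ u) (hu : u ≤ N / 2) {ρ : ℝ}
    (hρ : ρ ≤ 3 / 8 * Real.cos (Real.pi / N)) :
    0 ≤ 1 - ρ - ρ * (Real.sin (Real.pi / N) ^ 2 / (Real.sin (Real.pi * u / N) ^ 2 - Real.sin (Real.pi / N) ^ 2)) ∧
    kr (raisedCos N) u ^ 2 ≤ 1 / (N * Real.sin (Real.pi * u / N)) ^ 2 *
      (1 - ρ - ρ * (Real.sin (Real.pi / N) ^ 2 /
        (Real.sin (Real.pi * u / N) ^ 2 - Real.sin (Real.pi / N) ^ 2))) ^ 2 := by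
  obtain ⟨hs, hs', h1, hd⟩ := raisedCos_aux hN h0 hu
  have hs2 : 0 < Real.sin (Real.pi / N) ^ 2 := by positivity
  have hN0 : (0 : ℝ) < N := by exact_mod_cast (by omega : 0 < N)
  rw [kr_raisedCos_eq (by omega) hs hd.ne', mul_pow]
  have hc1 := Real.cos_le_one (Real.pi / N)
  set s := Real.sin (Real.pi * u / N)
  set s' := Real.sin (Real.pi / N)
  set c := Real.cos (Real.pi / N)
  have e : 1 - 3 / 8 * c * s ^ 2 / (s ^ 2 - s' ^ 2) = 1 - 3 / 8 * c - 3 / 8 * c * (s' ^ 2 / (s ^ 2 - s' ^ 2)) := by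
    field_simp; ring
  rw [e]
  have hy0 : 0 ≤ s' ^ 2 / (s ^ 2 - s' ^ 2) := by positivity
  have hb0 : 0 ≤ 1 - 3 / 8 * c - 3 / 8 * c * (s' ^ 2 / (s ^ 2 - s' ^ 2)) := by
    rw [← e, sub_nonneg, div_le_one hd]
    linarith
  have hle : 1 - 3 / 8 * c - 3 / 8 * c * (s' ^ 2 / (s ^ 2 - s' ^ 2)) ≤
      1 - ρ - ρ * (s' ^ 2 / (s ^ 2 - s' ^ 2)) := by nlinarith
  refine ⟨hb0.trans hle, mul_le_mul ?_ (pow_le_pow_left₀ hb0 hle 2) (sq_nonneg _) (by positivity)⟩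
  rw [div_pow]
  refine div_le_div_of_nonneg_right ?_ (by positivity)
  nlinarith [Real.sin_sq_add_cos_sq (Real.pi * u), sq_nonneg (Real.cos (Real.pi * u))]

/-- The decay of the kernel of the raised cosine window. -/
theorem kr_raisedCos_sq_le_far (hN : 6 ≤ N) (h0 : 1.3 ≤ u) (hu : u ≤ N / 2) {ρ : ℝ}
    (hρ : ρ ≤ 3 / 8 * Real.cos (Real.pi / N)) (hρ0 : 0 ≤ ρ) :
    kr (raisedCos N) u ^ 2 ≤ (1 - ρ) ^ 2 * (1 / (Real.pi * u) ^ 2 + 1 / N ^ 2) := by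
  have hN0 : (0 : ℝ) < N := by exact_mod_cast (by omega : 0 < N)
  obtain ⟨h1, h2⟩ := kr_raisedCos_sq_le hN h0 hu hρ
  obtain ⟨hs, hs', -, hd⟩ := raisedCos_aux hN h0 hu
  have hp := Real.pi_pos
  have hu0 : 0 < u := by linarith
  refine h2.trans ?_
  rw [mul_comm]
  have hs2 : 0 < Real.sin (Real.pi / N) ^ 2 := by positivity
  refine mul_le_mul (pow_le_pow_left₀ h1 (sub_le_self _ (by positivity)) 2) ?_ (by positivity) (sq_nonneg _)
  have h4 := one_div_sin_sq_le (a := Real.pi * u / N) (by positivity)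
    (by rw [div_le_div_iff₀ hN0 two_pos]; nlinarith)
  rw [mul_pow, ← one_div_mul_one_div]
  calc 1 / (N : ℝ) ^ 2 * (1 / Real.sin (Real.pi * u / N) ^ 2) ≤
        1 / (N : ℝ) ^ 2 * (1 / (Real.pi * u / N) ^ 2 + 1) := mul_le_mul_of_nonneg_left h4 (by positivity)
    _ = _ := by field_simp

theorem cos_sin_bounds (hN : 6 ≤ N) (hβ : (Real.pi / N) ^ 2 ≤ β) (hβ6 : β ≤ 1) :
    3 / 8 * (1 - β / 2) ≤ 3 / 8 * Real.cos (Real.pi / N) ∧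
      9.8695 * (1 - β / 6) ^ 2 ≤ (N * Real.sin (Real.pi / N)) ^ 2 := by
  have hN0 : (0 : ℝ) < N := by exact_mod_cast (by omega : 0 < N)
  have hp := Real.pi_pos
  have h1 := Real.one_sub_sq_div_two_le_cos (x := Real.pi / N)
  refine ⟨by linarith, ?_⟩
  have h2 : Real.pi / N - (Real.pi / N) ^ 3 / 6 ≤ Real.sin (Real.pi / N) := Real.sin_ge_sub_cube (by positivity)
  have h3 : 3.14159 * (1 - β / 6) ≤ N * Real.sin (Real.pi / N) := by
    have e : N * (Real.pi / N - (Real.pi / N) ^ 3 / 6) = Real.pi * (1 - (Real.pi / N) ^ 2 / 6) := by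
      field_simp
    have h4 := mul_le_mul_of_nonneg_left h2 hN0.le
    rw [e] at h4
    refine le_trans ?_ h4
    exact mul_le_mul (by linarith [Real.pi_gt_d6]) (by linarith) (by linarith) hp.le
  refine le_trans ?_ (pow_le_pow_left₀ (mul_nonneg (by norm_num) (by linarith)) h3 2)
  rw [mul_pow]
  exact mul_le_mul_of_nonneg_right (by norm_num) (sq_nonneg _)

/-- In terms of z = sin(πu/N)/sin(π/N) the bound is ((1-ρ)z² - 1)/(z(z² - 1)) divided by N sin(π/N),
so a bound uniform in u is one cubic inequality in z. -/
theorem kr_raisedCos_sq_le_near (hN : 6 ≤ N) (h0 : 1.3 ≤ u) (hu : u ≤ N / 2) {ρ m C : ℝ}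
    (hρ : ρ ≤ 3 / 8 * Real.cos (Real.pi / N))
    (hC : m ^ 2 ≤ C * (N * Real.sin (Real.pi / N)) ^ 2)
    (hz : ∀ z : ℝ, 1 ≤ z → (1 - ρ) * z ^ 2 - 1 ≤ m * (z * (z ^ 2 - 1))) : kr (raisedCos N) u ^ 2 ≤ C := by
  have hN0 : (0 : ℝ) < N := by exact_mod_cast (by omega : 0 < N)
  obtain ⟨h1, h2⟩ := kr_raisedCos_sq_le hN h0 hu hρ
  obtain ⟨hs, hs', -, hd⟩ := raisedCos_aux hN h0 hu
  refine h2.trans ?_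
  set s := Real.sin (Real.pi * u / N)
  set s' := Real.sin (Real.pi / N)
  have hs2 : 0 < s' ^ 2 := by positivity
  set z := s / s' with hzd
  have hzs : s = z * s' := by rw [hzd]; field_simp
  have hz1 : 1 ≤ z := by
    rw [hzd, one_le_div hs']
    exact abs_le_of_sq_le_sq' (by linarith) hs.le |>.2
  have hz2 : 0 < z ^ 2 - 1 := by
    have : s ^ 2 - s' ^ 2 = (z ^ 2 - 1) * s' ^ 2 := by rw [hzs]; ring
    rw [this] at hd
    exact pos_of_mul_pos_left hd hs2.le
  have e : 1 - ρ - ρ * (s' ^ 2 / (s ^ 2 - s' ^ 2)) = ((1 - ρ) * z ^ 2 - 1) / (z ^ 2 - 1) := by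
    rw [hzs, show (z * s') ^ 2 - s' ^ 2 = (z ^ 2 - 1) * s' ^ 2 by ring]
    field_simp
    ring
  rw [e] at h1 ⊢
  have h4 : ((1 - ρ) * z ^ 2 - 1) / (z ^ 2 - 1) ≤ m * z := by
    rw [div_le_iff₀ hz2]; linarith [hz z hz1]
  have hz0 : 0 < z := by linarith
  rw [one_div_mul_eq_div, div_le_iff₀ (by positivity), hzs]
  calc (((1 - ρ) * z ^ 2 - 1) / (z ^ 2 - 1)) ^ 2 ≤ (m * z) ^ 2 := pow_le_pow_left₀ h1 h4 2
    _ = m ^ 2 * z ^ 2 := by ring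
    _ ≤ C * (N * s') ^ 2 * z ^ 2 := mul_le_mul_of_nonneg_right hC (sq_nonneg _)
    _ = _ := by ring

end Kernel

/-- Bounds for the squared kernel of the raised cosine window away from the origin. -/
structure RaisedCosBound (N : ℕ) (f C : ℝ) : Prop where
  near : ∀ u : ℝ, 1.3 ≤ |u| → |u| ≤ N / 2 → kr (raisedCos N) u ^ 2 ≤ C
  far : ∀ u : ℝ, 1.3 ≤ |u| → |u| ≤ N / 2 →
    kr (raisedCos N) u ^ 2 ≤ f * (1 / (Real.pi * |u|) ^ 2 + 1 / (N : ℝ) ^ 2)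

theorem raisedCosBound {N : ℕ} (hN : 6 ≤ N) {β ρ m C f : ℝ} (hβ : (Real.pi / N) ^ 2 ≤ β) (hβ1 : β ≤ 1)
    (hρ0 : 0 ≤ ρ) (hρ : ρ ≤ 3 / 8 * (1 - β / 2)) (hC0 : 0 ≤ C) (hC : m ^ 2 ≤ C * (9.8695 * (1 - β / 6) ^ 2))
    (hz : ∀ z : ℝ, 1 ≤ z → (1 - ρ) * z ^ 2 - 1 ≤ m * (z * (z ^ 2 - 1))) (hf : (1 - ρ) ^ 2 ≤ f) :
    RaisedCosBound N f C := by
  obtain ⟨h1, h2⟩ := cos_sin_bounds hN hβ hβ1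
  refine ⟨fun u h0 hu => ?_, fun u h0 hu => ?_⟩
  · rw [← kr_sq_abs]
    exact kr_raisedCos_sq_le_near hN h0 hu (hρ.trans h1) (hC.trans (mul_le_mul_of_nonneg_left h2 hC0)) hz
  · rw [← kr_sq_abs]
    exact (kr_raisedCos_sq_le_far hN h0 hu (hρ.trans h1) hρ0).trans
      (mul_le_mul_of_nonneg_right hf (by positivity))

theorem pi_div_sq_le {N M : ℕ} (hM : 0 < M) (hN : M ≤ N) : (Real.pi / N) ^ 2 ≤ 9.8697 / M ^ 2 := by
  have hM0 : (0 : ℝ) < M := by exact_mod_cast hM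
  have hN' : (M : ℝ) ≤ N := by exact_mod_cast hN
  rw [div_pow]
  have h := pow_le_pow_left₀ Real.pi_pos.le Real.pi_lt_d6.le 2
  exact div_le_div₀ (by norm_num) (h.trans (by norm_num)) (by positivity) (pow_le_pow_left₀ hM0.le hN' 2)

/-- The quotient ((1-ρ)z² - 1)/(z(z² - 1)) peaks near z = 1.72 with a value just below m; hence the
square of z - 1.72. The two variants for larger N follow the same pattern. -/
theorem raisedCosBound_six {N : ℕ} (hN : 6 ≤ N) : RaisedCosBound N 0.4577 0.01 := by
  refine raisedCosBound hN (β := 0.27417) (ρ := 0.3235) (m := 0.2998)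
    ((pi_div_sq_le (by norm_num) hN).trans (by norm_num)) (by norm_num) (by norm_num) (by norm_num) (by norm_num)
    (by norm_num) (fun z hz => ?_) (by norm_num)
  nlinarith [mul_nonneg (by linarith : (0 : ℝ) ≤ z) (sq_nonneg (z - 1.72)), sq_nonneg (z - 1.72)]

theorem raisedCosBound_nine {N : ℕ} (hN : 9 ≤ N) : RaisedCosBound N 0.4198 0.008 := by
  refine raisedCosBound (by omega) (β := 0.12185) (ρ := 0.3521) (m := 0.2752)
    ((pi_div_sq_le (by norm_num) hN).trans (by norm_num)) (by norm_num) (by norm_num) (by norm_num) (by norm_num)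
    (by norm_num) (fun z hz => ?_) (by norm_num)
  nlinarith [mul_nonneg (by linarith : (0 : ℝ) ≤ z) (sq_nonneg (z - 1.77)), sq_nonneg (z - 1.77)]

theorem raisedCosBound_fifteen {N : ℕ} (hN : 15 ≤ N) : RaisedCosBound N 0.4011 0.0071 := by
  refine raisedCosBound (by omega) (β := 0.04387) (ρ := 0.3667) (m := 0.2627)
    ((pi_div_sq_le (by norm_num) hN).trans (by norm_num)) (by norm_num) (by norm_num) (by norm_num) (by norm_num)
    (by norm_num) (fun z hz => ?_) (by norm_num)
  nlinarith [mul_nonneg (by linarith : (0 : ℝ) ≤ z) (sq_nonneg (z - 1.8)), sq_nonneg (z - 1.8)]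

theorem tailBound_of_half_lt {a : ℝ → ℝ} {N : ℕ} {s A : ℝ} (hs : 0 ≤ s) (hA : N / 2 < A) : TailBound a N s A 0 := by
  refine ⟨fun _ => 0, fun _ => le_rfl, fun u hu j hj => ?_, fun n => by simp⟩
  have : 0 ≤ s * j := by positivity
  linarith

/-- The term 1/N² in the decay bound is not summable; it is charged only to cells that start below
N/2, and this counts them. -/
theorem sum_ite_le {s A H L : ℝ} (hs : 0 < s) (hL0 : 0 ≤ L) (hL : H - A + s ≤ L * s) (n : ℕ) :
    ∑ j ∈ Finset.range n, (if A + s * j ≤ H then (1 : ℝ) else 0) ≤ L := by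
  have h : ∀ n : ℕ, ∑ j ∈ Finset.range n, (if A + s * j ≤ H then (1 : ℝ) else 0) ≤ n := by
    intro n
    refine (Finset.sum_le_sum (g := fun _ => (1 : ℝ)) fun j _ => ?_).trans (by simp)
    split_ifs <;> norm_num
  induction n with
  | zero => simpa using hL0
  | succ n ih =>
    rw [Finset.sum_range_succ]
    split_ifs with hn
    · have h1 := h n
      have : ((n : ℝ) + 1) * s ≤ L * s := by linarith
      have := le_of_mul_le_mul_right this hs
      linarith
    · linarith

namespace RaisedCosBound

variable {N : ℕ} {f C : ℝ}

theorem far_le (h : RaisedCosBound N f C) (hf : 0 ≤ f) {A M u : ℝ} (hM : 0 < M) (hMN : M ≤ N) (hA : 1.3 ≤ A)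
    (hAu : A ≤ |u|) (hu : |u| ≤ N / 2) :
    kr (raisedCos N) u ^ 2 ≤ f * (1 / (Real.pi * A) ^ 2 + 1 / M ^ 2) := by
  have hp := Real.pi_pos
  refine (h.far u (hA.trans hAu) hu).trans (mul_le_mul_of_nonneg_left (add_le_add ?_ ?_) hf)
  · have : 0 < A := by linarith
    exact div_le_div_of_nonneg_left zero_le_one (by positivity) (by gcongr)
  · exact div_le_div_of_nonneg_left zero_le_one (by positivity) (by gcongr)

theorem tailBound (h : RaisedCosBound N f C) (hf : 0 ≤ f) (hN : 0 < N) {c s S L : ℝ} (hs : 0 < s)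
    (hA : 1.3 ≤ c * s) (hc : 0 < c) (hL0 : 0 ≤ L) (hL : N / 2 - c * s + s ≤ L * s)
    (hS : ∀ n, ∑ j ∈ Finset.range n, 1 / ((j : ℝ) + c) ^ 2 ≤ S) :
    TailBound (fun u => kr (raisedCos N) u ^ 2) N s (c * s) (f * (S / (Real.pi * s) ^ 2 + L / N ^ 2)) := by
  have hp := Real.pi_pos
  refine ⟨fun j => f * (1 / (Real.pi * s) ^ 2 * (1 / ((j : ℝ) + c) ^ 2) +
      1 / N ^ 2 * (if c * s + s * j ≤ N / 2 then (1 : ℝ) else 0)), fun j => ?_, fun u hu j hj => ?_, fun n => ?_⟩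
  · have : (0 : ℝ) ≤ if c * s + s * j ≤ N / 2 then (1 : ℝ) else 0 := by split_ifs <;> norm_num
    positivity
  · have h0 : 1.3 ≤ c * s + s * j := by
      have : 0 ≤ s * j := by positivity
      linarith
    dsimp only
    rw [if_pos (hj.trans hu)]
    refine (h.far_le hf (by exact_mod_cast hN : (0 : ℝ) < N) le_rfl h0 hj hu).trans (le_of_eq ?_)
    rw [show c * s + s * j = s * (j + c) by ring]
    field_simp
  · rw [← Finset.mul_sum, Finset.sum_add_distrib, ← Finset.mul_sum, ← Finset.mul_sum]
    refine mul_le_mul_of_nonneg_left (add_le_add ?_ ?_) hf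
    · rw [one_div_mul_eq_div]
      exact div_le_div_of_nonneg_right (hS n) (by positivity)
    · rw [one_div_mul_eq_div]
      exact div_le_div_of_nonneg_right (sum_ite_le hs hL0 hL n) (by positivity)

/-- The kernel of the raised cosine window on the cells around two points. -/
theorem tailBounds (h : RaisedCosBound N f C) (hf : 0 ≤ f) (hC : 0 ≤ C) {M : ℕ} (hM : 0 < M) (hN : M ≤ N) {s : ℝ}
    (hs : 2.6 ≤ s) :
    TailBound (fun u => kr (raisedCos N) u ^ 2) N s s
      (f * (5 / 3 / (Real.pi * s) ^ 2 + 1 / (2 * s * M))) ∧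
    TailBound (fun u => kr (raisedCos N) u ^ 2) N s (s / 2)
      (C + f * (1 / (Real.pi * s) ^ 2 + 1 / (2 * s * M))) := by
  have hM0 : (0 : ℝ) < M := by exact_mod_cast hM
  have hN0 : (0 : ℝ) < N := by exact_mod_cast (by omega : 0 < N)
  have hMN : (M : ℝ) ≤ N := by exact_mod_cast hN
  have hs0 : 0 < s := by linarith
  have hL : N / (2 * s) / (N : ℝ) ^ 2 ≤ 1 / (2 * s * M) := by
    rw [div_div, div_le_div_iff₀ (by positivity) (by positivity)]
    have : (N : ℝ) * M ≤ N * N := by gcongr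
    nlinarith
  have e : N / (2 * s) * s = (N : ℝ) / 2 := by field_simp
  constructor
  · have h1 := h.tailBound hf (by omega) (c := 1) (L := N / (2 * s)) hs0 (by linarith) one_pos (by positivity)
      (by rw [e]; linarith) sum_one_div_add_one_sq_le
    rw [one_mul] at h1
    exact h1.mono le_rfl (by gcongr)
  · refine TailBound.cons hC (fun u hu hA => h.near u (by linarith) hu) ?_
    have h1 := h.tailBound hf (by omega) (c := 3 / 2) (L := N / (2 * s)) hs0 (by linarith) (by norm_num)
      (by positivity) (by rw [e]; linarith) sum_one_div_add_three_half_sq_le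
    exact h1.mono (by linarith) (by gcongr)

end RaisedCosBound

theorem one_div_pi_mul_sq_le {A c : ℝ} (hA : 0 < A ^ 2) (h : 1 ≤ c * (9.8695 * A ^ 2)) : 1 / (Real.pi * A) ^ 2 ≤ c := by
  have h1 : 9.8695 ≤ Real.pi ^ 2 := by
    have := pow_le_pow_left₀ (by norm_num) Real.pi_gt_d6.le 2
    exact le_trans (by norm_num) this
  have h2 : 0 < Real.pi ^ 2 := by positivity
  have hc : 0 ≤ c := by
    by_contra hc
    have : c * (9.8695 * A ^ 2) < 0 := mul_neg_of_neg_of_pos (not_le.1 hc) (by positivity)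
    linarith
  rw [mul_pow, div_le_iff₀ (by positivity)]
  refine h.trans (mul_le_mul_of_nonneg_left (by gcongr) hc)

/-- For N ≤ 14 at most two cells start below N/2 and each is estimated separately; from N = 15 on
the general tail bounds are sharp enough. -/
theorem raisedCos_two {N : ℕ} (hN : 6 ≤ N) : ∃ C T₁ T₂ : ℝ, 0 ≤ C ∧
    (∀ u : ℝ, 1.3 ≤ |u| → |u| ≤ N / 2 → kr (raisedCos N) u ^ 2 ≤ C) ∧
    TailBound (fun u => kr (raisedCos N) u ^ 2) N (2 * √((2 : ℕ) : ℝ)) (2 * √((2 : ℕ) : ℝ)) T₁ ∧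
    TailBound (fun u => kr (raisedCos N) u ^ 2) N (2 * √((2 : ℕ) : ℝ)) (2 * √((2 : ℕ) : ℝ) / 2) T₂ ∧
    C + 2 * ((T₁ + T₂) * (1 + 2 * T₂)) ≤ 0.0735 := by
  have hs1 : 2.8284 ≤ 2 * √((2 : ℕ) : ℝ) := by
    have : 1.4142 ≤ √((2 : ℕ) : ℝ) := Real.le_sqrt_of_sq_le (by norm_num)
    linarith
  have hs2 : (2 * √((2 : ℕ) : ℝ)) ^ 2 = 8 := by rw [mul_pow, Real.sq_sqrt (by norm_num)]; norm_num
  set s := 2 * √((2 : ℕ) : ℝ)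
  have hp8 : 1 / (Real.pi * s) ^ 2 ≤ 0.01267 := one_div_pi_mul_sq_le (by rw [hs2]; norm_num) (by rw [hs2]; norm_num)
  have hp18 : 1 / (Real.pi * (s / 2 + s)) ^ 2 ≤ 0.00564 := by
    have : (s / 2 + s) ^ 2 = 18 := by linear_combination 9 / 4 * hs2
    exact one_div_pi_mul_sq_le (by rw [this]; norm_num) (by rw [this]; norm_num)
  have hp32 : 1 / (Real.pi * (s + s)) ^ 2 ≤ 0.00317 := by
    have : (s + s) ^ 2 = 32 := by linear_combination 4 * hs2
    exact one_div_pi_mul_sq_le (by rw [this]; norm_num) (by rw [this]; norm_num)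
  rcases lt_or_ge N 15 with h15 | h15
  · rcases lt_or_ge N 9 with h9 | h9
    · have hB := raisedCosBound_six hN
      have hN8 : (N : ℝ) ≤ 8 := by exact_mod_cast (by omega : N ≤ 8)
      have hN6 : (6 : ℝ) ≤ N := by exact_mod_cast hN
      refine ⟨0.01, 0.0186, 0.01, by norm_num, hB.near, ?_, ?_, by norm_num⟩
      · refine (TailBound.cons (h := 0.0186) (by norm_num) (fun u hu hA => ?_)
          (tailBound_of_half_lt (by linarith) (by linarith))).mono le_rfl (by norm_num)
        refine (hB.far_le (by norm_num) (M := 6) (by norm_num) hN6 (by linarith) hA hu).trans ?_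
        linarith
      · exact (TailBound.cons (h := 0.01) (by norm_num) (fun u hu hA => hB.near u (by linarith) hu)
          (tailBound_of_half_lt (by linarith) (by linarith))).mono le_rfl (by norm_num)
    · have hB := raisedCosBound_nine h9
      have hN14 : (N : ℝ) ≤ 14 := by exact_mod_cast (by omega : N ≤ 14)
      have hN9 : (9 : ℝ) ≤ N := by exact_mod_cast h9
      refine ⟨0.008, 0.01515, 0.0156, by norm_num, hB.near, ?_, ?_, by norm_num⟩
      · refine (TailBound.cons (h := 0.01051) (by norm_num) (fun u hu hA => ?_)
          (TailBound.cons (h := 0.00462) (by norm_num) (fun u hu hA => ?_)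
          (tailBound_of_half_lt (by linarith) (by linarith)))).mono le_rfl (by norm_num)
        · refine (hB.far_le (by norm_num) (M := 9) (by norm_num) hN9 (by linarith) hA hu).trans ?_
          linarith
        · refine (hB.far_le (by norm_num) (M := 11.3136) (by norm_num) (by linarith) (by linarith) hA hu).trans ?_
          linarith
      · refine (TailBound.cons (h := 0.008) (by norm_num) (fun u hu hA => hB.near u (by linarith) hu)
          (TailBound.cons (h := 0.00756) (by norm_num) (fun u hu hA => ?_)
          (tailBound_of_half_lt (by linarith) (by linarith)))).mono le_rfl (by norm_num)
        refine (hB.far_le (by norm_num) (M := 9) (by norm_num) hN9 (by linarith) hA hu).trans ?_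
        linarith
  · obtain ⟨h1, h2⟩ := (raisedCosBound_fifteen h15).tailBounds (by norm_num) (by norm_num) (by norm_num) h15
      (s := s) (by linarith)
    have h3 : 1 / (2 * s * (15 : ℕ)) ≤ 0.01179 := by
      rw [div_le_iff₀ (by positivity)]; push_cast; linarith
    refine ⟨0.0071, 0.01321, 0.01692, by norm_num, (raisedCosBound_fifteen h15).near, h1.mono le_rfl ?_,
      h2.mono le_rfl ?_, by norm_num⟩
    · rw [div_eq_mul_one_div (5 / 3 : ℝ)]; linarith
    · linarith

theorem raisedCos_three {N : ℕ} (hN : 7 ≤ N) : ∃ C T₁ T₂ : ℝ, 0 ≤ C ∧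
    (∀ u : ℝ, 1.3 ≤ |u| → |u| ≤ N / 2 → kr (raisedCos N) u ^ 2 ≤ C) ∧
    TailBound (fun u => kr (raisedCos N) u ^ 2) N (2 * √((3 : ℕ) : ℝ)) (2 * √((3 : ℕ) : ℝ)) T₁ ∧
    TailBound (fun u => kr (raisedCos N) u ^ 2) N (2 * √((3 : ℕ) : ℝ)) (2 * √((3 : ℕ) : ℝ) / 2) T₂ ∧
    C + 3 * ((T₁ + T₂) * (1 + 2 * T₂) ^ 2) ≤ 0.16 := by
  have hs1 : 3.464 ≤ 2 * √((3 : ℕ) : ℝ) := by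
    have : 1.732 ≤ √((3 : ℕ) : ℝ) := Real.le_sqrt_of_sq_le (by norm_num)
    linarith
  have hs2 : (2 * √((3 : ℕ) : ℝ)) ^ 2 = 12 := by rw [mul_pow, Real.sq_sqrt (by norm_num)]; norm_num
  set s := 2 * √((3 : ℕ) : ℝ)
  have hp12 : 1 / (Real.pi * s) ^ 2 ≤ 0.00845 := one_div_pi_mul_sq_le (by rw [hs2]; norm_num) (by rw [hs2]; norm_num)
  have hB := raisedCosBound_six (by omega : 6 ≤ N)
  obtain ⟨h1, h2⟩ := hB.tailBounds (by norm_num) (by norm_num) (by norm_num) hN (s := s) (by linarith)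
  have h3 : 1 / (2 * s * (7 : ℕ)) ≤ 0.02063 := by
    rw [div_le_iff₀ (by positivity)]; push_cast; linarith
  refine ⟨0.01, 0.0159, 0.02332, by norm_num, hB.near, h1.mono le_rfl ?_, h2.mono le_rfl ?_, by norm_num⟩
  · rw [div_eq_mul_one_div (5 / 3 : ℝ)]; linarith
  · linarith

/-! ### Large δ in dimensions two and three -/

section Large

variable {d r n : ℕ} (w : Fin r → ℂ)

theorem kr_sq_sum_le {N : ℕ} (hN : 0 < N) {v : Fin N → ℝ} (hv0 : ∀ k, 0 ≤ v k) (hv1 : ∑ k, v k = 1) {s δ : ℝ}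
    (hs : 0 < s) {Ξ : Fin r → Fin d → ℝ} (hsep : Sep s N Ξ) {l₀ : Fin r} {Y : Fin d → ℝ}
    (hY : ∀ i, |Y i - Ξ l₀ i| ≤ δ) {G T₁ T₂ : ℝ}
    (hG : TailBound (fun u => kr v u ^ 2) N s (s / 2) G) (hT₁ : TailBound (fun u => kr v u ^ 2) N s s T₁)
    (hT₂ : TailBound (fun u => kr v u ^ 2) N s (s - δ) T₂) :
    ∑ l ∈ Finset.univ.erase l₀, (∏ i, kr v (Y i - Ξ l i)) ^ 2 ≤
      d * ((T₁ + T₂) * (1 + 2 * G) ^ (d - 1)) := by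
  obtain ⟨g, hg0, hg, hgG⟩ := hG
  obtain ⟨t, ht0, ht, htT⟩ := hT₁
  obtain ⟨t', ht0', ht', htT'⟩ := hT₂
  simp only [← Finset.prod_pow]
  exact threshold_sum_le hs hsep l₀ (Y := Y) (δ := δ) hY
    (a := fun u => kr v u ^ 2) (fun _ => sq_nonneg _)
    (fun u => by rw [← sq_abs]; exact pow_le_one₀ (abs_nonneg _) ((abs_kr_le hv0 u).trans hv1.le))
    (fun u => kr_sq_red hN v u) hN hg hg0 hgG ht ht0 htT ht' ht0' htT'

/-- All kernel values together, when `x` is far from all nodes. -/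
theorem sum_kr_sq_le {ξ : Fin r → UnitAddTorus (Fin d)} {x : UnitAddTorus (Fin d)}
    {s δ : ℝ} {l₀ : Fin r} {X : Fin d → ℝ} {Ξ : Fin r → Fin d → ℝ}
    (hC : IsConfig n ξ x s δ l₀ X Ξ) (hs : 0 < s) (hδ : δ ≤ s / 2) {v : Fin (n + 1) → ℝ} (hv0 : ∀ k, 0 ≤ v k)
    (hv1 : ∑ k, v k = 1) {K T₁ T₂ : ℝ} (hK : kr v δ ^ 2 ≤ K)
    (hT₁ : TailBound (fun u => kr v u ^ 2) (n + 1) s s T₁)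
    (hT₂ : TailBound (fun u => kr v u ^ 2) (n + 1) s (s / 2) T₂) :
    ∑ l, (∏ i, kr v (X i - Ξ l i)) ^ 2 ≤ K + d * ((T₁ + T₂) * (1 + 2 * T₂) ^ (d - 1)) := by
  rw [← Finset.add_sum_erase _ _ (Finset.mem_univ l₀)]
  refine add_le_add ?_ (kr_sq_sum_le (Nat.succ_pos n) hv0 hv1 hs hC.sep hC.near hT₂ hT₁
    (hT₂.mono (by linarith) le_rfl))
  obtain ⟨i, hi⟩ := hC.attained
  refine le_trans ?_ hK
  rw [← hi, kr_sq_abs, ← Finset.prod_pow, ← Finset.mul_prod_erase Finset.univ _ (Finset.mem_univ i)]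
  refine mul_le_of_le_one_right (sq_nonneg _) (Finset.prod_le_one (fun _ _ => sq_nonneg _) fun j _ => ?_)
  rw [← sq_abs]
  exact pow_le_one₀ (abs_nonneg _) ((abs_kr_le hv0 _).trans hv1.le)

/-- Let q be the normalised squared distance and C = ‖c‖. The raised cosine gives 1 - q - ν/2 ≤ κ'C,
the improved window gives 1 + lam C² - 2κC ≤ (3π/7)^d q. If q < q₀, the first inequality forces C >
c₀ by `h1`; beyond c₀ the quadratic is increasing by `h2` and already at least (3π/7)^d q₀ by `h3`,
contradicting the second. -/
theorem le_one_sub_signalFun_of_coeff {ξ : Fin r → UnitAddTorus (Fin d)}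
    (S : SVD ((n + 1) ^ d) (momentMatrix (discreteMeasure w ξ) n)) {x : UnitAddTorus (Fin d)}
    {s δ : ℝ} {l₀ : Fin r} {X : Fin d → ℝ} {Ξ : Fin r → Fin d → ℝ}
    (hC : IsConfig n ξ x s δ l₀ X Ξ) (hN : 6 ≤ n + 1) {lam κ κ' ν c₀ q₀ : ℝ} (hl : 0 ≤ lam) (hκ : 0 ≤ κ)
    (hκ' : 0 < κ')
    (hrow : ∀ l, ∑ m ∈ Finset.univ.erase l, |∏ i, kap (1 / 28) (n + 1) (Ξ l i - Ξ m i)| ≤ 1 - lam)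
    (hK : ∑ l, (∏ i, kap (1 / 28) (n + 1) (X i - Ξ l i)) ^ 2 ≤ κ ^ 2)
    (hK' : ∑ l, (∏ i, kr (raisedCos (n + 1)) (X i - Ξ l i)) ^ 2 ≤ κ' ^ 2)
    (hν0 : 0 ≤ ν) (hν : 1.0703125 ^ d - 1 ≤ ν ^ 2) (h1 : κ' * c₀ ≤ 1 - q₀ - ν / 2) (h2 : κ ≤ lam * c₀)
    (h3 : (3 * Real.pi / 7) ^ d * q₀ ≤ 1 + lam * c₀ ^ 2 - 2 * κ * c₀) : q₀ ≤ 1 - signalFun S x := by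
  obtain ⟨c, horth, hc⟩ := exists_coeff w ξ S x hC.coe_left hC.coe_right
  set F := ∑ k : Fin d → Fin (n + 1), ‖Evec X k - ∑ l, c l * Evec (Ξ l) k‖ ^ 2 with hF
  set q := 1 / ((n + 1 : ℕ) : ℝ) ^ d * F with hq
  have hqc : q = 1 / ((n : ℝ) + 1) ^ d * F := by rw [hq]; push_cast; rfl
  rw [← hqc] at hc
  by_contra! hlt
  have hs0 : 0 ≤ ∑ l, ‖c l‖ ^ 2 := Finset.sum_nonneg fun _ _ => sq_nonneg _
  have hI2 := one_sub_sub_le_mul_of_orthogonal (Nat.succ_pos n) (isSymm_raisedCos (n + 1))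
    (sum_raisedCos (by omega)) hν0 (by rw [mul_sum_raisedCos_sq (by omega)]; exact hν) X Ξ horth hq hκ'.le
    (Real.sqrt_nonneg (∑ l, ‖c l‖ ^ 2)) hK' (Real.sq_sqrt hs0).ge
  have hI1 := one_add_sub_le_of_quadratic (Nat.succ_pos n) (isSymm_wt (1 / 28) (n + 1))
    (fun k => wt_nonneg (by norm_num) le_rfl (by omega) k) (fun k => wt_le (by omega) k)
    (kap_zero (by omega) (1 / 28)) X Ξ c hrow hκ hK
  rw [← hF, ← hq] at hI1
  set C := √(∑ l, ‖c l‖ ^ 2)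
  have hcC : c₀ < C := lt_of_mul_lt_mul_left (lt_of_lt_of_le (lt_of_le_of_lt h1 (by linarith)) hI2) hκ'.le
  have h4 : (3 * Real.pi / 7) ^ d * q < (3 * Real.pi / 7) ^ d * q₀ :=
    mul_lt_mul_of_pos_left (by linarith) (by have := Real.pi_pos; positivity)
  have h5 : 0 ≤ (C - c₀) * (lam * (C + c₀) - 2 * κ) := by
    refine mul_nonneg (by linarith) ?_
    have : lam * c₀ ≤ lam * C := mul_le_mul_of_nonneg_left hcC.le hl
    linarith
  linarith

theorem wt_sum {N : ℕ} (hN : 5 ≤ N) (θ : ℝ) : ∑ k, wt θ N k = 1 := by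
  rw [← kr_zero]; exact kap_zero hN θ

/-- The value 0.5625 is (9/32) · 2, the target at the largest admissible δ² = 2. -/
theorem large_two {ξ : Fin r → UnitAddTorus (Fin 2)}
    (S : SVD ((n + 1) ^ 2) (momentMatrix (discreteMeasure w ξ) n)) {x : UnitAddTorus (Fin 2)}
    {δ : ℝ} {l₀ : Fin r} {X : Fin 2 → ℝ} {Ξ : Fin r → Fin 2 → ℝ}
    (hC : IsConfig n ξ x (2 * √((2 : ℕ) : ℝ)) δ l₀ X Ξ) (hN : 6 ≤ n + 1) (h0 : 1.3 ≤ δ)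
    (h1 : δ ≤ √((2 : ℕ) : ℝ)) : 0.5625 ≤ 1 - signalFun S x := by
  have hN' : (6 : ℝ) ≤ (n + 1 : ℕ) := by exact_mod_cast hN
  have hs1 : √((2 : ℕ) : ℝ) ≤ 1.4143 := by
    rw [Real.sqrt_le_left (by norm_num)]; norm_num
  have hδ : |δ| = δ := abs_of_nonneg (by linarith)
  have hs0 : 0 < 2 * √((2 : ℕ) : ℝ) := by positivity
  have hδs : δ ≤ 2 * √((2 : ℕ) : ℝ) / 2 := by rwa [mul_div_cancel_left₀ _ two_ne_zero]
  have hδN : |δ| ≤ ((n + 1 : ℕ) : ℝ) / 2 := by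
    rw [hδ]; exact h1.trans (hs1.trans (by linarith))
  obtain ⟨C, T₁, T₂, hC0, hnear, hT₁, hT₂, hsum⟩ := raisedCos_two hN
  have hK' := sum_kr_sq_le hC hs0 hδs (raisedCos_nonneg (n + 1)) (sum_raisedCos (by omega))
    (hnear δ (by rw [hδ]; exact h0) hδN) hT₁ hT₂
  have hK := sum_kr_sq_le hC hs0 hδs
    (fun k => wt_nonneg (by norm_num) le_rfl (by omega) k) (wt_sum (by omega) (1 / 28)) (K := 0.135 ^ 2)
    (sq_le_of_abs_le (abs_kap_le_const (N := n + 1) (by omega) hδN (by rw [hδ]; exact h0)))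
    (tailBound_kap_sq_sep (by omega) (d := 2) (by norm_num)) (tailBound_kap_sq_half (by omega) le_rfl)
  refine le_one_sub_signalFun_of_coeff w S hC hN (lam := 0.585) (κ := 0.2518) (κ' := 0.27112) (ν := 0.38155)
    (c₀ := 0.91) (by norm_num) (by norm_num) (by norm_num) (row_sum_two_le (by omega) hC.sep)
    (hK.trans ?_) (hK'.trans ?_) (by norm_num) (by norm_num) (by norm_num) (by norm_num) ?_
  · norm_num
  · refine le_trans ?_ (hsum.trans (by norm_num))
    norm_num
  · have := pow_le_pow_left₀ (by have := Real.pi_pos; positivity)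
      (show 3 * Real.pi / 7 ≤ 1.3464 by linarith [Real.pi_lt_d4]) 2
    norm_num at this ⊢
    linarith

/-- The value 0.3609 is just above `gapConst 3` times the largest admissible δ² = 3. -/
theorem large_three {ξ : Fin r → UnitAddTorus (Fin 3)}
    (S : SVD ((n + 1) ^ 3) (momentMatrix (discreteMeasure w ξ) n)) {x : UnitAddTorus (Fin 3)}
    {δ : ℝ} {l₀ : Fin r} {X : Fin 3 → ℝ} {Ξ : Fin r → Fin 3 → ℝ}
    (hC : IsConfig n ξ x (2 * √((3 : ℕ) : ℝ)) δ l₀ X Ξ) (hN : 7 ≤ n + 1) (h0 : 1.3 ≤ δ)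
    (h1 : δ ≤ √((3 : ℕ) : ℝ)) : 0.3609 ≤ 1 - signalFun S x := by
  have hN' : (7 : ℝ) ≤ (n + 1 : ℕ) := by exact_mod_cast hN
  have hs1 : √((3 : ℕ) : ℝ) ≤ 1.7321 := by
    rw [Real.sqrt_le_left (by norm_num)]; norm_num
  have hδ : |δ| = δ := abs_of_nonneg (by linarith)
  have hs0 : 0 < 2 * √((3 : ℕ) : ℝ) := by positivity
  have hδs : δ ≤ 2 * √((3 : ℕ) : ℝ) / 2 := by rwa [mul_div_cancel_left₀ _ two_ne_zero]
  have hδN : |δ| ≤ ((n + 1 : ℕ) : ℝ) / 2 := by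
    rw [hδ]; exact h1.trans (hs1.trans (by linarith))
  obtain ⟨C, T₁, T₂, hC0, hnear, hT₁, hT₂, hsum⟩ := raisedCos_three hN
  have hK' := sum_kr_sq_le hC hs0 hδs (raisedCos_nonneg (n + 1)) (sum_raisedCos (by omega))
    (hnear δ (by rw [hδ]; exact h0) hδN) hT₁ hT₂
  have hK := sum_kr_sq_le hC hs0 hδs
    (fun k => wt_nonneg (by norm_num) le_rfl (by omega) k) (wt_sum (by omega) (1 / 28)) (K := 0.135 ^ 2)
    (sq_le_of_abs_le (abs_kap_le_const (N := n + 1) (by omega) hδN (by rw [hδ]; exact h0)))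
    (tailBound_kap_sq_sep (by omega) (d := 3) (by norm_num)) (tailBound_kap_sq_half (by omega) (by norm_num))
  refine le_one_sub_signalFun_of_coeff w S hC (by omega) (lam := 0.479) (κ := 0.286) (κ' := 0.4) (ν := 0.4756)
    (c₀ := 1) (by norm_num) (by norm_num) (by norm_num) (row_sum_three_le (by omega) hC.sep)
    (hK.trans ?_) (hK'.trans ?_) (by norm_num) (by norm_num) (by norm_num) (by norm_num) ?_
  · norm_num
  · refine le_trans ?_ (hsum.trans (by norm_num))
    norm_num
  · have := pow_le_pow_left₀ (by have := Real.pi_pos; positivity)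
      (show 3 * Real.pi / 7 ≤ 1.3464 by linarith [Real.pi_lt_d4]) 3
    norm_num at this ⊢
    linarith

end Large

/-! ### The constant of (3) and the union of all ranges -/

/-- The constant in the quadratic upper bound near a node. -/
noncomputable def gapConst (d : ℕ) : ℝ := (2 * d - 1) / (3 * d ^ 2) * (3 / (2 * √(d : ℝ))) ^ d

theorem gapConst_eq {d : ℕ} (hd : 1 ≤ d) :
    3 ^ (d - 1) * (2 * (d : ℝ) - 1) / (2 ^ d * (d : ℝ) ^ (2 + (d : ℝ) / 2)) = gapConst d := by
  have h0 : (0 : ℝ) < d := by exact_mod_cast hd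
  have e : (d : ℝ) ^ (2 + (d : ℝ) / 2) = d ^ 2 * √(d : ℝ) ^ d := by
    rw [Real.rpow_add h0, Real.sqrt_eq_rpow, ← Real.rpow_natCast ((d : ℝ) ^ (1 / 2 : ℝ)), ← Real.rpow_mul h0.le,
      ← Real.rpow_natCast (d : ℝ) 2]
    congr 2
    ring
  obtain ⟨m, rfl⟩ : ∃ m, d = m + 1 := ⟨d - 1, by omega⟩
  have hs : √((m + 1 : ℕ) : ℝ) ≠ 0 := (Real.sqrt_pos.2 h0).ne'
  rw [e, gapConst, div_pow, mul_pow, Nat.add_sub_cancel]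
  field_simp
  ring

theorem sq_div_sqrt {d : ℕ} (a : ℝ) : (a / √(d : ℝ)) ^ 2 = a ^ 2 / d := by
  rw [div_pow, Real.sq_sqrt (Nat.cast_nonneg d)]

theorem le_of_sq_le_div {d e : ℕ} (he : 0 < e) (hde : e ≤ d) {B c b : ℝ} (hb : 0 ≤ b)
    (hB : B ^ 2 ≤ c / d) (h : c ≤ b ^ 2 * e) : B ≤ b := by
  have he' : (0 : ℝ) < e := by exact_mod_cast he
  have hde' : (e : ℝ) ≤ d := by exact_mod_cast hde
  refine le_of_sq_le_sq (hB.trans ?_) hb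
  rw [div_le_iff₀ (by linarith)]
  exact h.trans (mul_le_mul_of_nonneg_left hde' (sq_nonneg b))

theorem pi_sq_le : Real.pi ^ 2 ≤ 9.8697 := by
  have := Real.pi_lt_d6; have := Real.pi_pos
  nlinarith

/-- Collecting powers gives the base 3π/(4√d), which is at most 1 from d = 6 on; only d = 4 and d =
5 need numbers. -/
theorem gapConst_mul_pi_half_pow_le {d : ℕ} (hd : 4 ≤ d) : gapConst d * (Real.pi / 2) ^ d ≤ 0.4662 := by
  have hd' : (4 : ℝ) ≤ d := by exact_mod_cast hd
  have hB0 : 0 ≤ 3 * Real.pi / 4 / √(d : ℝ) := by have := Real.pi_pos; positivity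
  have hB : (3 * Real.pi / 4 / √(d : ℝ)) ^ 2 ≤ 5.552 / d := by
    rw [sq_div_sqrt]
    refine div_le_div_of_nonneg_right ?_ (by positivity)
    nlinarith [pi_sq_le]
  have hP : (3 * Real.pi / 4 / √(d : ℝ)) ^ d ≤ 2 := by
    rcases Nat.lt_or_ge d 6 with h | h
    · have h1 := le_of_sq_le_div (e := 4) (b := 1.1782) (by norm_num) hd (by norm_num) hB (by norm_num)
      interval_cases d
      · exact (pow_le_pow_left₀ hB0 h1 4).trans (by norm_num)
      · have h2 := le_of_sq_le_div (e := 5) (b := 1.06) (by norm_num) le_rfl (by norm_num) hB (by norm_num)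
        exact (pow_le_pow_left₀ hB0 h2 5).trans (by norm_num)
    · have h1 := le_of_sq_le_div (b := 1) (by norm_num) h (by norm_num) hB (by norm_num)
      exact (pow_le_one₀ hB0 h1).trans (by norm_num)
  have e : gapConst d * (Real.pi / 2) ^ d = (2 * d - 1) / (3 * d ^ 2) * (3 * Real.pi / 4 / √(d : ℝ)) ^ d := by
    rw [gapConst, mul_assoc, ← mul_pow]; congr 2; ring
  have h0 : (0 : ℝ) ≤ (2 * d - 1) / (3 * d ^ 2) := div_nonneg (by linarith) (by positivity)
  rw [e]
  refine (mul_le_mul_of_nonneg_left hP h0).trans ?_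
  rw [div_mul_eq_mul_div, div_le_iff₀ (by positivity)]
  nlinarith

theorem gapConst_mul_pow_mul_le {d : ℕ} (hd : 4 ≤ d) : gapConst d * (3 * Real.pi / 7) ^ d * d ≤ 0.7 := by
  have hd' : (4 : ℝ) ≤ d := by exact_mod_cast hd
  have hB0 : 0 ≤ 9 * Real.pi / 14 / √(d : ℝ) := by have := Real.pi_pos; positivity
  have hB : (9 * Real.pi / 14 / √(d : ℝ)) ^ 2 ≤ 4.08 / d := by
    rw [sq_div_sqrt]
    refine div_le_div_of_nonneg_right ?_ (by positivity)
    nlinarith [pi_sq_le]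
  have hP : (9 * Real.pi / 14 / √(d : ℝ)) ^ d ≤ 1.05 := by
    rcases Nat.lt_or_ge d 5 with h | h
    · have h1 := le_of_sq_le_div (e := 4) (b := 1.01) (by norm_num) hd (by norm_num) hB (by norm_num)
      interval_cases d
      exact (pow_le_pow_left₀ hB0 h1 4).trans (by norm_num)
    · have h1 := le_of_sq_le_div (b := 1) (by norm_num) h (by norm_num) hB (by norm_num)
      exact (pow_le_one₀ hB0 h1).trans (by norm_num)
  have e : gapConst d * (3 * Real.pi / 7) ^ d * d = (2 * d - 1) / (3 * d ^ 2) * d * (9 * Real.pi / 14 / √(d : ℝ)) ^ d := by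
    rw [gapConst, mul_assoc, mul_assoc, ← mul_assoc (_ ^ d), mul_comm (_ ^ d * _), ← mul_assoc, ← mul_pow]
    congr 2; ring
  have h0 : (0 : ℝ) ≤ (2 * d - 1) / (3 * d ^ 2) * d :=
    mul_nonneg (div_nonneg (by linarith) (by positivity)) (by linarith)
  rw [e]
  refine (mul_le_mul_of_nonneg_left hP h0).trans ?_
  rw [div_mul_eq_mul_div, div_mul_eq_mul_div, div_le_iff₀ (by positivity)]
  nlinarith

theorem gapConst_pos {d : ℕ} (hd : 1 ≤ d) : 0 < gapConst d := by
  have h0 : (1 : ℝ) ≤ d := by exact_mod_cast hd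
  have := Real.sqrt_pos.2 (zero_lt_one.trans_le h0)
  exact mul_pos (div_pos (by linarith) (by positivity)) (by positivity)

theorem gapConst_one : gapConst 1 = 1 / 2 := by norm_num [gapConst]

theorem gapConst_two : gapConst 2 = 9 / 32 := by
  have : √((2 : ℕ) : ℝ) ^ 2 = 2 := Real.sq_sqrt (by norm_num)
  rw [gapConst, div_pow, mul_pow, this]; norm_num

theorem gapConst_three_le : gapConst 3 ≤ 0.120282 := by
  have h0 : √((3 : ℕ) : ℝ) ^ 2 = 3 := Real.sq_sqrt (by norm_num)
  have h1 : 1.73205 ≤ √((3 : ℕ) : ℝ) := Real.le_sqrt_of_sq_le (by norm_num)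
  have h3 : √((3 : ℕ) : ℝ) ^ 3 = 3 * √((3 : ℕ) : ℝ) := by rw [pow_succ, h0]
  rw [gapConst, div_pow, mul_pow, h3]
  generalize √((3 : ℕ) : ℝ) = s at *
  push_cast
  rw [← mul_div_assoc, div_le_iff₀ (by positivity)]
  nlinarith

theorem gapConst_mul_le {d : ℕ} (hd : 1 ≤ d) : gapConst d * d ≤ 0.75 := by
  rcases Nat.lt_or_ge d 4 with h | h
  · interval_cases d
    · rw [gapConst_one]; norm_num
    · rw [gapConst_two]; norm_num
    · have := gapConst_three_le; push_cast; linarith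
  · have h1 : (1 : ℝ) ≤ (3 * Real.pi / 7) ^ d := one_le_pow₀ (by linarith [Real.pi_gt_three])
    have h2 := gapConst_mul_pow_mul_le h
    have h3 : 0 ≤ gapConst d * d := mul_nonneg (gapConst_pos hd).le (by positivity)
    have h4 : gapConst d * (3 * Real.pi / 7) ^ d * d = gapConst d * d * (3 * Real.pi / 7) ^ d := by ring
    rw [h4] at h2
    nlinarith

theorem mul_sq_le_of_mul_le {C R W δ q : ℝ} (hW : 0 < W) (hC : C * W ≤ R) (h : R * δ ^ 2 ≤ W * q) :
    C * δ ^ 2 ≤ q := by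
  have : W * (C * δ ^ 2) ≤ W * q := by
    refine le_trans ?_ h
    nlinarith [sq_nonneg δ]
  exact le_of_mul_le_mul_left this hW

theorem pi_half_cube_le : (Real.pi / 2) ^ 3 ≤ 3.875786 := by
  have h := Real.pi_lt_d6
  exact (pow_le_pow_left₀ (by have := Real.pi_pos; positivity) (show Real.pi / 2 ≤ 1.5707965 by linarith) 3).trans
    (by norm_num)

variable {d r n : ℕ} (w : Fin r → ℂ)

/-- For δ ≤ 1/2 and d ≥ 2 the split is at Euclidean displacement q = 1/16, for d = 1 at δ = 0.3. For
δ ≥ 1/2 the improved window covers everything except δ > 1.3 for d = 2 and δ > 1.68 for d = 3. The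
hypothesis `hN` supplies N ≥ 5, and N ≥ 6 and N ≥ 7 where d = 2 and d = 3 need it. -/
theorem gapConst_mul_sq_le (hd : 1 ≤ d) {ξ : Fin r → UnitAddTorus (Fin d)}
    (S : SVD ((n + 1) ^ d) (momentMatrix (discreteMeasure w ξ) n)) {x : UnitAddTorus (Fin d)} {δ : ℝ}
    {l₀ : Fin r} {X : Fin d → ℝ} {Ξ : Fin r → Fin d → ℝ} (hC : IsConfig n ξ x (2 * √(d : ℝ)) δ l₀ X Ξ)
    (hN : 4 * √(d : ℝ) < (n : ℝ) + 1) (h0 : 0 ≤ δ) (hδ : δ ≤ √(d : ℝ)) :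
    gapConst d * δ ^ 2 ≤ 1 - signalFun S x := by
  have hpi := Real.pi_pos
  have hpi' := Real.pi_lt_d6
  have hW1 : 0 < (Real.pi / 2) ^ d := by positivity
  have hW2 : 0 < (3 * Real.pi / 7) ^ d := by positivity
  have hp2 : (Real.pi / 2) ^ 2 ≤ 2.4675 := by nlinarith [pi_sq_le]
  have hq2 : (3 * Real.pi / 7) ^ 2 ≤ 1.8128 := by nlinarith [pi_sq_le]
  have hq3 : (3 * Real.pi / 7) ^ 3 ≤ 2.4408 := (pow_le_pow_left₀ (by positivity)
    (show 3 * Real.pi / 7 ≤ 1.3463971 by linarith) 3).trans (by norm_num)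
  have hN5 : ∀ {a : ℝ} {m : ℕ}, a ^ 2 ≤ d → 0 ≤ a → (m : ℝ) ≤ 4 * a → m < n + 1 := by
    intro a m ha ha0 hm
    have := Real.le_sqrt_of_sq_le ha
    have h : (m : ℝ) < ((n + 1 : ℕ) : ℝ) := by push_cast; linarith
    exact_mod_cast h
  have hd' : (1 : ℝ) ≤ d := by exact_mod_cast hd
  have hn5 : 5 ≤ n + 1 := hN5 (a := 1) (m := 4) (by linarith) (by norm_num) (by norm_num)
  have hδ2 : δ ^ 2 ≤ d := by
    have := pow_le_pow_left₀ h0 hδ 2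
    rwa [Real.sq_sqrt (by linarith)] at this
  rcases Nat.lt_or_ge d 2 with hd1 | hd2
  · obtain rfl : d = 1 := by omega
    have hδ1 : δ ≤ 1 := by
      push_cast at hδ2; nlinarith
    rw [pow_one] at hW1 hW2
    rcases le_total δ 0.3 with h1 | h1
    · exact mul_sq_le_of_mul_le (R := 0.7855) hW1 (by rw [gapConst_one]; linarith)
        (by simpa only [pow_one] using center_gap_one w S hC hn5 h1)
    rcases le_total δ (1 / 2) with h2 | h2
    · exact mul_sq_le_of_mul_le (R := 0.7855) hW1 (by rw [gapConst_one]; linarith)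
        (by simpa only [pow_one] using small_gap_one w S hC hn5 h1 h2)
    · exact mul_sq_le_of_mul_le (R := 0.6733) hW2 (by rw [gapConst_one]; linarith)
        (by simpa only [pow_one] using mid_one w S hC hn5 h2 hδ1)
  by_cases hs : δ ≤ 1 / 2
  · have hR : ∃ R, gapConst d * (Real.pi / 2) ^ d ≤ R ∧ 0 ≤ R ∧ R ≤ 0.694 ∧ (3 ≤ d → R ≤ 0.4662) := by
      rcases Nat.lt_or_ge d 4 with h | h
      · interval_cases d
        · exact ⟨0.694, by rw [gapConst_two]; linarith, by norm_num, le_rfl, by norm_num⟩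
        · refine ⟨0.4662, ?_, by norm_num, by norm_num, fun _ => le_rfl⟩
          exact (mul_le_mul gapConst_three_le pi_half_cube_le hW1.le (by norm_num)).trans (by norm_num)
      · exact ⟨0.4662, gapConst_mul_pi_half_pow_le h, by norm_num, by norm_num, fun _ => le_rfl⟩
    obtain ⟨R, hR, hR0, hR1, hR3⟩ := hR
    refine mul_sq_le_of_mul_le hW1 hR ?_
    rcases le_total (∑ i, (X i - Ξ l₀ i) ^ 2) (1 / 16) with hq | hq
    · exact center_gap_of_two_le w S hd2 hC hn5 rfl hq hR0 hR1 hR3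
    · exact small_gap w S hd2 hC hn5 hs rfl hq (by linarith)
  have hs' : 1 / 2 ≤ δ := (not_le.1 hs).le
  have hfar : ∀ {D : ℝ}, gapConst d * d ≤ D → D ≤ 1 - signalFun S x → gapConst d * δ ^ 2 ≤ 1 - signalFun S x :=
    fun h1 h2 => (mul_le_mul_of_nonneg_left hδ2 (gapConst_pos hd).le).trans (h1.trans h2)
  rcases Nat.lt_or_ge d 4 with h | h
  · interval_cases d
    · rcases le_total δ 1.3 with h1 | h1
      · exact mul_sq_le_of_mul_le hW2 (by rw [gapConst_two]; linarith) (mid_two w S hC hn5 hs' h1)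
      · refine hfar ?_ (large_two w S hC (hN5 (a := 1.4) (m := 5) (by norm_num) (by norm_num) (by norm_num)) h1 hδ)
        rw [gapConst_two]; norm_num
    · rcases le_total δ 1.68 with h1 | h1
      · refine mul_sq_le_of_mul_le hW2 ?_ (mid_three w S hC hn5 hs' h1)
        exact (mul_le_mul gapConst_three_le hq3 hW2.le (by norm_num)).trans (by norm_num)
      · refine hfar ?_ (large_three w S hC (hN5 (a := 1.7) (m := 6) (by norm_num) (by norm_num) (by norm_num))
          (by linarith) hδ)
        have := gapConst_three_le
        push_cast; linarith
  · exact mul_sq_le_of_mul_le hW2 le_rfl (mid_of_four_le w h S hC hN.le hs' hδ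
      (mul_nonneg (gapConst_pos hd).le hW2.le) (gapConst_mul_pow_mul_le h))

/-! ### A single node -/

theorem kr_uniform_mul_sin {N : ℕ} (hN : 0 < N) (u : ℝ) :
    kr (fun _ : Fin N => 1 / (N : ℝ)) u * (N * Real.sin (Real.pi * u / N)) = Real.sin (Real.pi * u) := by
  have hN0 : (N : ℝ) ≠ 0 := by exact_mod_cast hN.ne'
  rw [← sum_cos_node_mul_sin hN u, kr, ← Finset.mul_sum]
  field_simp

theorem sum_node_sq {N : ℕ} (hN : 0 < N) : ∑ k : Fin N, node N k ^ 2 * N = Real.pi ^ 2 * ((N : ℝ) ^ 2 - 1) / 12 := by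
  have hN0 : (N : ℝ) ≠ 0 := by exact_mod_cast hN.ne'
  have h : ∀ (c : ℝ) (M : ℕ), ∑ k ∈ Finset.range M, ((k : ℝ) - c) ^ 2 =
      M * (M - 1) * (2 * M - 1) / 6 - c * (M * (M - 1)) + M * c ^ 2 := by
    intro c M
    induction M with
    | zero => simp
    | succ m ih => rw [Finset.sum_range_succ, ih]; push_cast; ring
  have := h (((N : ℝ) - 1) / 2) N
  rw [← Fin.sum_univ_eq_sum_range (fun k : ℕ => ((k : ℝ) - ((N : ℝ) - 1) / 2) ^ 2)] at this
  simp only [node, div_pow, mul_pow]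
  rw [← Finset.sum_mul, ← Finset.sum_div, ← Finset.mul_sum, this]
  field_simp
  ring

/-- Averaging cos x ≤ 1 - (2/π²)x² over the nodes, with (N² - 1)/N² ≥ 3/4, bounds the kernel by 1 -
δ²/2; squaring this loses no more than δ²/4 because δ ≤ 1. -/
theorem kr_uniform_sq_le_of_le_one {N : ℕ} (hN : 2 ≤ N) {δ : ℝ} (h0 : 0 ≤ δ) (h1 : δ ≤ 1) :
    kr (fun _ : Fin N => 1 / (N : ℝ)) δ ^ 2 ≤ 1 - 0.75 * δ ^ 2 := by
  have hN' : (2 : ℝ) ≤ N := by exact_mod_cast hN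
  have hN0 : (0 : ℝ) < N := by linarith
  have hpi := Real.pi_pos
  rcases h0.eq_or_lt with rfl | hp
  · rw [kr_zero]; simp [hN0.ne']
  have hpos : 0 ≤ kr (fun _ : Fin N => 1 / (N : ℝ)) δ := by
    have h2 := kr_uniform_mul_sin (N := N) (by omega) δ
    have h3 : 0 ≤ Real.sin (Real.pi * δ) := Real.sin_nonneg_of_nonneg_of_le_pi (by positivity) (by nlinarith)
    have h4 : 0 < Real.sin (Real.pi * δ / N) := by
      refine Real.sin_pos_of_pos_of_lt_pi (by positivity) ?_
      rw [div_lt_iff₀ hN0]; nlinarith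
    rw [← h2] at h3
    exact nonneg_of_mul_nonneg_left h3 (by positivity)
  have hle : kr (fun _ : Fin N => 1 / (N : ℝ)) δ ≤ 1 - δ ^ 2 / 2 := by
    have h2 : kr (fun _ : Fin N => 1 / (N : ℝ)) δ ≤
        ∑ k : Fin N, (1 / (N : ℝ) - 8 * δ ^ 2 / (Real.pi ^ 2 * N ^ 2) * (node N k ^ 2 * N)) := by
      refine Finset.sum_le_sum fun k _ => ?_
      have hk := abs_node_le k
      have h3 := Real.cos_le_one_sub_mul_cos_sq (x := 2 * δ * node N k) (by
        rw [abs_mul, abs_of_nonneg (by positivity : 0 ≤ 2 * δ)]; nlinarith [abs_nonneg (node N k)])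
      refine (mul_le_mul_of_nonneg_left h3 (by positivity)).trans (le_of_eq ?_)
      field_simp
      ring
    rw [Finset.sum_sub_distrib, ← Finset.mul_sum, sum_node_sq (by omega)] at h2
    refine h2.trans ?_
    rw [Finset.sum_const, Finset.card_univ, Fintype.card_fin, nsmul_eq_mul, mul_one_div_cancel hN0.ne',
      show 8 * δ ^ 2 / (Real.pi ^ 2 * (N : ℝ) ^ 2) * (Real.pi ^ 2 * ((N : ℝ) ^ 2 - 1) / 12) =
        2 / 3 * δ ^ 2 * ((N ^ 2 - 1) / N ^ 2) by field_simp; ring]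
    have h4 : (3 : ℝ) / 4 ≤ ((N : ℝ) ^ 2 - 1) / N ^ 2 := by
      rw [div_le_div_iff₀ (by norm_num) (by positivity)]; nlinarith
    nlinarith [mul_le_mul_of_nonneg_left h4 (sq_nonneg δ)]
  have hδ : δ ^ 2 ≤ 1 := pow_le_one₀ h0 h1
  have := pow_le_pow_left₀ hpos hle 2
  nlinarith [sq_nonneg δ]

theorem kr_uniform_sq_le_of_one_le {N : ℕ} {δ : ℝ} (h1 : 1 ≤ δ) (h2 : δ ≤ N / 2) :
    kr (fun _ : Fin N => 1 / (N : ℝ)) δ ^ 2 ≤ 1 / 4 := by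
  have hN0 : (0 : ℝ) < N := by linarith
  have hpi := Real.pi_pos
  have h3 := kr_uniform_mul_sin (N := N) (by exact_mod_cast hN0) δ
  have h4 : 2 * δ ≤ N * Real.sin (Real.pi * δ / N) := by
    have := Real.mul_le_sin (x := Real.pi * δ / N) (by positivity) (by
      rw [div_le_iff₀ hN0]; nlinarith)
    have h5 := mul_le_mul_of_nonneg_left this hN0.le
    refine le_trans (le_of_eq ?_) h5
    field_simp
  have h6 : |kr (fun _ : Fin N => 1 / (N : ℝ)) δ| * 2 ≤ 1 := by
    have h7 := Real.abs_sin_le_one (Real.pi * δ)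
    rw [← h3, abs_mul, abs_of_nonneg (show 0 ≤ N * Real.sin (Real.pi * δ / N) by linarith)] at h7
    exact (mul_le_mul_of_nonneg_left (by linarith) (abs_nonneg _)).trans h7
  rw [← sq_abs]
  nlinarith [abs_nonneg (kr (fun _ : Fin N => 1 / (N : ℝ)) δ)]

/-- Without other nodes there is no residual and decay is irrelevant, so the uniform weight with ω =
1 gives 1 - p ≥ 1 - K² directly. It also covers small N, for which the earlier kernel bounds are not
available. -/
theorem gapConst_mul_sq_le_of_subsingleton [Subsingleton (Fin r)] (hd : 1 ≤ d) (hn : 1 ≤ n)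
    {ξ : Fin r → UnitAddTorus (Fin d)}
    (S : SVD ((n + 1) ^ d) (momentMatrix (discreteMeasure w ξ) n)) {x : UnitAddTorus (Fin d)} {s δ : ℝ}
    {l₀ : Fin r} {X : Fin d → ℝ} {Ξ : Fin r → Fin d → ℝ} (hC : IsConfig n ξ x s δ l₀ X Ξ)
    (h0 : 0 ≤ δ) (hδ : δ ≤ √(d : ℝ)) (hδN : δ ≤ (n + 1 : ℕ) / 2) :
    gapConst d * δ ^ 2 ≤ 1 - signalFun S x := by
  set u : Fin (n + 1) → ℝ := fun _ => 1 / ((n + 1 : ℕ) : ℝ) with hu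
  have hN0 : ((n + 1 : ℕ) : ℝ) ≠ 0 := by positivity
  have hu0 : ∀ k, 0 ≤ u k := fun k => by simp only [hu]; positivity
  have hu1 : kr u 0 = 1 := by rw [kr_zero]; simp [hu]; field_simp
  have hab : ∀ v, |kr u v| ≤ 1 := fun v => (abs_kr_le hu0 v).trans_eq (by rw [← kr_zero, hu1])
  have hE : ∀ l : Fin r, Finset.univ.erase l = ∅ := fun l => by
    ext m; simp [Subsingleton.elim m l]
  have key : 1 - (∏ i, kr u (X i - Ξ l₀ i)) ^ 2 ≤ 1 - signalFun S x := by
    obtain ⟨c, -, hc⟩ := exists_coeff w ξ S x hC.coe_left hC.coe_right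
    have hq := quadratic_le (Nat.succ_pos n) (w := u) (fun _ => rfl) hu0 (ω := 1) (fun _ => le_rfl) hu1 X Ξ c
    have hM : ∀ l m, ∏ i, kr u (Ξ l i - Ξ m i) = ∏ i, kr u (Ξ m i - Ξ l i) :=
      fun l m => Finset.prod_congr rfl fun i _ => by rw [← kr_neg, neg_sub]
    have hM1 : ∀ l, ∏ i, kr u (Ξ l i - Ξ l i) = 1 := fun l => by simp [hu1]
    have hpos := le_quadratic_of_row_sum (M := fun l m => ∏ i, kr u (Ξ l i - Ξ m i)) (lam := 1) hM hM1
      (fun l => by rw [hE]; simp)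
    have hs := sub_le_quadratic (K := fun l => ∏ i, kr u (X i - Ξ l i)) one_pos hM hpos (hM1 l₀) (fun l => (c l).re)
    have him := (mul_nonneg zero_le_one (Finset.sum_nonneg fun l _ => sq_nonneg _)).trans (hpos fun l => (c l).im)
    rw [← Finset.add_sum_erase _ _ (Finset.mem_univ l₀), hM1, hE] at hs
    rw [one_pow, one_mul] at hq
    push_cast at hq
    simp only [mul_one, sub_self, Finset.sum_empty, add_zero, div_one, zero_pow two_ne_zero, sub_zero] at hs
    linarith
  refine le_trans ?_ key
  obtain ⟨i, hi⟩ := hC.attained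
  have h1 : (∏ i, kr u (X i - Ξ l₀ i)) ^ 2 ≤ kr u δ ^ 2 := by
    rw [← hi, kr_sq_abs, ← sq_abs, ← sq_abs (kr u _), Finset.abs_prod]
    refine pow_le_pow_left₀ (Finset.prod_nonneg fun _ _ => abs_nonneg _) ?_ 2
    rw [← Finset.mul_prod_erase _ _ (Finset.mem_univ i)]
    exact mul_le_of_le_one_right (abs_nonneg _) (Finset.prod_le_one (fun _ _ => abs_nonneg _) fun _ _ => hab _)
  have hg := gapConst_mul_le hd
  have hg0 := (gapConst_pos hd).le
  rcases le_total δ 1 with h | h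
  · have h2 := kr_uniform_sq_le_of_le_one (N := n + 1) (by omega) h0 h
    have hd' : (1 : ℝ) ≤ d := by exact_mod_cast hd
    have h3 : gapConst d ≤ 0.75 := by nlinarith
    have := mul_le_mul_of_nonneg_right h3 (sq_nonneg δ)
    linarith
  · have h2 := kr_uniform_sq_le_of_one_le h hδN
    have hδ2 : δ ^ 2 ≤ d := by
      have := pow_le_pow_left₀ h0 hδ 2
      rwa [Real.sq_sqrt (Nat.cast_nonneg d)] at this
    have := mul_le_mul_of_nonneg_left hδ2 hg0
    linarith

/-- Quadratic decay of the signal function away from the nearest node. -/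
theorem signalFun_le_one_sub_mul_sq (hd : 1 ≤ d) (hr : 1 ≤ r) (ξ : Fin r → UnitAddTorus (Fin d))
    (hξ : Function.Injective ξ) (S : SVD ((n + 1) ^ d) (momentMatrix (discreteMeasure w ξ) n)) (hn : 1 ≤ n)
    (hsep : ∀ j l, j ≠ l → 2 * √(d : ℝ) / ‖ξ j - ξ l‖ < (n : ℝ) + 1) (x : UnitAddTorus (Fin d))
    (hx : ∀ j, x ≠ ξ j) (hle : (⨅ j, ‖x - ξ j‖) ≤ √(d : ℝ) / ((n : ℝ) + 1)) :
    signalFun S x ≤ 1 - gapConst d * ((n : ℝ) + 1) ^ 2 * (⨅ j, ‖x - ξ j‖) ^ 2 := by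
  have : Nonempty (Fin r) := ⟨⟨0, hr⟩⟩
  have hN : (0 : ℝ) < (n : ℝ) + 1 := by positivity
  have hd0 : 0 < √(d : ℝ) := Real.sqrt_pos.2 (by exact_mod_cast hd)
  obtain ⟨l₀, hl₀⟩ := exists_eq_ciInf_of_finite (f := fun j => ‖x - ξ j‖)
  rw [← hl₀] at hle ⊢
  have hpos : 0 < ‖x - ξ l₀‖ := norm_pos_iff.2 (sub_ne_zero.2 (hx l₀))
  obtain ⟨X, Ξ, hX, hΞ, hS, hXΞ⟩ := exists_config (mul_pos two_pos hd0) ξ hξ hsep x l₀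
  obtain ⟨i, hi⟩ := exists_le_norm_apply hpos le_rfl
  have hC : IsConfig n ξ x (2 * √(d : ℝ)) (((n : ℝ) + 1) * ‖x - ξ l₀‖) l₀ X Ξ := by
    refine ⟨hX, hΞ, hS, fun j => ?_, i, ?_⟩
    · rw [hXΞ]; exact mul_le_mul_of_nonneg_left (norm_le_pi_norm _ j) hN.le
    · rw [hXΞ, le_antisymm (norm_le_pi_norm (x - ξ l₀) i) hi]
  have hδ : ((n : ℝ) + 1) * ‖x - ξ l₀‖ ≤ √(d : ℝ) := by rwa [mul_comm, ← le_div_iff₀ hN]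
  have h0 : 0 ≤ ((n : ℝ) + 1) * ‖x - ξ l₀‖ := by positivity
  suffices gapConst d * (((n : ℝ) + 1) * ‖x - ξ l₀‖) ^ 2 ≤ 1 - signalFun S x by
    rw [mul_pow, ← mul_assoc] at this; linarith
  by_cases hsub : Subsingleton (Fin r)
  · refine gapConst_mul_sq_le_of_subsingleton w hd hn S hC h0 hδ ?_
    have := norm_torus_le_half (x - ξ l₀)
    push_cast
    nlinarith
  -- Two nodes on the torus are at distance at most 1/2, so the separation condition itself forces
  -- 4√d < n + 1.
  · obtain ⟨j, l, hjl⟩ := (not_subsingleton_iff_nontrivial.1 hsub).exists_pair_ne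
    refine gapConst_mul_sq_le w hd S hC ?_ h0 hδ
    refine lt_of_le_of_lt ?_ (hsep j l hjl)
    have h1 : 0 < ‖ξ j - ξ l‖ := norm_pos_iff.2 (sub_ne_zero.2 (hξ.ne hjl))
    rw [le_div_iff₀ h1]
    nlinarith [norm_torus_le_half (ξ j - ξ l)]

end TrigMoment

/-- On `UnitAddTorus (Fin d) = (Fin d → ℝ/ℤ)` Mathlib's norm gives the wrap-around maximum
distance: `‖x - y‖ = min_{k ∈ ℤ^d} max_i |x_i - y_i + k_i|`. -/
theorem mainTheorem5 {d r : ℕ} (hd : 1 ≤ d) (hr : 1 ≤ r)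
    (w : Fin r → ℂ) (hw : ∀ j, w j ≠ 0)
    (ξ : Fin r → UnitAddTorus (Fin d)) (hξ : Function.Injective ξ)
    (S : ∀ n : ℕ, TrigMoment.SVD ((n + 1) ^ d)
      (TrigMoment.momentMatrix (TrigMoment.discreteMeasure w ξ) n)) :
    (∀ n : ℕ, 1 ≤ n → (∀ j l, j ≠ l → 4 * (d : ℝ) / ‖ξ j - ξ l‖ < (n : ℝ) + 1) →
      ∀ x, (∀ j, x ≠ ξ j) →
        TrigMoment.signalFun (S n) x ≤
          1 / ((n : ℝ) + 1) ^ 2 * ((⨆ j, ‖w j‖) / (⨅ j, ‖w j‖)) *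
            (1 / 3 * ∑ j, 1 / ‖x - ξ j‖ ^ 2)) ∧
    (∀ x, Tendsto (fun n : ℕ => TrigMoment.signalFun (S n) x) atTop
      (𝓝 ((TrigMoment.zariskiClosure (TrigMoment.supp
        (TrigMoment.discreteMeasure w ξ))).indicator (fun _ => (1 : ℝ)) x))) ∧
    (∀ n : ℕ, 1 ≤ n → (∀ j l, j ≠ l → 2 * √(d : ℝ) / ‖ξ j - ξ l‖ < (n : ℝ) + 1) →
      ∀ x, (∀ j, x ≠ ξ j) → (⨅ j, ‖x - ξ j‖) ≤ √(d : ℝ) / ((n : ℝ) + 1) →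
        TrigMoment.signalFun (S n) x ≤
          1 - 3 ^ (d - 1) * (2 * (d : ℝ) - 1) / (2 ^ d * (d : ℝ) ^ (2 + (d : ℝ) / 2)) *
            ((n : ℝ) + 1) ^ 2 * (⨅ j, ‖x - ξ j‖) ^ 2) := by
  refine ⟨fun n _ hsep x hx => ?_, fun x => TrigMoment.tendsto_signalFun hd w hw ξ hξ S x,
    fun n hn hsep x hx hle => ?_⟩
  · refine (TrigMoment.signalFun_le_of_separated hd w ξ (S n) hsep hξ x hx).trans ?_
    refine mul_le_mul_of_nonneg_right ?_ (by positivity)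
    exact le_mul_of_one_le_right (by positivity) (TrigMoment.one_le_iSup_div_iInf hr hw)
  · rw [TrigMoment.gapConst_eq hd]
    exact TrigMoment.signalFun_le_one_sub_mul_sq w hd hr ξ hξ (S n) hn hsep x hx hle
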